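/- **Model.** A 3SAT formula over $n$ variables is a set of clauses, each with (up to) three literals; to solve it means to output a satisfying assignment if there is one, and to report that there is none otherwise. A hybrid algorithm with a device of $M$ qubits is a fixed classical program (a while-program over binary trees built from nil and cons cells, every elementary operation and test costing one step) which may, as further one-step operations, apply the gates $X$, $H$, $T$, CNOT, Toffoli to qubits of the device, initially in the state $|0\cdots0\rangle$, or measure a qubit in the computational basis and use the outcome. It solves 3SAT in time $T(n)$ with $q(n)$ qubits if, on every formula over $n$ variables and with a device of $q(n)$ qubits, it always halts within $T(n)$ steps and its output is correct with probability at least $2/3$. We write $T(n)=O^*(g(n))$ if $T(n)=O(p(n)g(n))$ for some polynomial $p$. Let $\gamma_0=\log_2(4/3)$, the exponent in the running time $O^*(2^{\gamma_0 n})$ of Schöning's algorithm. **Theorem.** There are constants $A,B>0$ such that for each $c\in(0,1)$ the equation $$A\,\beta\ln(1/\beta)+B\,\beta=c$$ has exactly one solution $\beta=\beta(c)$ in $(0,1)$, such that $\beta(c)=\Theta(c/\log(1/c))$ as $c\to0^+$, and such that the following holds with $f(c)=(1-\log_2\sqrt3)\,\beta(c)$. For every $c\in(0,1)$ one has $f(c)>0$,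 and for every $\varepsilon>0$ there is a hybrid algorithm which, with a device of $M=\lfloor cn\rfloor$ qubits, solves 3SAT on $n$ variables in time $$O^*\!\left(2^{(\gamma_0-f(c)+\varepsilon)n}\right).$$ In particular, for every $c\in(0,1)$ there are $\gamma<\gamma_0$ and a hybrid algorithm which solves 3SAT on $n$ variables in time $O^*(2^{\gamma n})$ with $\lfloor cn\rfloor$ qubits: there is no threshold for $c$ below which the advantage over Schöning's algorithm is lost. -/

import Mathlib

noncomputable section

namespace HybridSAT

/-! ### 3SAT instances -/

/-- A literal over the variables `x_0, …, x_{n-1}`: the pair `(i, true)` is the literal `x_i` and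
the pair `(i, false)` is its negation. -/
abbrev Literal (n : ℕ) : Type := Fin n × Bool

/-- A clause is given by three literals. They may coincide, so that every clause with one, two or
three distinct literals is covered. -/
abbrev Clause (n : ℕ) : Type := Literal n × Literal n × Literal n

/-- An assignment of truth values to the `n` variables. -/
abbrev Assignment (n : ℕ) : Type := Fin n → Bool

/-- A 3SAT formula over `n` variables: a set of clauses, written down in some order. -/
structure Formula (n : ℕ) where
  clauses : List (Clause n)
  nodup : clauses.Nodup

/-- The literal `l` has the value true under `x`. -/
def Literal.IsTrue {n : ℕ} (l : Literal n) (x : Assignment n) : Prop := x l.1 = l.2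

/-- The clause `C` is satisfied by `x`. -/
def Clause.IsSatisfied {n : ℕ} (C : Clause n) (x : Assignment n) : Prop :=
  Literal.IsTrue C.1 x ∨ Literal.IsTrue C.2.1 x ∨ Literal.IsTrue C.2.2 x

/-- `x` is a satisfying assignment of `F`. -/
def Formula.IsSatisfied {n : ℕ} (F : Formula n) (x : Assignment n) : Prop :=
  ∀ C ∈ F.clauses, Clause.IsSatisfied C x

/-! ### The classical data: binary trees built from `nil` and `cons` cells -/

/-- Data values of the classical computer. -/
inductive DTree : Type
  | nil : DTree
  | cons : DTree → DTree → DTree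

namespace DTree

/-- First component of a cell. -/
def head : DTree → DTree
  | nil => nil
  | cons a _ => a

/-- Second component of a cell. -/
def tail : DTree → DTree
  | nil => nil
  | cons _ b => b

/-- The number of `tail` steps to `nil`; this is the number that a tree stands for when it is used
as the index of a qubit. -/
def length : DTree → ℕ
  | nil => 0
  | cons _ b => length b + 1

/-- Truth values as trees. -/
def ofBool : Bool → DTree
  | false => nil
  | true => cons nil nil

/-- Natural numbers as trees, in unary. -/
def ofNat : ℕ → DTree
  | 0 => nil
  | k + 1 => cons nil (ofNat k)

/-- Finite sequences as trees. -/
def ofList : List DTree → DTree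
  | [] => nil
  | a :: l => cons a (ofList l)

end DTree

/-- A literal as a tree: its sign and the index of its variable. -/
def encodeLiteral {n : ℕ} (l : Literal n) : DTree :=
  DTree.cons (DTree.ofBool l.2) (DTree.ofNat l.1)

/-- A clause as the sequence of its three literals. -/
def encodeClause {n : ℕ} (C : Clause n) : DTree :=
  DTree.ofList [encodeLiteral C.1, encodeLiteral C.2.1, encodeLiteral C.2.2]

/-- A formula as the number of its variables and the sequence of its clauses. -/
def encodeFormula {n : ℕ} (F : Formula n) : DTree :=
  DTree.cons (DTree.ofNat n) (DTree.ofList (F.clauses.map encodeClause))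

/-- The output that reports the assignment `x`. The output `nil` reports that there is none. -/
def encodeAssignment {n : ℕ} (x : Assignment n) : DTree :=
  DTree.cons DTree.nil (DTree.ofList ((List.ofFn x).map DTree.ofBool))

/-- The output is a satisfying assignment if there is one, and `nil` if there is none. -/
def IsCorrectOutput {n : ℕ} (F : Formula n) (out : DTree) : Prop :=
  (∃ x, F.IsSatisfied x ∧ out = encodeAssignment x) ∨
    ((¬ ∃ x, F.IsSatisfied x) ∧ out = DTree.nil)

/-! ### The quantum device: `M` qubits, a finite universal gate set, measurements -/

/-- A vector of `(ℂ²)^{⊗ M}`, given by its coordinates in the computational basis. -/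
abbrev QState (M : ℕ) : Type := (Fin M → Bool) → ℂ

/-- The basis state `|0…0⟩`. -/
def QState.zero (M : ℕ) : QState M := fun b => if b = fun _ => false then 1 else 0

/-- The square of the Euclidean norm. -/
def QState.weight {M : ℕ} (ψ : QState M) : ℝ := ∑ b, ‖ψ b‖ ^ 2

/-- The NOT gate (Pauli `X`) on qubit `i`. -/
def QState.applyX {M : ℕ} (i : Fin M) (ψ : QState M) : QState M :=
  fun b => ψ (Function.update b i (!b i))

/-- The Hadamard gate on qubit `i`. -/
def QState.applyH {M : ℕ} (i : Fin M) (ψ : QState M) : QState M :=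
  fun b => (ψ (Function.update b i false) +
    (if b i then -1 else 1) * ψ (Function.update b i true)) / (Real.sqrt 2 : ℂ)

/-- The gate `T = diag(1, exp(iπ/4))` on qubit `i`. -/
def QState.applyT {M : ℕ} (i : Fin M) (ψ : QState M) : QState M :=
  fun b => (if b i then Complex.exp (Complex.I * (Real.pi / 4 : ℝ)) else 1) * ψ b

/-- The controlled NOT gate with control `i` and target `j` (for `i ≠ j`). -/
def QState.applyCNOT {M : ℕ} (i j : Fin M) (ψ : QState M) : QState M :=
  fun b => ψ (Function.update b j (xor (b j) (b i)))

/-- The Toffoli gate with controls `i`, `j` and target `k` (for distinct `i`, `j`, `k`). -/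
def QState.applyToffoli {M : ℕ} (i j k : Fin M) (ψ : QState M) : QState M :=
  fun b => ψ (Function.update b k (xor (b k) (b i && b j)))

/-- The projection to the subspace on which qubit `i` has the value `v`. -/
def QState.project {M : ℕ} (i : Fin M) (v : Bool) (ψ : QState M) : QState M :=
  fun b => if b i = v then ψ b else 0

/-! ### Hybrid programs -/

/-- Programs of a classical computer that controls a quantum device. The classical part is the
usual language of while-programs over trees, with variables indexed by natural numbers. The
operands of the gates and of the measurement are the variables which hold the indices of the
qubits. -/
inductive Cmd : Type
  /-- `x := nil` -/
  | setNil (x : ℕ) : Cmd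
  /-- `x := y` -/
  | copy (x y : ℕ) : Cmd
  /-- `x := cons y z` -/
  | cons (x y z : ℕ) : Cmd
  /-- `x := head y` -/
  | head (x y : ℕ) : Cmd
  /-- `x := tail y` -/
  | tail (x y : ℕ) : Cmd
  /-- first `C`, then `D` -/
  | seq (C D : Cmd) : Cmd
  /-- if `x` is not `nil` then `C` else `D` -/
  | cond (x : ℕ) (C D : Cmd) : Cmd
  /-- while `x` is not `nil` do `C` -/
  | loop (x : ℕ) (C : Cmd) : Cmd
  /-- NOT gate -/
  | gateX (p : ℕ) : Cmd
  /-- Hadamard gate -/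
  | gateH (p : ℕ) : Cmd
  /-- `T` gate -/
  | gateT (p : ℕ) : Cmd
  /-- controlled NOT gate -/
  | gateCNOT (p q : ℕ) : Cmd
  /-- Toffoli gate -/
  | gateToffoli (p q r : ℕ) : Cmd
  /-- measure a qubit in the computational basis and store the outcome in `x` -/
  | measure (x p : ℕ) : Cmd

/-- A branch of the joint computation with a device of `M` qubits: the commands which are still to
be carried out, the values of the variables, and the state of the device. The state is not
normalised: the measurements project it, so that the square of its norm is the probability of the
branch. -/
structure Config (M : ℕ) where
  todo : List Cmd
  store : ℕ → DTree
  state : QState M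

/-- Apply `g` at the qubit whose index is given by `a`. Without such a qubit among the `M` qubits
of the device, nothing happens. -/
def onQubit {M : ℕ} (a : DTree) (g : Fin M → QState M → QState M) (ψ : QState M) : QState M :=
  if h : a.length < M then g ⟨a.length, h⟩ ψ else ψ

/-- One step of the computation, from one branch to the list of its successors. Each command,
each test of a loop or a conditional, each gate and each measurement is one step. A measurement
has two successors, one for each outcome; all other steps have one. (A gate whose operands coincide
does nothing, and a measurement at an index which is not below `M` gives the outcome `0`.) A branch with nothing left to do has halted. -/
def step {M : ℕ} : Config M → List (Config M)
  | ⟨[], s, ψ⟩ => [⟨[], s, ψ⟩]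
  | ⟨Cmd.setNil x :: l, s, ψ⟩ => [⟨l, Function.update s x DTree.nil, ψ⟩]
  | ⟨Cmd.copy x y :: l, s, ψ⟩ => [⟨l, Function.update s x (s y), ψ⟩]
  | ⟨Cmd.cons x y z :: l, s, ψ⟩ => [⟨l, Function.update s x (DTree.cons (s y) (s z)), ψ⟩]
  | ⟨Cmd.head x y :: l, s, ψ⟩ => [⟨l, Function.update s x (s y).head, ψ⟩]
  | ⟨Cmd.tail x y :: l, s, ψ⟩ => [⟨l, Function.update s x (s y).tail, ψ⟩]
  | ⟨Cmd.seq C D :: l, s, ψ⟩ => [⟨C :: D :: l, s, ψ⟩]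
  | ⟨Cmd.cond x C D :: l, s, ψ⟩ =>
      match s x with
      | DTree.nil => [⟨D :: l, s, ψ⟩]
      | DTree.cons _ _ => [⟨C :: l, s, ψ⟩]
  | ⟨Cmd.loop x C :: l, s, ψ⟩ =>
      match s x with
      | DTree.nil => [⟨l, s, ψ⟩]
      | DTree.cons _ _ => [⟨C :: Cmd.loop x C :: l, s, ψ⟩]
  | ⟨Cmd.gateX p :: l, s, ψ⟩ => [⟨l, s, onQubit (s p) QState.applyX ψ⟩]
  | ⟨Cmd.gateH p :: l, s, ψ⟩ => [⟨l, s, onQubit (s p) QState.applyH ψ⟩]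
  | ⟨Cmd.gateT p :: l, s, ψ⟩ => [⟨l, s, onQubit (s p) QState.applyT ψ⟩]
  | ⟨Cmd.gateCNOT p q :: l, s, ψ⟩ =>
      [⟨l, s, onQubit (s p) (fun i => onQubit (s q) fun j φ =>
        if i ≠ j then QState.applyCNOT i j φ else φ) ψ⟩]
  | ⟨Cmd.gateToffoli p q r :: l, s, ψ⟩ =>
      [⟨l, s, onQubit (s p) (fun i => onQubit (s q) fun j => onQubit (s r) fun k φ =>
        if i ≠ j ∧ i ≠ k ∧ j ≠ k then QState.applyToffoli i j k φ else φ) ψ⟩]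
  | ⟨Cmd.measure x p :: l, s, ψ⟩ =>
      if h : (s p).length < M then
        [⟨l, Function.update s x (DTree.ofBool false), QState.project ⟨(s p).length, h⟩ false ψ⟩,
          ⟨l, Function.update s x (DTree.ofBool true), QState.project ⟨(s p).length, h⟩ true ψ⟩]
      else [⟨l, Function.update s x (DTree.ofBool false), ψ⟩]

/-- The branches of the computation after `t` steps. -/
def branches {M : ℕ} (c : Config M) : ℕ → List (Config M)
  | 0 => [c]
  | t + 1 => (branches c t).flatMap step

/-- The start of the program `P` with the input `a` in variable `0`. All other variables are `nil`
and all qubits are `0`. -/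
def start (M : ℕ) (P : Cmd) (a : DTree) : Config M :=
  ⟨[P], Function.update (fun _ => DTree.nil) 0 a, QState.zero M⟩

/-- Every branch of positive probability has halted after at most `t` steps. -/
def HaltsWithin (M : ℕ) (P : Cmd) (a : DTree) (t : ℕ) : Prop :=
  ∀ b ∈ branches (start M P a) t, b.state ≠ 0 → b.todo = []

open Classical in
/-- The probability that, after `t` steps, `P` has halted with a value in variable `0` for which
`E` holds. -/
def outputProb (M : ℕ) (P : Cmd) (a : DTree) (t : ℕ) (E : DTree → Prop) : ℝ :=
  (((branches (start M P a) t).filter fun b => b.todo = [] ∧ E (b.store 0)).map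
    fun b => b.state.weight).sum

/-- The program `P` solves 3SAT, with bounded error, when formulas over `n` variables are run on a
device of `q n` qubits: it always halts within `T n` steps, and its output is correct with
probability at least `2/3`. -/
def SolvesThreeSAT (P : Cmd) (q T : ℕ → ℕ) : Prop :=
  ∀ (n : ℕ) (F : Formula n),
    HaltsWithin (q n) P (encodeFormula F) (T n) ∧
      2 / 3 ≤ outputProb (q n) P (encodeFormula F) (T n) (IsCorrectOutput F)

/-- `T = O*(g)`: big-O up to a factor polynomial in `n`. -/
def IsOStar (T g : ℕ → ℝ) : Prop :=
  ∃ p : Polynomial ℝ, T =O[Filter.atTop] fun n => p.eval (n : ℝ) * g n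

/-- Some hybrid program solves 3SAT on `n` variables with a device of `⌊c n⌋` qubits in time
`O*(2^(γ n))`. -/
def HybridSolvable (c γ : ℝ) : Prop :=
  ∃ (P : Cmd) (T : ℕ → ℕ), SolvesThreeSAT P (fun n => ⌊c * n⌋₊) T ∧
    IsOStar (fun n => (T n : ℝ)) (fun n => (2 : ℝ) ^ (γ * n))

/-- The exponent `γ₀ = log₂ (4/3)` of Schöning's algorithm. -/
def schoeningExponent : ℝ := Real.logb 2 (4 / 3)

/-- The gain `f = (1 - log₂ √3) β` in the exponent. -/
def gain (β : ℝ) : ℝ := (1 - Real.logb 2 (Real.sqrt 3)) * β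

end HybridSAT

end

set_option linter.unusedSectionVars false

noncomputable section

namespace HybridSAT

open Function (update update_of_ne update_self iterate_succ_apply iterate_succ_apply' comp_def
  update_eq_self update_idem Involutive Injective comp_apply Bijective)
open List (mem_flatMap mem_singleton mem_map flatMap_map map_flatMap cons_append mem_cons
  length_cons mem_cons_of_mem foldl_nil take_of_length_le foldl_cons mem_of_mem_take length_take
  range range_succ length_range foldl_append sum_le_sum mem_pair length_eq_zero_iff flatMap_cons
  flatMap_nil append_nil map_append map_map map_congr_left map_cons sum_cons all_cons all_nil
  all_eq_true reverse_cons nil_append append_assoc mem_append nodup_append length_append all_map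
  mem_range nodup_cons mem_filter mem_reverse length_map take_add length_drop getD_eq_getElem
  getD_append take_left' getElem_mem getElem_map getElem_range drop_left')
open Nat (ble_eq zero_testBit pow_le_pow_right sub_le mod_lt cast_nonneg)
open Finset (sum_eq_single sum_add_distrib sum_congr sum_nonneg sum_filter sum_const card_univ
  prod_const card_lt_card mem_univ mul_sum card_le_card mem_product card_range sum_range_succ)
open Real (sqrt norm_eq_abs sq_sqrt mul_self_sqrt sin cos sqrt_pos pi_pos log log_le_log log_pow
  rpow_natCast rpow_mul rpow_add norm_of_nonneg negMulLog log_inv log_pos logb)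
open Polynomial (eval_add eval_comp eval_one eval_C eval_X eval_mul eval_pow)
open QState (applyX applyH applyCNOT applyToffoli project weight)
open Bool (false_eq_true not_eq_true' not_eq_true)
open Set (mem_ofPred_eq)

section

/-! ### Execution of programs -/

/-! A trial combines Schöning's walk with a quantum local search. From a random start the walk comes
within distance `r` of a fixed solution with probability about `2^r (3/4)^n`, which is `2^r` times
the probability of reaching the solution itself. From such a point a solution is reached by at most
`r` choices of a literal in the first false clause, so by one of `3^r` sequences of choices, and
Grover's search over these sequences takes about `3^(r/2)` iterations of a polynomial oracle. As `√3
< 2`, something is gained for every `r` proportional to `n`. In the version used here three ternary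
choices share five coins (`27 ≤ 32`), which gives `2^(5r/6)` iterations, and hashing costs a further
factor `2^(r/16)` in the probability. What remains is `r (15/16 - 5/6) = 5r/48`. The generous
constants `A = B = 2^20` leave room to take `r` at least `4 β n`, and this covers the factor in
`gain`.

The real issue is space: the oracle has to be reversible and must fit into `O(r log (n/r))` qubits,
whereas a plain list of `r` variables needs `r log n`. Two devices achieve this.

(1) With `r = 2^D`, the recursion `Walk.gen` computes the first half of a stretch of steps into a
register of the next level, computes the second half on top of it, adds the first half to the target
and uncomputes it. There are three calls per level, so `3^D` single steps, polynomially many, and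
one register per level, where level `j` holds at most `2^(D-j)` variables. Correctness is
`Walk.Valid.run_gen`.

(2) A register stores a set of variables by hashing. The address of a place is a prefix of the hash
value, so only the remaining bits, about `log (n/r)` of them plus `j/2`, have to be stored. With
`2^(D+8-j/2)` places on level `j`, both the sizes of the registers (`Trial.sum_level_le`) and the
probabilities of collisions (`sum_bins_le`) are dominated by convergent series. The hash values are
thrown anew in each trial, and it suffices that they are good with probability `2^(-r/16)`
(`le_mean_goodHash`), since repetition pays for this.

The oracle is sound whatever the hash values are (`Walk.Valid.forall_of_accepts`,
`Trial.satRaw_decode`), and complete for good ones (`Walk.Valid.accepts_of_follows`,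
`Trial.exists_flag`). The bound on the walk is `le_hit` with `hit_le_sum_goodProb`; Grover's
iteration is `groverState_succ`, with the unknown number of solutions handled by
`exists_iterations`. All this is collected in `Trial.le_successProb`.

On the side of the machine, the predicate `PT` is a calculus of polynomial time functions, by which
the circuits are seen to be computable; `Scheme.exists_trialCmd`, `Scheme.exists_loopCmd` and
`Scheme.exists_mainCmd` turn a trial into a program which repeats it. The balance of exponents is
drawn in `Trial.two_le_successProb`, `Trial.time_le` and `Trial.numQubits_le`, with `r` between
`n/2^(h+1)` and `n/2^h`. Finally `hybridSolvable_of_load` chooses `h` for the given fraction of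
qubits. -/

/-- Stores of the classical part. -/
abbrev Store : Type := ℕ → DTree

/-- Every branch of the computation from `c` passes, after at most `t` steps, through exactly one
of the configurations in the list. -/
inductive Reaches {M : ℕ} : Config M → ℕ → List (Config M) → Prop
  | done (c : Config M) (t : ℕ) : Reaches c t [c]
  | step (c : Config M) (t : ℕ) (K : Config M → List (Config M))
      (h : ∀ c' ∈ step c, Reaches c' t (K c')) : Reaches c (t + 1) ((step c).flatMap K)

variable {M : ℕ} {c : Config M} {t t' : ℕ} {L : List (Store × QState M)} {u : ℕ}
   {K : Store × QState M → List (Store × QState M)} {C : Cmd} {s : Store} {ψ : QState M} {D : Cmd}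
   {s' : Store} {x : ℕ} {α β : Type}

lemma Reaches.mono {L : List (Config M)} (h : Reaches c t L) (htt : t ≤ t') : Reaches c t' L := by
  induction h generalizing t' with
  | done c t => exact .done c t'
  | step c t K _ ih =>
    obtain ⟨u, rfl⟩ : ∃ u, t' = u + 1 := ⟨t' - 1, by omega⟩
    exact .step c u K fun c' hc' => ih c' hc' (by omega)

lemma Reaches.trans {L : List (Config M)}
    {K : Config M → List (Config M)} (h : Reaches c t L) (hK : ∀ c' ∈ L, Reaches c' u (K c')) :
    Reaches c (t + u) (L.flatMap K) := by
  induction h with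
  | done c t => simpa using (hK c (by simp)).mono (Nat.le_add_left u t)
  | step c t K₀ _ ih =>
    rw [List.flatMap_assoc, Nat.add_right_comm]
    refine .step c _ _ fun c' hc' => ih c' hc' fun c'' hc'' => hK c'' ?_
    exact mem_flatMap.2 ⟨c', hc', hc''⟩

lemma branches_succ (c : Config M) (t : ℕ) :
    branches c (t + 1) = (step c).flatMap fun c' => branches c' t := by
  induction t with
  | zero => simp [branches]
  | succ t ih =>
    rw [branches, ih, List.flatMap_assoc]
    rfl

lemma branches_of_todo_eq_nil (c : Config M) (hc : c.todo = []) (t : ℕ) : branches c t = [c] := by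
  obtain ⟨l, s, ψ⟩ := c
  obtain rfl : l = [] := hc
  induction t with
  | zero => rfl
  | succ t ih => simp [branches, ih, step]

/-- Halted configurations are fixed by `step`, so a branch which ends early waits unchanged. Upper
bounds on the running time of single branches are therefore enough to know all branches at time `t`
exactly. -/
lemma Reaches.branches_eq {L : List (Config M)}
    (h : Reaches c t L) (hL : ∀ b ∈ L, b.todo = []) : branches c t = L := by
  induction h with
  | done c t => exact branches_of_todo_eq_nil c (hL c (by simp)) t
  | step c t K _ ih =>
    rw [branches_succ]
    refine List.flatMap_congr fun c' hc' => ih c' hc' fun b hb => hL b ?_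
    exact mem_flatMap.2 ⟨c', hc', hb⟩

/-- The command `C`, started with the store `s` and the device in the state `ψ`, ends after at most
`t` steps, with the branches in `L`. -/
def Runs (C : Cmd) (s : Store) (ψ : QState M) (t : ℕ) (L : List (Store × QState M)) : Prop :=
  ∀ l, Reaches ⟨C :: l, s, ψ⟩ t (L.map fun p => ⟨l, p.1, p.2⟩)

lemma Runs.mono (h : Runs C s ψ t L) (ht : t ≤ t') : Runs C s ψ t' L :=
  fun l => (h l).mono ht

lemma Runs.of_step
    (h : ∀ l, step ⟨C :: l, s, ψ⟩ = L.map fun p => ⟨l, p.1, p.2⟩) : Runs C s ψ 1 L := by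
  intro l
  have := Reaches.step (M := M) ⟨C :: l, s, ψ⟩ 0 (fun c => [c]) (fun c' _ => .done c' 0)
  simpa [h l] using this

lemma Runs.of_step_eq (l' : List Cmd) (s' : Store) (ψ' : QState M)
    (h : ∀ l, step ⟨C :: l, s, ψ⟩ = [⟨l' ++ l, s', ψ'⟩])
    (h' : ∀ l, Reaches ⟨l' ++ l, s', ψ'⟩ t (L.map fun p => ⟨l, p.1, p.2⟩)) :
    Runs C s ψ (t + 1) L := by
  intro l
  have := Reaches.step (M := M) ⟨C :: l, s, ψ⟩ t
    (fun _ => L.map fun p => ⟨l, p.1, p.2⟩) (fun c' hc' => by grind)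
  simpa [h l] using this

lemma Reaches.flatMap {c : Config M} {l l' : List Cmd} (h : Reaches c t (L.map fun p => ⟨l, p.1, p.2⟩))
    (hK : ∀ p ∈ L, Reaches ⟨l, p.1, p.2⟩ u ((K p).map fun p => ⟨l', p.1, p.2⟩)) :
    Reaches c (t + u) ((L.flatMap K).map fun p => ⟨l', p.1, p.2⟩) := by
  have := h.trans (u := u) (K := fun c => (K (c.store, c.state)).map fun p => ⟨l', p.1, p.2⟩) (by
    intro c' hc'
    obtain ⟨p, hp, rfl⟩ := mem_map.1 hc'
    exact hK p hp)
  simpa [flatMap_map, map_flatMap] using this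

lemma Runs.seq (h : Runs C s ψ t L) (hK : ∀ p ∈ L, Runs D p.1 p.2 u (K p)) :
    Runs (.seq C D) s ψ (t + u + 1) (L.flatMap K) := by
  refine Runs.of_step_eq [C, D] s ψ (fun l => rfl) fun l => (h (D :: l)).flatMap fun p hp => hK p hp l

lemma Runs.seq_single {ψ' : QState M} (h : Runs C s ψ t [(s', ψ')]) (hD : Runs D s' ψ' u L) :
    Runs (.seq C D) s ψ (t + u + 1) L := by
  simpa using h.seq (K := fun _ => L) (u := u) (by simpa using hD)

lemma DTree.exists_eq_cons {d : DTree} (h : d ≠ .nil) : ∃ a b, d = .cons a b := by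
  cases d <;> simp_all

lemma Runs.cond_nil (hx : s x = .nil) (h : Runs D s ψ t L) : Runs (.cond x C D) s ψ (t + 1) L :=
  Runs.of_step_eq [D] s ψ (fun l => by simp [step, hx]) h

lemma Runs.cond_cons (hx : s x ≠ .nil) (h : Runs C s ψ t L) : Runs (.cond x C D) s ψ (t + 1) L := by
  obtain ⟨a, b, hab⟩ := DTree.exists_eq_cons hx
  exact Runs.of_step_eq [C] s ψ (fun l => by simp [step, hab]) h

lemma Runs.loop_nil (hx : s x = .nil) : Runs (.loop x C) s ψ 1 [(s, ψ)] :=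
  Runs.of_step fun l => by simp [step, hx]

lemma Runs.loop_cons
    (hx : s x ≠ .nil) (h : Runs C s ψ t L) (hK : ∀ p ∈ L, Runs (.loop x C) p.1 p.2 u (K p)) :
    Runs (.loop x C) s ψ (t + u + 1) (L.flatMap K) := by
  obtain ⟨a, b, hab⟩ := DTree.exists_eq_cons hx
  refine Runs.of_step_eq [C, .loop x C] s ψ (fun l => by simp [step, hab]) fun l =>
    (h (.loop x C :: l)).flatMap fun p hp => hK p hp l

/-- `C` acts on the store alone, turning `s` into `s'` in at most `t` steps. -/
def ClassicalRun (C : Cmd) (s : Store) (t : ℕ) (s' : Store) : Prop :=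
  ∀ (M : ℕ) (ψ : QState M), Runs C s ψ t [(s', ψ)]

lemma ClassicalRun.mono (h : ClassicalRun C s t s')
    (ht : t ≤ t') : ClassicalRun C s t' s' := fun M ψ => (h M ψ).mono ht

lemma ClassicalRun.seq {s'' : Store} (h : ClassicalRun C s t s')
    (h' : ClassicalRun D s' u s'') : ClassicalRun (.seq C D) s (t + u + 1) s'' :=
  fun M ψ => (h M ψ).seq_single (h' M ψ)

lemma classicalRun_setNil (x : ℕ) (s : Store) : ClassicalRun (.setNil x) s 1 (update s x .nil) :=
  fun _ _ => Runs.of_step fun _ => rfl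

lemma classicalRun_copy (x y : ℕ) (s : Store) : ClassicalRun (.copy x y) s 1 (update s x (s y)) :=
  fun _ _ => Runs.of_step fun _ => rfl

lemma classicalRun_cons (x y z : ℕ) (s : Store) :
    ClassicalRun (.cons x y z) s 1 (update s x (.cons (s y) (s z))) :=
  fun _ _ => Runs.of_step fun _ => rfl

lemma classicalRun_head (x y : ℕ) (s : Store) :
    ClassicalRun (.head x y) s 1 (update s x (s y).head) :=
  fun _ _ => Runs.of_step fun _ => rfl

lemma classicalRun_tail (x y : ℕ) (s : Store) :
    ClassicalRun (.tail x y) s 1 (update s x (s y).tail) :=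
  fun _ _ => Runs.of_step fun _ => rfl

lemma ClassicalRun.cond_nil (hx : s x = .nil)
    (h : ClassicalRun D s t s') : ClassicalRun (.cond x C D) s (t + 1) s' :=
  fun M ψ => .cond_nil hx (h M ψ)

lemma ClassicalRun.cond_cons (hx : s x ≠ .nil)
    (h : ClassicalRun C s t s') : ClassicalRun (.cond x C D) s (t + 1) s' :=
  fun M ψ => .cond_cons hx (h M ψ)

lemma ClassicalRun.loop_nil (hx : s x = .nil) :
    ClassicalRun (.loop x C) s 1 s := fun _ _ => .loop_nil hx

lemma ClassicalRun.loop_cons {s'' : Store} (hx : s x ≠ .nil)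
    (h : ClassicalRun C s t s') (h' : ClassicalRun (.loop x C) s' u s'') :
    ClassicalRun (.loop x C) s (t + u + 1) s'' := fun M ψ => by
  simpa using Runs.loop_cons (K := fun _ => [(s'', ψ)]) hx (h M ψ) (u := u) (by simpa using h' M ψ)

/-! ### Functions computed in polynomial time -/

/-- The number of nodes of a tree. -/
def DTree.size : DTree → ℕ
  | .nil => 1
  | .cons a b => a.size + b.size + 1

lemma DTree.size_pos (a : DTree) : 0 < a.size := by cases a <;> simp [DTree.size]

/-- Types whose elements are represented by trees. -/
class Code (α : Type) where
  enc : α → DTree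

open Code (enc)

instance : Code DTree := ⟨id⟩
instance : Code Unit := ⟨fun _ => .nil⟩
instance : Code Bool := ⟨DTree.ofBool⟩
instance : Code ℕ := ⟨DTree.ofNat⟩
instance {α β : Type} [Code α] [Code β] : Code (α × β) := ⟨fun p => .cons (enc p.1) (enc p.2)⟩
instance {α : Type} [Code α] : Code (List α) := ⟨fun l => DTree.ofList (l.map enc)⟩

/-- The size of the code of `a`. -/
def csize [Code α] (a : α) : ℕ := (enc a).size

lemma csize_pos [Code α] (a : α) : 0 < csize a := DTree.size_pos _

lemma enc_pair [Code α] [Code β] (a : α) (b : β) : enc (a, b) = .cons (enc a) (enc b) := rfl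
lemma enc_nil [Code α] : enc ([] : List α) = .nil := rfl
lemma enc_cons [Code α] (a : α) (l : List α) : enc (a :: l) = .cons (enc a) (enc l) := rfl
lemma enc_succ (n : ℕ) : enc (n + 1) = .cons .nil (enc n) := rfl
lemma enc_false : enc false = .nil := rfl
lemma enc_true : enc true = .cons .nil .nil := rfl

lemma csize_pair [Code α] [Code β] (a : α) (b : β) : csize (a, b) = csize a + csize b + 1 := rfl
lemma csize_nil [Code α] : csize ([] : List α) = 1 := rfl
lemma csize_cons [Code α] (a : α) (l : List α) : csize (a :: l) = csize a + csize l + 1 := rfl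
lemma csize_nat (n : ℕ) : csize n = 2 * n + 1 := by
  induction n with
  | zero => rfl
  | succ n ih =>
    have : csize (n + 1) = 1 + csize n + 1 := rfl
    omega
lemma csize_bool_le (b : Bool) : csize b ≤ 3 := by cases b <;> decide
lemma csize_unit (u : Unit) : csize u = 1 := rfl

lemma csize_append [Code α] (l l' : List α) : csize (l ++ l') + 1 = csize l + csize l' := by
  induction l with
  | nil => simp [csize_nil]; omega
  | cons a l ih => simp only [cons_append, csize_cons]; omega

lemma csize_le_of_mem [Code α] {a : α} {l : List α} (h : a ∈ l) : csize a < csize l := by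
  induction l with
  | nil => simp at h
  | cons b l ih =>
    rw [csize_cons]
    rcases mem_cons.1 h with rfl | h
    · omega
    · grind

lemma length_lt_csize [Code α] (l : List α) : l.length < csize l := by
  induction l with
  | nil => simp [csize_nil]
  | cons b l ih => simp only [csize_cons, length_cons]; omega

lemma csize_take_le [Code α] (l : List α) (i : ℕ) : csize (l.take i) ≤ csize l := by
  induction l generalizing i with
  | nil => simp
  | cons b l ih =>
    cases i with
    | zero => simp [csize_nil, csize_cons]
    | succ i => simp only [List.take_succ_cons, csize_cons]; have := ih i; omega

lemma eval_mono (p : Polynomial ℕ) {a b : ℕ} (h : a ≤ b) : p.eval a ≤ p.eval b := by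
  simp only [Polynomial.eval_eq_sum_range]
  gcongr

/-- `f` is computed in polynomial time by a program which has its argument and its value in the
variable `k` and leaves the variables below `k` as they are. -/
@[fun_prop]
def PT [Code α] [Code β] (f : α → β) : Prop :=
  -- The bound on the size is a separate requirement: `cons k k k` doubles a tree in one step, so a
  -- polynomial number of steps does not bound the size of the result, and composition would fail.
  ∃ p : Polynomial ℕ, (∀ a, csize (f a) ≤ p.eval (csize a)) ∧ ∀ k, ∃ C : Cmd,
    ∀ (a : α) (s : Store), s k = enc a → ∃ s' : Store, (∀ v < k, s' v = s v) ∧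
      s' k = enc (f a) ∧ ClassicalRun C s (p.eval (csize a)) s'

/-! ### Closure properties of polynomial time functions -/

section closure

variable {α β γ δ σ τ : Type} [Code α] [Code β] [Code γ] [Code δ] [Code σ] [Code τ]

variable {f : α → β} {g : σ → τ → α → τ} {l : σ → List α}

/-- Size and time may be bounded by different polynomials. -/
lemma PT.intro (p q : Polynomial ℕ) (hp : ∀ a, csize (f a) ≤ p.eval (csize a))
    (hq : ∀ k, ∃ C : Cmd, ∀ (a : α) (s : Store), s k = enc a → ∃ s' : Store,
      (∀ v < k, s' v = s v) ∧ s' k = enc (f a) ∧ ClassicalRun C s (q.eval (csize a)) s') :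
    PT f := by
  refine ⟨p + q, fun a => by rw [eval_add]; exact le_add_right (hp a), fun k => ?_⟩
  obtain ⟨C, hC⟩ := hq k
  refine ⟨C, fun a s hs => ?_⟩
  obtain ⟨s', h1, h2, h3⟩ := hC a s hs
  exact ⟨s', h1, h2, h3.mono (by simp_all)⟩

@[fun_prop] lemma PT.comp {g : β → γ} (hg : PT g) (hf : PT f) : PT fun a => g (f a) := by
  obtain ⟨p, hp, hpC⟩ := hg
  obtain ⟨q, hq, hqC⟩ := hf
  refine PT.intro (p.comp q) (q + p.comp q + 1) (fun a => ?_) fun k => ?_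
  · rw [eval_comp]
    exact (hp _).trans (eval_mono p (hq a))
  obtain ⟨C, hC⟩ := hqC k
  obtain ⟨D, hD⟩ := hpC k
  refine ⟨.seq C D, fun a s hs => ?_⟩
  obtain ⟨s', h1, h2, h3⟩ := hC a s hs
  obtain ⟨s'', h1', h2', h3'⟩ := hD (f a) s' h2
  refine ⟨s'', fun v hv => (h1' v hv).trans (h1 v hv), h2', ?_⟩
  refine (h3.seq h3').mono ?_
  simp only [eval_add, eval_comp, eval_one]
  have := eval_mono p (hq a)
  omega

/-- A function with the same code is computed by the same program. -/
lemma PT.of_enc_eq {f' : γ → δ} (hf : PT f) (e : γ → α)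
    (he : ∀ c, enc c = enc (e c)) (he' : ∀ c, enc (f' c) = enc (f (e c))) : PT f' := by
  obtain ⟨p, hp, hpC⟩ := hf
  refine ⟨p, fun c => ?_, fun k => ?_⟩
  · have := hp (e c)
    rwa [csize, ← he' c, csize, ← he c] at this
  · obtain ⟨C, hC⟩ := hpC k
    refine ⟨C, fun c s hs => ?_⟩
    obtain ⟨s', h1, h2, h3⟩ := hC (e c) s (hs.trans (he c))
    refine ⟨s', h1, h2.trans (he' c).symm, ?_⟩
    rwa [csize, ← he c] at h3

@[fun_prop] lemma PT.id : PT fun a : α => a :=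
  PT.intro .X (.C 1) (fun a => by simp) fun k => ⟨.copy k k, fun a s hs =>
    ⟨s, fun _ _ => rfl, hs, by simpa using classicalRun_copy k k s⟩⟩

lemma exists_cmd_const (d : DTree) : ∃ t : ℕ, ∀ k, ∃ C : Cmd, ∀ s : Store, ∃ s' : Store,
    (∀ v < k, s' v = s v) ∧ s' k = d ∧ ClassicalRun C s t s' := by
  induction d with
  | nil =>
    refine ⟨1, fun k => ⟨.setNil k, fun s => ⟨_, fun v hv => ?_, ?_, classicalRun_setNil k s⟩⟩⟩
    · simp [hv.ne]
    · simp
  | cons a b iha ihb =>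
    obtain ⟨t, ht⟩ := iha
    obtain ⟨u, hu⟩ := ihb
    refine ⟨t + (u + 1 + 1) + 1, fun k => ?_⟩
    obtain ⟨C, hC⟩ := ht k
    obtain ⟨D, hD⟩ := hu (k + 1)
    refine ⟨.seq C (.seq D (.cons k k (k + 1))), fun s => ?_⟩
    obtain ⟨s1, h11, h12, h13⟩ := hC s
    obtain ⟨s2, h21, h22, h23⟩ := hD s1
    refine ⟨_, fun v hv => ?_, ?_, h13.seq (h23.seq (classicalRun_cons k k (k + 1) s2))⟩
    · grind
    · grind

@[fun_prop] lemma PT.const (b : β) : PT fun _ : α => b := by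
  obtain ⟨t, ht⟩ := exists_cmd_const (enc b)
  refine PT.intro (.C (csize b)) (.C t) (fun a => by simp) fun k => ?_
  obtain ⟨C, hC⟩ := ht k
  exact ⟨C, fun a s _ => by simp_all⟩

@[fun_prop] lemma PT.prodMk {g : α → γ} (hf : PT f) (hg : PT g) : PT fun a => (f a, g a) := by
  obtain ⟨p, hp, hpC⟩ := hf
  obtain ⟨q, hq, hqC⟩ := hg
  refine PT.intro (p + q + 1) (p + q + 7) (fun a => ?_) fun k => ?_
  · rw [csize_pair]
    simp only [eval_add, eval_one]
    have := hp a
    have := hq a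
    omega
  obtain ⟨C, hC⟩ := hpC (k + 1)
  obtain ⟨D, hD⟩ := hqC (k + 2)
  refine ⟨.seq (.copy (k + 1) k) (.seq C (.seq (.copy (k + 2) k) (.seq D
    (.cons k (k + 1) (k + 2))))), fun a s hs => ?_⟩
  obtain ⟨s1, h11, h12, h13⟩ := hC a (update s (k + 1) (s k)) (by simpa using hs)
  obtain ⟨s2, h21, h22, h23⟩ := hD a (update s1 (k + 2) (s1 k)) (by
    simpa [h11 k (by omega)] using hs)
  refine ⟨_, fun v hv => ?_, ?_, ((classicalRun_copy _ _ s).seq (h13.seq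
    ((classicalRun_copy _ _ s1).seq (h23.seq (classicalRun_cons k (k + 1) (k + 2) s2))))).mono ?_⟩
  · grind
  · rw [update_self, h22, h21 (k + 1) (by omega), update_of_ne (by omega), h12,
      enc_pair]
  · have h7 : Polynomial.eval (csize a) (7 : Polynomial ℕ) = 7 := Polynomial.eval_natCast ..
    simp only [eval_add, h7]
    omega

lemma PT.fst' : PT fun p : α × β => p.1 :=
  PT.intro .X (.C 1) (fun ⟨a, b⟩ => by rw [csize_pair]; simp; omega)
    fun k => ⟨.head k k, fun ⟨a, b⟩ s hs =>
    ⟨update s k (s k).head, fun v hv => by simp [hv.ne], by rw [update_self, hs, enc_pair]; rfl,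
      by simpa using classicalRun_head k k s⟩⟩

lemma PT.snd' : PT fun p : α × β => p.2 :=
  PT.intro .X (.C 1) (fun ⟨a, b⟩ => by rw [csize_pair]; simp; omega)
    fun k => ⟨.tail k k, fun ⟨a, b⟩ s hs =>
    ⟨update s k (s k).tail, fun v hv => by simp [hv.ne], by rw [update_self, hs, enc_pair]; rfl,
      by simpa using classicalRun_tail k k s⟩⟩

@[fun_prop] lemma PT.fst {f : α → β × γ} (hf : PT f) : PT fun a => (f a).1 := PT.fst'.comp hf

@[fun_prop] lemma PT.snd {f : α → β × γ} (hf : PT f) : PT fun a => (f a).2 := PT.snd'.comp hf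

lemma PT.ite_bool {c : α → Bool} {g : α → β} (hc : PT c) (hf : PT f) (hg : PT g) :
    PT fun a => if c a = true then f a else g a := by
  obtain ⟨p, hp, hpC⟩ := hc
  obtain ⟨q, hq, hqC⟩ := hf
  obtain ⟨r, hr, hrC⟩ := hg
  refine PT.intro (q + r) (p + q + r + .C 4) (fun a => ?_) fun k => ?_
  · have h1 := hq a
    have h2 := hr a
    rw [eval_add]
    split_ifs <;> omega
  obtain ⟨C, hC⟩ := hpC (k + 1)
  obtain ⟨D, hD⟩ := hqC k
  obtain ⟨E, hE⟩ := hrC k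
  refine ⟨.seq (.copy (k + 1) k) (.seq C (.cond (k + 1) D E)), fun a s hs => ?_⟩
  obtain ⟨s1, h11, h12, h13⟩ := hC a (update s (k + 1) (s k)) (by simpa using hs)
  have hk : s1 k = enc a := by grind
  have hv : ∀ v < k, s1 v = s v := by grind
  simp only [eval_add, eval_C]
  cases hca : c a with
  | true =>
    obtain ⟨s2, h21, h22, h23⟩ := hD a s1 hk
    refine ⟨s2, fun v h => (h21 v h).trans (hv v h), by grind,
      ((classicalRun_copy _ _ s).seq (h13.seq (.cond_cons ?_ h23))).mono (by omega)⟩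
    rw [h12, hca, enc_true]
    simp
  | false =>
    obtain ⟨s2, h21, h22, h23⟩ := hE a s1 hk
    refine ⟨s2, fun v h => (h21 v h).trans (hv v h), by grind,
      ((classicalRun_copy _ _ s).seq (h13.seq (.cond_nil ?_ h23))).mono (by omega)⟩
    rw [h12, hca, enc_false]

lemma PT.tail_tree : PT DTree.tail :=
  PT.intro .X (.C 1) (fun a => by
      simp only [eval_X]
      cases a with
      | nil => exact le_refl _
      | cons a b => change b.size ≤ a.size + b.size + 1; omega)
    fun k => ⟨.tail k k, fun a s hs =>
    ⟨update s k (s k).tail, fun v hv => by simp [hv.ne],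
      by rw [update_self, hs]; rfl,
      by simpa using classicalRun_tail k k s⟩⟩

lemma PT.head_tree : PT DTree.head :=
  PT.intro .X (.C 1) (fun a => by
      simp only [eval_X]
      cases a with
      | nil => exact le_refl _
      | cons a b => change a.size ≤ a.size + b.size + 1; omega)
    fun k => ⟨.head k k, fun a s hs =>
    ⟨update s k (s k).head, fun v hv => by simp [hv.ne],
      by rw [update_self, hs]; rfl,
      by simpa using classicalRun_head k k s⟩⟩

/-- Whether the tree is `nil`. -/
def DTree.isNil : DTree → Bool
  | .nil => true
  | .cons _ _ => false

lemma PT.isNil_tree : PT DTree.isNil :=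
  PT.intro (.C 3) (.C 4) (fun a => by rw [eval_C]; exact csize_bool_le _)
    fun k => ⟨.cond k (.setNil k) (.seq (.setNil k) (.cons k k k)), fun a s hs => by
      have hs' : s k = a := hs
      rw [eval_C]
      cases a with
      | nil =>
        exact ⟨_, fun v hv => by simp [hv.ne], by simp [DTree.isNil]; rfl,
          .cond_nil hs' ((classicalRun_setNil k s).seq (classicalRun_cons k k k _))⟩
      | cons a b =>
        exact ⟨_, fun v hv => by simp [hv.ne], by simp [DTree.isNil]; rfl,
          (ClassicalRun.cond_cons (by simp [hs']) (classicalRun_setNil k s)).mono (by omega)⟩⟩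

/-- The loop over the list in the variable `k + 1` with the accumulator `k + 2` and the body `C`. -/
def foldlLoop (k : ℕ) (C : Cmd) : Cmd :=
  .loop (k + 1) (.seq (.head (k + 3) (k + 1)) (.seq (.cons (k + 4) (k + 2) (k + 3))
    (.seq (.cons (k + 3) k (k + 4)) (.seq C (.seq (.copy (k + 2) (k + 3))
      (.tail (k + 1) (k + 1)))))))

/-- `B` bounds the accumulator at all intermediate stages and `L` the elements of the list; then
each call of the body has an argument of size at most `csize e + B + L + 2`, and the time is linear
in the length of the list. Some bound on the intermediate values is indispensable, as they could
grow exponentially. -/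
lemma exists_run_foldl {p : Polynomial ℕ} {k : ℕ} {C : Cmd}
    (hC : ∀ (a : σ × τ × α) (s : Store), s (k + 3) = enc a → ∃ s' : Store,
      (∀ v < k + 3, s' v = s v) ∧ s' (k + 3) = enc (g a.1 a.2.1 a.2.2) ∧
        ClassicalRun C s (p.eval (csize a)) s') (e : σ) (B L : ℕ) (l : List α) (t : τ)
    (hL : ∀ a ∈ l, csize a ≤ L) (hB : ∀ i, csize ((l.take i).foldl (g e) t) ≤ B)
    (s : Store) (h0 : s k = enc e) (h1 : s (k + 1) = enc l) (h2 : s (k + 2) = enc t) :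
    ∃ s' : Store, (∀ v < k + 1, s' v = s v) ∧ s' (k + 2) = enc (l.foldl (g e) t) ∧
      ClassicalRun (foldlLoop k C) s
        ((p.eval (csize e + B + L + 2) + 12) * l.length + 1) s' := by
  induction l generalizing t s with
  | nil => exact ⟨s, fun _ _ => rfl, h2, (ClassicalRun.loop_nil h1).mono (by simp)⟩
  | cons a l ih =>
    set s1 := update s (k + 3) (s (k + 1)).head with hs1
    set s2 := update s1 (k + 4) (.cons (s1 (k + 2)) (s1 (k + 3))) with hs2
    set s3 := update s2 (k + 3) (.cons (s2 k) (s2 (k + 4))) with hs3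
    obtain ⟨s4, h41, h42, h43⟩ := hC (e, t, a) s3 (by
      simp [hs3, hs2, hs1, h0, h1, h2, enc_pair, enc_cons, DTree.head])
    set s5 := update s4 (k + 2) (s4 (k + 3)) with hs5
    set s6 := update s5 (k + 1) (s5 (k + 1)).tail with hs6
    have hs3' : ∀ v < k + 3, s3 v = s v := by grind
    have hs6' : ∀ v < k + 1, s6 v = s v := by grind
    obtain ⟨s', h'1, h'2, h'3⟩ := ih (g e t a) (fun b hb => hL b (mem_cons_of_mem a hb))
      (fun i => hB (i + 1)) s6 ((hs6' k (by omega)).trans h0) (by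
        rw [hs6, update_self, hs5, update_of_ne (by omega), h41 _ (by omega),
          hs3' _ (by omega), h1]
        rfl) (by
        rw [hs6, update_of_ne (by omega), hs5, update_self, h42])
    refine ⟨s', fun v hv => (h'1 v hv).trans (hs6' v hv), h'2, ?_⟩
    refine (ClassicalRun.loop_cons (by rw [h1, enc_cons]; simp)
      ((classicalRun_head _ _ s).seq ((classicalRun_cons _ _ _ s1).seq
        ((classicalRun_cons _ _ _ s2).seq (h43.seq ((classicalRun_copy _ _ s4).seq
          (classicalRun_tail _ _ s5)))))) h'3).mono ?_
    have hp : p.eval (csize (e, t, a)) ≤ p.eval (csize e + B + L + 2) := by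
      apply eval_mono
      have := hB 0
      have := hL a (by simp)
      simp only [csize_pair, List.take_zero, foldl_nil] at *
      omega
    rw [length_cons, Nat.mul_add, Nat.mul_one]
    omega

/-- Iteration over a list, with values of polynomially bounded size. -/
lemma PT.foldl_of_bound {init : σ → τ} (hl : PT l)
    (hi : PT init) (hg : PT fun p : σ × τ × α => g p.1 p.2.1 p.2.2) (B : Polynomial ℕ)
    (hB : ∀ e i, csize (((l e).take i).foldl (g e) (init e)) ≤ B.eval (csize e)) :
    PT fun e => (l e).foldl (g e) (init e) := by
  obtain ⟨p, hp, hpC⟩ := hl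
  obtain ⟨q, hq, hqC⟩ := hi
  obtain ⟨r, hr, hrC⟩ := hg
  refine PT.intro B (p + q + ((r.comp (.X + B + p + .C 2) + .C 12) * p + .C 1) + .C 10)
    (fun e => ?_) fun k => ?_
  · simpa [take_of_length_le (le_refl (l e).length)] using hB e (l e).length
  obtain ⟨C, hC⟩ := hpC (k + 1)
  obtain ⟨D, hD⟩ := hqC (k + 2)
  obtain ⟨E, hE⟩ := hrC (k + 3)
  refine ⟨.seq (.copy (k + 1) k) (.seq C (.seq (.copy (k + 2) k) (.seq D (.seq (foldlLoop k E)
    (.copy k (k + 2)))))), fun e s hs => ?_⟩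
  obtain ⟨s1, h11, h12, h13⟩ := hC e (update s (k + 1) (s k)) (by simpa using hs)
  have hk : s1 k = enc e := by grind
  obtain ⟨s2, h21, h22, h23⟩ := hD e (update s1 (k + 2) (s1 k)) (by simpa using hk)
  have hs2 : ∀ v < k + 2, s2 v = s1 v := by grind
  obtain ⟨s3, h31, h32, h33⟩ := exists_run_foldl hE e (B.eval (csize e)) (p.eval (csize e)) (l e)
    (init e) (fun a ha => (csize_le_of_mem ha).le.trans (hp e)) (hB e) s2
    ((hs2 k (by omega)).trans hk) ((hs2 (k + 1) (by omega)).trans h12) h22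
  refine ⟨update s3 k (s3 (k + 2)), fun v hv => ?_, ?_,
    ((classicalRun_copy _ _ s).seq (h13.seq ((classicalRun_copy _ _ s1).seq (h23.seq
      (h33.seq (classicalRun_copy _ _ s3)))))).mono ?_⟩
  · grind
  · grind
  · simp only [eval_add, eval_C, eval_mul, eval_comp, eval_X]
    have : (r.eval (csize e + B.eval (csize e) + p.eval (csize e) + 2) + 12) * (l e).length ≤
        (r.eval (csize e + B.eval (csize e) + p.eval (csize e) + 2) + 12) * p.eval (csize e) :=
      Nat.mul_le_mul_left _ ((length_lt_csize _).le.trans (hp e))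
    omega

/-- Iteration over a list, with values of additively growing size. -/
lemma PT.foldl {init : σ → τ} (hl : PT l)
    (hi : PT init) (hg : PT fun p : σ × τ × α => g p.1 p.2.1 p.2.2) (B : Polynomial ℕ)
    (hB : ∀ e t, ∀ a ∈ l e, csize (g e t a) ≤ csize t + B.eval (csize e)) :
    PT fun e => (l e).foldl (g e) (init e) := by
  have hl' := hl
  have hi' := hi
  obtain ⟨p, hp, -⟩ := hl'
  obtain ⟨q, hq, -⟩ := hi'
  refine PT.foldl_of_bound hl hi hg (q + p * B) fun e i => ?_
  have key : ∀ (l' : List α) (t : τ), (∀ a ∈ l', a ∈ l e) →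
      csize (l'.foldl (g e) t) ≤ csize t + l'.length * B.eval (csize e) := by
    intro l'
    induction l' with
    | nil => intro t _; simp
    | cons a l' ih =>
      intro t h
      have h1 := ih (g e t a) fun b hb => h b (mem_cons_of_mem a hb)
      have h2 := hB e t a (h a (by simp))
      rw [foldl_cons, length_cons, Nat.add_mul, Nat.one_mul]
      omega
  refine (key _ _ fun a ha => mem_of_mem_take ha).trans ?_
  rw [eval_add, eval_mul]
  refine Nat.add_le_add (hq e) (Nat.mul_le_mul_right _ ?_)
  have := (length_lt_csize (l e)).le.trans (hp e)
  rw [length_take]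
  omega

end closure

end

open Code (enc)

section

/-! ### Lists, numbers and truth values in polynomial time -/

section library

variable {α β γ σ τ : Type} [Code α] [Code β] [Code γ] [Code σ] [Code τ]

variable {c : σ → Bool} {f g : σ → ℕ} {d : σ → Bool} {l : σ → List α} {n : σ → ℕ}

@[fun_prop] lemma PT.ite {f g : σ → α} (hc : PT c) (hf : PT f) (hg : PT g) :
    PT fun a => if c a = true then f a else g a := hc.ite_bool hf hg

@[fun_prop] lemma PT.cond {f g : σ → α} (hc : PT c) (hf : PT f) (hg : PT g) :
    PT fun a => cond (c a) (f a) (g a) := by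
  simpa [Bool.cond_eq_ite] using hc.ite_bool hf hg

@[fun_prop] lemma PT.not (hc : PT c) : PT fun a => !c a := by
  have : (fun a => !c a) = fun a => bif c a then false else true := by grind
  rw [this]; fun_prop

@[fun_prop] lemma PT.and (hc : PT c) (hd : PT d) : PT fun a => (c a && d a) := by
  have : (fun a => (c a && d a)) = fun a => bif c a then d a else false := by grind
  rw [this]; fun_prop

@[fun_prop] lemma PT.xor (hc : PT c) (hd : PT d) : PT fun a => Bool.xor (c a) (d a) := by
  have : (fun a => Bool.xor (c a) (d a)) = fun a => bif c a then !d a else d a := by grind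
  rw [this]; fun_prop

@[fun_prop] lemma PT.beq_bool (hc : PT c) (hd : PT d) : PT fun a => c a == d a := by
  have : (fun a => c a == d a) = fun a => bif c a then d a else !d a := by grind
  rw [this]; fun_prop

@[fun_prop] lemma PT.list_cons {f : σ → α} (hf : PT f) (hl : PT l) : PT fun e => f e :: l e :=
  (hf.prodMk hl).of_enc_eq (fun e => e) (fun _ => rfl) fun _ => rfl

lemma PT.succ (hf : PT f) : PT fun e => f e + 1 :=
  ((PT.const ()).prodMk hf).of_enc_eq (fun e => e) (fun _ => rfl) fun _ => rfl

@[fun_prop] lemma PT.tail (hl : PT l) : PT fun e => (l e).tail := by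
  have h : PT (fun l : List α => l.tail) :=
    PT.tail_tree.of_enc_eq (fun l : List α => enc l) (fun _ => rfl) fun l => by cases l <;> rfl
  exact h.comp hl

lemma PT.pred (hf : PT f) : PT fun e => f e - 1 := by
  have h : PT (fun n : ℕ => n - 1) :=
    PT.tail_tree.of_enc_eq (fun n : ℕ => enc n) (fun _ => rfl) fun n => by cases n <;> rfl
  exact h.comp hf

attribute [local fun_prop] PT.succ PT.pred

@[fun_prop] lemma PT.isEmpty (hl : PT l) : PT fun e => (l e).isEmpty := by
  have h : PT (fun l : List α => l.isEmpty) :=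
    PT.isNil_tree.of_enc_eq (fun l : List α => enc l) (fun _ => rfl) fun l => by cases l <;> rfl
  exact h.comp hl

@[fun_prop] lemma PT.beq_zero (hf : PT f) : PT fun e => f e == 0 := by
  have h : PT (fun n : ℕ => n == 0) :=
    PT.isNil_tree.of_enc_eq (fun n : ℕ => enc n) (fun _ => rfl) fun n => by cases n <;> rfl
  exact h.comp hf

@[fun_prop] lemma PT.headD {d : σ → α} (hl : PT l) (hd : PT d) : PT fun e => (l e).headD (d e) := by
  have h1 : PT fun e => enc (l e) := hl.of_enc_eq (fun e => e) (fun _ => rfl) fun _ => rfl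
  have h2 : PT fun e => enc (d e) := hd.of_enc_eq (fun e => e) (fun _ => rfl) fun _ => rfl
  refine (hl.isEmpty.ite h2 (PT.head_tree.comp h1)).of_enc_eq (fun e => e) (fun _ => rfl)
    fun e => ?_
  cases l e <;> rfl

@[fun_prop] lemma PT.replicate_unit (hf : PT f) : PT fun e => List.replicate (f e) () :=
  hf.of_enc_eq (fun e => e) (fun _ => rfl) fun e => by
    induction f e with
    | zero => rfl
    | succ n ih => rw [List.replicate_succ, enc_cons, ih]; rfl

lemma PT.length' : PT fun l : List α => l.length := by
  have : PT fun l : List α => l.foldl (fun n _ => n + 1) 0 :=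
    PT.foldl (g := fun (_ : List α) (n : ℕ) (_ : α) => n + 1) PT.id (PT.const 0) (by fun_prop)
      (.C 2) fun e t a _ => by simp [csize_nat]; omega
  refine this.of_enc_eq (fun l => l) (fun _ => rfl) fun l => ?_
  congr 1
  have : ∀ (l : List α) (n : ℕ), l.foldl (fun n _ => n + 1) n = n + l.length := by simp_all
  simp [this]

@[fun_prop] lemma PT.length (hl : PT l) : PT fun e => (l e).length := PT.length'.comp hl

lemma foldl_replicate {τ : Type} (h : τ → τ) (n : ℕ) (t : τ) :
    (List.replicate n ()).foldl (fun t _ => h t) t = h^[n] t := by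
  induction n generalizing t with
  | zero => rfl
  | succ n ih => rw [List.replicate_succ, foldl_cons, ih, iterate_succ_apply]

/-- Iteration of a function, with values of polynomially bounded size. -/
lemma PT.iterate_of_bound {init : σ → τ} {g : σ → τ → τ} (hn : PT n)
    (hi : PT init) (hg : PT fun p : σ × τ => g p.1 p.2) (B : Polynomial ℕ)
    (hB : ∀ e, ∀ i ≤ n e, csize ((g e)^[i] (init e)) ≤ B.eval (csize e)) :
    PT fun e => (g e)^[n e] (init e) := by
  have := PT.foldl_of_bound (l := fun e => List.replicate (n e) ()) (init := init)
    (g := fun e t _ => g e t) (by fun_prop) hi (by fun_prop) B fun e i => by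
      rw [List.take_replicate, foldl_replicate]
      exact hB e _ (min_le_right _ _)
  simpa only [foldl_replicate] using this

/-- Iteration of a function, with values of additively growing size. -/
lemma PT.iterate {init : σ → τ} {g : σ → τ → τ} (hn : PT n)
    (hi : PT init) (hg : PT fun p : σ × τ => g p.1 p.2) (B : Polynomial ℕ)
    (hB : ∀ e t, csize (g e t) ≤ csize t + B.eval (csize e)) :
    PT fun e => (g e)^[n e] (init e) := by
  have := PT.foldl (l := fun e => List.replicate (n e) ()) (init := init)
    (g := fun e t _ => g e t) (by fun_prop) hi (by fun_prop) B fun e t _ _ => hB e t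
  simpa only [foldl_replicate] using this

@[fun_prop] lemma PT.add (hf : PT f) (hg : PT g) : PT fun e => f e + g e := by
  have := PT.iterate (n := g) (init := f) (g := fun _ t => t + 1) hg hf (by fun_prop) (.C 2)
    fun e t => by simp [csize_nat]; omega
  simpa using this

@[fun_prop] lemma PT.sub (hf : PT f) (hg : PT g) : PT fun e => f e - g e := by
  have := PT.iterate (n := g) (init := f) (g := fun _ t => t - 1) hg hf (by fun_prop) (.C 2)
    fun e t => by simp [csize_nat]; omega
  have h : ∀ n m : ℕ, (fun t => t - 1)^[n] m = m - n := by
    intro n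
    induction n with
    | zero => simp
    | succ n ih => intro m; rw [iterate_succ_apply, ih]; omega
  simpa only [h] using this

@[fun_prop] lemma PT.mul (hf : PT f) (hg : PT g) : PT fun e => f e * g e := by
  have hf' := hf
  obtain ⟨p, hp, -⟩ := hf'
  have := PT.iterate (n := g) (init := fun _ => 0) (g := fun e t => t + f e) hg (by fun_prop)
    (by fun_prop) p
    fun e t => by have := hp e; simp only [csize_nat] at *; omega
  have h : ∀ n m k : ℕ, (fun t => t + m)^[n] k = k + m * n := by
    intro n
    induction n with
    | zero => simp
    | succ n ih => intro m k; rw [iterate_succ_apply, ih]; ring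
  simpa only [h, Nat.zero_add] using this

@[fun_prop] lemma PT.ble (hf : PT f) (hg : PT g) : PT fun e => Nat.ble (f e) (g e) := by
  have : (fun e => Nat.ble (f e) (g e)) = fun e => f e - g e == 0 := by
    funext e
    rw [Bool.eq_iff_iff]
    simp [Nat.sub_eq_zero_iff_le]
  rw [this]; fun_prop

@[fun_prop] lemma PT.beq_nat (hf : PT f) (hg : PT g) : PT fun e => f e == g e := by
  have : (fun e => f e == g e) = fun e => Nat.ble (f e) (g e) && Nat.ble (g e) (f e) := by
    funext e
    rw [Bool.eq_iff_iff]
    simp only [beq_iff_eq, Bool.and_eq_true, ble_eq]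
    omega
  rw [this]; fun_prop

@[fun_prop] lemma PT.append {l' : σ → List α} (hl : PT l) (hl' : PT l') : PT fun e => l e ++ l' e := by
  -- A fold can only push elements to the front, so one fold reverses `l e` and a second one pushes
  -- the result onto `l' e`.
  have hrev : PT fun e => (l e).foldl (fun acc a => a :: acc) [] :=
    PT.foldl_of_bound (g := fun _ acc a => a :: acc) hl (PT.const []) (by fun_prop)
      (hl.choose) fun e i => by
        have hs := hl.choose_spec.1 e
        refine le_trans ?_ hs
        refine le_trans ?_ (csize_take_le (l e) i)
        have : ∀ (m acc : List α), csize (m.foldl (fun acc a => a :: acc) acc) + 1 =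
            csize m + csize acc := by
          intro m
          induction m with
          | nil => intro acc; simp [csize_nil]; omega
          | cons a m ih => intro acc; simp only [foldl_cons, ih, csize_cons]; omega
        have := this ((l e).take i) []
        simp only [csize_nil] at this
        omega
  have h2 : PT fun e => ((l e).foldl (fun acc a => a :: acc) []).foldl (fun acc a => a :: acc)
      (l' e) := by
    have hrev' := hrev
    obtain ⟨p, hp, -⟩ := hrev'
    refine PT.foldl (g := fun _ acc a => a :: acc) hrev hl' (by fun_prop) (p + 1) fun e t a ha => ?_
    have := (csize_le_of_mem ha).trans_le (hp e)
    simp only [csize_cons, eval_add, eval_one]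
    omega
  have h1 : ∀ m acc : List α, m.foldl (fun acc a => a :: acc) acc = m.reverse ++ acc := by simp_all
  simpa [h1] using h2

@[fun_prop] lemma PT.flatMap {g : σ → α → List β} (hl : PT l)
    (hg : PT fun p : σ × α => g p.1 p.2) : PT fun e => (l e).flatMap (g e) := by
  obtain ⟨p, hp, -⟩ := _root_.id hl
  obtain ⟨q, hq, -⟩ := _root_.id hg
  have := PT.foldl (l := l) (init := fun _ => []) (g := fun e acc a => acc ++ g e a) hl (by fun_prop)
    (by fun_prop) (q.comp (.X + p + 1)) fun e t a ha => by
      have h1 := csize_append t (g e a)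
      have h2 := hq (e, a)
      have h3 : q.eval (csize (e, a)) ≤ q.eval (csize e + p.eval (csize e) + 1) := by
        apply eval_mono
        have := (csize_le_of_mem ha).trans_le (hp e)
        rw [csize_pair]; omega
      simp only [eval_comp, eval_add, eval_X, eval_one] at *
      omega
  have h : ∀ (e : σ) (m : List α) (acc : List β),
      m.foldl (fun acc a => acc ++ g e a) acc = acc ++ m.flatMap (g e) := by
    intro e m
    induction m with
    | nil => simp
    | cons a m ih => intro acc; simp [ih]
  simpa [h] using this

@[fun_prop] lemma PT.map {g : σ → α → β} (hl : PT l)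
    (hg : PT fun p : σ × α => g p.1 p.2) : PT fun e => (l e).map (g e) := by
  have : PT fun e => (l e).flatMap fun a => [g e a] := by fun_prop
  simpa [← List.map_eq_flatMap] using this

@[fun_prop] lemma PT.filter {g : σ → α → Bool} (hl : PT l)
    (hg : PT fun p : σ × α => g p.1 p.2) : PT fun e => (l e).filter (g e) := by
  have : PT fun e => (l e).flatMap fun a => bif g e a then [a] else [] := by fun_prop
  have h : ∀ e, (l e).filter (g e) = (l e).flatMap fun a => bif g e a then [a] else [] := by
    intro e
    induction l e with
    | nil => rfl
    | cons a m ih => cases h : g e a <;> simp [h, ih]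
  simpa only [h] using this

@[fun_prop] lemma PT.all {g : σ → α → Bool} (hl : PT l)
    (hg : PT fun p : σ × α => g p.1 p.2) : PT fun e => (l e).all (g e) := by
  have : PT fun e => ((l e).filter fun a => !g e a).isEmpty := by fun_prop
  have h : ∀ e, (l e).all (g e) = ((l e).filter fun a => !g e a).isEmpty := by
    intro e
    rw [Bool.eq_iff_iff]
    simp
  simpa only [h] using this

@[fun_prop] lemma PT.reverse (hl : PT l) : PT fun e => (l e).reverse := by
  obtain ⟨p, hp, -⟩ := _root_.id hl
  have := PT.foldl (l := l) (init := fun _ => []) (g := fun _ acc a => a :: acc) hl (by fun_prop)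
    (by fun_prop) (p + 1) fun e t a ha => by
      have := (csize_le_of_mem ha).trans_le (hp e)
      simp only [csize_cons, eval_add, eval_one]
      omega
  simpa using this

@[fun_prop] lemma PT.drop (hn : PT n) (hl : PT l) : PT fun e => (l e).drop (n e) := by
  have := PT.iterate (n := n) (init := l) (g := fun _ t => t.tail) hn hl (by fun_prop) (.C 0)
    fun e t => by
      cases t with
      | nil => simp
      | cons a t => simp only [List.tail_cons, csize_cons]; omega
  have h : ∀ (n : ℕ) (m : List α), (fun t => t.tail)^[n] m = m.drop n := by
    intro n
    induction n with
    | zero => simp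
    | succ n ih => intro m; rw [iterate_succ_apply, ih, List.drop_tail]
  simpa only [h] using this

@[fun_prop] lemma PT.getD {d : σ → α} (hn : PT n) (hl : PT l) (hd : PT d) :
    PT fun e => (l e).getD (n e) (d e) := by
  have : PT fun e => ((l e).drop (n e)).headD (d e) := by fun_prop
  have h : ∀ e, (l e).getD (n e) (d e) = ((l e).drop (n e)).headD (d e) := by simp_all
  simpa only [h] using this

@[fun_prop] lemma PT.range (hn : PT n) : PT fun e => List.range (n e) := by
  obtain ⟨p, hp, -⟩ := _root_.id hn
  have h : ∀ i, (fun t : List ℕ => t ++ [t.length])^[i] [] = List.range i := by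
    intro i
    induction i with
    | zero => rfl
    | succ i ih => rw [iterate_succ_apply', ih, range_succ, length_range]
  have := PT.foldl_of_bound (l := fun e => List.replicate (n e) ()) (init := fun _ => ([] : List ℕ))
    (g := fun _ t _ => t ++ [t.length]) (by fun_prop) (by fun_prop) (by fun_prop)
    ((.C 2 * p + .C 2) * p + 1) fun e i => by
      rw [List.take_replicate, foldl_replicate]
      rw [h]
      have h2 : ∀ i, csize (List.range i) ≤ (2 * i + 2) * i + 1 := by
        intro i
        induction i with
        | zero => simp [csize_nil]
        | succ i ih =>
          have := csize_append (List.range i) [i]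
          rw [range_succ]
          simp only [csize_cons, csize_nil, csize_nat] at this
          nlinarith
      refine (h2 _).trans ?_
      have h3 : n e ≤ p.eval (csize e) := by have := hp e; rw [csize_nat] at this; omega
      have h4 : min i (n e) ≤ p.eval (csize e) := (min_le_right _ _).trans h3
      simp only [eval_add, eval_mul, eval_one, eval_C]
      gcongr
  simpa only [foldl_replicate, h] using this

@[fun_prop] lemma PT.take (hn : PT n) (hl : PT l) : PT fun e => (l e).take (n e) := by
  have : PT fun e => ((l e).reverse.drop ((l e).length - n e)).reverse := by fun_prop
  have h : ∀ e, (l e).take (n e) = ((l e).reverse.drop ((l e).length - n e)).reverse := by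
    intro e
    rw [List.drop_reverse, List.reverse_reverse]
    rcases le_total (n e) (l e).length with h | h
    · congr 1; omega
    · simp_all
  simpa only [h] using this

end library

end

section

/-! ### Lists of gates -/

/-- A gate: its kind (`0` for `X`, `1` for `H`, `2` for CNOT, from `3` on Toffoli) and the indices
of its operands. -/
abbrev Gate : Type := ℕ × ℕ × ℕ × ℕ

variable {M n : ℕ} {f g : List Bool → ℝ} {ψ : QState M} {s : Store} {p₁ p₂ : Store × QState M}
   {L₁ L₂ : List (Store × QState M)}

/-- The tree operand of `onQubit` replaced by a number. -/
def onIndex (a : ℕ) (g : Fin M → QState M → QState M) (ψ : QState M) : QState M :=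
  if h : a < M then g ⟨a, h⟩ ψ else ψ

lemma length_enc_nat (n : ℕ) : (enc n).length = n := by
  induction n with
  | zero => rfl
  | succ n ih => exact congrArg (· + 1) ih

lemma onQubit_enc (a : ℕ) : onQubit (M := M) (enc a) = onIndex a := by
  funext g ψ
  simp only [onQubit, onIndex, length_enc_nat]

/-- The effect of a gate on the state of the device. -/
def Gate.app : Gate → QState M → QState M
  | (0, p, _, _), ψ => onIndex p applyX ψ
  | (1, p, _, _), ψ => onIndex p applyH ψ
  | (2, p, q, _), ψ => onIndex p (fun i => onIndex q fun j φ =>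
        if i ≠ j then applyCNOT i j φ else φ) ψ
  | (_ + 3, p, q, r), ψ => onIndex p (fun i => onIndex q fun j => onIndex r fun k φ =>
        if i ≠ j ∧ i ≠ k ∧ j ≠ k then applyToffoli i j k φ else φ) ψ

/-- The effect of a list of gates. -/
def appGates (l : List Gate) (ψ : QState M) : QState M := l.foldl (fun ψ g => g.app ψ) ψ

lemma appGates_nil (ψ : QState M) : appGates [] ψ = ψ := rfl
lemma appGates_cons (g : Gate) (l : List Gate) (ψ : QState M) :
    appGates (g :: l) ψ = appGates l (g.app ψ) := rfl
lemma appGates_append (l l' : List Gate) (ψ : QState M) :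
    appGates (l ++ l') ψ = appGates l' (appGates l ψ) := foldl_append ..

/-- Apply the gate whose kind is in `k + 2` and whose operands are in `k + 3`, `k + 4`, `k + 5`. -/
def gateCmd (k : ℕ) : Cmd :=
  .cond (k + 2) (.seq (.tail (k + 2) (k + 2)) (.cond (k + 2) (.seq (.tail (k + 2) (k + 2))
    (.cond (k + 2) (.gateToffoli (k + 3) (k + 4) (k + 5)) (.gateCNOT (k + 3) (k + 4))))
      (.gateH (k + 3)))) (.gateX (k + 3))

/-- Apply the gates of the list in the variable `k`. -/
def gateLoop (k : ℕ) : Cmd :=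
  .loop k (.seq (.head (k + 1) k) (.seq (.tail k k) (.seq (.head (k + 2) (k + 1))
    (.seq (.tail (k + 1) (k + 1)) (.seq (.head (k + 3) (k + 1)) (.seq (.tail (k + 1) (k + 1))
      (.seq (.head (k + 4) (k + 1)) (.seq (.tail (k + 5) (k + 1)) (gateCmd k)))))))))

/-- The kind is a number in unary, so each nested test peels off one cell. Only `k + 2` changes, and
thus the rest of the list of gates in `k` survives. -/
lemma exists_run_gateCmd (k : ℕ) (g : Gate) (s : Store) (h2 : s (k + 2) = enc g.1)
    (h3 : s (k + 3) = enc g.2.1) (h4 : s (k + 4) = enc g.2.2.1) (h5 : s (k + 5) = enc g.2.2.2) :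
    ∃ s' : Store, (∀ v, v ≠ k + 2 → s' v = s v) ∧ ∀ (M : ℕ) (ψ : QState M),
      Runs (gateCmd k) s ψ 10 [(s', g.app ψ)] := by
  obtain ⟨tag, p, q, r⟩ := g
  simp only at h2 h3 h4 h5
  set s1 := update s (k + 2) (s (k + 2)).tail with hs1
  set s2 := update s1 (k + 2) (s1 (k + 2)).tail with hs2
  have e1 : ∀ v, v ≠ k + 2 → s1 v = s v := fun v hv => update_of_ne hv ..
  have e2 : ∀ v, v ≠ k + 2 → s2 v = s v := by grind
  match tag with
  | 0 =>
    refine ⟨s, fun _ _ => rfl, fun M ψ => ?_⟩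
    refine (Runs.cond_nil h2 (t := 1) (Runs.of_step fun l => ?_)).mono (by omega)
    simp only [step, h3, onQubit_enc, Gate.app, List.map]
  | 1 =>
    refine ⟨s1, e1, fun M ψ => ?_⟩
    refine (Runs.cond_cons (by rw [h2, enc_succ]; simp) ((classicalRun_tail _ _ s M ψ).seq_single
      (.cond_nil ?_ (t := 1) (Runs.of_step fun l => ?_)))).mono (by omega)
    · rw [update_self, h2]; rfl
    · simp only [step, e1 (k + 3) (by omega), h3, onQubit_enc, Gate.app, List.map, ← hs1]
  | 2 =>
    refine ⟨s2, e2, fun M ψ => ?_⟩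
    refine (Runs.cond_cons (by rw [h2, enc_succ]; simp) ((classicalRun_tail _ _ s M ψ).seq_single
      (.cond_cons ?_ ((classicalRun_tail _ _ s1 M ψ).seq_single
        (.cond_nil ?_ (t := 1) (Runs.of_step fun l => ?_)))))).mono (by omega)
    · rw [update_self, h2]; simp [enc_succ, DTree.tail]
    · rw [update_self, hs1, update_self, h2]; rfl
    · simp only [step, e2 (k + 3) (by omega), e2 (k + 4) (by omega), h3, h4, onQubit_enc,
        Gate.app, List.map, ← hs2]
  | n + 3 =>
    refine ⟨s2, e2, fun M ψ => ?_⟩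
    refine (Runs.cond_cons (by rw [h2, enc_succ]; simp) ((classicalRun_tail _ _ s M ψ).seq_single
      (.cond_cons ?_ ((classicalRun_tail _ _ s1 M ψ).seq_single
        (.cond_cons ?_ (t := 1) (Runs.of_step fun l => ?_)))))).mono (by omega)
    · rw [update_self, h2]; simp [enc_succ, DTree.tail]
    · rw [update_self, hs1, update_self, h2]; simp [enc_succ, DTree.tail]
    · simp only [step, e2 (k + 3) (by omega), e2 (k + 4) (by omega), e2 (k + 5) (by omega), h3, h4,
        h5, onQubit_enc, Gate.app, List.map, ← hs2]

lemma exists_run_gateLoop (k : ℕ) (l : List Gate) (s : Store) (hk : s k = enc l) :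
    ∃ s' : Store, (∀ v < k, s' v = s v) ∧ ∀ (M : ℕ) (ψ : QState M),
      Runs (gateLoop k) s ψ (30 * l.length + 1) [(s', appGates l ψ)] := by
  induction l generalizing s with
  | nil => exact ⟨s, fun _ _ => rfl, fun M ψ => Runs.loop_nil hk⟩
  | cons g l ih =>
    obtain ⟨tag, p, q, r⟩ := g
    set s1 := update s (k + 1) (s k).head with hs1
    set s2 := update s1 k (s1 k).tail with hs2
    set s3 := update s2 (k + 2) (s2 (k + 1)).head with hs3
    set s4 := update s3 (k + 1) (s3 (k + 1)).tail with hs4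
    set s5 := update s4 (k + 3) (s4 (k + 1)).head with hs5
    set s6 := update s5 (k + 1) (s5 (k + 1)).tail with hs6
    set s7 := update s6 (k + 4) (s6 (k + 1)).head with hs7
    set s8 := update s7 (k + 5) (s7 (k + 1)).tail with hs8
    have hv : ∀ v < k, s8 v = s v := by grind
    obtain ⟨hk8, e1, e2, e3, e4⟩ : s8 k = enc l ∧ s8 (k + 2) = enc tag ∧ s8 (k + 3) = enc p ∧
        s8 (k + 4) = enc q ∧ s8 (k + 5) = enc r := by
      simp [hs8, hs7, hs6, hs5, hs4, hs3, hs2, hs1, hk, enc_cons, enc_pair, DTree.tail, DTree.head]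
    obtain ⟨s9, h9, h9'⟩ := exists_run_gateCmd k (tag, p, q, r) s8 e1 e2 e3 e4
    obtain ⟨s', hs'1, hs'2⟩ := ih s9 ((h9 k (by omega)).trans hk8)
    refine ⟨s', fun v hvk => by grind, fun M ψ => ?_⟩
    have := Runs.loop_cons (x := k) (K := fun p => [(s', appGates l p.2)])
      (by rw [hk, enc_cons]; simp)
      ((classicalRun_head (k + 1) k s M ψ).seq_single
      ((classicalRun_tail k k s1 M ψ).seq_single
      ((classicalRun_head (k + 2) (k + 1) s2 M ψ).seq_single
      ((classicalRun_tail (k + 1) (k + 1) s3 M ψ).seq_single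
      ((classicalRun_head (k + 3) (k + 1) s4 M ψ).seq_single
      ((classicalRun_tail (k + 1) (k + 1) s5 M ψ).seq_single
      ((classicalRun_head (k + 4) (k + 1) s6 M ψ).seq_single
      ((classicalRun_tail (k + 5) (k + 1) s7 M ψ).seq_single (h9' M ψ)))))))))
      (u := 30 * l.length + 1) (by
        intro p hp
        rw [mem_singleton] at hp
        subst hp
        exact hs'2 M _)
    refine (Runs.mono this ?_ : _)
    rw [length_cons]
    omega

/-! ### Sums over bit strings -/

/-- The bit strings of length `n`. -/
def bitLists : ℕ → List (List Bool)
  | 0 => [[]]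
  | n + 1 => [false, true].flatMap fun v => (bitLists n).map fun ρ => ρ ++ [v]

/-- The sum of `f` over the bit strings of length `n`. -/
def bsum (n : ℕ) (f : List Bool → ℝ) : ℝ := ((bitLists n).map f).sum

lemma bsum_zero (f : List Bool → ℝ) : bsum 0 f = f [] := by simp [bsum, bitLists]

lemma bsum_succ (n : ℕ) (f : List Bool → ℝ) :
    bsum (n + 1) f = bsum n (fun ρ => f (ρ ++ [false])) + bsum n (fun ρ => f (ρ ++ [true])) := by
  simp [bsum, bitLists, comp_def]

lemma length_of_mem_bitLists {ρ : List Bool} (h : ρ ∈ bitLists n) : ρ.length = n := by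
  induction n generalizing ρ with
  | zero => simp [bitLists] at h; simp [h]
  | succ n ih =>
    simp only [bitLists, mem_flatMap, mem_map] at h
    obtain ⟨v, -, ρ', h, rfl⟩ := h
    simp [ih h]

lemma exists_eq_append_singleton {n : ℕ} {ρ : List Bool} (h : ρ.length = n + 1) :
    ∃ ρ' v, ρ = ρ' ++ [v] ∧ ρ'.length = n := by
  rcases List.eq_nil_or_concat ρ with rfl | ⟨ρ', v, rfl⟩
  · simp at h
  · exact ⟨ρ', v, by simp, by simpa using h⟩

lemma length_bitLists (n : ℕ) : (bitLists n).length = 2 ^ n := by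
  induction n with
  | zero => rfl
  | succ n ih => simp [bitLists, ih]; ring

lemma bsum_le (h : ∀ ρ, ρ.length = n → f ρ ≤ g ρ) : bsum n f ≤ bsum n g :=
  sum_le_sum fun ρ hρ => h ρ (length_of_mem_bitLists hρ)

lemma bsum_congr (h : ∀ ρ, ρ.length = n → f ρ = g ρ) : bsum n f = bsum n g :=
  le_antisymm (bsum_le fun ρ hρ => (h ρ hρ).le) (bsum_le fun ρ hρ => (h ρ hρ).ge)

lemma bsum_add (f g : List Bool → ℝ) :
    bsum n (fun ρ => f ρ + g ρ) = bsum n f + bsum n g := by simp [bsum]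

lemma bsum_mul_left (c : ℝ) (f : List Bool → ℝ) :
    bsum n (fun ρ => c * f ρ) = c * bsum n f := by simp [bsum, List.sum_map_mul_left]

lemma bsum_const (n : ℕ) (c : ℝ) : bsum n (fun _ => c) = 2 ^ n * c := by
  simp [bsum, length_bitLists]

lemma bsum_nonneg (h : ∀ ρ, ρ.length = n → 0 ≤ f ρ) : 0 ≤ bsum n f := by
  have := bsum_le (n := n) (f := fun _ => 0) h
  simpa [bsum_const] using this

/-- Strings of length `m + n` are split after `m` bits. -/
lemma bsum_append (m n : ℕ) (f : List Bool → ℝ) :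
    bsum (m + n) f = bsum m fun ρ => bsum n fun ρ' => f (ρ ++ ρ') := by
  induction n generalizing f with
  | zero => simp [bsum_zero]
  | succ n ih =>
    rw [← Nat.add_assoc, bsum_succ, ih, ih, ← bsum_add]
    simp [bsum_succ]

lemma bsum_succ' (n : ℕ) (f : List Bool → ℝ) :
    bsum (n + 1) f = bsum n (fun ρ => f (false :: ρ)) + bsum n (fun ρ => f (true :: ρ)) := by
  rw [Nat.add_comm, bsum_append, bsum_succ, bsum_zero, bsum_zero]
  rfl

/-! ### Coins and measurements -/

/-- The string `ρ` as a basis state of the device, with `false` beyond its end. -/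
def toBits (ρ : List Bool) : Fin M → Bool := fun i => ρ.getD i false

lemma toBits_nil : (toBits [] : Fin M → Bool) = fun _ => false := by
  funext i; simp [toBits]

lemma toBits_append_singleton (ρ : List Bool) (v : Bool) (h : ρ.length < M) :
    (toBits (ρ ++ [v]) : Fin M → Bool) = update (toBits ρ) ⟨ρ.length, h⟩ v := by
  funext i
  rcases lt_trichotomy (i : ℕ) ρ.length with hi | hi | hi
  · rw [update_of_ne (by grind)]
    simp [toBits, List.getElem?_append_left hi]
  · obtain rfl : i = ⟨ρ.length, h⟩ := Fin.ext hi
    simp [toBits]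
  · rw [update_of_ne (by grind)]
    simp only [toBits, List.getD_eq_getElem?_getD]
    rw [List.getElem?_eq_none (by simp; omega), List.getElem?_eq_none (by omega)]

/-- In `ψ`, the qubits from `Q` on are in the state `0`. -/
def SuppBelow (Q : ℕ) (ψ : QState M) : Prop :=
  ∀ (b : Fin M → Bool) (i : Fin M), Q ≤ i → b i = true → ψ b = 0

lemma SuppBelow.eq_smul_zero (h : SuppBelow 0 ψ) : ψ = ψ (toBits []) • QState.zero M := by
  funext b
  by_cases hb : b = fun _ => false
  · simp [QState.zero, toBits_nil, hb]
  · obtain ⟨i, hi⟩ : ∃ i, b i = true := by grind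
    simp [QState.zero, hb, h b i (Nat.zero_le _) hi]

/-- The state after qubit `i` was measured with the outcome `v` and then reset. -/
def takeBit (i : Fin M) (v : Bool) (ψ : QState M) : QState M :=
  fun b => if b i = false then ψ (update b i v) else 0

lemma project_false_eq_takeBit (i : Fin M) (ψ : QState M) :
    project i false ψ = takeBit i false ψ := by
  funext b
  by_cases hb : b i = false
  · have : update b i false = b := by rw [← hb, update_eq_self]
    simp [project, takeBit, hb, this]
  · simp [project, takeBit, hb]

lemma applyX_project_true_eq_takeBit (i : Fin M) (ψ : QState M) :
    applyX i (project i true ψ) = takeBit i true ψ := by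
  funext b
  cases hb : b i <;> simp [project, takeBit, hb, applyX]

lemma SuppBelow.takeBit {Q : ℕ} (h : SuppBelow (Q + 1) ψ) (hQ : Q < M)
    (v : Bool) : SuppBelow Q (takeBit ⟨Q, hQ⟩ v ψ) := by
  intro b i hi hb
  unfold HybridSAT.takeBit
  split_ifs with hb'
  · have hne : i ≠ ⟨Q, hQ⟩ := by rintro rfl; simp [hb] at hb'
    refine h _ i ?_ (by grind)
    have : (i : ℕ) ≠ Q := fun h => hne (Fin.ext h)
    omega
  · rfl

lemma takeBit_toBits (ρ : List Bool) (h : ρ.length < M) (v : Bool) (ψ : QState M) :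
    takeBit ⟨ρ.length, h⟩ v ψ (toBits ρ) = ψ (toBits (ρ ++ [v])) := by
  rw [toBits_append_singleton ρ v h, takeBit, if_pos]
  simp [toBits]

/-- Measure the qubit with its index in `p`, reset it, and keep the outcome in `x`. -/
def measureReset (x p y : ℕ) : Cmd := .seq (.measure x p) (.cond x (.gateX p) (.setNil y))

-- In `Runs.seq` the continuation is a function of the pair of store and state. To continue two
-- branches in different ways they have to be distinguishable, which is what `hne` provides; in the
-- applications the stores differ in the outcome of the measurement.
open Classical in
lemma Runs.seq_pair {C D : Cmd} {t u : ℕ} (hne : p₁.1 ≠ p₂.1)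
    (h : Runs C s ψ t [p₁, p₂]) (h₁ : Runs D p₁.1 p₁.2 u L₁) (h₂ : Runs D p₂.1 p₂.2 u L₂) :
    Runs (.seq C D) s ψ (t + u + 1) (L₁ ++ L₂) := by
  have hne' : p₂ ≠ p₁ := fun h => hne (congrArg Prod.fst h.symm)
  have := h.seq (D := D) (u := u) (K := fun p => if p = p₁ then L₁ else L₂) (by
    intro p hp
    rcases mem_pair.1 hp with rfl | rfl
    · simpa using h₁
    · simpa [hne'] using h₂)
  simpa [hne'] using this

open Classical in
lemma Runs.loop_pair {C : Cmd} {x : ℕ} {t u : ℕ} (hx : s x ≠ .nil)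
    (hne : p₁.1 ≠ p₂.1) (h : Runs C s ψ t [p₁, p₂]) (h₁ : Runs (.loop x C) p₁.1 p₁.2 u L₁)
    (h₂ : Runs (.loop x C) p₂.1 p₂.2 u L₂) :
    Runs (.loop x C) s ψ (t + u + 1) (L₁ ++ L₂) := by
  have hne' : p₂ ≠ p₁ := fun h => hne (congrArg Prod.fst h.symm)
  have := Runs.loop_cons (u := u) (K := fun p => if p = p₁ then L₁ else L₂) hx h (by
    intro p hp
    rcases mem_pair.1 hp with rfl | rfl
    · simpa using h₁
    · simpa [hne'] using h₂)
  simpa [hne'] using this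

lemma exists_runs_measureReset {x p y : ℕ} (hxp : x ≠ p) (hxy : x ≠ y) (s : Store)
    (ψ : QState M) (i : ℕ) (hp : s p = enc i) (hi : i < M) : ∃ S : Bool → Store,
      (∀ v, S v x = enc v ∧ ∀ w, w ≠ x → w ≠ y → S v w = s w) ∧
      Runs (measureReset x p y) s ψ 5
        [(S false, takeBit ⟨i, hi⟩ false ψ), (S true, takeBit ⟨i, hi⟩ true ψ)] := by
  set s0 := update s x (DTree.ofBool false) with hs0
  set s1 := update s x (DTree.ofBool true) with hs1
  have hl : (s p).length = i := by rw [hp, length_enc_nat]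
  refine ⟨fun v => bif v then s1 else update s0 y .nil, fun v => ?_, ?_⟩
  · cases v
    · refine ⟨by simp [hs0, hxy]; rfl, fun w hw hw' => by grind⟩
    · refine ⟨by simp [hs1]; rfl, fun w hw hw' => by simp [hs1, hw]⟩
  have hm : Runs (.measure x p) s ψ 1
      [(s0, project ⟨i, hi⟩ false ψ), (s1, project ⟨i, hi⟩ true ψ)] := by
    refine Runs.of_step fun l => ?_
    subst hl
    simp only [step, hi, dif_pos, List.map, hs0, hs1]
  refine Runs.mono (t := 1 + 2 + 1) (hm.seq_pair (u := 2)
    (L₁ := [(_, _)]) (L₂ := [(_, _)]) (fun h => ?_) (.cond_nil (t := 1) ?_ ?_)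
    (.cond_cons (t := 1) ?_ ?_)) (by omega)
  · have := congrFun h x
    simp [hs0, hs1, DTree.ofBool] at this
  · simp [hs0, DTree.ofBool]
  · rw [← project_false_eq_takeBit]
    exact classicalRun_setNil _ _ _ _
  · simp [hs1, DTree.ofBool]
  · rw [← applyX_project_true_eq_takeBit]
    refine Runs.of_step fun l => ?_
    have h1 : s1 p = enc i := by grind
    simp only [step, h1, onQubit_enc, List.map, onIndex, hi, dif_pos]
    rfl

/-- Measure and reset the qubits below the number in `k`, and put the outcomes in front of the
list in `k + 1`. -/
def measureLoop (k : ℕ) : Cmd :=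
  .loop k (.seq (.tail k k) (.seq (measureReset (k + 2) k (k + 3)) (.cons (k + 1) (k + 2) (k + 1))))

/-- The qubits are measured from the highest index down and each outcome is put in front, so the
outcome that comes first is the last letter of `ρ`; this is the recursion of `bitLists`. Since each
qubit is reset after its measurement, the branch ends in a multiple of the zero state, and the
factor is the amplitude of `ρ`. The device is then ready for the next trial. -/
lemma exists_runs_measureLoop (k Q : ℕ) (hQ : Q ≤ M) (s : Store) (ψ : QState M)
    (hψ : SuppBelow Q ψ) (a : List Bool) (hk : s k = enc Q) (hk1 : s (k + 1) = enc a) :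
    ∃ S : List Bool → Store, (∀ ρ, ρ.length = Q → S ρ (k + 1) = enc (ρ ++ a) ∧
      ∀ v < k, S ρ v = s v) ∧
      Runs (measureLoop k) s ψ (20 * Q + 1)
        ((bitLists Q).map fun ρ => (S ρ, ψ (toBits ρ) • QState.zero M)) := by
  induction Q generalizing s ψ a with
  | zero =>
    refine ⟨fun _ => s, fun ρ hρ => ?_, ?_⟩
    · grind
    · unfold measureLoop
      simpa [bitLists, ← hψ.eq_smul_zero] using Runs.loop_nil (C := _) (ψ := ψ) hk
  | succ Q ih =>
    set s1 := update s k (s k).tail with hs1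
    have h1k : s1 k = enc Q := by rw [hs1, update_self, hk]; rfl
    have h1 : ∀ v, v ≠ k → s1 v = s v := fun v hv => update_of_ne hv ..
    obtain ⟨S, hS, hrun⟩ := exists_runs_measureReset (x := k + 2) (p := k) (y := k + 3) (by omega)
      (by omega) s1 ψ Q h1k hQ
    set R : Bool → Store := fun v =>
      update (S v) (k + 1) (.cons (S v (k + 2)) (S v (k + 1)))
    have hR : ∀ v, R v = update (S v) (k + 1) (.cons (S v (k + 2)) (S v (k + 1))) :=
      fun _ => rfl
    have hRk : ∀ v, R v k = enc Q := by grind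
    have hRk1 : ∀ v, R v (k + 1) = enc (v :: a) := fun v => by
      rw [hR, update_self, (hS v).1, (hS v).2 (k + 1) (by omega) (by omega),
        h1 _ (by omega), hk1, enc_cons]
    have hRlt : ∀ v, ∀ w < k, R v w = s w := by grind
    choose T hT hTrun using fun v => ih (by omega) (R v) (takeBit ⟨Q, hQ⟩ v ψ) (hψ.takeBit hQ v)
      (v :: a) (hRk v) (hRk1 v)
    -- The last letter of `ρ` is the outcome of the measurement carried out here, the others come
    -- from the rest of the loop.
    refine ⟨fun ρ => T (ρ.getLastD false) ρ.dropLast, fun ρ hρ => ?_, ?_⟩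
    · obtain ⟨ρ', v, rfl, hρ'⟩ := exists_eq_append_singleton hρ
      simp only [List.getLastD_concat, List.dropLast_concat]
      refine ⟨by grind, fun w hw => ?_⟩
      rw [(hT v ρ' hρ').2 w hw, hRlt v w hw]
    · have hbody : Runs (.seq (.tail k k) (.seq (measureReset (k + 2) k (k + 3))
          (.cons (k + 1) (k + 2) (k + 1)))) s ψ 10
          [(R false, takeBit ⟨Q, hQ⟩ false ψ), (R true, takeBit ⟨Q, hQ⟩ true ψ)] := by
        refine Runs.mono (t := 1 + (5 + 1 + 1) + 1)
          ((classicalRun_tail k k s M ψ).seq_single (hrun.seq_pair (u := 1)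
          (L₁ := [(R false, takeBit ⟨Q, hQ⟩ false ψ)]) (L₂ := [(R true, takeBit ⟨Q, hQ⟩ true ψ)])
          ?_ ?_ ?_)) (by omega)
        · intro h
          have := (hS false).1.symm.trans ((congrFun h (k + 2)).trans (hS true).1)
          simp [enc_false, enc_true] at this
        · exact classicalRun_cons _ _ _ _ M _
        · exact classicalRun_cons _ _ _ _ M _
      have := Runs.loop_pair (x := k) (by rw [hk, enc_succ]; simp) (fun h => by
          have := (hRk1 false).symm.trans ((congrFun h (k + 1)).trans (hRk1 true))
          simp [enc_cons, enc_false, enc_true] at this) hbody (hTrun false) (hTrun true)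
      refine (Runs.mono this (by omega) : Runs (measureLoop k) s ψ (20 * (Q + 1) + 1) _) |> cast ?_
      congr 1
      simp only [bitLists, flatMap_cons, flatMap_nil, append_nil, map_append, map_map]
      congr 1 <;> refine map_congr_left fun ρ hρ => ?_
      all_goals
        have hρ' := length_of_mem_bitLists hρ
        subst hρ'
        simp [takeBit_toBits]

/-- Throw as many coins as the number in `k` says, with the qubit whose index is in `k + 2`, and
put the outcomes in front of the list in `k + 1`. -/
def coinLoop (k : ℕ) : Cmd :=
  .loop k (.seq (.gateH (k + 2)) (.seq (measureReset (k + 3) (k + 2) (k + 4))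
    (.seq (.cons (k + 1) (k + 3) (k + 1)) (.tail k k))))

lemma takeBit_applyH_smul_zero (i : Fin M) (v : Bool) (z : ℂ) :
    takeBit i v (applyH i (z • QState.zero M)) =
      (z / (sqrt 2 : ℂ)) • QState.zero M := by
  funext b
  by_cases hb : b i = false
  · have h1 : update (update b i v) i false = b := by grind
    have h2 : QState.zero M (update (update b i v) i true) = 0 := by
      rw [QState.zero, if_neg]
      intro h
      have := congrFun h i
      simp at this
    simp only [takeBit, hb, if_true, applyH, Pi.smul_apply, h1, h2, smul_eq_mul]
    ring
  · have : b ≠ fun _ => false := fun h => hb (by rw [h])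
    simp [takeBit, hb, QState.zero, this]

/-- A single qubit serves for all coins, because it is reset after each throw. Both outcomes divide
the amplitude by `√2`, so all strings get the same factor. -/
lemma exists_runs_coinLoop (hM : 0 < M) (k n : ℕ) (s : Store) (z : ℂ) (a : List Bool)
    (hk : s k = enc n) (hk1 : s (k + 1) = enc a) (hk2 : s (k + 2) = enc 0) :
    ∃ S : List Bool → Store, (∀ ρ, ρ.length = n → S ρ (k + 1) = enc (ρ ++ a) ∧
      ∀ v < k, S ρ v = s v) ∧
      Runs (coinLoop k) s (z • QState.zero M) (20 * n + 1)
        ((bitLists n).map fun ρ => (S ρ, (z / (sqrt 2 : ℂ) ^ n) • QState.zero M)) := by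
  induction n generalizing s z a with
  | zero =>
    refine ⟨fun _ => s, fun ρ hρ => ?_, ?_⟩
    · grind
    · unfold coinLoop
      simpa [bitLists] using Runs.loop_nil (C := _) (ψ := z • QState.zero M) hk
  | succ n ih =>
    obtain ⟨S, hS, hrun⟩ := exists_runs_measureReset (x := k + 3) (p := k + 2) (y := k + 4)
      (by omega) (by omega) s (applyH ⟨0, hM⟩ (z • QState.zero M)) 0 hk2 hM
    rw [takeBit_applyH_smul_zero, takeBit_applyH_smul_zero] at hrun
    set z' := z / (sqrt 2 : ℂ) with hz'
    set R : Bool → Store := fun v =>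
      update (S v) (k + 1) (.cons (S v (k + 3)) (S v (k + 1)))
    set R' : Bool → Store := fun v => update (R v) k (R v k).tail
    have hR : ∀ v, R v = update (S v) (k + 1) (.cons (S v (k + 3)) (S v (k + 1))) :=
      fun _ => rfl
    have hR' : ∀ v, R' v = update (R v) k (R v k).tail := fun _ => rfl
    have hR1 : ∀ v w, w ≠ k → w ≠ k + 1 → w ≠ k + 3 → w ≠ k + 4 → R' v w = s w :=
      fun v w h0 h1 h3 h4 => by grind
    have hRk : ∀ v, R' v k = enc n := fun v => by
      rw [hR', update_self, hR, update_of_ne (by omega),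
        (hS v).2 k (by omega) (by omega), hk]
      rfl
    have hRk1 : ∀ v, R' v (k + 1) = enc (v :: a) := fun v => by
      rw [hR', update_of_ne (by omega), hR, update_self, (hS v).1,
        (hS v).2 (k + 1) (by omega) (by omega), hk1, enc_cons]
    choose T hT hTrun using fun v => ih (R' v) z' (v :: a) (hRk v) (hRk1 v)
      ((hR1 v _ (by omega) (by omega) (by omega) (by omega)).trans hk2)
    refine ⟨fun ρ => T (ρ.getLastD false) ρ.dropLast, fun ρ hρ => ?_, ?_⟩
    · obtain ⟨ρ', v, rfl, hρ'⟩ := exists_eq_append_singleton hρ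
      simp only [List.getLastD_concat, List.dropLast_concat]
      refine ⟨by grind, fun w hw => ?_⟩
      rw [(hT v ρ' hρ').2 w hw, hR1 v w (by omega) (by omega) (by omega) (by omega)]
    · have hH : Runs (.gateH (k + 2)) s (z • QState.zero M) 1
          [(s, applyH ⟨0, hM⟩ (z • QState.zero M))] := by
        refine Runs.of_step fun l => ?_
        simp only [step, hk2, onQubit_enc, List.map, onIndex, hM, dif_pos]
      have hbody : Runs (.seq (.gateH (k + 2)) (.seq (measureReset (k + 3) (k + 2) (k + 4))
          (.seq (.cons (k + 1) (k + 3) (k + 1)) (.tail k k)))) s (z • QState.zero M) 12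
          [(R' false, z' • QState.zero M), (R' true, z' • QState.zero M)] := by
        refine Runs.mono (t := 1 + (5 + 3 + 1) + 1)
          (hH.seq_single (hrun.seq_pair (u := 3)
          (L₁ := [(R' false, z' • QState.zero M)]) (L₂ := [(R' true, z' • QState.zero M)])
          ?_ ?_ ?_)) (by omega)
        · intro h
          have := (hS false).1.symm.trans ((congrFun h (k + 3)).trans (hS true).1)
          simp [enc_false, enc_true] at this
        · exact (classicalRun_cons _ _ _ _).seq (classicalRun_tail _ _ _) M _
        · exact (classicalRun_cons _ _ _ _).seq (classicalRun_tail _ _ _) M _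
      have := Runs.loop_pair (x := k) (by rw [hk, enc_succ]; simp) (fun h => by
          have := (hRk1 false).symm.trans ((congrFun h (k + 1)).trans (hRk1 true))
          simp [enc_cons, enc_false, enc_true] at this) hbody (hTrun false) (hTrun true)
      refine (Runs.mono this (by omega) :
        Runs (coinLoop k) s (z • QState.zero M) (20 * (n + 1) + 1) _) |> cast ?_
      have hz : z' / (sqrt 2 : ℂ) ^ n = z / (sqrt 2 : ℂ) ^ (n + 1) := by grind
      congr 1
      simp [bitLists, comp_def, hz]

end

section

/-! ### Gates preserve the norm -/

variable {M : ℕ} {i j : Fin M} {Q : ℕ} {ψ : QState M}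

lemma weight_smul_zero (z : ℂ) : (z • QState.zero M).weight = ‖z‖ ^ 2 := by
  unfold weight
  rw [sum_eq_single (fun _ => false)]
  · simp [QState.zero]
  · intro b _ hb
    simp [QState.zero, hb]
  · simp

lemma weight_comp_involutive (σ : (Fin M → Bool) → Fin M → Bool)
    (hσ : Involutive σ) (ψ : QState M) : weight (fun b => ψ (σ b)) = ψ.weight :=
  Equiv.sum_comp hσ.toPerm fun b => ‖ψ b‖ ^ 2

lemma flip_involutive (i : Fin M) : Involutive fun b : Fin M → Bool => update b i (!b i) := by
  intro b
  simp

lemma cnot_involutive (h : i ≠ j) :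
    Involutive fun b : Fin M → Bool => update b j (xor (b j) (b i)) := by
  intro b
  funext k
  by_cases hk : k = j
  · simp_all
  · simp [hk]

lemma toffoli_involutive {k : Fin M} (h : i ≠ k) (h' : j ≠ k) :
    Involutive fun b : Fin M → Bool => update b k (xor (b k) (b i && b j)) := by
  intro b
  funext l
  by_cases hl : l = k
  · simp_all
  · simp [hl]

lemma weight_applyH (i : Fin M) (ψ : QState M) : (applyH i ψ).weight = ψ.weight := by
  -- Each basis state is paired with the one in which qubit `i` is flipped; on such a pair the
  -- Hadamard gate is governed by the parallelogram law.
  have key : ∀ φ : QState M, 2 * φ.weight =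
      ∑ b, (‖φ b‖ ^ 2 + ‖φ (update b i (!b i))‖ ^ 2) := by
    intro φ
    rw [sum_add_distrib]
    have := weight_comp_involutive _ (flip_involutive i) φ
    unfold weight at *
    rw [this]; ring
  have : 2 * (applyH i ψ).weight = 2 * ψ.weight := by
    rw [key, key]
    refine sum_congr rfl fun b _ => ?_
    have hs : ‖(sqrt 2 : ℂ)‖ ^ 2 = 2 := by
      rw [Complex.norm_real, norm_eq_abs, sq_abs, sq_sqrt (by norm_num)]
    have par : ∀ a c : ℂ, ‖(a + c) / (sqrt 2 : ℂ)‖ ^ 2 + ‖(a - c) / (sqrt 2 : ℂ)‖ ^ 2 =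
        ‖a‖ ^ 2 + ‖c‖ ^ 2 := by
      intro a c
      rw [norm_div, norm_div, div_pow, div_pow, hs, ← add_div]
      have := parallelogram_law_with_norm ℝ a c
      field_simp
      nlinarith [this]
    cases hb : b i
    · have h1 : update b i false = b := by rw [← hb, update_eq_self]
      have := par (ψ b) (ψ (update b i true))
      simpa [applyH, hb, h1, sub_eq_add_neg] using this
    · have h1 : update b i true = b := by rw [← hb, update_eq_self]
      have := par (ψ (update b i false)) (ψ b)
      rw [add_comm] at this
      simp only [applyH, hb, h1, update_idem, update_self, Bool.not_true, if_true]
      simp only [false_eq_true, if_false, one_mul, neg_one_mul, ← sub_eq_add_neg]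
      rw [this, add_comm]
  linarith

lemma Gate.weight_app (g : Gate) (ψ : QState M) : (g.app ψ).weight = ψ.weight := by
  match g with
  | (0, p, q, r) =>
    simp only [Gate.app, onIndex]
    split_ifs
    · exact weight_comp_involutive _ (flip_involutive _) ψ
    · rfl
  | (1, p, q, r) =>
    simp only [Gate.app, onIndex]
    split_ifs
    · exact weight_applyH _ ψ
    · rfl
  | (2, p, q, r) =>
    simp only [Gate.app, onIndex]
    split_ifs with h1 h2 h3
    · exact weight_comp_involutive _ (cnot_involutive h3) ψ
    all_goals rfl
  | (_ + 3, p, q, r) =>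
    simp only [Gate.app, onIndex]
    split_ifs with h1 h2 h3 h4
    · exact weight_comp_involutive _ (toffoli_involutive h4.2.1 h4.2.2) ψ
    all_goals rfl

lemma weight_appGates (l : List Gate) (ψ : QState M) : (appGates l ψ).weight = ψ.weight := by
  induction l generalizing ψ with
  | nil => rfl
  | cons g l ih => rw [appGates_cons, ih, g.weight_app]

/-- All operands of the gate are below `Q`. -/
def Gate.Below (Q : ℕ) (g : Gate) : Prop := g.2.1 < Q ∧ g.2.2.1 < Q ∧ g.2.2.2 < Q

lemma SuppBelow.app (h : SuppBelow Q ψ) {g : Gate} (hg : g.Below Q) : SuppBelow Q (g.app ψ) := by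
  intro b i hi hb
  have aux : ∀ (j : Fin M) (v : Bool), (j : ℕ) < Q → ψ (update b j v) = 0 := by
    intro j v hj
    refine h _ i hi ?_
    rw [update_of_ne (by grind), hb]
  match g with
  | (0, p, q, r) =>
    simp only [Gate.app, onIndex]
    split_ifs
    · exact aux _ _ hg.1
    · exact h b i hi hb
  | (1, p, q, r) =>
    simp only [Gate.app, onIndex]
    split_ifs with hp
    · simp [applyH, aux ⟨p, hp⟩ _ hg.1]
    · exact h b i hi hb
  | (2, p, q, r) =>
    simp only [Gate.app, onIndex]
    split_ifs with h1 h2 h3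
    · exact aux _ _ hg.2.1
    all_goals exact h b i hi hb
  | (_ + 3, p, q, r) =>
    simp only [Gate.app, onIndex]
    split_ifs with h1 h2 h3 h4
    · exact aux _ _ hg.2.2
    all_goals exact h b i hi hb

lemma SuppBelow.appGates (h : SuppBelow Q ψ) {l : List Gate}
    (hl : ∀ g ∈ l, Gate.Below Q g) : SuppBelow Q (appGates l ψ) := by
  induction l generalizing ψ with
  | nil => exact h
  | cons g l ih =>
    exact ih (h.app (hl g (by simp))) fun g' hg' => hl g' (mem_cons_of_mem g hg')

lemma suppBelow_smul_zero (Q : ℕ) (z : ℂ) : SuppBelow Q (z • QState.zero M) := by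
  intro b i _ hb
  have : b ≠ fun _ => false := by grind
  simp [QState.zero, this]

/-- A sum over the basis states of the first `Q` qubits. -/
lemma sum_eq_bsum (hQ : Q ≤ M) (G : (Fin M → Bool) → ℝ)
    (hG : ∀ (b : Fin M → Bool) (i : Fin M), Q ≤ i → b i = true → G b = 0) :
    ∑ b, G b = bsum Q fun ρ => G (toBits ρ) := by
  induction Q generalizing G with
  | zero =>
    rw [bsum_zero, toBits_nil, sum_eq_single (fun _ => false)]
    · intro b _ hb
      obtain ⟨i, hi⟩ : ∃ i, b i = true := by
        by_contra! hc
        exact hb (funext fun i => by grind)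
      exact hG b i (Nat.zero_le _) hi
    · simp
  | succ Q ih =>
    let j : Fin M := ⟨Q, hQ⟩
    have hs : ∀ v : Bool, ∑ b, (if b j = false then G (update b j v) else 0) =
        bsum Q fun ρ => G (toBits (ρ ++ [v])) := by
      intro v
      rw [ih (by omega)]
      · refine bsum_congr fun ρ hρ => ?_
        subst hρ
        rw [toBits_append_singleton ρ v hQ, if_pos]
        simp [toBits, j]
      · intro b i hi hb
        split_ifs with hb'
        · grind
        · rfl
    rw [bsum_succ, ← hs, ← hs]
    have h2 : ∑ b, (if b j = false then G (update b j true) else 0) =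
        ∑ b, (if b j = true then G b else 0) := by
      rw [← Equiv.sum_comp (flip_involutive j).toPerm]
      refine sum_congr rfl fun b _ => ?_
      simp only [Involutive.coe_toPerm, update_self, update_idem]
      cases hb : b j
      · simp
      · have : update b j true = b := by rw [← hb, update_eq_self]
        simp [this]
    rw [h2, ← sum_add_distrib]
    refine sum_congr rfl fun b _ => ?_
    cases hb : b j
    · have : update b j false = b := by rw [← hb, update_eq_self]
      simp [this]
    · simp

lemma bsum_weight (hQ : Q ≤ M) (hψ : SuppBelow Q ψ) :
    (bsum Q fun ρ => ‖ψ (toBits ρ)‖ ^ 2) = ψ.weight :=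
  (sum_eq_bsum hQ (fun b => ‖ψ b‖ ^ 2) fun b i hi hb => by simp [hψ b i hi hb]).symm

lemma appGates_smul (z : ℂ) (l : List Gate) (ψ : QState M) :
    appGates l (z • ψ) = z • appGates l ψ := by
  induction l generalizing ψ with
  | nil => rfl
  | cons g l ih =>
    rw [appGates_cons, appGates_cons, ← ih]
    congr 1
    match g with
    | (0, p, q, r) =>
      simp only [Gate.app, onIndex]
      split_ifs <;> rfl
    | (1, p, q, r) =>
      simp only [Gate.app, onIndex]
      split_ifs
      · funext b
        simp only [applyH, Pi.smul_apply, smul_eq_mul]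
        ring
      · rfl
    | (2, p, q, r) =>
      simp only [Gate.app, onIndex]
      split_ifs <;> rfl
    | (_ + 3, p, q, r) =>
      simp only [Gate.app, onIndex]
      split_ifs <;> rfl

end

section

/-! ### Repetition by a stack of numbers -/

variable {M : ℕ} {C : Cmd} {s : Store} {ψ : QState M} {t : ℕ} {L : List (Store × QState M)}
   {K : Store × QState M → List (Store × QState M)}

/-- From the command `C` the computation comes back to `C`, after at most `t` steps, with the
branches in `L`. -/
def Passes (C : Cmd) (s : Store) (ψ : QState M) (t : ℕ) (L : List (Store × QState M)) : Prop :=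
  ∀ l, Reaches ⟨C :: l, s, ψ⟩ t (L.map fun p => ⟨C :: l, p.1, p.2⟩)

lemma Runs.passes_loop {x : ℕ} (hx : s x ≠ .nil) (h : Runs C s ψ t L) :
    Passes (.loop x C) s ψ (t + 1) L := by
  obtain ⟨a, b, hab⟩ := DTree.exists_eq_cons hx
  intro l
  have := Reaches.step (M := M) ⟨.loop x C :: l, s, ψ⟩ t
    (fun _ => L.map fun p => ⟨.loop x C :: l, p.1, p.2⟩) (fun c' hc' => by
      simp only [HybridSAT.step, hab, mem_singleton] at hc'
      subst hc'
      exact h _)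
  simpa [HybridSAT.step, hab] using this

lemma Passes.trans {u : ℕ} (h : Passes C s ψ t L) (hK : ∀ p ∈ L, Passes C p.1 p.2 u (K p)) :
    Passes C s ψ (t + u) (L.flatMap K) :=
  fun l => (h l).flatMap fun p hp => hK p hp l

lemma Passes.runs {u : ℕ} (h : Passes C s ψ t L) (hK : ∀ p ∈ L, Runs C p.1 p.2 u (K p)) :
    Runs C s ψ (t + u) (L.flatMap K) :=
  fun l => (h l).flatMap fun p hp => hK p hp l

/-- The number of repetitions that a stack of numbers stands for. -/
def stackReps (l : List ℕ) : ℕ := (l.map (2 ^ ·)).sum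

/-- Repeat `C` with the stack in the variable `k`: the number `0` on the top stands for one
repetition, and `h + 1` stands for twice as many as `h`. -/
def stackLoop (k : ℕ) (C : Cmd) : Cmd :=
  .loop k (.seq (.head (k + 1) k) (.seq (.tail k k)
    (.cond (k + 1) (.seq (.tail (k + 1) (k + 1)) (.seq (.cons k (k + 1) k) (.cons k (k + 1) k))) C)))

lemma exists_fun_of_forall_mem {α β : Type*} [Inhabited β] {L : List α} {R : α → β → Prop}
    (h : ∀ a ∈ L, ∃ b, R a b) : ∃ f : α → β, ∀ a ∈ L, R a (f a) := by
  classical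
  exact ⟨fun a => if ha : a ∈ L then (h a ha).choose else default, fun a ha => by grind⟩

section stackLoop

variable {M k t : ℕ} {C : Cmd} {Good : Store × QState M → Prop}
  {R : ℕ → Store × QState M → List (Store × QState M) → Prop}

/-- A number `h + 1` on the stack is replaced by two copies of `h`, so `2^h` repetitions need a
stack of polynomial size and no arithmetic. The relation `R j p L` stands for the result of `j`
repetitions: it must be additive in `j` and must not see the two variables of the loop (`hinv`). In
the time bound the term `- 14` is slack which absorbs the twelve steps of a split: `-28 + 12 ≤ -14`.
-/
lemma exists_passes_stackLoop
    (hcomp : ∀ i j p L K, R i p L → (∀ q ∈ L, R j q (K q)) → R (i + j) p (L.flatMap K))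
    (hinv : ∀ s s' ψ, (∀ v, v ≠ k → v ≠ k + 1 → s v = s' v) → Good (s, ψ) → Good (s', ψ) ∧
      ∀ j L, R j (s', ψ) L → R j (s, ψ) L)
    (hbody : ∀ s ψ, Good (s, ψ) → ∃ L, Runs C s ψ t L ∧ R 1 (s, ψ) L ∧
      ∀ p ∈ L, Good p ∧ p.1 k = s k)
    (h : ℕ) (rest : List ℕ) (s : Store) (ψ : QState M) (hs : s k = enc (h :: rest))
    (hG : Good (s, ψ)) : ∃ L, Passes (stackLoop k C) s ψ (2 ^ h * (t + 22) - 14) L ∧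
      R (2 ^ h) (s, ψ) L ∧ ∀ p ∈ L, Good p ∧ p.1 k = enc rest := by
  induction h generalizing s ψ rest with
  | zero =>
    set s1 := update s (k + 1) (s k).head with hs1
    set s2 := update s1 k (s1 k).tail with hs2
    have h2 : s2 k = enc rest := by
      rw [hs2, update_self, hs1, update_of_ne (by omega), hs]; rfl
    have h21 : s2 (k + 1) = .nil := by
      rw [hs2, update_of_ne (by omega), hs1, update_self, hs]; rfl
    obtain ⟨hG2, hR2⟩ := hinv s s2 ψ (fun v hv hv' => by grind) hG
    obtain ⟨L, hL, hRL, hLk⟩ := hbody s2 ψ hG2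
    refine ⟨L, ?_, hR2 _ _ hRL, fun p hp => ⟨(hLk p hp).1, (hLk p hp).2.trans h2⟩⟩
    intro l
    refine (Runs.passes_loop (by rw [hs, enc_cons]; simp)
      ((classicalRun_head (k + 1) k s M ψ).seq_single
        ((classicalRun_tail k k s1 M ψ).seq_single (.cond_nil h21 hL))) l).mono ?_
    simp only [pow_zero]
    omega
  | succ h ih =>
    set s1 := update s (k + 1) (s k).head with hs1
    set s2 := update s1 k (s1 k).tail with hs2
    set s3 := update s2 (k + 1) (s2 (k + 1)).tail with hs3
    set s4 := update s3 k (.cons (s3 (k + 1)) (s3 k)) with hs4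
    set s5 := update s4 k (.cons (s4 (k + 1)) (s4 k)) with hs5
    have h2 : s2 (k + 1) = enc (h + 1) := by
      rw [hs2, update_of_ne (by omega), hs1, update_self, hs]; rfl
    have h5 : s5 k = enc (h :: h :: rest) := by
      simp [hs5, hs4, hs3, hs2, hs1, hs, enc_cons, enc_succ, DTree.head, DTree.tail]
    obtain ⟨hG5, hR5⟩ := hinv s s5 ψ
      (fun v hv hv' => by grind) hG
    obtain ⟨L, hL, hRL, hLk⟩ := ih (h :: rest) s5 ψ h5 hG5
    obtain ⟨K, hK⟩ := exists_fun_of_forall_mem (L := L)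
      fun p hp => ih rest p.1 p.2 (hLk p hp).2 (hLk p hp).1
    have hne : s2 (k + 1) ≠ .nil := by rw [h2, enc_succ]; simp
    have hfirst : Passes (stackLoop k C) s ψ 12 [(s5, ψ)] := by
      intro l
      refine (Runs.passes_loop (by rw [hs, enc_cons]; simp)
        ((classicalRun_head (k + 1) k s M ψ).seq_single
          ((classicalRun_tail k k s1 M ψ).seq_single (.cond_cons hne
            ((classicalRun_tail _ _ s2 M ψ).seq_single ((classicalRun_cons _ _ _ s3 M ψ).seq_single
              (classicalRun_cons _ _ _ s4 M ψ)))))) l).mono (by omega)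
    have hall := hfirst.trans (K := fun _ => L.flatMap K)
      (u := (2 ^ h * (t + 22) - 14) + (2 ^ h * (t + 22) - 14)) (by
      intro p hp
      rw [mem_singleton] at hp
      subst hp
      exact hL.trans fun p hp => (hK p hp).1)
    refine ⟨L.flatMap K, fun l => ?_, ?_, fun p hp => ?_⟩
    · have := hall l
      simp only [flatMap_cons, flatMap_nil, append_nil] at this
      refine this.mono ?_
      have h1 : 1 ≤ 2 ^ h := Nat.one_le_two_pow
      have h3 : 1 * (t + 22) ≤ 2 ^ h * (t + 22) := Nat.mul_le_mul_right _ h1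
      rw [pow_succ, Nat.mul_right_comm]
      omega
    · rw [pow_succ, Nat.mul_two]
      exact hR5 _ _ (hcomp _ _ _ _ _ hRL fun p hp => (hK p hp).2.1)
    · grind

lemma exists_runs_stackLoop
    (hcomp : ∀ i j p L K, R i p L → (∀ q ∈ L, R j q (K q)) → R (i + j) p (L.flatMap K))
    (hzero : ∀ p, R 0 p [p])
    (hinv : ∀ s s' ψ, (∀ v, v ≠ k → v ≠ k + 1 → s v = s' v) → Good (s, ψ) → Good (s', ψ) ∧
      ∀ j L, R j (s', ψ) L → R j (s, ψ) L)
    (hbody : ∀ s ψ, Good (s, ψ) → ∃ L, Runs C s ψ t L ∧ R 1 (s, ψ) L ∧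
      ∀ p ∈ L, Good p ∧ p.1 k = s k)
    (st : List ℕ) (s : Store) (ψ : QState M) (hs : s k = enc st) (hG : Good (s, ψ)) :
    ∃ L, Runs (stackLoop k C) s ψ (stackReps st * (t + 22) + 1) L ∧
      R (stackReps st) (s, ψ) L ∧ ∀ p ∈ L, Good p := by
  induction st generalizing s ψ with
  | nil =>
    refine ⟨[(s, ψ)], ?_, by simpa [stackReps] using hzero (s, ψ), by simpa using hG⟩
    exact (Runs.loop_nil hs).mono (by omega)
  | cons h rest ih =>
    obtain ⟨L, hL, hRL, hLk⟩ := exists_passes_stackLoop hcomp hinv hbody h rest s ψ hs hG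
    obtain ⟨K, hK⟩ := exists_fun_of_forall_mem (L := L)
      fun p hp => ih p.1 p.2 (hLk p hp).2 (hLk p hp).1
    refine ⟨L.flatMap K, (hL.runs fun p hp => (hK p hp).1).mono ?_, ?_, fun p hp => ?_⟩
    · simp only [stackReps, map_cons, sum_cons, Nat.add_mul]
      omega
    · exact hcomp _ _ _ _ _ hRL fun p hp => (hK p hp).2.1
    · grind

end stackLoop

lemma exists_run_innerLoop (k : ℕ) (gates : List Gate) (st : List ℕ) (s : Store)
    (hk : s k = enc gates) (hk1 : s (k + 1) = enc st) (M : ℕ) (ψ : QState M) :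
    ∃ s' : Store, (∀ v < k + 1, s' v = s v) ∧
      Runs (stackLoop (k + 1) (.seq (.copy (k + 3) k) (gateLoop (k + 3)))) s ψ
        (stackReps st * (30 * gates.length + 30) + 1) [(s', (appGates gates)^[stackReps st] ψ)] := by
  obtain ⟨L, hL, ⟨s', rfl, h'⟩, -⟩ := exists_runs_stackLoop (k := k + 1) (t := 30 * gates.length + 3)
    (C := .seq (.copy (k + 3) k) (gateLoop (k + 3)))
    (Good := fun p : Store × QState M => p.1 k = enc gates)
    (R := fun j p L => ∃ s' : Store, L = [(s', (appGates gates)^[j] p.2)] ∧ ∀ v < k + 1, s' v = p.1 v)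
    (by
      rintro i j p L K ⟨s', rfl, h'⟩ hK
      obtain ⟨s'', h1, h2⟩ := hK _ (List.mem_singleton_self _)
      refine ⟨s'', ?_, fun v hv => (h2 v hv).trans (h' v hv)⟩
      simp only [flatMap_cons, flatMap_nil, append_nil, h1]
      rw [Nat.add_comm i j, Function.iterate_add_apply])
    (fun p => ⟨p.1, rfl, fun _ _ => rfl⟩)
    (fun s s' ψ h hG => ⟨(h k (by omega) (by omega)).symm.trans hG, fun j L => by grind⟩)
    (fun s ψ hG => by
      obtain ⟨s', h1, h2⟩ := exists_run_gateLoop (k + 3) gates (update s (k + 3) (s k))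
        (by grind)
      have h3 : ∀ v < k + 3, s' v = s v := by grind
      refine ⟨[(s', appGates gates ψ)], ((classicalRun_copy _ _ s M ψ).seq_single
        (h2 M ψ)).mono (by omega), ⟨s', rfl, fun v hv => h3 v (by omega)⟩, ?_⟩
      simp only [mem_singleton, forall_eq]
      exact ⟨(h3 k (by omega)).trans hG, h3 _ (by omega)⟩)
    st s ψ hk1 hk
  exact ⟨s', h', hL.mono (by nlinarith)⟩

/-! ### Formulas as lists -/

/-- The number of variables and the clauses, each as the list of its literals. -/
abbrev RawFormula : Type := ℕ × List (List (Bool × ℕ))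

variable {n : ℕ} {y : List Bool}

/-- The clause as the list of its literals. -/
def rawClause (C : Clause n) : List (Bool × ℕ) :=
  [(C.1.2, (C.1.1 : ℕ)), (C.2.1.2, (C.2.1.1 : ℕ)), (C.2.2.2, (C.2.2.1 : ℕ))]

/-- The formula as a list of lists. -/
def rawFormula (F : Formula n) : RawFormula := (n, F.clauses.map rawClause)

lemma enc_rawFormula (F : Formula n) : enc (rawFormula F) = encodeFormula F := by
  simp only [rawFormula, enc_pair, encodeFormula]
  congr 1
  change DTree.ofList ((F.clauses.map rawClause).map enc) = _
  rw [map_map]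
  rfl

/-- The clause is false under the assignment `y`. -/
def unsatClause (y : List Bool) (C : List (Bool × ℕ)) : Bool :=
  C.all fun l => !(y.getD l.2 false == l.1)

/-- The formula is true under the assignment `y`. -/
def satRaw (F : RawFormula) (y : List Bool) : Bool := F.2.all fun C => !unsatClause y C

/-- The assignment which the list `y` stands for. -/
def toAssignment (y : List Bool) : Assignment n := fun i => y.getD i false

lemma unsatClause_rawClause (C : Clause n) (y : List Bool) :
    unsatClause y (rawClause C) = false ↔ C.IsSatisfied (toAssignment y) := by
  simp only [unsatClause, rawClause, Clause.IsSatisfied, Literal.IsTrue, toAssignment,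
    all_cons, all_nil, Bool.and_true, Bool.and_eq_false_iff, Bool.not_eq_false',
    beq_iff_eq]

lemma satRaw_rawFormula (F : Formula n) (y : List Bool) :
    satRaw (rawFormula F) y = true ↔ F.IsSatisfied (toAssignment y) := by
  simp only [satRaw, rawFormula, all_eq_true, mem_map, forall_exists_index, and_imp,
    forall_apply_eq_imp_iff₂, Formula.IsSatisfied, not_eq_true', unsatClause_rawClause]

lemma ofFn_toAssignment (hy : y.length = n) : List.ofFn (toAssignment y : Assignment n) = y := by
  subst hy
  refine List.ext_getElem (by simp) fun i h1 h2 => ?_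
  simp [toAssignment, h2]

lemma encodeAssignment_toAssignment (hy : y.length = n) :
    encodeAssignment (toAssignment y : Assignment n) = enc ((), y) := by
  rw [encodeAssignment, ofFn_toAssignment hy]
  rfl

end

/-! ### Repeated trials -/

lemma mem_bitLists {n : ℕ} {o : List Bool} (ho : o.length = n) : o ∈ bitLists n := by
  induction n generalizing o with
  | zero => simp [bitLists, length_eq_zero_iff.1 ho]
  | succ n ih =>
    obtain ⟨o', v, rfl, ho'⟩ := exists_eq_append_singleton ho
    simp only [bitLists, mem_flatMap, mem_map]
    exact ⟨v, by grind, o', ih ho', rfl⟩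

lemma enc_bool_injective : Injective (enc : Bool → DTree) := by
  intro a b h
  cases a <;> cases b <;> first | rfl | (rw [enc_false, enc_true] at h; cases h)

lemma enc_list_injective {α : Type} [Code α] (ha : Injective (enc : α → DTree)) :
    Injective (enc : List α → DTree) := by
  intro l
  induction l with
  | nil => intro l' h; cases l' with
    | nil => rfl
    | cons a l' => rw [enc_nil, enc_cons] at h; cases h
  | cons a l ih => intro l' h; cases l' with
    | nil => rw [enc_nil, enc_cons] at h; cases h
    | cons b l' =>
      rw [enc_cons, enc_cons] at h
      injection h with h1 h2
      rw [ih h2, ha h1]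

lemma enc_bits_injective : Injective (enc : List Bool → DTree) :=
  enc_list_injective enc_bool_injective

lemma csize_bits_le (l : List Bool) : csize l ≤ 4 * l.length + 1 := by
  induction l with
  | nil => simp [csize_nil]
  | cons b l ih =>
    have := csize_bool_le b
    rw [csize_cons, length_cons]
    omega

/-- The version of `Runs.seq` for branches indexed by coins or outcomes. The index must be
recoverable from the store (`hf`), since continuations are functions of configurations; in the
applications a variable holds the code of the index. -/
lemma Runs.seq_map {M : ℕ} {C D : Cmd} {s : Store} {ψ : QState M} {t u : ℕ} {α : Type*}
    {l : List α} {f : α → Store × QState M} {K : α → List (Store × QState M)}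
    (h : Runs C s ψ t (l.map f)) (hf : ∀ x ∈ l, ∀ y ∈ l, (f x).1 = (f y).1 → x = y)
    (hK : ∀ x ∈ l, Runs D (f x).1 (f x).2 u (K x)) :
    Runs (.seq C D) s ψ (t + u + 1) (l.flatMap K) := by
  classical
  let K' : Store × QState M → List (Store × QState M) := fun p =>
    if hp : ∃ x ∈ l, f x = p then K hp.choose else []
  have hK' : ∀ x ∈ l, K' (f x) = K x := by
    intro x hx
    have hp : ∃ y ∈ l, f y = f x := ⟨x, hx, rfl⟩
    have h1 := hp.choose_spec
    simp only [K', dif_pos hp]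
    rw [hf _ h1.1 x hx (congrArg Prod.fst h1.2)]
  have := h.seq (D := D) (u := u) (K := K') (by
    intro p hp
    obtain ⟨x, hx, rfl⟩ := mem_map.1 hp
    rw [hK' x hx]
    exact hK x hx)
  rw [flatMap_map] at this
  rwa [List.flatMap_congr fun x hx => hK' x hx] at this

/-- The functions which make up a hybrid algorithm of the following form: throw coins, apply
gates, some of them repeatedly, measure all qubits, and take a candidate for a satisfying
assignment from the outcome. All this is repeated. -/
structure Scheme where
  ncoins : RawFormula → ℕ
  prep : RawFormula × List Bool → List Gate
  body : RawFormula × List Bool → List Gate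
  post : RawFormula × List Bool → List Gate
  stack : RawFormula × List Bool → List ℕ
  nq : RawFormula → ℕ
  cand : (RawFormula × List Bool) × List Bool → List Bool
  rounds : RawFormula → ℕ
  pt_ncoins : PT ncoins
  pt_prep : PT prep
  pt_body : PT body
  pt_post : PT post
  pt_stack : PT stack
  pt_nq : PT nq
  pt_cand : PT cand
  pt_rounds : PT rounds

namespace Scheme

variable (X : Scheme)

/-- The state of the device before the final measurement. -/
def final (M : ℕ) (a : RawFormula × List Bool) : QState M :=
  appGates (X.post a) ((appGates (X.body a))^[stackReps (X.stack a)]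
    (appGates (X.prep a) (QState.zero M)))

/-- The new record after a trial. -/
def record (p : DTree × ((RawFormula × List Bool) × List Bool)) : DTree :=
  bif p.1.isNil then (bif satRaw p.2.1.1 (X.cand p.2) then enc ((), X.cand p.2) else .nil) else p.1

lemma pt_satRaw : PT fun p : RawFormula × List Bool => satRaw p.1 p.2 := by
  unfold satRaw unsatClause
  fun_prop

lemma pt_record : PT X.record := by
  have h1 := X.pt_cand
  have h2 : PT fun p : DTree × ((RawFormula × List Bool) × List Bool) => p.1.isNil :=
    PT.isNil_tree.comp PT.fst'
  have h3 : PT fun p : DTree × ((RawFormula × List Bool) × List Bool) =>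
      satRaw p.2.1.1 (X.cand p.2) :=
    pt_satRaw.comp (f := fun p : DTree × ((RawFormula × List Bool) × List Bool) =>
      (p.2.1.1, X.cand p.2)) (by fun_prop)
  have h4 : PT fun p : DTree × ((RawFormula × List Bool) × List Bool) => enc ((), X.cand p.2) := by
    have : PT fun p : DTree × ((RawFormula × List Bool) × List Bool) => ((), X.cand p.2) := by
      fun_prop
    exact this.of_enc_eq (fun e => e) (fun _ => rfl) fun _ => rfl
  unfold record
  fun_prop

/-- One trial for given coins, as a function of the programs for its parts. -/
def trialCmd (Cprep Cbody Cstack Cpost Cnq Crec : Cmd) : Cmd :=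
  .seq (.seq (.seq (.copy 5 4) (.seq Cprep (gateLoop 5)))
    (.seq (.seq (.copy 5 4) (.seq Cbody (.seq (.copy 6 4) (.seq Cstack
      (stackLoop 6 (.seq (.copy 8 5) (gateLoop 8)))))))
    (.seq (.seq (.copy 5 4) (.seq Cpost (gateLoop 5)))
    (.seq (.copy 5 0) (.seq Cnq (.seq (.setNil 6) (measureLoop 5)))))))
    (.seq (.cons 4 4 6) (.seq (.cons 4 1 4) (.seq Crec (.copy 1 4))))

/-- A trial starts and ends, in every branch, with a multiple of the zero state, and the factor for
the outcome `o` is the amplitude of `o` in `X.final`. So trials are composed by multiplying scalars.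
The variables `0` (formula), `2` and `3` survive, `1` holds the record, and everything from `4` on
is working space. -/
lemma exists_trialCmd : ∃ C : Cmd, ∃ p : Polynomial ℕ, ∀ (M : ℕ) (a : RawFormula)
    (ρ : List Bool) (found : DTree) (s : Store) (w : ℂ), s 0 = enc a → s 1 = found →
    s 4 = enc (a, ρ) → X.nq a ≤ M → (∀ g ∈ X.prep (a, ρ), Gate.Below (X.nq a) g) →
    (∀ g ∈ X.body (a, ρ), Gate.Below (X.nq a) g) → (∀ g ∈ X.post (a, ρ), Gate.Below (X.nq a) g) →
    ∃ S : List Bool → Store,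
      (∀ o, o.length = X.nq a → S o 1 = X.record (found, (a, ρ), o) ∧
        ∀ v < 4, v ≠ 1 → S o v = s v) ∧
      Runs C s (w • QState.zero M)
        (p.eval (csize (a, ρ) + found.size) * (stackReps (X.stack (a, ρ)) + 1))
        ((bitLists (X.nq a)).map fun o =>
          (S o, (w * X.final M (a, ρ) (toBits o)) • QState.zero M)) := by
  obtain ⟨pprep, hprep, hprepC⟩ := X.pt_prep
  obtain ⟨pbody, hbody, hbodyC⟩ := X.pt_body
  obtain ⟨pstack, hstack, hstackC⟩ := X.pt_stack
  obtain ⟨ppost, hpost, hpostC⟩ := X.pt_post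
  obtain ⟨pnq, hnq, hnqC⟩ := X.pt_nq
  obtain ⟨prec, hrec, hrecC⟩ := X.pt_record
  obtain ⟨Cprep, hCprep⟩ := hprepC 5
  obtain ⟨Cbody, hCbody⟩ := hbodyC 5
  obtain ⟨Cstack, hCstack⟩ := hstackC 6
  obtain ⟨Cpost, hCpost⟩ := hpostC 5
  obtain ⟨Cnq, hCnq⟩ := hnqC 5
  obtain ⟨Crec, hCrec⟩ := hrecC 4
  refine ⟨trialCmd Cprep Cbody Cstack Cpost Cnq Crec,
    .C 31 * pprep + .C 31 * pbody + pstack + .C 31 * ppost + .C 21 * pnq +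
      prec.comp (.X + .C 4 * pnq + .C 5) + .C 80, ?_⟩
  intro M a ρ found s w h0 h1 h4 hM hgprep hgbody hgpost
  -- the three lists of gates
  obtain ⟨s1, h1lt, h1k, h1run⟩ := hCprep (a, ρ) (update s 5 (s 4)) (by simp [h4])
  obtain ⟨s2, h2lt, h2run⟩ := exists_run_gateLoop 5 _ s1 h1k
  have e2 : ∀ v < 5, s2 v = s v := by grind
  obtain ⟨s3, h3lt, h3k, h3run⟩ := hCbody (a, ρ) (update s2 5 (s2 4))
    (by grind)
  have e3 : ∀ v < 5, s3 v = s v := by grind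
  obtain ⟨s4, h4lt, h4k, h4run⟩ := hCstack (a, ρ) (update s3 6 (s3 4))
    (by grind)
  have e4 : ∀ v < 5, s4 v = s v := by grind
  obtain ⟨s5, h5lt, h5run⟩ := exists_run_innerLoop 5 (X.body (a, ρ)) (X.stack (a, ρ)) s4
    (by grind) h4k M
    (appGates (X.prep (a, ρ)) (w • QState.zero M))
  have e5 : ∀ v < 5, s5 v = s v := by grind
  obtain ⟨s6, h6lt, h6k, h6run⟩ := hCpost (a, ρ) (update s5 5 (s5 4))
    (by grind)
  obtain ⟨s7, h7lt, h7run⟩ := exists_run_gateLoop 5 _ s6 h6k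
  have e7 : ∀ v < 5, s7 v = s v := by grind
  obtain ⟨s8, h8lt, h8k, h8run⟩ := hCnq a (update s7 5 (s7 0))
    (by grind)
  have e8 : ∀ v < 5, s8 v = s v := by grind
  set s9 := update s8 6 .nil with hs9
  have e9 : ∀ v < 5, s9 v = s v := by grind
  -- the state before the measurement
  have hfin : appGates (X.post (a, ρ)) ((appGates (X.body (a, ρ)))^[stackReps (X.stack (a, ρ))]
      (appGates (X.prep (a, ρ)) (w • QState.zero M))) = w • X.final M (a, ρ) := by
    have hit : ∀ (j : ℕ) (ψ : QState M), (appGates (X.body (a, ρ)))^[j] (w • ψ) =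
        w • (appGates (X.body (a, ρ)))^[j] ψ := by
      intro j
      induction j with
      | zero => intro ψ; rfl
      | succ j ih =>
        intro ψ; rw [iterate_succ_apply, appGates_smul, ih, iterate_succ_apply]
    rw [appGates_smul, hit, appGates_smul]
    rfl
  have hsupp : SuppBelow (X.nq a) (w • X.final M (a, ρ)) := by
    rw [← hfin]
    refine SuppBelow.appGates ?_ hgpost
    have : ∀ j, SuppBelow (X.nq a) ((appGates (X.body (a, ρ)))^[j]
        (appGates (X.prep (a, ρ)) (w • QState.zero M))) := by
      intro j
      induction j with
      | zero => exact (suppBelow_smul_zero _ _).appGates hgprep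
      | succ j ih => rw [iterate_succ_apply']; exact ih.appGates hgbody
    exact this _
  obtain ⟨S, hS, hSrun⟩ := exists_runs_measureLoop 5 (X.nq a) hM s9 (w • X.final M (a, ρ)) hsupp []
    (by grind) (by rw [hs9, update_self]; rfl)
  -- after the measurement
  have hlast : ∀ o ∈ bitLists (X.nq a), ∃ s' : Store, s' 1 = X.record (found, (a, ρ), o) ∧
      (∀ v < 4, v ≠ 1 → s' v = s v) ∧
      ClassicalRun (.seq (.cons 4 4 6) (.seq (.cons 4 1 4) (.seq Crec (.copy 1 4)))) (S o)
        (prec.eval (csize (a, ρ) + found.size + 4 * pnq.eval (csize (a, ρ) + found.size) + 5) + 6)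
        s' := by
    intro o ho
    have hol := length_of_mem_bitLists ho
    obtain ⟨hSo, hSlt⟩ := hS o hol
    have eS : ∀ v < 5, S o v = s v := fun v hv => (hSlt v hv).trans (e9 v hv)
    set r1 := update (S o) 4 (.cons (S o 4) (S o 6)) with hr1
    set r2 := update r1 4 (.cons (r1 1) (r1 4)) with hr2
    obtain ⟨r3, h3lt', h3k', h3run'⟩ := hCrec (found, (a, ρ), o) r2 (by
      simp only [hr2, hr1, update_self]
      rw [update_of_ne (by omega), eS 1 (by omega), eS 4 (by omega), h1, h4]
      simp only [Nat.reduceAdd] at hSo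
      rw [hSo, append_nil]
      rfl)
    refine ⟨update r3 1 (r3 4), by rw [update_self, h3k']; rfl,
      fun v hv hv1 => ?_, ((classicalRun_cons _ _ _ _).seq ((classicalRun_cons _ _ _ r1).seq
        (h3run'.seq (classicalRun_copy _ _ r3)))).mono ?_⟩
    · grind
    · have hm : prec.eval (csize (found, (a, ρ), o)) ≤ prec.eval (csize (a, ρ) + found.size +
          4 * pnq.eval (csize (a, ρ) + found.size) + 5) := by
        apply eval_mono
        have q1 : csize o ≤ 4 * X.nq a + 1 := hol ▸ csize_bits_le o
        have q2 : X.nq a ≤ pnq.eval (csize (a, ρ) + found.size) := by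
          have q3 := hnq a
          have q4 : pnq.eval (csize a) ≤ pnq.eval (csize (a, ρ) + found.size) :=
            eval_mono _ (by rw [csize_pair a ρ]; omega)
          rw [csize_nat] at q3
          omega
        rw [csize_pair, csize_pair (a, ρ) o]
        change found.size + _ + 1 ≤ _
        omega
      omega
  have : Inhabited Store := ⟨s⟩
  obtain ⟨S', hS'⟩ := exists_fun_of_forall_mem hlast
  refine ⟨S', fun o ho => ?_, ?_⟩
  · have hmem : o ∈ bitLists (X.nq a) := mem_bitLists ho
    exact ⟨(hS' o hmem).1, (hS' o hmem).2.1⟩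
  have hpre := (((classicalRun_copy 5 4 s M (w • QState.zero M)).seq_single
    ((h1run M _).seq_single (h2run M _))).seq_single
    (((classicalRun_copy 5 4 s2 M _).seq_single ((h3run M _).seq_single
      ((classicalRun_copy 6 4 s3 M _).seq_single ((h4run M _).seq_single h5run)))).seq_single
    (((classicalRun_copy 5 4 s5 M _).seq_single ((h6run M _).seq_single (h7run M _))).seq_single
    ((classicalRun_copy 5 0 s7 M _).seq_single ((h8run M _).seq_single
      ((classicalRun_setNil 6 s8 M _).seq_single (by rw [hfin]; exact hSrun)))))))
  have htot := hpre.seq_map (D := .seq (.cons 4 4 6) (.seq (.cons 4 1 4) (.seq Crec (.copy 1 4))))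
    (K := fun o => [(S' o, (w • X.final M (a, ρ)) (toBits o) • QState.zero M)])
    (u := prec.eval (csize (a, ρ) + found.size + 4 * pnq.eval (csize (a, ρ) + found.size) + 5) + 6)
    (fun o ho o' ho' h => by
      have q1 := (hS o (length_of_mem_bitLists ho)).1
      have q2 := (hS o' (length_of_mem_bitLists ho')).1
      have q3 := q1.symm.trans ((congrFun h 6).trans q2)
      simpa using enc_bits_injective q3)
    (fun o ho => (hS' o ho).2.2 M _)
  rw [← List.map_eq_flatMap] at htot
  refine (Runs.mono htot ?_ : _)
  have b1 := (length_lt_csize (X.prep (a, ρ))).le.trans (hprep (a, ρ))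
  have b2 := (length_lt_csize (X.body (a, ρ))).le.trans (hbody (a, ρ))
  have b3 := (length_lt_csize (X.post (a, ρ))).le.trans (hpost (a, ρ))
  have b4 : X.nq a ≤ pnq.eval (csize (a, ρ)) := by
    have q3 := hnq a
    have q4 : pnq.eval (csize a) ≤ pnq.eval (csize (a, ρ)) := eval_mono _ (by rw [csize_pair a ρ]; omega)
    rw [csize_nat] at q3
    omega
  have b5 : pnq.eval (csize a) ≤ pnq.eval (csize (a, ρ)) := eval_mono _ (by rw [csize_pair a ρ]; omega)
  have m1 := eval_mono pprep (Nat.le_add_right (csize (a, ρ)) found.size)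
  have m2 := eval_mono pbody (Nat.le_add_right (csize (a, ρ)) found.size)
  have m3 := eval_mono ppost (Nat.le_add_right (csize (a, ρ)) found.size)
  have m4 := eval_mono pnq (Nat.le_add_right (csize (a, ρ)) found.size)
  have m5 := eval_mono pstack (Nat.le_add_right (csize (a, ρ)) found.size)
  simp only [eval_add, eval_mul, eval_C, eval_comp, eval_X]
  have b6 : stackReps (X.stack (a, ρ)) * (30 * (X.body (a, ρ)).length + 30) ≤
      stackReps (X.stack (a, ρ)) * (30 * pbody.eval (csize (a, ρ) + found.size) + 30) :=
    Nat.mul_le_mul_left _ (by omega)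
  generalize csize (a, ρ) + found.size = x at *
  have b7 : stackReps (X.stack (a, ρ)) * (30 * pbody.eval x + 30) ≤
    stackReps (X.stack (a, ρ)) * (31 * pprep.eval x + 31 * pbody.eval x + pstack.eval x +
      31 * ppost.eval x + 21 * pnq.eval x + prec.eval (x + 4 * pnq.eval x + 5) + 80) :=
    Nat.mul_le_mul_left _ (by omega)
  refine le_of_le_of_eq ?_ ((Nat.add_one_mul (stackReps (X.stack (a, ρ))) _).symm.trans
    (Nat.mul_comm _ _))
  omega

end Scheme

section

/-! ### The probabilities of the trials -/

lemma sum_map_flatMap {α β : Type*} (l : List α) (f : α → List β) (g : β → ℝ) :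
    ((l.flatMap f).map g).sum = (l.map fun x => ((f x).map g).sum).sum := by
  induction l with
  | nil => rfl
  | cons a l ih => simp [ih]

variable {M : ℕ}

/-- The total weight of the branches. -/
def totalWeight (L : List (Store × QState M)) : ℝ := (L.map fun p => p.2.weight).sum

/-- The total weight of the branches with the value `nil` in the variable `1`. -/
def openWeight (L : List (Store × QState M)) : ℝ :=
  (L.map fun p => if (p.1 1).isNil then p.2.weight else 0).sum

lemma weight_nonneg (ψ : QState M) : 0 ≤ ψ.weight :=
  sum_nonneg fun _ _ => by positivity

namespace Scheme

variable (X : Scheme)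

/-- The probability that a trial finds a satisfying assignment. -/
def successProb (M : ℕ) (a : RawFormula) : ℝ :=
  bsum (X.ncoins a) fun ρ => (1 / 2) ^ X.ncoins a * bsum (X.nq a) fun o =>
    if satRaw a (X.cand ((a, ρ), o)) then ‖X.final M (a, ρ) (toBits o)‖ ^ 2 else 0

/-- The scheme can be carried out with `M` qubits, with at most `R` repetitions in each trial. -/
structure Fits (M R : ℕ) (a : RawFormula) : Prop where
  pos : 0 < M
  nq_le : X.nq a ≤ M
  prep : ∀ ρ : List Bool, ρ.length = X.ncoins a → ∀ g ∈ X.prep (a, ρ), Gate.Below (X.nq a) g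
  body : ∀ ρ : List Bool, ρ.length = X.ncoins a → ∀ g ∈ X.body (a, ρ), Gate.Below (X.nq a) g
  post : ∀ ρ : List Bool, ρ.length = X.ncoins a → ∀ g ∈ X.post (a, ρ), Gate.Below (X.nq a) g
  reps : ∀ ρ : List Bool, ρ.length = X.ncoins a → stackReps (X.stack (a, ρ)) ≤ R
  cand : ∀ ρ o : List Bool, ρ.length = X.ncoins a → o.length = X.nq a →
    (X.cand ((a, ρ), o)).length = a.1

variable {X}

variable {M R : ℕ} {a : RawFormula} {ρ : List Bool} {d : DTree}

lemma Fits.suppBelow_final (h : X.Fits M R a)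
    (hρ : ρ.length = X.ncoins a) : SuppBelow (X.nq a) (X.final M (a, ρ)) := by
  refine SuppBelow.appGates ?_ (h.post ρ hρ)
  have : ∀ j, SuppBelow (X.nq a) ((appGates (X.body (a, ρ)))^[j]
      (appGates (X.prep (a, ρ)) (QState.zero M))) := by
    intro j
    induction j with
    | zero => simpa using (suppBelow_smul_zero (M := M) (X.nq a) 1).appGates (h.prep ρ hρ)
    | succ j ih => rw [iterate_succ_apply']; exact ih.appGates (h.body ρ hρ)
  exact this _

lemma weight_final (M : ℕ) (p : RawFormula × List Bool) : (X.final M p).weight = 1 := by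
  unfold final
  rw [weight_appGates]
  have : ∀ j, ((appGates (X.body p))^[j] (appGates (X.prep p) (QState.zero M))).weight = 1 := by
    intro j
    induction j with
    | zero => simpa [weight_appGates] using weight_smul_zero (M := M) 1
    | succ j ih => rw [iterate_succ_apply', weight_appGates, ih]
  exact this _

lemma Fits.bsum_final (h : X.Fits M R a) (hρ : ρ.length = X.ncoins a) :
    (bsum (X.nq a) fun o => ‖X.final M (a, ρ) (toBits o)‖ ^ 2) = 1 := by
  rw [bsum_weight h.nq_le (h.suppBelow_final hρ), weight_final]

/-- The values of the record: nothing or a satisfying assignment. -/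
def IsRecord (a : RawFormula) (d : DTree) : Prop :=
  d = .nil ∨ ∃ y : List Bool, d = enc ((), y) ∧ satRaw a y = true ∧ y.length = a.1

lemma IsRecord.size_le (h : IsRecord a d) : d.size ≤ 2 * csize a + 3 := by
  rcases h with rfl | ⟨y, rfl, -, hy⟩
  · simp [DTree.size]
  · have h1 := csize_bits_le y
    have h2 : (enc ((), y)).size = csize () + csize y + 1 := csize_pair () y
    have h3 : csize a = csize a.1 + csize a.2 + 1 := csize_pair a.1 a.2
    rw [csize_nat] at h3
    rw [h2, csize_unit]
    omega

lemma Fits.isRecord (h : X.Fits M R a)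
    (hd : IsRecord a d) {o : List Bool} (hρ : ρ.length = X.ncoins a) (ho : o.length = X.nq a) :
    IsRecord a (X.record (d, (a, ρ), o)) := by
  unfold record
  cases hn : d.isNil
  · simpa using hd
  · cases hs : satRaw a (X.cand ((a, ρ), o))
    · exact .inl (by simp)
    · exact .inr ⟨_, rfl, hs, h.cand ρ o hρ ho⟩

lemma isNil_record (d : DTree) (a : RawFormula) (ρ o : List Bool) :
    (X.record (d, (a, ρ), o)).isNil = (d.isNil && !satRaw a (X.cand ((a, ρ), o))) := by
  unfold record
  cases hn : d.isNil
  · simp [hn]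
  · cases hs : satRaw a (X.cand ((a, ρ), o)) <;> rfl

/-- The coins contribute `(1/2)^n` and the measurement the square of the amplitude, so the branches
of one trial carry the product distribution. Hence the weight of the branches without a solution
shrinks at least by the factor `1 - successProb`, while branches with a solution keep it. The time
bound refers only to the formula and to `R`, because `IsRecord` bounds the size of the record. -/
lemma exists_iterCmd (X : Scheme) : ∃ C : Cmd, ∃ p : Polynomial ℕ, ∀ (M R : ℕ) (a : RawFormula),
    X.Fits M R a → ∀ (s : Store) (z : ℂ), s 0 = enc a → IsRecord a (s 1) →
    ∃ L : List (Store × QState M), Runs C s (z • QState.zero M) (p.eval (csize a) * (R + 1)) L ∧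
      totalWeight L = ‖z‖ ^ 2 ∧
      openWeight L ≤ (1 - X.successProb M a) * (if (s 1).isNil then ‖z‖ ^ 2 else 0) ∧
      ∀ q ∈ L, q.1 0 = enc a ∧ IsRecord a (q.1 1) ∧ (∃ z' : ℂ, q.2 = z' • QState.zero M) ∧
        q.1 2 = s 2 := by
  obtain ⟨pc, hpc, hpcC⟩ := X.pt_ncoins
  obtain ⟨Cc, hCc⟩ := hpcC 4
  obtain ⟨Ct, pt, hCt⟩ := X.exists_trialCmd
  refine ⟨.seq (.seq (.copy 4 0) (.seq Cc (.seq (.setNil 5) (.seq (.setNil 6) (coinLoop 4)))))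
    (.seq (.cons 4 0 5) Ct),
    .C 21 * pc + pt.comp (.C 3 * .X + .C 4 * pc + .C 5) + .C 30, ?_⟩
  intro M R a hfit s z h0 h1
  obtain ⟨s1, h1lt, h1k, h1run⟩ := hCc a (update s 4 (s 0)) (by simp [h0])
  set s2 := update s1 5 .nil with hs2
  set s3 := update s2 6 .nil with hs3
  have e3 : ∀ v < 4, s3 v = s v := by grind
  obtain ⟨S, hS, hSrun⟩ := exists_runs_coinLoop hfit.pos 4 (X.ncoins a) s3 z []
    (by grind)
    (by rw [hs3, update_of_ne (by omega), hs2, update_self]; rfl)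
    (by rw [hs3, update_self]; rfl)
  set n := X.ncoins a with hn
  have hpre := (classicalRun_copy 4 0 s M (z • QState.zero M)).seq_single
    ((h1run M _).seq_single ((classicalRun_setNil 5 s1 M _).seq_single
      ((classicalRun_setNil 6 s2 M _).seq_single hSrun)))
  have htr : ∀ ρ ∈ bitLists n, ∃ T : List Bool → Store,
      (∀ o, o.length = X.nq a → T o 1 = X.record (s 1, (a, ρ), o) ∧ ∀ v < 4, v ≠ 1 → T o v = s v) ∧
      Runs (.seq (.cons 4 0 5) Ct) (S ρ) ((z / (sqrt 2 : ℂ) ^ n) • QState.zero M)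
        (pt.eval (3 * csize a + 4 * pc.eval (csize a) + 5) * (R + 1) + 2)
        ((bitLists (X.nq a)).map fun o =>
          (T o, (z / (sqrt 2 : ℂ) ^ n * X.final M (a, ρ) (toBits o)) • QState.zero M)) := by
    intro ρ hρ
    have hl := length_of_mem_bitLists hρ
    obtain ⟨hS1, hS2⟩ := hS ρ hl
    have e4 : ∀ v < 4, update (S ρ) 4 (.cons (S ρ 0) (S ρ 5)) v = s v := by grind
    obtain ⟨T, hT, hTrun⟩ := hCt M a ρ (s 1) (update (S ρ) 4 (.cons (S ρ 0) (S ρ 5)))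
      (z / (sqrt 2 : ℂ) ^ n) (by grind) (e4 1 (by omega))
      (by
        rw [update_self, hS2 0 (by omega), e3 0 (by omega), h0]
        simp only [Nat.reduceAdd, append_nil] at hS1
        rw [hS1]; rfl)
      hfit.nq_le (hfit.prep ρ hl) (hfit.body ρ hl) (hfit.post ρ hl)
    refine ⟨T, fun o ho => ⟨(hT o ho).1, fun v hv hv1 => ((hT o ho).2 v hv hv1).trans (e4 v hv)⟩,
      ((classicalRun_cons 4 0 5 (S ρ) M _).seq_single hTrun).mono ?_⟩
    have b1 : pt.eval (csize (a, ρ) + (s 1).size) ≤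
        pt.eval (3 * csize a + 4 * pc.eval (csize a) + 5) := by
      apply eval_mono
      have q1 := csize_bits_le ρ
      have q2 := h1.size_le
      have q3 := hpc a
      rw [csize_nat] at q3
      rw [csize_pair]
      omega
    have b2 := Nat.mul_le_mul b1 (Nat.add_le_add_right (hfit.reps ρ hl) 1)
    omega
  have : Inhabited (List Bool → Store) := ⟨fun _ => s⟩
  obtain ⟨T, hT⟩ := exists_fun_of_forall_mem htr
  set K : List Bool → List (Store × QState M) := fun ρ => (bitLists (X.nq a)).map
    fun o => (T ρ o, (z / (sqrt 2 : ℂ) ^ n * X.final M (a, ρ) (toBits o)) • QState.zero M) with hK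
  have htot := hpre.seq_map (D := .seq (.cons 4 0 5) Ct) (K := K)
    (fun ρ hρ ρ' hρ' h => by
      have q1 := (hS ρ (length_of_mem_bitLists hρ)).1
      have q2 := (hS ρ' (length_of_mem_bitLists hρ')).1
      have q3 := q1.symm.trans ((congrFun h 5).trans q2)
      simpa using enc_bits_injective q3)
    (fun ρ hρ => (hT ρ hρ).2)
  have hz : ∀ w : ℂ, ‖z / (sqrt 2 : ℂ) ^ n * w‖ ^ 2 = ‖z‖ ^ 2 * ((1 / 2) ^ n * ‖w‖ ^ 2) := by
    intro w
    have hs : ‖(sqrt 2 : ℂ)‖ ^ 2 = 2 := by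
      rw [Complex.norm_real, norm_eq_abs, sq_abs, sq_sqrt (by norm_num)]
    rw [norm_mul, norm_div, norm_pow, mul_pow, div_pow, ← pow_mul, Nat.mul_comm n 2, pow_mul, hs,
      one_div, inv_pow]
    ring
  refine ⟨_, htot.mono ?_, ?_, ?_, ?_⟩
  · have q3 := hpc a
    rw [csize_nat] at q3
    simp only [eval_add, eval_mul, eval_C, eval_comp, eval_X]
    generalize pt.eval (3 * csize a + 4 * pc.eval (csize a) + 5) = u
    rw [Nat.add_mul, Nat.add_mul]
    have q4 := Nat.mul_le_mul_left (21 * pc.eval (csize a)) (Nat.le_add_left 1 R)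
    omega
  · have : totalWeight ((bitLists n).flatMap K) =
        bsum n fun ρ => ‖z‖ ^ 2 * ((1 / 2) ^ n * bsum (X.nq a) fun o =>
          ‖X.final M (a, ρ) (toBits o)‖ ^ 2) := by
      rw [totalWeight, sum_map_flatMap]
      simp only [hK, map_map, comp_def, weight_smul_zero, hz]
      change bsum n (fun ρ => bsum (X.nq a) _) = _
      simp only [bsum_mul_left]
    rw [this, bsum_congr (g := fun _ => ‖z‖ ^ 2 * (1 / 2) ^ n) fun ρ hρ => by
      rw [hfit.bsum_final hρ, mul_one], bsum_const, mul_left_comm, ← mul_pow]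
    norm_num
  · have : openWeight ((bitLists n).flatMap K) =
        bsum n fun ρ => bsum (X.nq a) fun o => if (T ρ o 1).isNil then
          ‖z‖ ^ 2 * ((1 / 2) ^ n * ‖X.final M (a, ρ) (toBits o)‖ ^ 2) else 0 := by
      rw [openWeight, sum_map_flatMap]
      simp only [hK, map_map, comp_def, weight_smul_zero, hz]
      rfl
    rw [this]
    have h2 : ∀ ρ : List Bool, ρ.length = n → ∀ o : List Bool, o.length = X.nq a →
        (T ρ o 1).isNil = ((s 1).isNil && !satRaw a (X.cand ((a, ρ), o))) := by
      intro ρ hρ o ho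
      rw [((hT ρ (mem_bitLists hρ)).1 o ho).1, isNil_record]
    cases hnil : (s 1).isNil
    · simp only [false_eq_true, if_false, mul_zero]
      rw [bsum_congr (g := fun _ => 0) fun ρ hρ => by
        rw [bsum_congr (g := fun _ => 0) fun o ho => by grind]
        simp [bsum_const]]
      simp [bsum_const]
    · have h3 : (bsum n fun ρ => bsum (X.nq a) fun o => if (T ρ o 1).isNil then
          ‖z‖ ^ 2 * ((1 / 2) ^ n * ‖X.final M (a, ρ) (toBits o)‖ ^ 2) else 0) +
          ‖z‖ ^ 2 * X.successProb M a = ‖z‖ ^ 2 := by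
        rw [successProb, ← bsum_mul_left, ← bsum_add]
        rw [bsum_congr (g := fun _ => ‖z‖ ^ 2 * (1 / 2) ^ n) fun ρ hρ => ?_]
        · rw [bsum_const, mul_left_comm, ← mul_pow]
          norm_num
        · rw [← mul_assoc, ← bsum_mul_left, ← bsum_add]
          rw [bsum_congr (g := fun o => ‖z‖ ^ 2 * (1 / 2) ^ n * ‖X.final M (a, ρ) (toBits o)‖ ^ 2)
            fun o ho => ?_]
          · rw [bsum_mul_left, hfit.bsum_final hρ, mul_one]
          · rw [h2 ρ hρ o ho, hnil]
            cases satRaw a (X.cand ((a, ρ), o)) <;> simp [hn]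
            ring
      simp only [if_true]
      linarith
  · intro q hq
    obtain ⟨ρ, hρ, hq⟩ := mem_flatMap.1 hq
    obtain ⟨o, ho, rfl⟩ := mem_map.1 hq
    obtain ⟨q1, q2⟩ := (hT ρ hρ).1 o (length_of_mem_bitLists ho)
    refine ⟨(q2 0 (by omega) (by omega)).trans h0, ?_, ⟨_, rfl⟩, q2 2 (by omega) (by omega)⟩
    simp only [q1]
    exact hfit.isRecord h1 (length_of_mem_bitLists hρ) (length_of_mem_bitLists ho)

end Scheme

end

/-! ### Tables -/

/-- Equality of trees. -/
def DTree.eqb : DTree → DTree → Bool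
  | .nil, d => d.isNil
  | .cons a b, d => !d.isNil && (a.eqb d.head && b.eqb d.tail)

lemma DTree.eqb_iff (t d : DTree) : t.eqb d = true ↔ d = t := by
  induction t generalizing d with
  | nil => cases d <;> simp [DTree.eqb, DTree.isNil]
  | cons a b iha ihb => cases d <;> simp [DTree.eqb, DTree.isNil, iha, ihb, DTree.head, DTree.tail]

lemma PT.eqb (t : DTree) : PT t.eqb := by
  induction t with
  | nil => exact PT.isNil_tree
  | cons a b iha ihb =>
    have h1 := PT.isNil_tree
    have h2 := iha.comp PT.head_tree
    have h3 := ihb.comp PT.tail_tree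
    exact h1.not.and (h2.and h3)

/-- Finitely many inputs can be hard-wired into a program. This disposes of the formulas with few
variables, for which the device may be too small for the circuit or even have no qubit. -/
lemma exists_pt_table (g : DTree → DTree) (l : List DTree) :
    ∃ f : DTree → DTree, PT f ∧ ∀ d ∈ l, f d = g d := by
  induction l with
  | nil => exact ⟨fun d => d, PT.id, by simp⟩
  | cons a l ih =>
    obtain ⟨f, hf, hfl⟩ := ih
    refine ⟨fun d => bif a.eqb d then g a else f d, PT.cond (PT.eqb a) (PT.const (g a)) hf, ?_⟩
    intro d hd
    cases h : a.eqb d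
    · rcases mem_cons.1 hd with rfl | hd
      · rw [(DTree.eqb_iff d d).2 rfl] at h; cases h
      · grind
    · obtain rfl := (DTree.eqb_iff a d).1 h
      simp only [h, cond_true]

lemma enc_nat_injective : Injective (enc : ℕ → DTree) := fun a b h => by
  rw [← length_enc_nat a, h, length_enc_nat]

lemma enc_prod_injective {α β : Type} [Code α] [Code β]
    (ha : Injective (enc : α → DTree)) (hb : Injective (enc : β → DTree)) :
    Injective (enc : α × β → DTree) := by
  rintro ⟨a, b⟩ ⟨a', b'⟩ h
  rw [enc_pair, enc_pair] at h
  injection h with h1 h2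
  rw [ha h1, hb h2]

lemma enc_rawFormula_injective : Injective (enc : RawFormula → DTree) :=
  enc_prod_injective enc_nat_injective
    (enc_list_injective (enc_list_injective (enc_prod_injective enc_bool_injective enc_nat_injective)))

instance (n : ℕ) : Finite (Formula n) :=
  Finite.of_injective (fun F : Formula n => (⟨F.clauses, F.nodup⟩ : {l : List (Clause n) // l.Nodup}))
    fun F G h => by
      cases F; cases G
      simpa using h

/-! ### Correct outputs -/

lemma isCorrectOutput_of_sat {n : ℕ} (F : Formula n) {y : List Bool} (hy : y.length = n)
    (h : satRaw (rawFormula F) y = true) : IsCorrectOutput F (enc ((), y)) :=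
  .inl ⟨toAssignment y, (satRaw_rawFormula F y).1 h, (encodeAssignment_toAssignment hy).symm⟩

lemma exists_satRaw_iff {n : ℕ} (F : Formula n) :
    (∃ y : List Bool, y.length = n ∧ satRaw (rawFormula F) y = true) ↔ ∃ x, F.IsSatisfied x := by
  constructor
  · rintro ⟨y, -, h⟩
    exact ⟨_, (satRaw_rawFormula F y).1 h⟩
  · rintro ⟨x, hx⟩
    refine ⟨List.ofFn x, by simp, (satRaw_rawFormula F _).2 ?_⟩
    convert hx
    funext i
    simp [toAssignment]

/-- No algorithm is needed here, as the function is used only through a finite table. -/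
lemma exists_correct_fun : ∃ g : DTree → DTree, ∀ (n : ℕ) (F : Formula n),
    IsCorrectOutput F (g (encodeFormula F)) := by
  classical
  let g : DTree → DTree := fun d =>
    if h : ∃ p : RawFormula × List Bool, enc p.1 = d ∧ p.2.length = p.1.1 ∧ satRaw p.1 p.2 = true then
      enc ((), h.choose.2) else .nil
  refine ⟨g, fun n F => ?_⟩
  by_cases h : ∃ p : RawFormula × List Bool, enc p.1 = encodeFormula F ∧ p.2.length = p.1.1 ∧
      satRaw p.1 p.2 = true
  · simp only [g, dif_pos h]
    obtain ⟨h1, h2, h3⟩ := h.choose_spec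
    have h4 := enc_rawFormula_injective (h1.trans (enc_rawFormula F).symm)
    rw [h4] at h2 h3
    exact isCorrectOutput_of_sat F h2 h3
  · simp only [g, dif_neg h]
    refine .inr ⟨fun hx => h ?_, rfl⟩
    obtain ⟨y, hy, hs⟩ := (exists_satRaw_iff F).2 hx
    exact ⟨(rawFormula F, y), enc_rawFormula F, hy, hs⟩

/-- The clauses are distinct, so there are at most `(2n)^3` of them. This is what turns polynomials
in the size of the formula into polynomials in `n`. -/
lemma exists_csize_rawFormula_le : ∃ p : Polynomial ℕ, ∀ (n : ℕ) (F : Formula n),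
    csize (rawFormula F) ≤ p.eval n := by
  refine ⟨.C 2 * .X + .C 3 + (.C 8 * .X ^ 3) * (.C 6 * .X + .C 20), fun n F => ?_⟩
  have h1 : F.clauses.length ≤ 8 * n ^ 3 := by
    have := F.nodup.length_le_card
    simp only [Fintype.card_prod, Fintype.card_fin, Fintype.card_bool] at this
    calc _ ≤ _ := this
      _ = 8 * n ^ 3 := by ring
  have h2 : ∀ C : Clause n, csize (rawClause C) ≤ 6 * n + 19 := by
    intro C
    have b : ∀ l : Literal n, csize (l.2, (l.1 : ℕ)) ≤ 2 * n + 5 := fun l => by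
      have := csize_bool_le l.2
      have := l.1.2
      rw [csize_pair, csize_nat]; omega
    have b1 := b C.1
    have b2 := b C.2.1
    have b3 := b C.2.2
    simp only [rawClause, csize_cons, csize_nil]
    omega
  have h3 : ∀ l : List (Clause n), csize (l.map rawClause) ≤ l.length * (6 * n + 20) + 1 := by
    intro l
    induction l with
    | nil => simp [csize_nil]
    | cons C l ih =>
      have := h2 C
      rw [map_cons, csize_cons, length_cons, Nat.add_one_mul]
      omega
  have h4 := h3 F.clauses
  have h5 := Nat.mul_le_mul_right (6 * n + 20) h1
  rw [rawFormula, csize_pair, csize_nat]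
  simp only [eval_add, eval_mul, eval_C, eval_X, eval_pow]
  omega

/-! ### The program -/

lemma haltsWithin_and_le_outputProb {M : ℕ} {P : Cmd} {a : DTree} {t : ℕ}
    {L : List (Store × QState M)} {E : DTree → Prop} {x : ℝ}
    (h : Runs P (update (fun _ => DTree.nil) 0 a) (QState.zero M) t L) [DecidablePred E]
    (hx : x ≤ (L.map fun p => if E (p.1 0) then p.2.weight else 0).sum) :
    HaltsWithin M P a t ∧ x ≤ outputProb M P a t E := by
  have hb := (h []).branches_eq fun b hb => by grind
  change branches (start M P a) t = _ at hb
  refine ⟨fun b hb' _ => ?_, ?_⟩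
  · grind
  · rw [outputProb, hb]
    refine hx.trans (le_of_eq ?_)
    clear * -
    induction L with
    | nil => simp
    | cons p L ih =>
      rw [map_cons, sum_cons, ih, map_cons, List.filter_cons]
      by_cases hE : E (p.1 0) <;> simp [hE]

namespace Scheme

lemma Fits.successProb_le_one {X : Scheme} {M R : ℕ} {a : RawFormula} (h : X.Fits M R a) :
    X.successProb M a ≤ 1 := by
  have : X.successProb M a ≤ bsum (X.ncoins a) fun _ => (1 / 2) ^ X.ncoins a := by
    refine bsum_le fun ρ hρ => ?_
    rw [← mul_one ((1 / 2 : ℝ) ^ X.ncoins a), mul_assoc, one_mul]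
    refine mul_le_mul_of_nonneg_left ?_ (by positivity)
    rw [← h.bsum_final hρ]
    refine bsum_le fun o _ => ?_
    split_ifs
    · rfl
    · positivity
  rw [bsum_const, ← mul_pow] at this
  simpa using this

lemma exists_loopCmd (X : Scheme) : ∃ C : Cmd, ∃ p : Polynomial ℕ, ∀ (M R : ℕ) (a : RawFormula),
    X.Fits M R a → ∀ s : Store, s 0 = enc a → s 1 = .nil → s 2 = enc [X.rounds a] →
    ∃ L : List (Store × QState M),
      Runs C s (QState.zero M) (p.eval (csize a) * (2 ^ X.rounds a * (R + 1))) L ∧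
      totalWeight L = 1 ∧
      openWeight L ≤ (1 - X.successProb M a) ^ 2 ^ X.rounds a ∧ ∀ q ∈ L, IsRecord a (q.1 1) := by
  obtain ⟨C, p, hC⟩ := X.exists_iterCmd
  refine ⟨stackLoop 2 C, p + .C 23, fun M R a hfit s h0 h1 h2 => ?_⟩
  have hp := sub_nonneg.2 hfit.successProb_le_one
  have := exists_runs_stackLoop (M := M) (k := 2) (t := p.eval (csize a) * (R + 1)) (C := C)
    (Good := fun σ => σ.1 0 = enc a ∧ IsRecord a (σ.1 1) ∧ ∃ z : ℂ, σ.2 = z • QState.zero M)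
    -- After `j` trials no weight is lost, and the weight of the branches without a solution has
    -- decayed by the `j`-th power; both statements are multiplicative under concatenation of runs.
    (R := fun j σ L => totalWeight L = σ.2.weight ∧ openWeight L ≤
      (1 - X.successProb M a) ^ j * (if (σ.1 1).isNil then σ.2.weight else 0))
    (by
      rintro i j σ L K ⟨hL1, hL2⟩ hK
      constructor
      · rw [← hL1, totalWeight, sum_map_flatMap, totalWeight]
        exact congrArg List.sum (map_congr_left fun q hq => (hK q hq).1)
      · rw [openWeight, sum_map_flatMap, pow_add, mul_comm (_ ^ i), mul_assoc]
        refine le_trans (sum_le_sum fun q hq => (hK q hq).2) ?_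
        rw [List.sum_map_mul_left]
        exact mul_le_mul_of_nonneg_left hL2 (pow_nonneg hp j))
    (fun σ => by simp [totalWeight, openWeight])
    (fun s s' ψ h hG => by grind)
    (fun s ψ hG => by
      obtain ⟨g0, g1, z, rfl⟩ := hG
      obtain ⟨L, hL, hL1, hL2, hL3⟩ := hC M R a hfit s z g0 g1
      refine ⟨L, hL, ⟨by rw [hL1, weight_smul_zero], by rw [pow_one, weight_smul_zero]; exact hL2⟩, ?_⟩
      exact fun q hq => ⟨⟨(hL3 q hq).1, (hL3 q hq).2.1, (hL3 q hq).2.2.1⟩, (hL3 q hq).2.2.2⟩)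
    [X.rounds a] s (QState.zero M) h2 ⟨h0, .inl h1, 1, (one_smul _ _).symm⟩
  obtain ⟨L, hL, ⟨hL1, hL2⟩, hL3⟩ := this
  have hz : (QState.zero M).weight = 1 := by simpa using weight_smul_zero (M := M) 1
  have hr : stackReps [X.rounds a] = 2 ^ X.rounds a := by simp [stackReps]
  rw [hz] at hL1 hL2
  rw [hr] at hL hL2
  refine ⟨L, hL.mono ?_, hL1, hL2.trans ?_, fun q hq => (hL3 q hq).2.1⟩
  · rw [eval_add, eval_C]
    have : 1 ≤ 2 ^ X.rounds a := Nat.one_le_two_pow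
    generalize 2 ^ X.rounds a = N at *
    generalize p.eval (csize a) = u
    nlinarith [Nat.zero_le (N * R)]
  · simp [h1, DTree.isNil]

/-- Below `n₀` the answer is looked up in a table; from `n₀` on the trials are repeated. No error
occurs on unsatisfiable formulas, since the record only accepts checked assignments. -/
lemma exists_mainCmd (X : Scheme) (n₀ : ℕ) : ∃ P : Cmd, ∃ p : Polynomial ℕ,
    (∀ (n M : ℕ) (F : Formula n), n < n₀ → ∀ t, p.eval n ≤ t → HaltsWithin M P (encodeFormula F) t ∧
        2 / 3 ≤ outputProb M P (encodeFormula F) t (IsCorrectOutput F)) ∧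
    ∀ (n M R : ℕ) (F : Formula n), n₀ ≤ n → X.Fits M R (rawFormula F) →
      ((∃ x, F.IsSatisfied x) → 2 ≤ 2 ^ X.rounds (rawFormula F) * X.successProb M (rawFormula F)) →
      ∀ t, p.eval n * (2 ^ X.rounds (rawFormula F) * (R + 1)) ≤ t →
      HaltsWithin M P (encodeFormula F) t ∧
        2 / 3 ≤ outputProb M P (encodeFormula F) t (IsCorrectOutput F) := by
  classical
  obtain ⟨g, hg⟩ := exists_correct_fun
  have hfin : (⋃ n : Fin n₀, Set.range fun F : Formula n => encodeFormula F).Finite :=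
    Set.finite_iUnion fun n => Set.finite_range _
  obtain ⟨tab, htab, htabF⟩ := exists_pt_table g hfin.toFinset.toList
  have hball : PT fun a : RawFormula => Nat.ble n₀ a.1 := (PT.const n₀).ble PT.fst'
  have hst : PT fun a : RawFormula => [X.rounds a] := X.pt_rounds.list_cons (PT.const [])
  obtain ⟨p1, -, hp1⟩ := hball
  obtain ⟨p2, -, hp2⟩ := hst
  obtain ⟨p3, -, hp3⟩ := htab
  obtain ⟨C1, hC1⟩ := hp1 2
  obtain ⟨C2, hC2⟩ := hp2 2
  obtain ⟨C3, hC3⟩ := hp3 0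
  obtain ⟨C4, p4, hC4⟩ := X.exists_loopCmd
  obtain ⟨ps, hps⟩ := exists_csize_rawFormula_le
  refine ⟨.seq (.seq (.copy 2 0) C1) (.cond 2
      (.seq (.seq (.copy 2 0) (.seq C2 (.setNil 1))) (.seq C4 (.copy 0 1))) C3),
    (p1 + p2 + p3 + p4 + .C 20).comp ps, ?_, ?_⟩
  · intro n M F hn t ht
    have hev : (p1.eval (csize (rawFormula F)) + p3.eval (csize (rawFormula F)) + 20) ≤ t := by
      refine le_trans ?_ ht
      simp only [eval_comp, eval_add, eval_C]
      have m1 := eval_mono p1 (hps n F)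
      have m3 := eval_mono p3 (hps n F)
      omega
    set s : Store := update (fun _ => DTree.nil) 0 (encodeFormula F) with hs
    obtain ⟨s1, h1lt, h1k, h1run⟩ := hC1 (rawFormula F) (update s 2 (s 0))
      (by simp [hs, enc_rawFormula])
    have hb : Nat.ble n₀ (rawFormula F).1 = false := by
      rw [Bool.eq_false_iff, ne_eq, ble_eq]
      exact Nat.not_le.2 hn
    obtain ⟨s2, -, h2k, h2run⟩ := hC3 (encodeFormula F) s1
      (by rw [h1lt 0 (by omega), update_of_ne (by omega), hs, update_self]; rfl)
    have hrun := ((classicalRun_copy 2 0 s).seq h1run).seq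
      (.cond_nil (C := .seq (.seq (.copy 2 0) (.seq C2 (.setNil 1))) (.seq C4 (.copy 0 1)))
        (h1k.trans (congrArg enc hb)) h2run)
    have hcs : csize (encodeFormula F) = csize (rawFormula F) := by
      rw [← enc_rawFormula]; rfl
    rw [hcs] at hrun
    refine haltsWithin_and_le_outputProb ((hrun M (QState.zero M)).mono (by omega)) ?_
    have hz : (QState.zero M).weight = 1 := by simpa using weight_smul_zero (M := M) 1
    have hout : IsCorrectOutput F (s2 0) := by
      rw [h2k]
      change IsCorrectOutput F (tab (encodeFormula F))
      rw [htabF _ (by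
        simp only [Finset.mem_toList, Set.Finite.mem_toFinset, Set.mem_iUnion]
        exact ⟨⟨n, hn⟩, F, rfl⟩)]
      exact hg n F
    simp only [map_cons, List.map_nil, sum_cons, List.sum_nil, hout, if_true, hz]
    norm_num
  · intro n M R F hn hfit hsucc t ht
    set a := rawFormula F with ha
    set s : Store := update (fun _ => DTree.nil) 0 (encodeFormula F) with hs
    have hs0 : s 0 = enc a := by rw [ha, enc_rawFormula, hs, update_self]
    obtain ⟨s1, h1lt, h1k, h1run⟩ := hC1 a (update s 2 (s 0)) (by simp [hs0])
    have hb : Nat.ble n₀ a.1 = true := by rw [ble_eq]; exact hn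
    have h10 : s1 0 = enc a := by grind
    obtain ⟨s2, h2lt, h2k, h2run⟩ := hC2 a (update s1 2 (s1 0)) (by simp [h10])
    have h20 : s2 0 = enc a := by grind
    obtain ⟨L, hL, hL1, hL2, hL3⟩ := hC4 M R a hfit (update s2 1 .nil)
      (by grind) (by simp)
      (by grind)
    have hrun := ((((classicalRun_copy 2 0 s).seq h1run) M (QState.zero M)).seq_single
      (Runs.cond_cons (D := C3) (by rw [h1k]; simp only [hb, enc_true]; simp)
        ((((classicalRun_copy 2 0 s1).seq (h2run.seq (classicalRun_setNil 1 s2))) M _).seq_single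
          (hL.seq (K := fun q => [(update q.1 0 (q.1 1), q.2)]) (u := 1)
            fun q _ => classicalRun_copy 0 1 q.1 M q.2))))
    refine haltsWithin_and_le_outputProb (hrun.mono ?_) ?_
    · refine le_trans ?_ ht
      simp only [eval_comp, eval_add, eval_C]
      have m1 := eval_mono p1 (hps n F)
      have m2 := eval_mono p2 (hps n F)
      have m4 := Nat.mul_le_mul_right (2 ^ X.rounds a * (R + 1)) (eval_mono p4 (hps n F))
      have m5 : 1 ≤ 2 ^ X.rounds a * (R + 1) := Nat.mul_pos (by positivity) (by omega)
      rw [← ha] at m1 m2 m4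
      generalize 2 ^ X.rounds a * (R + 1) = N at *
      generalize p1.eval (ps.eval n) = u1 at *
      generalize p2.eval (ps.eval n) = u2 at *
      generalize p3.eval (ps.eval n) = u3 at *
      generalize p4.eval (ps.eval n) = u4 at *
      have m6 := Nat.mul_le_mul_left (u1 + u2 + u3 + 20) m5
      calc _ ≤ (u1 + u2 + u3 + 20) * 1 + u4 * N := by omega
        _ ≤ (u1 + u2 + u3 + 20) * N + u4 * N := by omega
        _ = _ := by ring
    · rw [← List.map_eq_flatMap, map_map]
      by_cases hsat : ∃ x, F.IsSatisfied x
      · have hp := hsucc hsat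
        have hone : totalWeight L - openWeight L ≤ (L.map ((fun p : Store × QState M =>
            if IsCorrectOutput F (p.1 0) then p.2.weight else 0) ∘
            fun q => (update q.1 0 (q.1 1), q.2))).sum := by
          rw [totalWeight, openWeight, sub_le_iff_le_add, ← List.sum_map_add]
          refine sum_le_sum fun q hq => ?_
          rcases hL3 q hq with h | ⟨y, h, hy, hyl⟩
          · simp only [h, DTree.isNil, if_true, comp_apply]
            have : 0 ≤ if IsCorrectOutput F (update q.1 0 .nil 0) then q.2.weight else 0 := by
              split_ifs
              · exact weight_nonneg _
              · exact le_rfl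
            linarith
          · have hc : IsCorrectOutput F (q.1 1) := h ▸ isCorrectOutput_of_sat F hyl hy
            simp only [comp_apply, update_self, hc, if_true]
            have : 0 ≤ if (q.1 1).isNil = true then q.2.weight else 0 := by
              split_ifs
              · exact weight_nonneg _
              · exact le_rfl
            linarith
        refine le_trans ?_ hone
        -- With `p` the success probability and `N` the number of trials, `(1 - p)^N ≤ exp (-N p) ≤
        -- exp (-2) ≤ 1/3`, because `N p ≥ 2` and `exp 2 ≥ 3`.
        have h1 : (1 - X.successProb M a) ^ 2 ^ X.rounds a ≤ 1 / 3 := by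
          calc (1 - X.successProb M a) ^ 2 ^ X.rounds a
              ≤ Real.exp (-X.successProb M a) ^ 2 ^ X.rounds a :=
                pow_le_pow_left₀ (sub_nonneg.2 hfit.successProb_le_one)
                  (by linarith [Real.add_one_le_exp (-X.successProb M a)]) _
            _ = Real.exp (-(2 ^ X.rounds a * X.successProb M a)) := by
                rw [← Real.exp_nat_mul]; push_cast; ring_nf
            _ ≤ Real.exp (-2) := Real.exp_le_exp.2 (by linarith)
            _ ≤ 1 / 3 := by
                rw [Real.exp_neg, one_div]
                exact inv_anti₀ (by norm_num) (by linarith [Real.add_one_le_exp (2 : ℝ)])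
        linarith
      · have : (L.map ((fun p : Store × QState M =>
            if IsCorrectOutput F (p.1 0) then p.2.weight else 0) ∘
            fun q => (update q.1 0 (q.1 1), q.2))).sum = totalWeight L := by
          rw [totalWeight]
          refine congrArg List.sum (map_congr_left fun q hq => ?_)
          rcases hL3 q hq with h | ⟨y, h, hy, hyl⟩
          · have hc : IsCorrectOutput F (q.1 1) := .inr ⟨hsat, h⟩
            simp only [comp_apply, update_self, hc, if_true]
          · exact absurd ((exists_satRaw_iff F).1 ⟨y, hyl, hy⟩) hsat
        rw [this, hL1]
        norm_num

/-- A scheme which finds satisfying assignments with sufficient probability gives a hybrid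
algorithm. -/
lemma hybridSolvable (X : Scheme) {c γ : ℝ} (n₀ : ℕ) (b R : ℕ → ℕ)
    (hfit : ∀ n, n₀ ≤ n → ∀ F : Formula n, X.Fits ⌊c * n⌋₊ (R n) (rawFormula F))
    (hrounds : ∀ n, n₀ ≤ n → ∀ F : Formula n, X.rounds (rawFormula F) = b n)
    (hP : ∀ n, n₀ ≤ n → ∀ F : Formula n, (∃ x, F.IsSatisfied x) →
      2 ≤ 2 ^ b n * X.successProb ⌊c * n⌋₊ (rawFormula F))
    (hT : IsOStar (fun n => 2 ^ b n * ((R n : ℝ) + 1)) fun n => 2 ^ (γ * n)) :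
    HybridSolvable c γ := by
  obtain ⟨P, p, h1, h2⟩ := X.exists_mainCmd n₀
  refine ⟨P, fun n => p.eval n * (2 ^ b n * (R n + 1)), fun n F => ?_, ?_⟩
  · rcases lt_or_ge n n₀ with hn | hn
    · exact h1 n _ F hn _ (Nat.le_mul_of_pos_right _ (Nat.mul_pos (by positivity) (by omega)))
    · exact h2 n _ (R n) F hn (hfit n hn F) (by grind) _
        (by grind)
  · obtain ⟨q, hq⟩ := hT
    refine ⟨p.map (Nat.castRingHom ℝ) * q, ?_⟩
    have := (Asymptotics.isBigO_refl (fun n : ℕ => (p.map (Nat.castRingHom ℝ)).eval (n : ℝ))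
      Filter.atTop).mul hq
    refine this.congr (fun n => ?_) fun n => ?_
    · have : (p.map (Nat.castRingHom ℝ)).eval (n : ℝ) = ((p.eval n : ℕ) : ℝ) := by
        simp
      simp [this]
    · rw [eval_mul, mul_assoc]

end Scheme

section

/-! ### Multiply controlled NOT gates -/

/-- A NOT gate with several controls, each with the value for which it is active, and a target. -/
abbrev MCX (α : Type) : Type := List (α × Bool) × α

section mcx

variable {α : Type}

/-- All controls in `c` are active. -/
def holds (w : α → Bool) (c : List (α × Bool)) : Bool := c.all fun p => w p.1 == p.2

lemma holds_nil (w : α → Bool) : holds w [] = true := rfl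
lemma holds_cons (w : α → Bool) (p : α × Bool) (c : List (α × Bool)) :
    holds w (p :: c) = (w p.1 == p.2 && holds w c) := rfl
lemma holds_append (w : α → Bool) (c d : List (α × Bool)) :
    holds w (c ++ d) = (holds w c && holds w d) := List.all_append ..

lemma holds_congr {w w' : α → Bool} {c : List (α × Bool)} (h : ∀ p ∈ c, w p.1 = w' p.1) :
    holds w c = holds w' c := by
  induction c with
  | nil => rfl
  | cons p c ih =>
    rw [holds_cons, holds_cons, h p (by simp), ih fun q hq => h q (by simp [hq])]

variable [DecidableEq α]

/-- The effect of the gate on a basis state. -/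
def MCX.act (g : MCX α) (w : α → Bool) : α → Bool :=
  update w g.2 (xor (w g.2) (holds w g.1))

/-- The effect of a list of gates on a basis state. -/
def run (L : List (MCX α)) (w : α → Bool) : α → Bool := L.foldl (fun w g => g.act w) w

lemma run_nil (w : α → Bool) : run [] w = w := rfl
lemma run_cons (g : MCX α) (L : List (MCX α)) (w : α → Bool) :
    run (g :: L) w = run L (g.act w) := rfl
lemma run_singleton (g : MCX α) (w : α → Bool) : run [g] w = g.act w := rfl
lemma run_append (L L' : List (MCX α)) (w : α → Bool) :
    run (L ++ L') w = run L' (run L w) := foldl_append ..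

/-- The target is not a control. -/
def MCX.Proper (g : MCX α) : Prop := ∀ p ∈ g.1, p.1 ≠ g.2

variable {g : MCX α} {L : List (MCX α)} {U : Set α} {w w' : α → Bool} {scr : ℕ → α}

lemma MCX.Proper.act_act (h : g.Proper) (w : α → Bool) : g.act (g.act w) = w := by
  have : holds (g.act w) g.1 = holds w g.1 :=
    holds_congr fun p hp => update_of_ne (h p hp) _ _
  unfold MCX.act at *
  rw [this]
  simp

lemma run_reverse_run (h : ∀ g ∈ L, g.Proper) (w : α → Bool) : run L.reverse (run L w) = w := by
  induction L generalizing w with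
  | nil => rfl
  | cons g L ih =>
    rw [reverse_cons, run_append, run_singleton, run_cons,
      ih (fun g hg => h g (by simp [hg]))]
    exact (h g (by simp)).act_act w

/-- All qubits of the gate are in `U`. -/
def MCX.On (U : Set α) (g : MCX α) : Prop := g.2 ∈ U ∧ ∀ p ∈ g.1, p.1 ∈ U

lemma MCX.On.act_congr (hg : g.On U)
    (h : ∀ u ∈ U, w u = w' u) : ∀ u ∈ U, g.act w u = g.act w' u := by
  intro u hu
  unfold MCX.act
  rw [holds_congr fun p hp => h _ (hg.2 p hp), h _ hg.1]
  by_cases hug : u = g.2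
  · grind
  · grind

lemma run_congr (hL : ∀ g ∈ L, g.On U)
    (h : ∀ u ∈ U, w u = w' u) : ∀ u ∈ U, run L w u = run L w' u := by
  induction L generalizing w w' with
  | nil => exact h
  | cons g L ih =>
    exact ih (fun g hg => hL g (by simp [hg])) ((hL g (by simp)).act_congr h)

lemma run_of_notMem (hL : ∀ g ∈ L, g.On U) (w : α → Bool)
    {u : α} (hu : u ∉ U) : run L w u = w u := by
  induction L generalizing w with
  | nil => rfl
  | cons g L ih =>
    rw [run_cons, ih fun g hg => hL g (by simp [hg])]
    exact update_of_ne (by rintro rfl; exact hu (hL g (by simp)).1) _ _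

/-! ### Elementary gates -/

/-- Put the conjunction of `a` and the controls step by step into auxiliary qubits, and change the
target accordingly. -/
def chain (scr : ℕ → α) (a : α) (i : ℕ) : List (α × Bool) → α → List (MCX α)
  | [], t => [([(a, true)], t)]
  | (q, v) :: cs, t =>
    let f : List (MCX α) := bif v then [] else [([], q)]
    f ++ [([(a, true), (q, true)], scr i)] ++ f ++ chain scr (scr i) (i + 1) cs t ++
      f ++ [([(a, true), (q, true)], scr i)] ++ f

/-- The gate as a sequence of gates with at most two controls. -/
def expand (scr : ℕ → α) (g : MCX α) : List (MCX α) :=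
  [([], scr 0)] ++ chain scr (scr 0) 1 g.1 g.2 ++ [([], scr 0)]

/-- A control which is active at `0` is a positive control conjugated by a NOT gate on the same
qubit. -/
lemma run_polarity {a q s : α} {v : Bool} (haq : a ≠ q) (hqs : q ≠ s) (w : α → Bool) :
    run ((bif v then [] else [([], q)]) ++ [([(a, true), (q, true)], s)] ++
      (bif v then [] else [([], q)])) w = MCX.act ([(a, true), (q, v)], s) w := by
  cases v
  · simp only [cond_false, cons_append, nil_append, run_cons, run_nil, MCX.act,
      holds_cons, holds_nil]
    funext u
    by_cases hus : u = s
    · subst hus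
      simp [update_of_ne hqs.symm, update_of_ne haq]
    · grind
  · rfl

/-- The auxiliary qubit `scr (i + 1)` receives the conjunction of `scr i` and the next control. The
inner chain changes only the target, so repeating the same gates afterwards restores `scr (i + 1)`
to `false`. -/
lemma run_chain (hscr : Injective scr) (cs : List (α × Bool)) (t : α)
    (ht : ∀ i, t ≠ scr i) (hcs : ∀ p ∈ cs, p.1 ≠ t ∧ ∀ i, p.1 ≠ scr i) (i : ℕ) (w : α → Bool)
    (hw : ∀ j, i + 1 ≤ j → w (scr j) = false) :
    run (chain scr (scr i) (i + 1) cs t) w =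
      update w t (xor (w t) (w (scr i) && holds w cs)) := by
  induction cs generalizing i w with
  | nil =>
    funext u
    simp [chain, run_cons, run_nil, MCX.act, holds_cons, holds_nil]
  | cons p cs ih =>
    obtain ⟨q, v⟩ := p
    obtain ⟨hqt, hqs⟩ := hcs (q, v) (by simp)
    have hss : scr i ≠ scr (i + 1) := by grind
    have e : chain scr (scr i) (i + 1) ((q, v) :: cs) t =
        ((bif v then [] else [([], q)]) ++ [([(scr i, true), (q, true)], scr (i + 1))] ++
          (bif v then [] else [([], q)])) ++ (chain scr (scr (i + 1)) (i + 1 + 1) cs t ++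
        ((bif v then [] else [([], q)]) ++ [([(scr i, true), (q, true)], scr (i + 1))] ++
          (bif v then [] else [([], q)]))) := by
      simp only [chain, append_assoc]
    rw [e, run_append, run_append, run_polarity (hqs i).symm (hqs _),
      run_polarity (hqs i).symm (hqs _)]
    have h1 : MCX.act ([(scr i, true), (q, v)], scr (i + 1)) w =
        update w (scr (i + 1)) (w (scr i) && w q == v) := by
      simp [MCX.act, holds_cons, holds_nil, hw (i + 1) le_rfl]
    rw [h1, ih (fun p hp => hcs p (by simp [hp])) (i + 1) _ (fun j hj => by grind)]
    have h2 : holds (update w (scr (i + 1)) (w (scr i) && w q == v)) cs = holds w cs :=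
      holds_congr fun p hp => update_of_ne ((hcs p (by simp [hp])).2 _) _ _
    rw [h2, holds_cons]
    funext u
    simp only [MCX.act, holds_cons, holds_nil]
    by_cases hus : u = scr (i + 1)
    · grind
    · rw [update_of_ne hus]
      by_cases hut : u = t
      · subst hut
        simp [update_of_ne (ht _), Bool.and_assoc]
      · grind

/-- `scr 0` is set to `true` as the empty conjunction and reset in the end, so that the chain treats
all numbers of controls alike, zero included. -/
lemma run_expand (hscr : Injective scr) (hg : g.Proper)
    (ht : ∀ i, g.2 ≠ scr i) (hcs : ∀ p ∈ g.1, ∀ i, p.1 ≠ scr i) (w : α → Bool)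
    (hw : ∀ j, w (scr j) = false) : run (expand scr g) w = g.act w := by
  have h0 : MCX.act ([], scr 0) w = update w (scr 0) true := by
    simp [MCX.act, holds_nil, hw 0]
  rw [expand, run_append, run_append, run_singleton, run_singleton, h0,
    run_chain hscr g.1 g.2 ht (fun p hp => ⟨hg p hp, hcs p hp⟩) 0 _ (fun j hj => by grind)]
  have h2 : holds (update w (scr 0) true) g.1 = holds w g.1 :=
    holds_congr fun p hp => update_of_ne (hcs p hp _) _ _
  rw [h2]
  funext u
  simp only [MCX.act, holds_nil]
  by_cases hus : u = scr 0
  · grind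
  · rw [update_of_ne hus]
    by_cases hut : u = g.2
    · subst hut
      simp [update_of_ne (ht _)]
    · grind

lemma run_flatMap_expand (hscr : Injective scr)
    (hL : ∀ g ∈ L, g.Proper ∧ (∀ i, g.2 ≠ scr i) ∧ ∀ p ∈ g.1, ∀ i, p.1 ≠ scr i) (w : α → Bool)
    (hw : ∀ j, w (scr j) = false) : run (L.flatMap (expand scr)) w = run L w := by
  induction L generalizing w with
  | nil => rfl
  | cons g L ih =>
    obtain ⟨h1, h2, h3⟩ := hL g (by simp)
    rw [flatMap_cons, run_append, run_expand hscr h1 h2 h3 w hw, run_cons]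
    exact ih (fun g hg => hL g (by simp [hg])) _ fun j => by
      rw [MCX.act, update_of_ne (h2 j).symm, hw j]

/-- At most two controls, all positive, and different operands. -/
def MCX.Elementary (g : MCX α) : Prop :=
  g.1 = [] ∨ (∃ a, g.1 = [(a, true)] ∧ a ≠ g.2) ∨
    ∃ a b, g.1 = [(a, true), (b, true)] ∧ a ≠ b ∧ a ≠ g.2 ∧ b ≠ g.2

lemma MCX.Elementary.proper (h : g.Elementary) : g.Proper := by
  rcases h with h | ⟨a, h, h1⟩ | ⟨a, b, h, -, h1, h2⟩ <;> intro p hp <;> rw [h] at hp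
  · simp at hp
  · grind
  · grind

/-- Only three shapes of gates occur in a chain: the final CNOT, the Toffoli gates into auxiliary
qubits, and the NOT gates on controls. Any property of the gates has to be checked on these alone.
-/
lemma forall_mem_chain {p : MCX α → Prop} {t : α} (cs : List (α × Bool)) (i : ℕ)
    (h : ∀ j ≤ i + cs.length, p ([(scr j, true)], t))
    (hT : ∀ c ∈ cs, ∀ j < i + cs.length, p ([(scr j, true), (c.1, true)], scr (j + 1)))
    (hX : ∀ c ∈ cs, p ([], c.1)) : ∀ g ∈ chain scr (scr i) (i + 1) cs t, p g := by
  induction cs generalizing i with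
  | nil => simpa [chain] using h i
  | cons c cs ih =>
    have := ih (i + 1) (fun j hj => h j (by grind))
      (fun c hc j hj => hT c (by simp [hc]) j (by grind)) fun c hc => hX c (by simp [hc])
    have h1 := hT c (by simp) i (by simp)
    have h2 := hX c (by simp)
    intro g hg
    simp only [chain, mem_append, mem_singleton] at hg
    have hf : g ∈ (bif c.2 then [] else [(([] : List (α × Bool)), c.1)]) → p g := by grind
    rcases hg with (((((hg | rfl) | hg) | hg) | hg) | rfl) | hg
    exacts [hf hg, h1, hf hg, this g hg, hf hg, h1, hf hg]

lemma elementary_of_mem_expand (hscr : Injective scr)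
    (ht : ∀ i, g.2 ≠ scr i) (hcs : ∀ p ∈ g.1, ∀ i, p.1 ≠ scr i) : ∀ g' ∈ expand scr g,
      g'.Elementary := by
  intro g' hg'
  simp only [expand, mem_append, mem_singleton] at hg'
  rcases hg' with (rfl | hg') | rfl
  · exact .inl rfl
  · exact forall_mem_chain _ 0 (fun j _ => .inr (.inl ⟨_, rfl, (ht j).symm⟩)) (fun c hc j _ =>
      .inr (.inr ⟨_, _, rfl, (hcs c hc j).symm, hscr.ne (by omega), hcs c hc _⟩))
      (fun _ _ => .inl rfl) _ hg'
  · exact .inl rfl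

lemma on_of_mem_expand (hg : g.On U)
    (hscr : ∀ j, j ≤ g.1.length → scr j ∈ U) : ∀ g' ∈ expand scr g, g'.On U := by
  intro g' hg'
  simp only [expand, mem_append, mem_singleton] at hg'
  rcases hg' with (rfl | hg') | rfl
  · exact ⟨hscr 0 (by omega), by simp⟩
  · refine forall_mem_chain _ 0 (fun j hj => ⟨hg.1, ?_⟩) (fun c hc j hj => ⟨hscr _ (by omega), ?_⟩)
      (fun c hc => ⟨hg.2 c hc, by simp⟩) _ hg'
    · simpa using hscr j (by omega)
    · simpa using ⟨hscr j (by omega), hg.2 c hc⟩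
  · exact ⟨hscr 0 (by omega), by simp⟩

/-! ### Gates on the device -/

/-- An elementary gate as a gate of the device, for a numbering of the qubits. -/
def MCX.toGate (f : α → ℕ) (g : MCX α) : Gate :=
  match g.1 with
  | [] => (0, f g.2, f g.2, f g.2)
  | [a] => (2, f a.1, f g.2, f g.2)
  | a :: b :: _ => (3, f a.1, f b.1, f g.2)

variable {M : ℕ}

/-- The value of each qubit in a basis state of the device. -/
def pull (f : α → ℕ) (b : Fin M → Bool) : α → Bool := fun u => if h : f u < M then b ⟨f u, h⟩ else false

/-- The effect of a gate on a basis state of the device. -/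
def MCX.phys (f : α → ℕ) (g : MCX α) (b : Fin M → Bool) : Fin M → Bool := fun i =>
  if (i : ℕ) = f g.2 then xor (b i) (holds (pull f b) g.1) else b i

/-- The effect of a list of gates on a basis state of the device. -/
def physRun (f : α → ℕ) (L : List (MCX α)) (b : Fin M → Bool) : Fin M → Bool :=
  L.foldl (fun b g => g.phys f b) b

variable {f : α → ℕ} {U : Set α} {g : MCX α} {L : List (MCX α)}

lemma pull_phys (hf : Set.InjOn f U) (hM : ∀ u ∈ U, f u < M)
    (hg : g.On U) (b : Fin M → Bool) : ∀ u ∈ U, pull f (g.phys f b) u = g.act (pull f b) u := by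
  intro u hu
  simp only [pull, hM u hu, dif_pos, MCX.phys, MCX.act]
  by_cases hug : u = g.2
  · grind
  · rw [if_neg fun h => hug (hf hu hg.1 h), update_of_ne hug, pull, dif_pos (hM _ hu)]

lemma pull_physRun (hf : Set.InjOn f U) (hM : ∀ u ∈ U, f u < M) (hL : ∀ g ∈ L, g.On U) (b : Fin M → Bool) :
    ∀ u ∈ U, pull f (physRun f L b) u = run L (pull f b) u := by
  induction L generalizing b with
  | nil => exact fun u _ => rfl
  | cons g L ih =>
    intro u hu
    have hL' : ∀ g ∈ L, g.On U := fun g hg => hL g (by simp [hg])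
    exact (ih hL' (g.phys f b) u hu).trans
      (run_congr hL' (pull_phys hf hM (hL g (by simp)) b) u hu)

lemma physRun_of_notMem (hL : ∀ g ∈ L, g.On U)
    (b : Fin M → Bool) {i : Fin M} (hi : ∀ u ∈ U, f u ≠ i) : physRun f L b i = b i := by
  induction L generalizing b with
  | nil => rfl
  | cons g L ih =>
    refine (ih (fun g hg => hL g (by simp [hg])) (g.phys f b)).trans ?_
    exact if_neg fun h => hi _ (hL g (by simp)).1 h.symm

lemma holds_pull_phys (hf : Set.InjOn f U) (hM : ∀ u ∈ U, f u < M) (hg : g.On U) (hp : g.Proper) (b : Fin M → Bool) :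
    holds (pull f (g.phys f b)) g.1 = holds (pull f b) g.1 :=
  holds_congr fun p hpm => by
    rw [pull_phys hf hM hg b _ (hg.2 p hpm), MCX.act, update_of_ne (hp p hpm)]

lemma phys_involutive (hf : Set.InjOn f U) (hM : ∀ u ∈ U, f u < M) (hg : g.On U) (hp : g.Proper) :
    Involutive (g.phys f : (Fin M → Bool) → Fin M → Bool) := by
  intro b
  funext i
  have := holds_pull_phys hf hM hg hp b
  unfold MCX.phys at *
  rw [this]
  by_cases hi : (i : ℕ) = f g.2 <;> simp [hi]

lemma physRun_bijective (hf : Set.InjOn f U) (hM : ∀ u ∈ U, f u < M) (hL : ∀ g ∈ L, g.On U ∧ g.Proper) :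
    Bijective (physRun f L : (Fin M → Bool) → Fin M → Bool) := by
  induction L with
  | nil => exact Function.bijective_id
  | cons g L ih =>
    exact (ih fun g hg => hL g (by simp [hg])).comp
      (phys_involutive hf hM (hL g (by simp)).1 (hL g (by simp)).2).bijective

lemma app_toGate (hf : Set.InjOn f U) (hM : ∀ u ∈ U, f u < M) (hg : g.On U) (he : g.Elementary) (ψ : QState M) :
    (g.toGate f).app ψ = fun b => ψ (g.phys f b) := by
  obtain ⟨c, t⟩ := g
  have ht := hM _ hg.1
  have key : ∀ (b : Fin M → Bool) (v : Bool), holds (pull f b) c = v →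
      MCX.phys f (c, t) b = update b ⟨f t, ht⟩ (xor (b ⟨f t, ht⟩) v) := by
    intro b v hv
    funext i
    simp only [MCX.phys, hv]
    by_cases hi : i = ⟨f t, ht⟩
    · subst hi; simp
    · grind
  rcases he with h | ⟨a, h, h1⟩ | ⟨a, d, h, h1, h2, h3⟩
  all_goals
    simp only at h
    subst h
    funext b
  · rw [key b true rfl]
    have ht' : f t < M := ht
    simp [MCX.toGate, Gate.app, onIndex, applyX, ht']
  · have ha := hM a (hg.2 (a, true) (by simp))
    have hne : f a ≠ f t := fun h => h1 (hf (hg.2 (a, true) (by simp)) hg.1 h)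
    rw [key b (b ⟨f a, ha⟩) (by simp [holds_cons, holds_nil, pull, ha])]
    simp [MCX.toGate, Gate.app, onIndex, applyCNOT, ha, ht, hne]
  · have ha := hM a (hg.2 (a, true) (by simp))
    have hd := hM d (hg.2 (d, true) (by simp))
    have hne1 : f a ≠ f d := fun h => h1 (hf (hg.2 (a, true) (by simp)) (hg.2 (d, true) (by simp)) h)
    have hne2 : f a ≠ f t := fun h => h2 (hf (hg.2 (a, true) (by simp)) hg.1 h)
    have hne3 : f d ≠ f t := fun h => h3 (hf (hg.2 (d, true) (by simp)) hg.1 h)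
    rw [key b (b ⟨f a, ha⟩ && b ⟨f d, hd⟩) (by simp [holds_cons, holds_nil, pull, ha, hd])]
    simp [MCX.toGate, Gate.app, onIndex, applyToffoli, ha, hd, ht, hne1, hne2, hne3]

lemma below_toGate {Q : ℕ} (hQ : ∀ u ∈ U, f u < Q) (hg : g.On U) : (g.toGate f).Below Q := by
  obtain ⟨c, t⟩ := g
  have ht := hQ _ hg.1
  match c, hg with
  | [], _ => exact ⟨ht, ht, ht⟩
  | [a], hg => exact ⟨hQ _ (hg.2 a (by simp)), ht, ht⟩
  | a :: d :: _, hg => exact ⟨hQ _ (hg.2 a (by simp)), hQ _ (hg.2 d (by simp)), ht⟩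

/-- The gates act on amplitudes by substitution while `physRun` moves basis states forward; the two
agree because each single gate is an involution of the basis. -/
lemma appGates_map_toGate (hf : Set.InjOn f U) (hM : ∀ u ∈ U, f u < M) (hL : ∀ g ∈ L, g.On U ∧ g.Elementary) (ψ : QState M) (b : Fin M → Bool) :
    appGates (L.map (MCX.toGate f)) ψ (physRun f L b) = ψ b := by
  induction L generalizing ψ b with
  | nil => rfl
  | cons g L ih =>
    obtain ⟨h1, h2⟩ := hL g (by simp)
    refine (ih (fun g hg => hL g (by simp [hg])) _ (g.phys f b)).trans ?_
    simp only [app_toGate hf hM h1 h2]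
    rw [phys_involutive hf hM h1 h2.proper]

/-- A list of multiply controlled gates as a list of gates of the device. -/
def compile (scr : ℕ → α) (f : α → ℕ) (L : List (MCX α)) : List Gate :=
  (L.flatMap (expand scr)).map (MCX.toGate f)

/-- The gates in `L` are proper and on the qubits in `U`, which are correctly numbered and contain
sufficiently many auxiliary qubits, which are not used in `L`. -/
structure Compilable (scr : ℕ → α) (f : α → ℕ) (U : Set α) (M : ℕ) (L : List (MCX α)) : Prop where
  inj : Set.InjOn f U
  lt : ∀ u ∈ U, f u < M
  scr_inj : Injective scr
  on : ∀ g ∈ L, g.On U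
  proper : ∀ g ∈ L, g.Proper
  scr_mem : ∀ g ∈ L, ∀ j ≤ g.1.length, scr j ∈ U
  target : ∀ g ∈ L, ∀ i, g.2 ≠ scr i
  control : ∀ g ∈ L, ∀ p ∈ g.1, ∀ i, p.1 ≠ scr i

variable {scr : ℕ → α} {f : α → ℕ} {U : Set α} {L : List (MCX α)}

lemma Compilable.expand_on (h : Compilable scr f U M L) :
    ∀ g ∈ L.flatMap (expand scr), g.On U ∧ g.Elementary := by
  intro g hg
  obtain ⟨g', hg', hg⟩ := mem_flatMap.1 hg
  exact ⟨on_of_mem_expand (h.on g' hg') (h.scr_mem g' hg') g hg,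
    elementary_of_mem_expand h.scr_inj (h.target g' hg') (h.control g' hg') g hg⟩

lemma Compilable.below (h : Compilable scr f U M L) : ∀ g ∈ compile scr f L, g.Below M := by
  intro g hg
  obtain ⟨g', hg', rfl⟩ := mem_map.1 hg
  exact below_toGate h.lt (h.expand_on g' hg').1

/-- The gates of the device permute the basis states as the multiply controlled gates say. -/
lemma Compilable.exists_perm {M' : ℕ} (h : Compilable scr f U M' L) (hM : M' ≤ M) :
    ∃ π : (Fin M → Bool) → Fin M → Bool, Bijective π ∧
      (∀ (ψ : QState M) b, appGates (compile scr f L) ψ (π b) = ψ b) ∧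
      (∀ b (i : Fin M), (∀ u ∈ U, f u ≠ i) → π b i = b i) ∧
      ∀ b : Fin M → Bool, (∀ j, scr j ∈ U → pull f b (scr j) = false) →
        ∀ u ∈ U, pull f (π b) u = run L (pull f b) u := by
  have hlt : ∀ u ∈ U, f u < M := fun u hu => (h.lt u hu).trans_le hM
  refine ⟨physRun f (L.flatMap (expand scr)),
    physRun_bijective h.inj hlt fun g hg => ⟨(h.expand_on g hg).1, (h.expand_on g hg).2.proper⟩,
    fun ψ b => appGates_map_toGate h.inj hlt h.expand_on ψ b,
    fun b i hi => physRun_of_notMem (fun g hg => (h.expand_on g hg).1) b hi, fun b hb u hu => ?_⟩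
  classical
  -- The numbering is controlled only on `U`. Values at other names are replaced by `false`, so that
  -- auxiliary names outside `U` count as clean as well; by `run_congr` this does not affect the
  -- values on `U`.
  let w : α → Bool := fun u => if u ∈ U then pull f b u else false
  have hw : ∀ u ∈ U, pull f b u = w u := fun u hu => (if_pos hu).symm
  have hws : ∀ j, w (scr j) = false := by grind
  rw [pull_physRun h.inj hlt (fun g hg => (h.expand_on g hg).1) b u hu,
    run_congr (fun g hg => (h.expand_on g hg).1) hw u hu,
    run_flatMap_expand h.scr_inj (fun g hg => ⟨h.proper g hg, h.target g hg, h.control g hg⟩) _ hws,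
    run_congr h.on hw u hu]

end mcx

end

/-! ### Hadamard gates on all qubits -/

section hadamard

variable {k : ℕ}

lemma applyH_applyH {M : ℕ} (i : Fin M) (ψ : QState M) : applyH i (applyH i ψ) = ψ := by
  have hs : (sqrt 2 : ℂ) * (sqrt 2 : ℂ) = 2 := by
    rw [← Complex.ofReal_mul, mul_self_sqrt (by norm_num)]; norm_num
  have hs0 : (sqrt 2 : ℂ) ≠ 0 := by grind
  funext b
  simp only [applyH, update_idem, update_self]
  have hb : b = update b i (b i) := (update_eq_self i b).symm
  rcases h : b i with _ | _
  · grind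
  · grind

/-- Hadamard gates on the qubits in a list. -/
def had (l : List (Fin k)) (a : QState k) : QState k := l.foldl (fun a i => applyH i a) a

lemma had_cons (i : Fin k) (l : List (Fin k)) (a : QState k) :
    had (i :: l) a = had l (applyH i a) := rfl
lemma had_append (l l' : List (Fin k)) (a : QState k) :
    had (l ++ l') a = had l' (had l a) := foldl_append ..

lemma applyH_linear {M : ℕ} (i : Fin M) (z : ℂ) (ψ φ : QState M) :
    applyH i (ψ + z • φ) = applyH i ψ + z • applyH i φ := by
  funext b
  simp only [applyH, Pi.add_apply, Pi.smul_apply, smul_eq_mul]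
  ring

lemma had_linear (l : List (Fin k)) (z : ℂ) (a c : QState k) :
    had l (a + z • c) = had l a + z • had l c := by
  induction l generalizing a c with
  | nil => rfl
  | cons i l ih => rw [had_cons, applyH_linear, ih]; rfl

lemma had_reverse_had (l : List (Fin k)) (a : QState k) : had l.reverse (had l a) = a := by
  induction l generalizing a with
  | nil => rfl
  | cons i l ih =>
    rw [reverse_cons, had_append, had_cons i l, ih]
    exact applyH_applyH i a

lemma had_zero (l : List (Fin k)) (hl : l.Nodup) (b : Fin k → Bool) : had l (QState.zero k) b =
      if ∀ i ∉ l, b i = false then (((1 / sqrt 2) ^ l.length : ℝ) : ℂ) else 0 := by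
  classical
  induction l using List.reverseRecOn generalizing b with
  | nil =>
    simp only [had, foldl_nil, QState.zero, funext_iff]
    simp
  | append_singleton l i ih =>
    have hi : i ∉ l := by grind
    have hl' : l.Nodup := (nodup_append.1 hl).1
    have h1 : ¬ ∀ j ∉ l, update b i true j = false := by grind
    have h2 : (∀ j ∉ l, update b i false j = false) ↔ ∀ j ∉ l ++ [i], b j = false := by grind
    rw [had_append]
    simp only [had, foldl_cons, foldl_nil, applyH]
    change (had l (QState.zero k) _ + _ * had l (QState.zero k) _) / _ = _
    rw [ih hl', ih hl', if_neg h1, mul_zero, add_zero]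
    simp only [h2]
    split_ifs
    · rw [length_append, List.length_singleton, pow_succ]
      push_cast
      ring
    · simp

lemma had_finRange_zero : had (List.finRange k) (QState.zero k) =
    fun _ => (((1 / sqrt 2) ^ k : ℝ) : ℂ) := by
  funext b
  rw [had_zero _ (List.nodup_finRange k), if_pos (by simp), List.length_finRange]

lemma had_reverse_finRange_zero : had (List.finRange k).reverse (QState.zero k) =
    fun _ => (((1 / sqrt 2) ^ k : ℝ) : ℂ) := by
  funext b
  rw [had_zero _ (List.nodup_reverse.2 (List.nodup_finRange k)), if_pos (by simp),
    List.length_reverse, List.length_finRange]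

lemma sum_applyH_mul (i : Fin k) (a c : QState k) :
    ∑ b, applyH i a b * c b = ∑ b, a b * applyH i c b := by
  classical
  have hsum : ∀ g : (Fin k → Bool) → ℂ, 2 * ∑ b, g b =
      ∑ b, (g b + g (update b i (!b i))) := by
    intro g
    rw [sum_add_distrib]
    have := Equiv.sum_comp (flip_involutive i).toPerm g
    simp only [Involutive.coe_toPerm] at this
    rw [this]; ring
  have h2 : (2 : ℂ) ≠ 0 := by norm_num
  apply mul_left_cancel₀ h2
  rw [hsum, hsum]
  refine sum_congr rfl fun b _ => ?_
  have hb : b = update b i (b i) := (update_eq_self i b).symm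
  simp only [applyH, update_idem, update_self]
  rcases h : b i with _ | _
  · grind
  · grind

lemma sum_had_mul (l : List (Fin k)) (a c : QState k) :
    ∑ b, had l a b * c b = ∑ b, a b * had l.reverse c b := by
  induction l generalizing a c with
  | nil => rfl
  | cons i l ih =>
    rw [had_cons, ih, sum_applyH_mul, reverse_cons, had_append]
    rfl

/-- The amplitude at zero is a bilinear pairing with the zero state. By the symmetry of the Hadamard
gates it equals the pairing of `a` with the uniform state. -/
lemma had_finRange_apply_zero (a : QState k) : had (List.finRange k) a (fun _ => false) =
    (((1 / sqrt 2) ^ k : ℝ) : ℂ) * ∑ b, a b := by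
  have := sum_had_mul (List.finRange k) a (QState.zero k)
  rw [had_reverse_finRange_zero, ← Finset.sum_mul, mul_comm] at this
  rw [← this, sum_eq_single (fun _ => false)]
  · simp [QState.zero]
  · intro b _ hb
    simp [QState.zero, hb]
  · simp

/-- Change the sign where `flag` holds. -/
def signFlip (flag : (Fin k → Bool) → Bool) (a : QState k) : QState k :=
  fun b => (if flag b then -1 else 1) * a b

/-- All bits are `0`. -/
def allZero (b : Fin k → Bool) : Bool := decide (∀ i, b i = false)

/-- The sign change at the all-zero string is `1 - 2|0⟩⟨0|`, and conjugation by the Hadamard gates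
replaces `|0⟩` by the uniform vector. The result is the negative of the usual inversion about the
mean, which accounts for the signs `(-1)^j` in `groverState`. -/
lemma diffusion (a : QState k) :
    had (List.finRange k).reverse (signFlip allZero (had (List.finRange k) a)) =
      fun b => a b - 2 * ((∑ b, a b) / 2 ^ k) := by
  have h1 : signFlip allZero (had (List.finRange k) a) = had (List.finRange k) a +
      (-2 * had (List.finRange k) a (fun _ => false)) • QState.zero k := by
    funext b
    simp only [signFlip, allZero, Pi.add_apply, Pi.smul_apply, smul_eq_mul, QState.zero,
      decide_eq_true_eq, funext_iff]
    by_cases h : ∀ i, b i = false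
    · have hb : b = fun _ => false := funext h
      rw [if_pos h, if_pos h, hb]; ring
    · grind
  rw [h1, had_linear, had_reverse_had, had_reverse_finRange_zero, had_finRange_apply_zero]
  funext b
  have hs : (((1 / sqrt 2) ^ k : ℝ) : ℂ) * (((1 / sqrt 2) ^ k : ℝ) : ℂ) = 1 / 2 ^ k := by
    rw [← Complex.ofReal_mul, ← mul_pow, div_mul_div_comm, mul_self_sqrt (by norm_num)]
    push_cast
    rw [div_pow]; simp
  simp only [Pi.add_apply, Pi.smul_apply, smul_eq_mul]
  linear_combination (-2 * ∑ b, a b) * hs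

end hadamard

/-! ### The iteration of Grover's algorithm -/

section amplitudes

variable {k : ℕ} (flag : (Fin k → Bool) → Bool)

/-- The angle of Grover's algorithm. -/
def groverAngle : ℝ :=
  Real.arcsin (sqrt ((Finset.univ.filter fun b => flag b = true).card / 2 ^ k))

/-- A state with one amplitude where `flag` holds, and another elsewhere. -/
def twoVal (x y : ℝ) : QState k := fun b => if flag b then (x : ℂ) else (y : ℂ)

lemma sum_twoVal (x y : ℝ) : ∑ b, twoVal flag x y b =
    (((Finset.univ.filter fun b => flag b = true).card * x +
      (2 ^ k - (Finset.univ.filter fun b => flag b = true).card) * y : ℝ) : ℂ) := by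
  have h : ∀ b, twoVal flag x y b = (y : ℂ) + if flag b = true then (x : ℂ) - y else 0 := by
    intro b
    unfold twoVal
    split_ifs <;> ring
  simp only [h]
  rw [sum_add_distrib, ← sum_filter]
  simp only [sum_const, card_univ, Fintype.card_pi, Fintype.card_bool,
    prod_const, Fintype.card_fin, nsmul_eq_mul]
  push_cast
  ring

lemma card_flag_le : ((Finset.univ.filter fun b => flag b = true).card : ℝ) ≤ 2 ^ k := by
  have := Finset.card_filter_le (Finset.univ : Finset (Fin k → Bool)) fun b => flag b = true
  simp only [card_univ, Fintype.card_pi, Fintype.card_bool, prod_const, Fintype.card_fin] at this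
  exact_mod_cast this

lemma card_flag_lt {b : Fin k → Bool} (h : ¬ flag b = true) :
    ((Finset.univ.filter fun b => flag b = true).card : ℝ) < 2 ^ k := by
  have := card_lt_card (Finset.filter_ssubset (p := fun b => flag b = true).2 ⟨b, mem_univ b, h⟩)
  simp only [card_univ, Fintype.card_pi, Fintype.card_bool, prod_const, Fintype.card_fin] at this
  exact_mod_cast this

/-- The state of the qubits with the coins after `j` iterations. -/
def groverState (j : ℕ) : QState k :=
  twoVal flag ((-1) ^ j * sin ((2 * j + 1) * groverAngle flag) /
      sqrt (Finset.univ.filter fun b => flag b = true).card)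
    ((-1) ^ j * cos ((2 * j + 1) * groverAngle flag) /
      sqrt (2 ^ k - (Finset.univ.filter fun b => flag b = true).card))

lemma sin_groverAngle : sin (groverAngle flag) =
    sqrt (Finset.univ.filter fun b => flag b = true).card / sqrt (2 ^ k) := by
  rw [groverAngle, Real.sin_arcsin ((by norm_num : (-1 : ℝ) ≤ 0).trans (Real.sqrt_nonneg _)),
    Real.sqrt_div' _ (by positivity)]
  rw [Real.sqrt_le_iff, one_pow, div_le_one (by positivity)]
  exact ⟨zero_le_one, card_flag_le flag⟩

lemma cos_groverAngle : cos (groverAngle flag) =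
    sqrt (2 ^ k - (Finset.univ.filter fun b => flag b = true).card) / sqrt (2 ^ k) := by
  rw [groverAngle, Real.cos_arcsin, sq_sqrt (by positivity), ← Real.sqrt_div' _ (by positivity)]
  congr 1
  field_simp

lemma groverState_zero (ht : 0 < (Finset.univ.filter fun b => flag b = true).card) :
    groverState flag 0 = fun _ => (((1 / sqrt 2) ^ k : ℝ) : ℂ) := by
  have hN : sqrt (2 ^ k) = sqrt 2 ^ k := by
    rw [Real.sqrt_eq_iff_mul_self_eq (by positivity) (by positivity), ← mul_pow,
      mul_self_sqrt (by norm_num)]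
  funext b
  simp only [groverState, twoVal, pow_zero, one_mul, Nat.cast_zero, mul_zero, zero_add]
  rw [sin_groverAngle, cos_groverAngle, hN, one_div, inv_pow]
  have h1 : sqrt (Finset.univ.filter fun b => flag b = true).card ≠ 0 := by positivity
  split_ifs with h
  · grind
  · have h2 : sqrt (2 ^ k - (Finset.univ.filter fun b => flag b = true).card) ≠ 0 := by
      rw [Real.sqrt_ne_zero', sub_pos]
      exact card_flag_lt flag h
    congr 1; field_simp

/-- In the plane spanned by the marked and the unmarked uniform vectors, one iteration is, up to
sign, the rotation by twice the angle; the proof is the addition theorem, with `sin` and `cos` of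
the angle read off from the number `t` of marked strings. -/
lemma groverState_succ (ht : 0 < (Finset.univ.filter fun b => flag b = true).card) (j : ℕ) :
    had (List.finRange k).reverse (signFlip allZero (had (List.finRange k)
      (signFlip flag (groverState flag j)))) = groverState flag (j + 1) := by
  rw [diffusion]
  set t : ℝ := ((Finset.univ.filter fun b => flag b = true).card : ℝ) with htdef
  have htpos : 0 < t := by rw [htdef]; exact_mod_cast ht
  set N : ℝ := 2 ^ k with hN
  have hNpos : 0 < N := by positivity
  have hle : t ≤ N := card_flag_le flag
  set θ := groverAngle flag with hθ
  have hs : sin θ = sqrt t / sqrt N := sin_groverAngle flag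
  have hc : cos θ = sqrt (N - t) / sqrt N := cos_groverAngle flag
  have hflip : ∀ x y : ℝ, signFlip flag (twoVal flag x y) = twoVal flag (-x) y := by
    intro x y
    funext b
    simp only [signFlip, twoVal]
    split_ifs <;> push_cast <;> ring
  unfold groverState
  rw [hflip, sum_twoVal, ← htdef, ← hN, ← hθ]
  have hNC : ((2 : ℂ) ^ k) = (N : ℂ) := by rw [hN]; push_cast; rfl
  rw [hNC]
  set u := sqrt t with hu
  set v := sqrt (N - t) with hv
  have hu2 : u * u = t := mul_self_sqrt htpos.le
  have hv2 : v * v = N - t := mul_self_sqrt (by linarith)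
  have hu0 : u ≠ 0 := (sqrt_pos.2 htpos).ne'
  have hNs : sqrt N * sqrt N = N := mul_self_sqrt hNpos.le
  have hN0 : sqrt N ≠ 0 := (sqrt_pos.2 hNpos).ne'
  set A := (-1) ^ j * sin ((2 * j + 1) * θ) with hA
  set B := (-1) ^ j * cos ((2 * j + 1) * θ) with hB
  have e : (2 * ((j + 1 : ℕ) : ℝ) + 1) * θ = (2 * j + 1) * θ + 2 * θ := by grind
  have e1 : u * u / N = sin θ * sin θ := by rw [hs, div_mul_div_comm, hNs]
  have e2 : u * v / N = sin θ * cos θ := by rw [hs, hc, div_mul_div_comm, hNs]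
  have := Real.sin_sq_add_cos_sq θ
  have hA' : (-1) ^ (j + 1) * sin ((2 * (j + 1 : ℕ) + 1) * θ) =
      -(A * (1 - 2 * (u * u / N))) - B * (2 * (u * v / N)) := by
    rw [e, Real.sin_add, Real.sin_two_mul, Real.cos_two_mul', e1, e2, hA, hB, pow_succ]
    linear_combination (-(-1) ^ j * sin ((2 * j + 1) * θ)) * this
  have hB' : (-1) ^ (j + 1) * cos ((2 * (j + 1 : ℕ) + 1) * θ) =
      A * (2 * (u * v / N)) - B * (1 - 2 * (u * u / N)) := by
    rw [e, Real.cos_add, Real.sin_two_mul, Real.cos_two_mul', e1, e2, hA, hB, pow_succ]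
    linear_combination (-(-1) ^ j * cos ((2 * j + 1) * θ)) * this
  have hmean : t * -(A / u) + (N - t) * (B / v) = -(u * A) + v * B := by
    have e1 : t * -(A / u) = -(u * A) := by grind
    have e2 : (N - t) * (B / v) = v * B := by
      rw [← hv2]
      -- If all strings are marked then `v = 0`, and with the convention for division by zero both
      -- sides vanish.
      by_cases h0 : v = 0
      · rw [h0]; ring
      · field_simp
    rw [e1, e2]
  rw [hA', hB', hmean]
  funext b
  simp only [twoVal]
  split_ifs with h
  · rw [← Complex.ofReal_ofNat, ← Complex.ofReal_div, ← Complex.ofReal_mul, ← Complex.ofReal_sub]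
    congr 1
    field_simp
    ring
  · have h2 : v ≠ 0 := by
      rw [hv, Real.sqrt_ne_zero', sub_pos]
      exact card_flag_lt flag h
    rw [← Complex.ofReal_ofNat, ← Complex.ofReal_div, ← Complex.ofReal_mul, ← Complex.ofReal_sub]
    congr 1
    have : u * u = N - v * v := by grind
    rw [this]
    field_simp
    ring

lemma weight_groverState (ht : 0 < (Finset.univ.filter fun b => flag b = true).card) (j : ℕ) :
    ∑ b, (if flag b then ‖groverState flag j b‖ ^ 2 else 0) =
      sin ((2 * j + 1) * groverAngle flag) ^ 2 := by
  have h1 : ∀ b, (if flag b then ‖groverState flag j b‖ ^ 2 else 0) = if flag b = true then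
      sin ((2 * j + 1) * groverAngle flag) ^ 2 /
        (Finset.univ.filter fun b => flag b = true).card else 0 := by
    intro b
    split_ifs with h
    · simp only [groverState, twoVal, h, if_true, Complex.norm_real, norm_eq_abs, sq_abs]
      rw [div_pow, sq_sqrt (by positivity), mul_pow, ← pow_mul, mul_comm j 2, pow_mul]
      norm_num
    · rfl
  simp only [h1]
  rw [← sum_filter, sum_const, nsmul_eq_mul]
  field_simp

end amplitudes

/-! ### Grover's algorithm on the device -/

/-- The places of the coins and of the qubit for the phases among the qubits of a device, for a
numbering `f` of the qubits in `U` and auxiliary qubits `scr`. -/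
structure GroverLayout {α : Type} (scr : ℕ → α) (f : α → ℕ) (U : Set α) (Q k : ℕ) (wn : ℕ → α)
    (mn : α) : Prop where
  inj : Set.InjOn f U
  lt : ∀ u ∈ U, f u < Q
  coin_mem : ∀ j < k, wn j ∈ U
  coin_inj : Injective wn
  minus_mem : mn ∈ U
  minus_ne : ∀ j, mn ≠ wn j
  scr_ne : ∀ i, scr i ≠ mn ∧ ∀ j, scr i ≠ wn j

namespace GroverLayout

variable {α : Type} [DecidableEq α] {scr : ℕ → α} {f : α → ℕ} {U : Set α} {Q k : ℕ} {wn : ℕ → α}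
  {mn : α} (G : GroverLayout scr f U Q k wn mn) {M : ℕ} (hM : Q ≤ M)

include G hM

/-- The qubit with a coin. -/
def coinAt (j : Fin k) : Fin M := ⟨f (wn j), (G.lt _ (G.coin_mem j j.2)).trans_le hM⟩

/-- The qubit for the phases. -/
def minusAt : Fin M := ⟨f mn, (G.lt _ G.minus_mem).trans_le hM⟩

lemma coinAt_injective : Injective (G.coinAt hM) := by
  intro i j h
  have := G.inj (G.coin_mem i i.2) (G.coin_mem j j.2) (Fin.ext_iff.1 h)
  exact Fin.ext (G.coin_inj this)

lemma minusAt_ne (j : Fin k) : G.minusAt hM ≠ G.coinAt hM j := fun h =>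
  G.minus_ne j (G.inj G.minus_mem (G.coin_mem j j.2) (Fin.ext_iff.1 h))

/-- All qubits except for the coins and the qubit for the phases are `0`. -/
def Clean (b : Fin M → Bool) : Prop :=
  ∀ i, b i = true → i = G.minusAt hM ∨ ∃ j, i = G.coinAt hM j

/-- The values of the coins. -/
def coins (b : Fin M → Bool) : Fin k → Bool := fun j => b (G.coinAt hM j)

open Classical in
/-- The state of the coins as a state of the device. -/
def lift (a : QState k) : QState M := fun b =>
  if G.Clean hM b then (if b (G.minusAt hM) then -1 else 1) * a (G.coins hM b) else 0

lemma clean_update_coin (b : Fin M → Bool) (j : Fin k) (v : Bool) :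
    G.Clean hM (update b (G.coinAt hM j) v) ↔ G.Clean hM b := by
  constructor
  · intro h i hi
    by_cases hij : i = G.coinAt hM j
    · grind
    · exact h i (by grind)
  · intro h i hi
    by_cases hij : i = G.coinAt hM j
    · grind
    · exact h i (by grind)

lemma clean_update_minus (b : Fin M → Bool) (v : Bool) :
    G.Clean hM (update b (G.minusAt hM) v) ↔ G.Clean hM b := by
  constructor
  · intro h i hi
    by_cases hij : i = G.minusAt hM
    · exact .inl hij
    · exact h i (by grind)
  · intro h i hi
    by_cases hij : i = G.minusAt hM
    · exact .inl hij
    · exact h i (by grind)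

lemma coins_update_coin (b : Fin M → Bool) (j : Fin k) (v : Bool) :
    G.coins hM (update b (G.coinAt hM j) v) = update (G.coins hM b) j v := by
  funext i
  by_cases hij : i = j
  · subst hij; simp [coins]
  · rw [update_of_ne hij]
    exact update_of_ne (fun h => hij (G.coinAt_injective hM h)) _ _

lemma coins_update_minus (b : Fin M → Bool) (v : Bool) :
    G.coins hM (update b (G.minusAt hM) v) = G.coins hM b := by
  funext i
  exact update_of_ne (G.minusAt_ne hM i).symm _ _

lemma applyH_lift (j : Fin k) (a : QState k) :
    applyH (G.coinAt hM j) (G.lift hM a) = G.lift hM (applyH j a) := by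
  funext b
  simp only [applyH, lift, coins_update_coin, update_of_ne (G.minusAt_ne hM j)]
  by_cases h : G.Clean hM b
  · have h' := fun v => (G.clean_update_coin hM b j v).2 h
    have e : G.coins hM b j = b (G.coinAt hM j) := rfl
    simp only [if_pos h, if_pos (h' _), e]
    ring_nf
  · have h' := fun v => mt (G.clean_update_coin hM b j v).1 h
    simp only [if_neg h, if_neg (h' _)]
    simp

/-- Hadamard gates on the coins. -/
lemma appGates_coins (l : List (Fin k)) (a : QState k) :
    appGates (l.map fun j : Fin k => ((1, f (wn j), f (wn j), f (wn j)) : Gate)) (G.lift hM a) =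
      G.lift hM (had l a) := by
  induction l generalizing a with
  | nil => rfl
  | cons j l ih =>
    rw [map_cons, appGates_cons]
    have hj : f (wn j) < M := (G.lt _ (G.coin_mem j j.2)).trans_le hM
    have : Gate.app ((1, f (wn j), f (wn j), f (wn j)) : Gate) (G.lift hM a) =
        G.lift hM (applyH j a) := by
      rw [← G.applyH_lift hM]
      simp [Gate.app, onIndex, hj, coinAt]
    rw [this, ih]
    rfl

/-- The state before the Hadamard gates on the coins. -/
lemma appGates_minus : appGates [((0, f mn, f mn, f mn) : Gate), (1, f mn, f mn, f mn)]
    (QState.zero M) = ((1 / sqrt 2 : ℝ) : ℂ) • G.lift hM (QState.zero k) := by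
  have hm : f mn < M := (G.lt _ G.minus_mem).trans_le hM
  funext b
  simp only [appGates_cons, appGates_nil, Gate.app, onIndex, dif_pos hm]
  change applyH (G.minusAt hM) (applyX (G.minusAt hM) (QState.zero M)) b = _
  simp only [applyH, applyX, update_idem, update_self, Pi.smul_apply, smul_eq_mul, lift]
  have h1 : update b (G.minusAt hM) (!true) = (fun _ => false) ↔
      G.Clean hM b ∧ G.coins hM b = fun _ => false := by
    constructor
    · intro h
      refine ⟨fun i hi => ?_, ?_⟩
      · by_cases him : i = G.minusAt hM
        · exact .inl him
        · have := congrFun h i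
          rw [update_of_ne him, hi] at this
          cases this
      · funext j
        have := congrFun h (G.coinAt hM j)
        rwa [update_of_ne (G.minusAt_ne hM j).symm] at this
    · rintro ⟨h, h'⟩
      funext i
      by_cases him : i = G.minusAt hM
      · rw [him]; simp
      · rw [update_of_ne him]
        cases hi : b i
        · rfl
        · rcases h i hi with h | ⟨j, rfl⟩
          · grind
          · exact hi.symm.trans (congrFun h' j)
  have h2 : update b (G.minusAt hM) (!false) ≠ fun _ => false := fun h => by
    have := congrFun h (G.minusAt hM)
    simp at this
  simp only [QState.zero]
  rw [if_neg h2]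
  by_cases hc : G.Clean hM b
  · rw [if_pos hc]
    by_cases h3 : G.coins hM b = fun _ => false
    · rw [if_pos h3, if_pos (h1.2 ⟨hc, h3⟩)]
      push_cast
      ring
    · grind
  · grind

/-- On the basis states with clean qubits, the gates in `L` add `flag` to the qubit for the
phases. -/
def _root_.HybridSAT.IsPhaseOracle {α : Type} [DecidableEq α] (U : Set α) (k : ℕ) (wn : ℕ → α)
    (mn : α) (flag : (Fin k → Bool) → Bool) (L : List (MCX α)) : Prop :=
  ∀ w : α → Bool, (∀ u ∈ U, w u = true → u = mn ∨ ∃ j < k, u = wn j) →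
    ∀ u ∈ U, HybridSAT.run L w u =
      update w mn (xor (w mn) (flag fun j : Fin k => w (wn j))) u

lemma pull_clean {b : Fin M → Bool} (hb : G.Clean hM b) :
    ∀ u ∈ U, pull f b u = true → u = mn ∨ ∃ j < k, u = wn j := by
  intro u hu h
  have hlt : f u < M := (G.lt _ hu).trans_le hM
  simp only [pull, dif_pos hlt] at h
  rcases hb _ h with h | ⟨j, h⟩
  · exact .inl (G.inj hu G.minus_mem (Fin.ext_iff.1 h))
  · exact .inr ⟨j, j.2, G.inj hu (G.coin_mem j j.2) (Fin.ext_iff.1 h)⟩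

lemma pull_scr {b : Fin M → Bool} (hb : G.Clean hM b) (j : ℕ) (hj : scr j ∈ U) :
    pull f b (scr j) = false := by
  by_contra h
  rw [Bool.not_eq_false] at h
  rcases G.pull_clean hM hb _ hj h with h | ⟨i, -, h⟩
  · exact (G.scr_ne j).1 h
  · exact (G.scr_ne j).2 i h

lemma pull_coin (b : Fin M → Bool) (j : Fin k) : pull f b (wn j) = G.coins hM b j := by
  have hlt : f (wn j) < M := (G.lt _ (G.coin_mem j j.2)).trans_le hM
  simp [pull, coins, coinAt, hlt]

/-- Phase kickback: the qubit for the phases carries opposite signs at `0` and `1`, so adding `flag`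
to it multiplies by the sign of `flag`. The gates permute the clean basis states among themselves by
an involution. As the permutation `π` of all basis states is injective, states that are not clean go
to states that are not clean, where the lift is zero. -/
lemma appGates_phase {flag : (Fin k → Bool) → Bool} {L : List (MCX α)}
    (hL : Compilable scr f U Q L) (hO : IsPhaseOracle U k wn mn flag L) (a : QState k) :
    appGates (compile scr f L) (G.lift hM a) = G.lift hM (signFlip flag a) := by
  obtain ⟨π, hπ, happ, hout, hpull⟩ := hL.exists_perm hM
  have hclean : ∀ b, G.Clean hM b → π b =
      update b (G.minusAt hM) (xor (b (G.minusAt hM)) (flag (G.coins hM b))) := by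
    intro b hb
    funext i
    have hm : pull f b mn = b (G.minusAt hM) := by
      have hlt : f mn < M := (G.lt _ G.minus_mem).trans_le hM
      simp [pull, minusAt, hlt]
    have hmm : pull f (π b) mn = π b (G.minusAt hM) := by
      have hlt : f mn < M := (G.lt _ G.minus_mem).trans_le hM
      simp [pull, minusAt, hlt]
    have hcoin : (fun j : Fin k => pull f b (wn j)) = G.coins hM b :=
      funext fun j => G.pull_coin hM b j
    by_cases hi : ∃ u ∈ U, f u = i
    · obtain ⟨u, hu, hui⟩ := hi
      have hlt : f u < M := (G.lt _ hu).trans_le hM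
      obtain rfl : i = ⟨f u, hlt⟩ := Fin.ext hui.symm
      have h1 := hpull b (G.pull_scr hM hb) u hu
      rw [hO _ (G.pull_clean hM hb) u hu, hm, hcoin] at h1
      by_cases hum : u = mn
      · subst hum
        rw [update_self, hmm] at h1
        change π b (G.minusAt hM) = update b (G.minusAt hM) _ (G.minusAt hM)
        rw [h1, update_self]
      · rw [update_of_ne hum] at h1
        simp only [pull, dif_pos hlt] at h1
        rw [h1, update_of_ne]
        intro h
        exact hum (G.inj hu G.minus_mem (Fin.ext_iff.1 h))
    · push Not at hi
      rw [hout b i hi, update_of_ne]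
      rintro rfl
      exact hi mn G.minus_mem rfl
  have hcc : ∀ b, G.Clean hM b → G.Clean hM (π b) := fun b hb => by
    rw [hclean b hb, clean_update_minus]; exact hb
  have hcoins : ∀ b, G.Clean hM b → G.coins hM (π b) = G.coins hM b := fun b hb => by
    rw [hclean b hb, coins_update_minus]
  have hππ : ∀ b, G.Clean hM b → π (π b) = b := fun b hb => by
    rw [hclean _ (hcc b hb), hcoins b hb, hclean b hb]
    simp
  funext b
  obtain ⟨b, rfl⟩ := hπ.2 b
  rw [happ]
  by_cases hb : G.Clean hM b
  · simp only [lift, if_pos hb, if_pos (hcc b hb), hcoins b hb, signFlip]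
    have : π b (G.minusAt hM) = xor (b (G.minusAt hM)) (flag (G.coins hM b)) := by
      rw [hclean b hb, update_self]
    rw [this]
    cases b (G.minusAt hM) <;> cases flag (G.coins hM b) <;> simp
  · have : ¬ G.Clean hM (π b) := fun h => by
      have h1 := hππ _ h
      have h2 := hπ.1 h1
      exact hb (h2 ▸ hcc _ h)
    simp [lift, hb, this]

/-- The gates before the iterations. -/
def _root_.HybridSAT.groverPrep {α : Type} (f : α → ℕ) (k : ℕ) (wn : ℕ → α) (mn : α) : List Gate :=
  [((0, f mn, f mn, f mn) : Gate), (1, f mn, f mn, f mn)] ++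
    (range k).map fun j => ((1, f (wn j), f (wn j), f (wn j)) : Gate)

/-- The gates of an iteration. -/
def _root_.HybridSAT.groverBody {α : Type} [DecidableEq α] (scr : ℕ → α) (f : α → ℕ) (k : ℕ)
    (wn : ℕ → α) (mn : α) (O : List (MCX α)) : List Gate :=
  compile scr f O ++ ((range k).map fun j => ((1, f (wn j), f (wn j), f (wn j)) : Gate)) ++
    compile scr f [((range k).map fun j => (wn j, false), mn)] ++
    ((range k).map fun j => ((1, f (wn j), f (wn j), f (wn j)) : Gate)).reverse

lemma map_range_eq (f : ℕ → Gate) :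
    (range k).map f = (List.finRange k).map fun j : Fin k => f j := by
  rw [← List.map_coe_finRange_eq_range, map_map]
  rfl

lemma iterate_body {flag : (Fin k → Bool) → Bool} {O : List (MCX α)}
    (hO : Compilable scr f U Q O) (hO' : IsPhaseOracle U k wn mn flag O)
    (hZ : Compilable scr f U Q [((range k).map fun j => (wn j, false), mn)])
    (ht : 0 < (Finset.univ.filter fun b => flag b = true).card) (j : ℕ) :
    (appGates (groverBody scr f k wn mn O))^[j] (appGates (groverPrep f k wn mn) (QState.zero M)) =
      ((1 / sqrt 2 : ℝ) : ℂ) • G.lift hM (groverState flag j) := by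
  induction j with
  | zero =>
    rw [Function.iterate_zero, id, groverPrep, appGates_append, G.appGates_minus hM, appGates_smul,
      map_range_eq G hM, G.appGates_coins hM, had_finRange_zero, groverState_zero flag ht]
  | succ j ih =>
    rw [iterate_succ_apply', ih, appGates_smul, groverBody, appGates_append,
      appGates_append, appGates_append, G.appGates_phase hM hO hO', map_range_eq G hM,
      G.appGates_coins hM, G.appGates_phase hM (flag := allZero) hZ, ← List.map_reverse,
      G.appGates_coins hM, groverState_succ flag ht]
    intro w hw u hu
    rw [run_singleton, MCX.act]
    congr 2
    rw [Bool.eq_iff_iff]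
    simp only [holds, all_map, all_eq_true, mem_range, comp_apply, beq_iff_eq,
      allZero, decide_eq_true_eq]
    exact ⟨fun h i => h i i.2, fun h i hi => h ⟨i, hi⟩⟩

/-- The basis state with given coins. -/
def place (p : (Fin k → Bool) × Bool) : Fin M → Bool := fun i =>
  open Classical in if i = G.minusAt hM then p.2 else
    if h : ∃ j, i = G.coinAt hM j then p.1 h.choose else false

lemma place_minus (p : (Fin k → Bool) × Bool) : G.place hM p (G.minusAt hM) = p.2 := by
  simp [place]

lemma coins_place (p : (Fin k → Bool) × Bool) : G.coins hM (G.place hM p) = p.1 := by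
  funext j
  have h : ∃ i, G.coinAt hM j = G.coinAt hM i := ⟨j, rfl⟩
  rw [coins, place, if_neg (G.minusAt_ne hM j).symm, dif_pos h]
  exact congrArg p.1 (G.coinAt_injective hM h.choose_spec).symm

lemma clean_place (p : (Fin k → Bool) × Bool) : G.Clean hM (G.place hM p) := by
  intro i hi
  by_contra! h
  rw [place, if_neg h.1, dif_neg (by grind)] at hi
  cases hi

/-- Each value of the coins occurs on two clean basis states, one for each value of the qubit for
the phases. The factor `2` later cancels the square of the factor `1/√2` in front of the lift. An
inequality is enough, as further good outcomes only help. -/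
lemma sum_lift_ge (flag : (Fin k → Bool) → Bool) (a : QState k) (g : (Fin M → Bool) → ℝ)
    (hg : ∀ b, 0 ≤ g b)
    (hg' : ∀ b, G.Clean hM b → flag (G.coins hM b) = true → g b = ‖a (G.coins hM b)‖ ^ 2) :
    2 * ∑ c, (if flag c then ‖a c‖ ^ 2 else 0) ≤ ∑ b, g b := by
  classical
  have hinj : Injective (G.place hM) := by
    intro p q h
    have h1 := congrArg (G.coins hM) h
    have h2 := congrFun h (G.minusAt hM)
    rw [coins_place, coins_place] at h1
    rw [place_minus, place_minus] at h2
    exact Prod.ext h1 h2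
  calc 2 * ∑ c, (if flag c then ‖a c‖ ^ 2 else 0)
      = ∑ p : (Fin k → Bool) × Bool, (if flag p.1 then ‖a p.1‖ ^ 2 else 0) := by
        rw [Fintype.sum_prod_type]
        simp only [Fintype.sum_bool, sum_add_distrib]
        ring
    _ ≤ ∑ p : (Fin k → Bool) × Bool, g (G.place hM p) := by
        refine Finset.sum_le_sum fun p _ => ?_
        split_ifs with h
        · have := hg' _ (G.clean_place hM p) (by rwa [coins_place])
          rw [coins_place] at this
          exact this.symm.le
        · exact hg _
    _ = ∑ b ∈ Finset.univ.image (G.place hM), g b :=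
        (Finset.sum_image fun p _ q _ h => hinj h).symm
    _ ≤ ∑ b, g b := Finset.sum_le_sum_of_subset_of_nonneg (Finset.subset_univ _) fun b _ _ => hg b

/-- The probability that Grover's algorithm, followed by the gates in `L`, gives an outcome with
the property `P`. -/
lemma sin_sq_le {flag : (Fin k → Bool) → Bool} {O L : List (MCX α)}
    (hO : Compilable scr f U Q O) (hO' : IsPhaseOracle U k wn mn flag O)
    (hZ : Compilable scr f U Q [((range k).map fun j => (wn j, false), mn)])
    (ht : 0 < (Finset.univ.filter fun b => flag b = true).card) (hL : Compilable scr f U Q L)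
    (P : (Fin M → Bool) → Prop) [DecidablePred P]
    (hP : ∀ w : α → Bool, (∀ u ∈ U, w u = true → u = mn ∨ ∃ j < k, u = wn j) →
      flag (fun j : Fin k => w (wn j)) = true → ∀ c : Fin M → Bool,
      (∀ u ∈ U, pull f c u = HybridSAT.run L w u) → P c) (j : ℕ) :
    sin ((2 * j + 1) * groverAngle flag) ^ 2 ≤ ∑ c, if P c then
      ‖appGates (compile scr f L) ((appGates (groverBody scr f k wn mn O))^[j]
        (appGates (groverPrep f k wn mn) (QState.zero M))) c‖ ^ 2 else 0 := by
  obtain ⟨π, hπ, happ, -, hpull⟩ := hL.exists_perm hM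
  rw [← Equiv.sum_comp (Equiv.ofBijective π hπ), G.iterate_body hM hO hO' hZ ht j]
  simp only [Equiv.ofBijective_apply, happ]
  rw [← weight_groverState flag ht j]
  have hs : ‖((1 / sqrt 2 : ℝ) : ℂ)‖ ^ 2 = 1 / 2 := by
    rw [Complex.norm_real, norm_eq_abs, sq_abs, div_pow, sq_sqrt (by norm_num), one_pow]
  have := G.sum_lift_ge hM flag (groverState flag j) (fun b => 2 * if P (π b) then
    ‖(((1 / sqrt 2 : ℝ) : ℂ) • G.lift hM (groverState flag j)) b‖ ^ 2 else 0)
    (fun b => by split_ifs <;> positivity) (fun b hb hf => by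
      have hPb : P (π b) := by
        refine hP (pull f b) (G.pull_clean hM hb) ?_ _ (hpull b (G.pull_scr hM hb))
        rw [← hf]
        exact congrArg flag (funext fun j => G.pull_coin hM b j)
      rw [if_pos hPb]
      simp only [lift, if_pos hb, Pi.smul_apply, smul_eq_mul, norm_mul, mul_pow, hs]
      split_ifs <;> simp)
  rw [← mul_sum] at this
  linarith

end GroverLayout

/-! ### The number of iterations -/

/-- The stack for the `s`-th number of iterations. -/
def groverStack (s : ℕ) : List ℕ := bif s == 0 then [] else [s - 1]

/-- The number of marked strings is unknown, so only zero and powers of two are tried as numbers of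
iterations. If the angle `θ` is already at least `π/6`, no iteration is needed. Otherwise `(2^(s+1)
+ 1) θ` at most doubles from one `s` to the next, and its first value beyond `π/6` is still at most
`π/2`. Since `θ ≥ 2^(-k/2)`, this happens for some `s ≤ (k+1)/2`. -/
lemma exists_iterations {k : ℕ} (flag : (Fin k → Bool) → Bool)
    (ht : 0 < (Finset.univ.filter fun b => flag b = true).card) :
    ∃ s, s ≤ (k + 1) / 2 + 1 ∧
      1 / 4 ≤ sin ((2 * stackReps (groverStack s) + 1) * groverAngle flag) ^ 2 := by
  set θ := groverAngle flag with hθ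
  have hpos : ∀ y : ℝ, Real.pi / 6 ≤ y → y ≤ Real.pi / 2 → 1 / 4 ≤ sin y ^ 2 := by
    intro y h1 h2
    have : 1 / 2 ≤ sin y := by
      rw [← Real.sin_pi_div_six]
      exact Real.sin_le_sin_of_le_of_le_pi_div_two (by grind) h2 h1
    nlinarith
  have hθ2 : θ ≤ Real.pi / 2 := Real.arcsin_le_pi_div_two _
  by_cases h0 : Real.pi / 6 ≤ θ
  · refine ⟨0, by omega, ?_⟩
    simp only [groverStack, stackReps]
    simpa using hpos θ h0 hθ2
  push Not at h0
  have hlow : (1 / sqrt 2) ^ k ≤ θ := by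
    have h1 : (1 / sqrt 2) ^ k ≤ sin θ := by
      rw [sin_groverAngle, div_pow, one_pow]
      have hN : sqrt (2 ^ k) = sqrt 2 ^ k := by
        rw [Real.sqrt_eq_iff_mul_self_eq (by positivity) (by positivity), ← mul_pow,
          mul_self_sqrt (by norm_num)]
      rw [hN]
      refine div_le_div_of_nonneg_right ?_ (by positivity)
      rw [Real.one_le_sqrt]
      exact_mod_cast ht
    have h2 : 0 ≤ θ := by
      rw [hθ, groverAngle, Real.arcsin_nonneg]
      positivity
    exact h1.trans (Real.sin_le h2)
  have h4 : 0 ≤ θ := le_trans (by positivity) hlow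
  have hend : Real.pi / 6 ≤ (2 ^ ((k + 1) / 2 + 1) + 1) * θ := by
    have h2 : (sqrt 2) ^ k ≤ 2 ^ ((k + 1) / 2) := by
      calc (sqrt 2) ^ k ≤ (sqrt 2) ^ (2 * ((k + 1) / 2)) :=
            pow_le_pow_right₀ (by rw [Real.one_le_sqrt]; norm_num) (by omega)
        _ = 2 ^ ((k + 1) / 2) := by rw [pow_mul, sq_sqrt (by norm_num)]
    have h3 : 1 ≤ 2 ^ ((k + 1) / 2) * θ := by
      calc (1 : ℝ) = sqrt 2 ^ k * (1 / sqrt 2) ^ k := by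
            rw [← mul_pow, mul_one_div_cancel (by positivity), one_pow]
        _ ≤ _ := mul_le_mul h2 hlow (by positivity) (by positivity)
    rw [pow_succ]
    linarith [Real.pi_lt_d2]
  classical
  obtain ⟨s, hs, hsle, hmin⟩ : ∃ s : ℕ, Real.pi / 6 ≤ (2 ^ (s + 1) + 1) * θ ∧ s ≤ (k + 1) / 2 ∧
      ∀ s' < s, (2 ^ (s' + 1) + 1) * θ < Real.pi / 6 :=
    have hex : ∃ s : ℕ, Real.pi / 6 ≤ (2 ^ (s + 1) + 1) * θ := ⟨_, hend⟩
    ⟨Nat.find hex, Nat.find_spec hex, Nat.find_min' hex hend,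
      fun s' hs' => not_le.1 (Nat.find_min hex hs')⟩
  refine ⟨s + 1, by omega, ?_⟩
  have hr : (2 * (stackReps (groverStack (s + 1)) : ℝ) + 1) = 2 ^ (s + 1) + 1 := by
    simp [groverStack, stackReps, pow_succ]
    ring
  rw [hr]
  refine hpos _ hs ?_
  rcases s with _ | s
  · grind
  · have h1 := hmin s (by omega)
    have h2 : (2 ^ (s + 1 + 1) + 1) * θ ≤ 2 * ((2 ^ (s + 1) + 1) * θ) := by
      rw [pow_succ]
      linarith
    linarith [pi_pos]

section

/-! ### Parities -/

/-- The parity of a list of truth values. -/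
def xorAll (l : List Bool) : Bool := l.foldr xor false

lemma xorAll_nil : xorAll [] = false := rfl
lemma xorAll_cons (b : Bool) (l : List Bool) : xorAll (b :: l) = xor b (xorAll l) := rfl
lemma xorAll_append (l l' : List Bool) : xorAll (l ++ l') = xor (xorAll l) (xorAll l') := by
  induction l with
  | nil => simp [xorAll_nil]
  | cons b l ih => simp [xorAll_cons, ih]
variable {α : Type*}

lemma xorAll_flatMap {β : Type*} (l : List α) (f : α → List β) (g : β → Bool) :
    xorAll ((l.flatMap f).map g) = xorAll (l.map fun a => xorAll ((f a).map g)) := by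
  induction l with
  | nil => rfl
  | cons a l ih =>
    rw [flatMap_cons, map_append, xorAll_append, ih, map_cons, xorAll_cons]
lemma xorAll_and_left (l : List α) (b : Bool) (g : α → Bool) :
    xorAll (l.map fun a => b && g a) = (b && xorAll (l.map g)) := by
  induction l with
  | nil => simp [xorAll_nil]
  | cons a l ih => simp only [map_cons, xorAll_cons, ih]; cases b <;> simp
lemma xorAll_and_right (l : List α) (b : Bool) (g : α → Bool) :
    xorAll (l.map fun a => g a && b) = (xorAll (l.map g) && b) := by
  simp only [Bool.and_comm _ b]
  exact xorAll_and_left l b g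
lemma xorAll_false (l : List α) : xorAll (l.map fun _ => false) = false := by
  induction l with
  | nil => rfl
  | cons a l ih => simpa [xorAll_cons] using ih
lemma xorAll_perm {l l' : List Bool} (h : l.Perm l') : xorAll l = xorAll l' := by
  induction h with
  | nil => rfl
  | cons a _ ih => rw [xorAll_cons, xorAll_cons, ih]
  | swap a b l => simp only [xorAll_cons, Bool.xor_left_comm]
  | trans _ _ h1 h2 => exact h1.trans h2

/-- Pointwise exclusive or. -/
def xorf {α : Type} (w d : α → Bool) : α → Bool := fun u => xor (w u) (d u)

lemma xorf_xorf {α : Type} (w d e : α → Bool) :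
    xorf (xorf w d) e = xorf w (fun u => xor (d u) (e u)) := by
  funext u; simp [xorf]

section general

variable {α : Type} [DecidableEq α]

/-- A circuit on the qubits in `S` commutes with changes outside of `S`. This is the form in which
disjointness of zones is used throughout. -/
lemma run_xorf_of_avoid {S : Set α} {L : List (MCX α)} (hL : ∀ g ∈ L, g.On S) {d : α → Bool}
    (hd : ∀ u ∈ S, d u = false) (w : α → Bool) : run L (xorf w d) = xorf (run L w) d := by
  funext u
  by_cases hu : u ∈ S
  · rw [run_congr hL (w' := w) (fun v hv => by simp [xorf, hd v hv]) u hu]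
    simp [xorf, hd u hu]
  · rw [run_of_notMem hL _ hu]
    simp only [xorf, run_of_notMem hL w hu]

lemma run_same_target (y : α) (cs : List (List (α × Bool))) (hcs : ∀ c ∈ cs, ∀ p ∈ c, p.1 ≠ y)
    (w : α → Bool) : run (cs.map fun c => (c, y)) w =
      update w y (xor (w y) (xorAll (cs.map (holds w)))) := by
  induction cs generalizing w with
  | nil => simp [run_nil, xorAll_nil]
  | cons c cs ih =>
    rw [map_cons, run_cons, ih (fun c hc => hcs c (by simp [hc]))]
    have h1 : cs.map (holds (MCX.act (c, y) w)) = cs.map (holds w) :=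
      map_congr_left fun c' hc' => holds_congr fun p hp =>
        update_of_ne (hcs c' (by simp [hc']) p hp) _ _
    rw [h1]
    funext u
    by_cases huy : u = y
    · subst huy; simp [MCX.act, xorAll_cons]
    · simp [MCX.act, update_of_ne huy]

end general

lemma testBit_add_one (c i : ℕ) :
    (c + 1).testBit i = xor (c.testBit i) ((range i).all fun t => c.testBit t) := by
  induction i generalizing c with
  | zero =>
    simp only [Nat.testBit_zero, List.range_zero, all_nil]
    rcases Nat.mod_two_eq_zero_or_one c with h | h <;> simp [Nat.add_mod, h]
  | succ i ih =>
    rw [List.range_succ_eq_map, all_cons, all_map]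
    simp only [Nat.testBit_succ, comp_def, Nat.testBit_zero]
    rcases Nat.mod_two_eq_zero_or_one c with h | h
    · have : (c + 1) / 2 = c / 2 := by omega
      simp [this, h]
    · have : (c + 1) / 2 = c / 2 + 1 := by omega
      simp [this, h, ih]

/-! ### The circuit of the local search -/

/-- The names of the qubits: zone and index. The zones are: `0` and `4` literals, `1` and `5`
counters, `2` coins, `3` auxiliary qubits, `6` phase, `7 + j` registers of level `j`. -/
abbrev QName : Type := ℕ × ℕ

lemma run_toggle (c : List (QName × Bool)) (T : List QName) (hT : T.Nodup) (hc : ∀ p ∈ c, p.1 ∉ T)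
    (w : QName → Bool) : run (T.map fun t => (c, t)) w =
      fun u => xor (w u) (holds w c && decide (u ∈ T)) := by
  induction T generalizing w with
  | nil => funext u; simp [run_nil]
  | cons t T ih =>
    have h1 : holds (MCX.act (c, t) w) c = holds w c :=
      holds_congr fun p hp => update_of_ne (fun h => hc p hp (by simp [h])) _ _
    rw [map_cons, run_cons, ih (nodup_cons.1 hT).2
      (fun p hp h => hc p hp (mem_cons_of_mem _ h)), h1]
    funext u
    simp only [MCX.act]
    by_cases hut : u = t
    · grind
    · simp [hut]

/-- The data which determine the circuit: number of variables, clauses, start, the patterns which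
represent the variables in the registers, the coins which select a literal, the size of the
counter. -/
structure Walk where
  n : ℕ
  clauses : List (List (Bool × ℕ))
  x : List Bool
  pat : ℕ → ℕ → List (QName × Bool)
  sel : ℕ → ℕ → List (List (QName × Bool))
  q : ℕ

namespace Walk

variable (A : Walk)

/-- A literal of a clause. -/
def lit (C : List (Bool × ℕ)) (a : ℕ) : Bool × ℕ := C.getD a (false, 0)

/-- The qubits which change when `v` is added to a register. -/
def patT (z v : ℕ) : List QName := ((A.pat z v).filter fun p => p.2).map fun p => p.1

/-- Add variables to a register, each under a condition. -/
def toggles (z : ℕ) (l : List (List (QName × Bool) × ℕ)) : List (MCX QName) :=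
  l.flatMap fun p => (A.patT z p.2).map fun t => (p.1, t)

/-- Compute whether the variables of the clause are in the registers. -/
def pre (yz : ℕ) (base : List ℕ) (C : List (Bool × ℕ)) : List (MCX QName) :=
  (range 3).flatMap fun a => base.map fun b => (A.pat b (lit C a).2, (yz, a))

/-- The condition that the clause is false. -/
def uns (yz : ℕ) (C : List (Bool × ℕ)) : List (QName × Bool) :=
  (range 3).map fun a => ((yz, a), A.x.getD (lit C a).2 false == (lit C a).1)

/-- Increment the counter under a condition. -/
def inc (cz : ℕ) (c : List (QName × Bool)) : List (MCX QName) :=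
  (range A.q).reverse.map fun i => (c ++ (range i).map fun t => ((cz, t), true), (cz, i))

/-- The condition that the counter is `0`. -/
def cntZero (cz : ℕ) : List (QName × Bool) := (range A.q).map fun i => ((cz, i), false)

/-- Count the clause if it is false. -/
def count (yz cz : ℕ) (base : List ℕ) (C : List (Bool × ℕ)) : List (MCX QName) :=
  A.pre yz base C ++ A.inc cz (A.uns yz C) ++ (A.pre yz base C).reverse

/-- If the clause is the first one that is false, add one of its variables to a register. -/
def leafClause (i : ℕ) (base : List ℕ) (z : ℕ) (C : List (Bool × ℕ)) : List (MCX QName) :=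
  A.pre 0 base C ++ A.toggles z ((range 3).flatMap fun a => (A.sel i a).map fun s =>
    (A.uns 0 C ++ A.cntZero 1 ++ s, (lit C a).2)) ++ A.inc 1 (A.uns 0 C) ++
    (A.pre 0 base C).reverse

/-- One step of the local search. -/
def leaf (i : ℕ) (base : List ℕ) (z : ℕ) : List (MCX QName) :=
  A.clauses.flatMap (A.leafClause i base z) ++ (A.clauses.flatMap (A.count 0 1 base)).reverse

/-- Add the contents of a register to another one. -/
def copy (j z : ℕ) : List (MCX QName) := A.toggles z ((range A.n).map fun v => (A.pat j v, v))

/-- Several steps of the local search, with the changes before them in the registers `base`. -/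
def gen : ℕ → ℕ → ℕ → List ℕ → ℕ → List (MCX QName)
  | 0, _, i, base, z => A.leaf i base z
  | d + 1, j, i, base, z => gen d (j + 1) i base (j + 1) ++
      gen d (j + 1) (i + 2 ^ d) ((j + 1) :: base) z ++ A.copy (j + 1) z ++ gen d (j + 1) i base (j + 1)

/-- Count all clauses which are false. -/
def countAll (yz cz : ℕ) (base : List ℕ) : List (MCX QName) := A.clauses.flatMap (A.count yz cz base)

/-- The circuit is built from qubits in `U`. -/
structure Valid (U : Set QName) (D B : ℕ) : Prop where
  lt : ∀ C ∈ A.clauses, ∀ a < 3, (lit C a).2 < A.n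
  pat : ∀ j ≤ D, ∀ v < A.n, ∀ p ∈ A.pat j v, p.1 ∈ U ∧ p.1.1 = 7 + j
  pat_nodup : ∀ j ≤ D, ∀ v < A.n, ((A.pat j v).map fun p => p.1).Nodup
  pat_length : ∀ j ≤ D, ∀ v < A.n, (A.pat j v).length ≤ B
  sel : ∀ i < 2 ^ D, ∀ a < 3, ∀ s ∈ A.sel i a, ∀ p ∈ s, p.1 ∈ U ∧ p.1.1 = 2
  sel_length : ∀ i < 2 ^ D, ∀ a < 3, ∀ s ∈ A.sel i a, 3 + A.q + s.length ≤ B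
  q_le : 3 + A.q ≤ B
  lits : ∀ a < 3, (0, a) ∈ U ∧ (4, a) ∈ U
  cnt : ∀ i < A.q, (1, i) ∈ U ∧ (5, i) ∈ U
  length_lt : A.clauses.length < 2 ^ A.q

variable {A} {U : Set QName} {D B : ℕ} (hA : A.Valid U D B)

/-- A well-formed gate with qubits in `S`. -/
def Fine (S : Set QName) (B : ℕ) (g : MCX QName) : Prop := g.On S ∧ g.Proper ∧ g.1.length ≤ B

include hA

variable {j v : ℕ} {S : Set ℕ} {z : ℕ} {l : List (List (QName × Bool) × ℕ)} {yz : ℕ} {base : List ℕ}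
   {C : List (Bool × ℕ)} {cz i : ℕ} {w : QName → Bool} {c : ℕ} {μ : ℕ → Bool}

lemma Valid.patT (hj : j ≤ D) (hv : v < A.n) {t : QName} (ht : t ∈ A.patT j v) :
    t ∈ U ∧ t.1 = 7 + j := by
  simp only [Walk.patT, mem_map, mem_filter] at ht
  obtain ⟨p, ⟨hp, -⟩, rfl⟩ := ht
  exact hA.pat j hj v hv p hp

lemma Valid.patT_nodup (hj : j ≤ D) (hv : v < A.n) : (A.patT j v).Nodup :=
  (hA.pat_nodup j hj v hv).sublist (List.filter_sublist.map _)

/-! #### All gates are well-formed -/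

lemma Valid.fine_toggles (hz : z ≤ D) (hzS : 7 + z ∈ S)
    (hl : ∀ p ∈ l, p.2 < A.n ∧ p.1.length ≤ B ∧ ∀ c ∈ p.1, c.1 ∈ U ∧ c.1.1 ∈ S ∧ c.1.1 ≠ 7 + z) :
    ∀ g ∈ A.toggles z l, Fine {u | u ∈ U ∧ u.1 ∈ S} B g := by
  intro g hg
  simp only [toggles, mem_flatMap, mem_map] at hg
  obtain ⟨p, hp, t, ht, rfl⟩ := hg
  obtain ⟨h1, h2, h3⟩ := hl p hp
  obtain ⟨h4, h5⟩ := hA.patT hz h1 ht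
  refine ⟨⟨⟨h4, h5 ▸ hzS⟩, fun c hc => ⟨(h3 c hc).1, (h3 c hc).2.1⟩⟩, fun c hc h => ?_, h2⟩
  exact (h3 c hc).2.2 (h ▸ h5)

lemma Valid.fine_pre (hy : yz = 0 ∨ yz = 4) (hyS : yz ∈ S)
    (hb : ∀ b ∈ base, b ≤ D ∧ 7 + b ∈ S) (hC : C ∈ A.clauses) :
    ∀ g ∈ A.pre yz base C, Fine {u | u ∈ U ∧ u.1 ∈ S} B g := by
  intro g hg
  simp only [pre, mem_flatMap, mem_map, mem_range] at hg
  obtain ⟨a, ha, b, hbm, rfl⟩ := hg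
  obtain ⟨hbD, hbS⟩ := hb b hbm
  have hv := hA.lt C hC a ha
  have hyU : (yz, a) ∈ U := by
    rcases hy with rfl | rfl
    exacts [(hA.lits a ha).1, (hA.lits a ha).2]
  refine ⟨⟨⟨hyU, hyS⟩, fun p hp => ?_⟩, fun p hp h => ?_, hA.pat_length b hbD _ hv⟩
  · obtain ⟨h1, h2⟩ := hA.pat b hbD _ hv p hp
    exact ⟨h1, h2 ▸ hbS⟩
  · obtain ⟨h1, h2⟩ := hA.pat b hbD _ hv p hp
    rw [h] at h2
    simp only at h2
    omega

lemma Valid.uns (hy : yz = 0 ∨ yz = 4) (C : List (Bool × ℕ)) :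
    ∀ p ∈ A.uns yz C, p.1 ∈ U ∧ p.1.1 = yz := by
  intro p hp
  simp only [Walk.uns, mem_map, mem_range] at hp
  obtain ⟨a, ha, rfl⟩ := hp
  rcases hy with rfl | rfl
  exacts [⟨(hA.lits a ha).1, rfl⟩, ⟨(hA.lits a ha).2, rfl⟩]

lemma Valid.cnt_mem (hc : cz = 1 ∨ cz = 5) (hi : i < A.q) : (cz, i) ∈ U := by
  rcases hc with rfl | rfl
  exacts [(hA.cnt i hi).1, (hA.cnt i hi).2]

lemma Valid.fine_inc (hy : yz = 0 ∨ yz = 4) (hyS : yz ∈ S)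
    (hc : cz = 1 ∨ cz = 5) (hcS : cz ∈ S) (C : List (Bool × ℕ)) :
    ∀ g ∈ A.inc cz (A.uns yz C), Fine {u | u ∈ U ∧ u.1 ∈ S} B g := by
  intro g hg
  simp only [inc, mem_map, mem_reverse, mem_range] at hg
  obtain ⟨i, hi, rfl⟩ := hg
  refine ⟨⟨⟨hA.cnt_mem hc hi, hcS⟩, fun p hp => ?_⟩, fun p hp h => ?_, ?_⟩
  · simp only [mem_append, mem_map, mem_range] at hp
    rcases hp with hp | ⟨t, ht, rfl⟩
    · obtain ⟨h1, h2⟩ := hA.uns hy C p hp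
      exact ⟨h1, h2 ▸ hyS⟩
    · exact ⟨hA.cnt_mem hc (ht.trans hi), hcS⟩
  · simp only [mem_append, mem_map, mem_range] at hp
    rcases hp with hp | ⟨t, ht, rfl⟩
    · obtain ⟨h1, h2⟩ := hA.uns hy C p hp
      rw [h] at h2
      simp only at h2
      omega
    · grind
  · have := hA.q_le
    simp only [Walk.uns, length_append, length_map, length_range]
    omega

lemma Valid.fine_count (hy : yz = 0 ∨ yz = 4) (hyS : yz ∈ S)
    (hc : cz = 1 ∨ cz = 5) (hcS : cz ∈ S) (hb : ∀ b ∈ base, b ≤ D ∧ 7 + b ∈ S) (hC : C ∈ A.clauses) :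
    ∀ g ∈ A.count yz cz base C, Fine {u | u ∈ U ∧ u.1 ∈ S} B g := by
  intro g hg
  simp only [count, mem_append, mem_reverse] at hg
  rcases hg with (hg | hg) | hg
  exacts [hA.fine_pre hy hyS hb hC g hg, hA.fine_inc hy hyS hc hcS C g hg,
    hA.fine_pre hy hyS hb hC g hg]

lemma Valid.fine_countAll (hy : yz = 0 ∨ yz = 4) (hyS : yz ∈ S)
    (hc : cz = 1 ∨ cz = 5) (hcS : cz ∈ S) (hb : ∀ b ∈ base, b ≤ D ∧ 7 + b ∈ S) :
    ∀ g ∈ A.countAll yz cz base, Fine {u | u ∈ U ∧ u.1 ∈ S} B g := by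
  intro g hg
  obtain ⟨C, hC, hg⟩ := mem_flatMap.1 hg
  exact hA.fine_count hy hyS hc hcS hb hC g hg

lemma Valid.sel_pairs (hi : i < 2 ^ D) (hS : 0 ∈ S ∧ 1 ∈ S ∧ 2 ∈ S) (z : ℕ) (hC : C ∈ A.clauses) :
    ∀ p ∈ (range 3).flatMap fun a => (A.sel i a).map fun s =>
      (A.uns 0 C ++ A.cntZero 1 ++ s, (lit C a).2),
      p.2 < A.n ∧ p.1.length ≤ B ∧ ∀ c ∈ p.1, c.1 ∈ U ∧ c.1.1 ∈ S ∧ c.1.1 ≠ 7 + z := by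
  intro p hp
  simp only [mem_flatMap, mem_map, mem_range] at hp
  obtain ⟨a, ha, s, hs, rfl⟩ := hp
  refine ⟨hA.lt C hC a ha, ?_, fun c hc => ?_⟩
  · have := hA.sel_length i hi a ha s hs
    simp only [Walk.uns, cntZero, length_append, length_map, length_range]
    omega
  · simp only [mem_append, cntZero, mem_map, mem_range] at hc
    rcases hc with (hc | ⟨t, ht, rfl⟩) | hc
    · obtain ⟨h1, h2⟩ := hA.uns (.inl rfl) C c hc
      exact ⟨h1, h2 ▸ hS.1, by omega⟩
    · exact ⟨hA.cnt_mem (.inl rfl) ht, hS.2.1, by grind⟩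
    · obtain ⟨h1, h2⟩ := hA.sel i hi a ha s hs c hc
      exact ⟨h1, h2 ▸ hS.2.2, by omega⟩

lemma Valid.fine_leaf (hS : 0 ∈ S ∧ 1 ∈ S ∧ 2 ∈ S) (hi : i < 2 ^ D) (hb : ∀ b ∈ base, b ≤ D ∧ 7 + b ∈ S) (hz : z ≤ D) (hzS : 7 + z ∈ S) :
    ∀ g ∈ A.leaf i base z, Fine {u | u ∈ U ∧ u.1 ∈ S} B g := by
  intro g hg
  simp only [leaf, mem_append, mem_flatMap, mem_reverse, leafClause] at hg
  rcases hg with ⟨C, hC, ((hg | hg) | hg) | hg⟩ | ⟨C, hC, hg⟩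
  exacts [hA.fine_pre (.inl rfl) hS.1 hb hC g hg,
    hA.fine_toggles hz hzS (hA.sel_pairs hi hS z hC) g hg,
    hA.fine_inc (.inl rfl) hS.1 (.inl rfl) hS.2.1 C g hg, hA.fine_pre (.inl rfl) hS.1 hb hC g hg,
    hA.fine_count (.inl rfl) hS.1 (.inl rfl) hS.2.1 hb hC g hg]

lemma Valid.fine_copy (hj : j ≤ D) (hjS : 7 + j ∈ S) (hz : z ≤ D)
    (hzS : 7 + z ∈ S) (hjz : j ≠ z) : ∀ g ∈ A.copy j z, Fine {u | u ∈ U ∧ u.1 ∈ S} B g := by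
  refine hA.fine_toggles hz hzS fun p hp => ?_
  simp only [mem_map, mem_range] at hp
  obtain ⟨v, hv, rfl⟩ := hp
  refine ⟨hv, hA.pat_length j hj v hv, fun c hc => ?_⟩
  obtain ⟨h1, h2⟩ := hA.pat j hj v hv c hc
  exact ⟨h1, h2 ▸ hjS, by omega⟩

lemma Valid.fine_gen (hS : 0 ∈ S ∧ 1 ∈ S ∧ 2 ∈ S) (d j i : ℕ) (base : List ℕ) (z : ℕ)
    (hd : j + d ≤ D) (hi : i + 2 ^ d ≤ 2 ^ D) (hb : ∀ b ∈ base, b ≤ j ∧ 7 + b ∈ S) (hz : z ≤ j)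
    (hzS : 7 + z ∈ S) (hjS : ∀ j', j < j' → j' ≤ j + d → 7 + j' ∈ S) :
    ∀ g ∈ A.gen d j i base z, Fine {u | u ∈ U ∧ u.1 ∈ S} B g := by
  induction d generalizing j i base z with
  | zero =>
    exact hA.fine_leaf hS (by simpa using hi) (fun b h => ⟨(hb b h).1.trans (by omega), (hb b h).2⟩)
      (by omega) hzS
  | succ d ih =>
    rw [pow_succ] at hi
    have hj1 : 7 + (j + 1) ∈ S := hjS (j + 1) (by omega) (by omega)
    have h1 := ih (j + 1) i base (j + 1) (by omega) (by omega)
      (fun b h => ⟨(hb b h).1.trans (by omega), (hb b h).2⟩) le_rfl hj1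
      (fun j' h h' => hjS j' (by omega) (by omega))
    have h2 := ih (j + 1) (i + 2 ^ d) ((j + 1) :: base) z (by omega) (by omega)
      (fun b h => by grind) (by omega) hzS
      (fun j' h h' => hjS j' (by omega) (by omega))
    have h3 := hA.fine_copy (S := S) (j := j + 1) (z := z) (by omega) hj1 (by omega) hzS (by omega)
    intro g hg
    simp only [gen, mem_append] at hg
    rcases hg with ((hg | hg) | hg) | hg
    exacts [h1 g hg, h2 g hg, h3 g hg, h1 g hg]

/-! #### The effect of the gates -/

lemma Valid.run_toggles (hz : z ≤ D)
    (hl : ∀ p ∈ l, p.2 < A.n ∧ ∀ c ∈ p.1, c.1.1 ≠ 7 + z) (w : QName → Bool) :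
    run (A.toggles z l) w = xorf w fun u => xorAll (l.map fun p =>
      holds w p.1 && decide (u ∈ A.patT z p.2)) := by
  induction l generalizing w with
  | nil => funext u; simp [toggles, run_nil, xorf, xorAll_nil]
  | cons p l ih =>
    obtain ⟨h1, h2⟩ := hl p (by simp)
    rw [toggles, flatMap_cons, run_append, run_toggle _ _ (hA.patT_nodup hz h1)
      (fun c hc h => h2 c hc (hA.patT hz h1 h).2)]
    change run (A.toggles z l) _ = _
    rw [ih (fun p hp => hl p (by simp [hp]))]
    have h3 : ∀ p' ∈ l, holds (fun u => xor (w u) (holds w p.1 && decide (u ∈ A.patT z p.2))) p'.1 =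
        holds w p'.1 := fun p' hp' => holds_congr fun c hc => by
      have : c.1 ∉ A.patT z p.2 := fun h =>
        (hl p' (by simp [hp'])).2 c hc (hA.patT hz h1 h).2
      simp [this]
    funext u
    simp only [xorf, map_cons, xorAll_cons, Bool.xor_assoc]
    have h4 : (l.map fun p' => holds (fun u => xor (w u) (holds w p.1 && decide (u ∈ A.patT z p.2))) p'.1 &&
        decide (u ∈ A.patT z p'.2)) = l.map fun p' => holds w p'.1 && decide (u ∈ A.patT z p'.2) :=
      map_congr_left fun p' hp' => by rw [h3 p' hp']
    rw [h4]

omit hA in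
/-- The parity of the registers in `base` at the variable `v`. -/
def memb (A : Walk) (base : List ℕ) (w : QName → Bool) (v : ℕ) : Bool :=
  xorAll (base.map fun b => holds w (A.pat b v))

omit hA in
/-- The clause is false for the start changed by `μ`. -/
def unsat (A : Walk) (μ : ℕ → Bool) (C : List (Bool × ℕ)) : Bool :=
  (range 3).all fun a => xor (A.x.getD (lit C a).2 false) (μ (lit C a).2) != (lit C a).1

lemma Valid.memb_congr (hb : ∀ b ∈ base, b ≤ D) {w' : QName → Bool}
    (hv : v < A.n) (h : ∀ b ∈ base, ∀ u : QName, u.1 = 7 + b → w u = w' u) :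
    A.memb base w v = A.memb base w' v := by
  unfold memb
  refine congrArg xorAll (map_congr_left fun b hbm => holds_congr fun p hp => ?_)
  exact h b hbm _ (hA.pat b (hb b hbm) v hv p hp).2

/-- The registers in `base` hold disjoint parts of the path, so the parity of their answers is
membership in the union; it is collected for each of the three variables. Three separate targets,
none of them in a register, make the three computations independent. -/
lemma Valid.run_pre (hy : yz = 0 ∨ yz = 4) (hb : ∀ b ∈ base, b ≤ D) (hC : C ∈ A.clauses) (w : QName → Bool) :
    run (A.pre yz base C) w = xorf w fun u =>
      (decide (u.1 = yz ∧ u.2 < 3) && A.memb base w (lit C u.2).2) := by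
  have key : ∀ a < 3, ∀ w : QName → Bool,
      run (base.map fun b => (A.pat b (lit C a).2, (yz, a))) w =
        update w (yz, a) (xor (w (yz, a)) (A.memb base w (lit C a).2)) := by
    intro a ha w
    have := run_same_target (yz, a) (base.map fun b => A.pat b (lit C a).2) (by
      intro c hc p hp h
      obtain ⟨b, hbm, rfl⟩ := mem_map.1 hc
      have := (hA.pat b (hb b hbm) _ (hA.lt C hC a ha) p hp).2
      rw [h] at this
      simp only at this
      omega) w
    rw [map_map, map_map] at this
    exact this
  have hm : ∀ (a a' : ℕ), a' < 3 → ∀ (w : QName → Bool) (v : Bool),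
      A.memb base (update w (yz, a) v) (lit C a').2 = A.memb base w (lit C a').2 := by
    intro a a' ha' w v
    refine hA.memb_congr hb (hA.lt C hC a' ha') fun b _ u hu => update_of_ne ?_ _ _
    rintro rfl
    simp only at hu
    omega
  have e : A.pre yz base C = (base.map fun b => (A.pat b (lit C 0).2, (yz, 0))) ++
      ((base.map fun b => (A.pat b (lit C 1).2, (yz, 1))) ++
        (base.map fun b => (A.pat b (lit C 2).2, (yz, 2)))) := by
    simp [pre, range_succ]
  rw [e, run_append, run_append, key 0 (by omega), key 1 (by omega), key 2 (by omega)]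
  simp only [hm _ 1 (by omega), hm _ 2 (by omega)]
  funext u
  obtain ⟨z, a⟩ := u
  by_cases hz : z = yz
  · subst hz
    simp only [xorf, Function.update_apply, Prod.mk.injEq, true_and]
    by_cases h2 : a = 2
    · subst h2; simp
    · grind
  · simp [xorf, hz]

omit hA in
lemma holds_uns (μ : ℕ → Bool) (C : List (Bool × ℕ)) (w : QName → Bool)
    (hw : ∀ a < 3, w (yz, a) = μ (lit C a).2) : holds w (A.uns yz C) = A.unsat μ C := by
  unfold holds Walk.uns unsat
  rw [all_map, Bool.eq_iff_iff]
  simp only [all_eq_true, mem_range, comp_apply]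
  refine forall₂_congr fun a ha => ?_
  rw [hw a ha]
  cases μ (lit C a).2 <;> cases A.x.getD (lit C a).2 false <;> cases (lit C a).1 <;> simp

omit hA in
/-- The state with the value `c` in the counter. -/
def setCnt (A : Walk) (cz c : ℕ) (w : QName → Bool) : QName → Bool := fun u =>
  if u.1 = cz ∧ u.2 < A.q then c.testBit u.2 else w u

omit hA in
-- A bit changes when all lower bits are `1`. The bits are treated from the top down, so the lower
-- ones still have their old values when they serve as controls.
lemma run_inc {ctrl : List (QName × Bool)} (hctrl : ∀ p ∈ ctrl, p.1.1 ≠ cz) (w : QName → Bool) (hw : ∀ i < A.q, w (cz, i) = c.testBit i) :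
    run (A.inc cz ctrl) w = A.setCnt cz (c + (holds w ctrl).toNat) w := by
  have key : ∀ m (w : QName → Bool), run ((range m).reverse.map fun i =>
      (ctrl ++ (range i).map fun t => ((cz, t), true), ((cz, i) : QName))) w =
      xorf w fun u => decide (u.1 = cz ∧ u.2 < m) &&
        (holds w ctrl && (range u.2).all fun t => w (cz, t)) := by
    intro m
    induction m with
    | zero => intro w; funext u; simp [run_nil, xorf]
    | succ m ih =>
      intro w
      have e : (range (m + 1)).reverse = m :: (range m).reverse := by
        rw [range_succ, List.reverse_append]; rfl
      rw [e, map_cons, run_cons, ih]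
      have h0 : ∀ u : QName, u ≠ (cz, m) → MCX.act (ctrl ++ (range m).map fun t => ((cz, t), true),
          ((cz, m) : QName)) w u = w u := fun u hu => update_of_ne hu _ _
      have h1 : holds (MCX.act (ctrl ++ (range m).map fun t => ((cz, t), true),
          ((cz, m) : QName)) w) ctrl = holds w ctrl :=
        holds_congr fun p hp => h0 _ fun h => hctrl p hp (by rw [h])
      have h2 : holds w ((range m).map fun t => (((cz, t) : QName), true)) =
          (range m).all fun t => w (cz, t) := by
        unfold holds
        rw [all_map]
        simp [comp_def]
      funext u
      obtain ⟨z, i⟩ := u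
      simp only [xorf, h1]
      by_cases hz : z = cz
      · subst hz
        rcases lt_trichotomy i m with hi | rfl | hi
        · grind
        · simp [MCX.act, holds_append, h2]
        · grind
      · grind
  rw [inc, key]
  funext u
  obtain ⟨z, i⟩ := u
  simp only [xorf, setCnt]
  by_cases hu : z = cz ∧ i < A.q
  · obtain ⟨rfl, hi⟩ := hu
    have h3 : ((range i).all fun t => w (z, t)) = (range i).all fun t => c.testBit t := by grind
    rw [h3, hw i hi]
    cases holds w ctrl
    · simp [hi]
    · simp [hi, testBit_add_one]
  · simp [hu]

/-- Clean literals, the value `c` in the counter, the changes `μ` in the registers in `base`. -/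
def _root_.HybridSAT.Walk.Ready (A : Walk) (yz cz : ℕ) (base : List ℕ) (μ : ℕ → Bool) (c : ℕ)
    (w : QName → Bool) : Prop :=
  (∀ a < 3, w (yz, a) = false) ∧ (∀ i < A.q, w (cz, i) = c.testBit i) ∧
    ∀ v < A.n, A.memb base w v = μ v

lemma Valid.run_pre_of_ready (hy : yz = 0 ∨ yz = 4) (hb : ∀ b ∈ base, b ≤ D)
    (hw : A.Ready yz cz base μ c w) (hC : C ∈ A.clauses) :
    run (A.pre yz base C) w = xorf w fun u => (decide (u.1 = yz ∧ u.2 < 3) && μ (lit C u.2).2) := by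
  rw [hA.run_pre hy hb hC]
  funext u
  simp only [xorf]
  by_cases h : u.1 = yz ∧ u.2 < 3
  · rw [hw.2.2 _ (hA.lt C hC _ h.2)]
  · simp [h]

lemma Valid.holds_uns_pre (hy : yz = 0 ∨ yz = 4) (hb : ∀ b ∈ base, b ≤ D)
    (hw : A.Ready yz cz base μ c w) (hC : C ∈ A.clauses) :
    holds (run (A.pre yz base C) w) (A.uns yz C) = A.unsat μ C := by
  refine holds_uns μ C _ fun a ha => ?_
  rw [hA.run_pre_of_ready hy hb hw hC]
  simp [xorf, ha, hw.1 a ha]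

lemma Valid.ready_setCnt (hy : yz = 0 ∨ yz = 4) (hc : cz = 1 ∨ cz = 5) (hb : ∀ b ∈ base, b ≤ D) {c' : ℕ}
    (hw : A.Ready yz cz base μ c w) : A.Ready yz cz base μ c' (A.setCnt cz c' w) := by
  refine ⟨fun a ha => ?_, fun i hi => ?_, fun v hv => ?_⟩
  · rw [setCnt, if_neg (by grind), hw.1 a ha]
  · rw [setCnt, if_pos ⟨rfl, hi⟩]
  · rw [← hw.2.2 v hv]
    refine hA.memb_congr hb hv fun b _ u hu => ?_
    rw [setCnt, if_neg (by omega)]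

/-- The counter is not touched by `pre`, so setting it commutes with `pre`, and the reversed `pre`
cleans the literals afterwards. Nothing but the counter has changed. -/
lemma Valid.run_inc_pre (hy : yz = 0 ∨ yz = 4) (hc : cz = 1 ∨ cz = 5) (hb : ∀ b ∈ base, b ≤ D)
    (hw : A.Ready yz cz base μ c w) (hC : C ∈ A.clauses) :
    run (A.count yz cz base C) w = A.setCnt cz (c + (A.unsat μ C).toNat) w := by
  have hp := hA.fine_pre (S := Set.univ) hy (Set.mem_univ _) (fun b h => ⟨hb b h, Set.mem_univ _⟩) hC
  have hne : ∀ p ∈ A.uns yz C, p.1.1 ≠ cz := fun p hp => by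
    rw [(hA.uns hy C p hp).2]; omega
  rw [count, run_append, run_append, run_inc hne (c := c), hA.holds_uns_pre hy hb hw hC]
  · have h1 : A.setCnt cz (c + (A.unsat μ C).toNat) (run (A.pre yz base C) w) =
        run (A.pre yz base C) (A.setCnt cz (c + (A.unsat μ C).toNat) w) := by
      rw [hA.run_pre_of_ready hy hb hw hC,
        hA.run_pre_of_ready hy hb (hA.ready_setCnt hy hc hb hw) hC]
      funext u
      simp only [setCnt, xorf]
      by_cases h : u.1 = cz ∧ u.2 < A.q
      · grind
      · grind
    rw [h1, run_reverse_run fun g hg => (hp g hg).2.1]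
  · intro i hi
    rw [hA.run_pre_of_ready hy hb hw hC, xorf, hw.2.1 i hi]
    have : ¬ (cz = yz ∧ i < 3) := by omega
    simp [this]

omit hA in
lemma setCnt_setCnt (cz c c' : ℕ) (w : QName → Bool) :
    A.setCnt cz c (A.setCnt cz c' w) = A.setCnt cz c w := by
  funext u
  simp only [setCnt]
  split_ifs <;> rfl

omit hA in
lemma Ready.setCnt_self (hw : A.Ready yz cz base μ c w) : A.setCnt cz c w = w := by
  funext u
  obtain ⟨z, i⟩ := u
  simp only [setCnt]
  split_ifs with h
  · obtain ⟨rfl, hi⟩ := h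
    exact (hw.2.1 i hi).symm
  · rfl

lemma Valid.run_count (hy : yz = 0 ∨ yz = 4) (hc : cz = 1 ∨ cz = 5) (hb : ∀ b ∈ base, b ≤ D)
    (hw : A.Ready yz cz base μ c w) (l : List (List (Bool × ℕ))) (hl : ∀ C ∈ l, C ∈ A.clauses) :
    run (l.flatMap (A.count yz cz base)) w = A.setCnt cz (c + l.countP (A.unsat μ)) w := by
  induction l generalizing c w with
  | nil => exact (Ready.setCnt_self hw).symm
  | cons C l ih =>
    rw [flatMap_cons, run_append, hA.run_inc_pre hy hc hb hw (hl C (by simp)),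
      ih (hA.ready_setCnt hy hc hb hw) (fun C hC => hl C (by simp [hC])), setCnt_setCnt,
      List.countP_cons]
    congr 1
    cases A.unsat μ C <;> simp
    omega

end Walk

end

/-! ### The effect of a single step, of the recursive search, and of the oracle -/

section

namespace Walk

variable {A : Walk} {U : Set QName} {D B : ℕ} (hA : A.Valid U D B)

/-- The coins for step `i` select the literal `a`. -/
def pick (A : Walk) (w : QName → Bool) (i a : ℕ) : Bool := xorAll ((A.sel i a).map (holds w))

/-- The contents of a register in zone `7 + z` which represents the variables in `l`. -/
def regX (A : Walk) (z : ℕ) (l : List ℕ) (u : QName) : Bool :=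
  xorAll (l.map fun v => decide (u ∈ A.patT z v))

/-- The change by a step which uses the clause `C`. -/
def move (A : Walk) (i z : ℕ) (C : List (Bool × ℕ)) (w : QName → Bool) (u : QName) : Bool :=
  xorAll ((range 3).map fun a => A.pick w i a && decide (u ∈ A.patT z (lit C a).2))

include hA

variable {z : ℕ} {l : List ℕ} {u : QName} {i : ℕ} {w w' : QName → Bool} {C : List (Bool × ℕ)}
   {c : ℕ} {base : List ℕ} {μ : ℕ → Bool} {P : List ℕ}

lemma Valid.regX_eq_false (hz : z ≤ D) (hl : ∀ v ∈ l, v < A.n)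
    (hu : u.1 ≠ 7 + z) : A.regX z l u = false := by
  have : (l.map fun v => decide (u ∈ A.patT z v)) = l.map fun _ => false :=
    map_congr_left fun v hv => decide_eq_false fun h => hu (hA.patT hz (hl v hv) h).2
  rw [regX, this, xorAll_false]

lemma Valid.pick_congr {a : ℕ} (hi : i < 2 ^ D) (ha : a < 3)
    (h : ∀ u : QName, u.1 = 2 → w u = w' u) : A.pick w i a = A.pick w' i a :=
  congrArg xorAll (map_congr_left fun s hs => holds_congr fun p hp =>
    h _ (hA.sel i hi a ha s hs p hp).2)

lemma Valid.move_congr (hi : i < 2 ^ D) (C : List (Bool × ℕ))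
    (h : ∀ u : QName, u.1 = 2 → w u = w' u) : A.move i z C w = A.move i z C w' := by
  funext u
  refine congrArg xorAll (map_congr_left fun a ha => ?_)
  rw [hA.pick_congr hi (mem_range.1 ha) h]

lemma Valid.move_eq_false (hz : z ≤ D) (hC : C ∈ A.clauses)
    (w : QName → Bool) (hu : u.1 ≠ 7 + z) : A.move i z C w u = false := by
  have : ((range 3).map fun a => A.pick w i a && decide (u ∈ A.patT z (lit C a).2)) =
      (range 3).map fun _ => false :=
    map_congr_left fun a ha => by
      rw [decide_eq_false fun h => hu (hA.patT hz (hA.lt C hC a (mem_range.1 ha)) h).2,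
        Bool.and_false]
  rw [move, this, xorAll_false]

omit hA in
lemma holds_cntZero (hc : c < 2 ^ A.q) {cz : ℕ}
    (hw : ∀ i < A.q, w (cz, i) = c.testBit i) : holds w (A.cntZero cz) = decide (c = 0) := by
  unfold holds cntZero
  rw [all_map, Bool.eq_iff_iff]
  simp only [all_eq_true, mem_range, comp_apply, beq_false, not_eq_true', decide_eq_true_eq]
  constructor
  · intro h
    refine Nat.eq_of_testBit_eq fun i => ?_
    rw [zero_testBit]
    by_cases hi : i < A.q
    · grind
    · exact Nat.testBit_lt_two_pow (hc.trans_le (pow_le_pow_right (by omega) (by omega)))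
  · grind

omit hA in
lemma on_avoid {S : Set ℕ} {L : List (MCX QName)}
    (hL : ∀ g ∈ L, Fine {u | u ∈ U ∧ u.1 ∈ S} B g) {d : QName → Bool}
    (hd : ∀ u : QName, u.1 ∈ S → d u = false) (w : QName → Bool) :
    run L (xorf w d) = xorf (run L w) d :=
  run_xorf_of_avoid (fun g hg => (hL g hg).1) (fun u hu => hd u hu.2) w

/-- The conditions of the toggles are the falsity of the clause, a counter which is still `0`, and
the coins. The gates after the toggles avoid the zone of register `z`, so the change of this
register passes through them, and the rest acts like `count`. -/
lemma Valid.run_leafClause (hi : i < 2 ^ D) (hb : ∀ b ∈ base, b ≤ D) (hz : z ≤ D) (hzb : z ∉ base) (hc : c < 2 ^ A.q) (hw : A.Ready 0 1 base μ c w) (hC : C ∈ A.clauses) :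
    run (A.leafClause i base z C) w = xorf (A.setCnt 1 (c + (A.unsat μ C).toNat) w) fun u =>
      (A.unsat μ C && decide (c = 0)) && A.move i z C w u := by
  have hS : (0 : ℕ) ∈ {s : ℕ | s ≠ 7 + z} ∧ (1 : ℕ) ∈ {s : ℕ | s ≠ 7 + z} ∧
      (2 : ℕ) ∈ {s : ℕ | s ≠ 7 + z} := by grind
  have hbS : ∀ b ∈ base, b ≤ D ∧ 7 + b ∈ {s : ℕ | s ≠ 7 + z} := fun b h => ⟨hb b h, fun e =>
    hzb ((by omega : b = z) ▸ h)⟩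
  have hpre := hA.fine_pre (.inl rfl) hS.1 hbS hC
  have hinc := hA.fine_inc (.inl rfl) hS.1 (.inl rfl) hS.2.1 C
  have htail : ∀ g ∈ A.inc 1 (A.uns 0 C) ++ (A.pre 0 base C).reverse,
      Fine {u | u ∈ U ∧ u.1 ∈ {s : ℕ | s ≠ 7 + z}} B g := by grind
  have hcount := hA.run_inc_pre (.inl rfl) (.inl rfl) hb hw hC
  rw [count, append_assoc, run_append] at hcount
  rw [leafClause, append_assoc, run_append (_ ++ _), run_append (A.pre 0 base C)]
  have hpairs := hA.sel_pairs hi (S := Set.univ) ⟨trivial, trivial, trivial⟩ z hC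
  rw [hA.run_toggles hz fun p hp => ⟨(hpairs p hp).1, fun c hc => ((hpairs p hp).2.2 c hc).2.2⟩]
  set w1 := run (A.pre 0 base C) w with hw1
  have h2 : ∀ u : QName, u.1 ≠ 0 → w1 u = w u := by
    intro u hu
    rw [hw1, hA.run_pre_of_ready (.inl rfl) hb hw hC]
    simp [xorf, hu]
  have key : (fun u => xorAll (((range 3).flatMap fun a => (A.sel i a).map fun s =>
      (A.uns 0 C ++ A.cntZero 1 ++ s, (lit C a).2)).map fun p =>
        holds w1 p.1 && decide (u ∈ A.patT z p.2))) =
      fun u => (A.unsat μ C && decide (c = 0)) && A.move i z C w u := by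
    funext u
    rw [xorAll_flatMap, move, ← xorAll_and_left]
    refine congrArg xorAll (map_congr_left fun a ha => ?_)
    rw [map_map, ← hA.pick_congr hi (mem_range.1 ha) (w := w1)
      (fun u hu => h2 u (by omega)), pick, ← xorAll_and_right, ← xorAll_and_left]
    refine congrArg xorAll (map_congr_left fun s _ => ?_)
    simp only [comp_apply, holds_append]
    rw [hw1, hA.holds_uns_pre (.inl rfl) hb hw hC, ← hw1,
      holds_cntZero hc (fun i hi => by rw [h2 _ (by simp), hw.2.1 i hi]), Bool.and_assoc]
  rw [key, on_avoid htail, hcount]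
  intro u hu
  rw [hA.move_eq_false hz hC w hu, Bool.and_false]

/-- Once a false clause has been met the counter is positive, so only the first false clause moves
anything. The bound on `c + l.length` prevents the counter from returning to `0` by overflow. -/
lemma Valid.run_leafClauses (hi : i < 2 ^ D) (hb : ∀ b ∈ base, b ≤ D) (hz : z ≤ D) (hzb : z ∉ base) (l : List (List (Bool × ℕ)))
    (hl : ∀ C ∈ l, C ∈ A.clauses) (hc : c + l.length < 2 ^ A.q) (hw : A.Ready 0 1 base μ c w) :
    run (l.flatMap (A.leafClause i base z)) w = xorf (A.setCnt 1 (c + l.countP (A.unsat μ)) w)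
      fun u => decide (c = 0) && ((l.find? (A.unsat μ)).elim false fun C => A.move i z C w u) := by
  induction l generalizing c w with
  | nil => funext u; simp [run_nil, xorf, Ready.setCnt_self hw]
  | cons C l ih =>
    have hC := hl C (by simp)
    rw [length_cons] at hc
    rw [flatMap_cons, run_append, hA.run_leafClause hi hb hz hzb (by omega) hw hC]
    set d : QName → Bool := fun u => (A.unsat μ C && decide (c = 0)) && A.move i z C w u with hd
    have hd0 : ∀ u : QName, u.1 ≠ 7 + z → d u = false := fun u hu => by
      rw [hd]; simp only; rw [hA.move_eq_false hz hC w hu, Bool.and_false]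
    set c' := c + (A.unsat μ C).toNat with hc'
    have hle : (A.unsat μ C).toNat ≤ 1 := Bool.toNat_le _
    have hr1 := hA.ready_setCnt (.inl rfl) (.inl rfl) hb (c' := c') hw
    have hr : A.Ready 0 1 base μ c' (xorf (A.setCnt 1 c' w) d) := by
      refine ⟨fun a ha => ?_, fun i hi => ?_, fun v hv => ?_⟩
      · rw [xorf, hd0 _ (by grind), hr1.1 a ha]; rfl
      · rw [xorf, hd0 _ (by grind), hr1.2.1 i hi, Bool.xor_false]
      · rw [← hr1.2.2 v hv]
        refine hA.memb_congr hb hv fun b hbm u hu => ?_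
        rw [xorf, hd0 u (fun e => hzb ((by omega : b = z) ▸ hbm)), Bool.xor_false]
    rw [ih (fun C hC => hl C (by simp [hC])) (by omega) hr]
    have hm : ∀ C', A.move i z C' (xorf (A.setCnt 1 c' w) d) = A.move i z C' w := fun C' =>
      hA.move_congr hi C' fun u hu => by
        rw [xorf, hd0 _ (by omega), setCnt, if_neg (by omega), Bool.xor_false]
    have hcount : c' + l.countP (A.unsat μ) = c + (C :: l).countP (A.unsat μ) := by grind
    funext u
    simp only [hm, xorf]
    rw [hcount]
    have h1 : A.setCnt 1 (c + (C :: l).countP (A.unsat μ)) (fun u => xor (A.setCnt 1 c' w u) (d u)) u =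
        xor (A.setCnt 1 (c + (C :: l).countP (A.unsat μ)) w u) (d u) := by
      by_cases h : u.1 = 1 ∧ u.2 < A.q
      · simp only [setCnt, if_pos h, hd0 u (by omega), Bool.xor_false]
      · simp only [setCnt, if_neg h]
    change xor (A.setCnt 1 _ (fun u => xor (A.setCnt 1 c' w u) (d u)) u) _ = _
    rw [h1, Bool.xor_assoc]
    congr 1
    rw [hd, List.find?_cons]
    simp only
    cases hu : A.unsat μ C
    · simp [hc', hu]
    · simp [hc', hu]

/-- The count does not read register `z`, which is not in `base`; hence the reversed count brings
the counter back to `0` and leaves only the move. -/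
lemma Valid.run_leaf (hi : i < 2 ^ D) (hb : ∀ b ∈ base, b ≤ D) (hz : z ≤ D) (hzb : z ∉ base) (hw : A.Ready 0 1 base μ 0 w) :
    run (A.leaf i base z) w =
      xorf w fun u => (A.clauses.find? (A.unsat μ)).elim false fun C => A.move i z C w u := by
  have hbS : ∀ b ∈ base, b ≤ D ∧ 7 + b ∈ {s : ℕ | s ≠ 7 + z} := fun b h => ⟨hb b h, fun e =>
    hzb ((by omega : b = z) ▸ h)⟩
  have hcnt : ∀ g ∈ A.clauses.flatMap (A.count 0 1 base),
      Fine {u | u ∈ U ∧ u.1 ∈ {s : ℕ | s ≠ 7 + z}} B g :=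
    hA.fine_countAll (.inl rfl) (S := {s : ℕ | s ≠ 7 + z}) (show 0 ≠ 7 + z by omega) (.inl rfl)
      (show 1 ≠ 7 + z by omega) hbS
  rw [leaf, run_append, hA.run_leafClauses hi hb hz hzb A.clauses (fun _ h => h)
    (by simpa using hA.length_lt) hw]
  rw [on_avoid (fun g hg => hcnt g (mem_reverse.1 hg)),
    ← hA.run_count (.inl rfl) (.inl rfl) hb hw A.clauses (fun _ h => h)]
  · rw [run_reverse_run fun g hg => (hcnt g hg).2.1]
    simp
  · intro u hu
    cases h : A.clauses.find? (A.unsat μ) with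
    | none => simp
    | some C => simp [hA.move_eq_false hz (List.mem_of_find?_eq_some h) w hu]

/-- The changes along the path `P`, when the coins in `w` select its variables and when the
patterns represent each of its relevant parts. -/
structure _root_.HybridSAT.Walk.Follows (A : Walk) (D : ℕ) (P : List ℕ) (w : QName → Bool) :
    Prop where
  nodup : P.Nodup
  lt : ∀ v ∈ P, v < A.n
  length_le : P.length ≤ 2 ^ D
  last : A.clauses.find? (A.unsat fun v => decide (v ∈ P)) = none
  step : ∀ i < P.length, ∃ C, ∃ a < 3,
    A.clauses.find? (A.unsat fun v => decide (v ∈ P.take i)) = some C ∧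
    P[i]? = some (lit C a).2 ∧ ∀ a' < 3, A.pick w i a' = (a' == a)
  -- This is the only condition by which the hash values enter the correctness of the search: a
  -- register that contains a chunk of the path answers membership correctly for all variables.
  reg : ∀ j ≤ D, ∀ i, 2 ^ (D - j) ∣ i → ∀ w' : QName → Bool,
    (∀ u : QName, u.1 = 7 + j → w' u = A.regX j ((P.drop i).take (2 ^ (D - j))) u) →
    ∀ v < A.n, holds w' (A.pat j v) = decide (v ∈ (P.drop i).take (2 ^ (D - j)))

lemma Valid.follows_congr (h : A.Follows D P w)
    (hw : ∀ u : QName, u.1 = 2 → w u = w' u) : A.Follows D P w' := by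
  refine ⟨h.nodup, h.lt, h.length_le, h.last, fun i hi => ?_, h.reg⟩
  obtain ⟨C, a, ha, h1, h2, h3⟩ := h.step i hi
  exact ⟨C, a, ha, h1, h2, fun a' ha' => by
    rw [← h3 a' ha', hA.pick_congr (hi.trans_le h.length_le) ha' hw]⟩

omit hA in
-- The variables of the path are distinct, so consecutive stretches are disjoint and exclusive or is
-- union.
lemma mem_take_add (hP : P.Nodup) (i m v : ℕ) : decide (v ∈ P.take (i + m)) =
      xor (decide (v ∈ (P.drop i).take m)) (decide (v ∈ P.take i)) := by
  rw [take_add]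
  have hd : v ∈ P.take i → v ∉ (P.drop i).take m := fun h h' =>
    (List.disjoint_take_drop hP le_rfl) h (mem_of_mem_take h')
  by_cases h1 : v ∈ P.take i <;> by_cases h2 : v ∈ (P.drop i).take m <;>
    simp_all [mem_append]

omit hA in
lemma regX_append (z : ℕ) (l l' : List ℕ) (u : QName) :
    A.regX z (l ++ l') u = xor (A.regX z l u) (A.regX z l' u) := by
  rw [regX, map_append, xorAll_append]; rfl

/-- The other register is read through its patterns for all `n` variables, since its contents are
not known as a list. The order in which variables are added is irrelevant for the parity. -/
lemma Valid.run_copy {j : ℕ} (hj : j ≤ D) (hz : z ≤ D) (hjz : j ≠ z)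
    (hl : l.Nodup) (hl' : ∀ v ∈ l, v < A.n)
    (hw : ∀ v < A.n, holds w (A.pat j v) = decide (v ∈ l)) :
    run (A.copy j z) w = xorf w (A.regX z l) := by
  rw [copy, hA.run_toggles hz]
  · congr 1
    funext u
    rw [map_map]
    have h1 : (range A.n).map ((fun p : List (QName × Bool) × ℕ =>
        holds w p.1 && decide (u ∈ A.patT z p.2)) ∘ fun v => (A.pat j v, v)) =
        (range A.n).map fun v => decide (v ∈ l) && decide (u ∈ A.patT z v) :=
      map_congr_left fun v hv => by grind
    have h2 : ∀ m : List ℕ, xorAll (m.map fun v => decide (v ∈ l) && decide (u ∈ A.patT z v)) =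
        xorAll ((m.filter (· ∈ l)).map fun v => decide (u ∈ A.patT z v)) := by
      intro m
      induction m with
      | nil => rfl
      | cons a m ih =>
        rw [map_cons, xorAll_cons, ih, List.filter_cons]
        by_cases ha : a ∈ l <;> simp [ha, xorAll_cons]
    rw [h1, h2, regX]
    refine xorAll_perm (List.Perm.map _ ?_)
    rw [List.perm_ext_iff_of_nodup (List.nodup_range.filter _) hl]
    intro v
    simp only [mem_filter, mem_range, decide_eq_true_eq]
    exact ⟨fun h => h.2, fun h => ⟨hl' v h, h⟩⟩
  · intro p hp
    simp only [mem_map, mem_range] at hp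
    obtain ⟨v, hv, rfl⟩ := hp
    refine ⟨hv, fun c hc h => ?_⟩
    have := (hA.pat j hj v hv c hc).2
    omega

/-- Bennett's recursion: with the first half of the stretch held in level `j + 1`, the second half
is computed with that register added to `base`; the first half is then copied to `z`, and the same
call as in the beginning removes it from level `j + 1`. The invariants are that the registers in
`base` together hold the path up to step `i`, and that all deeper levels are empty. Adding a chunk
is an exclusive or, hence the second identical call is the uncomputation. -/
lemma Valid.run_gen (d j i : ℕ) (base : List ℕ) (z : ℕ) (w : QName → Bool)
    (hP : A.Follows D P w) (hd : j + d = D) (hi : i + 2 ^ d ≤ 2 ^ D) (hdvd : 2 ^ d ∣ i)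
    (hb : ∀ b ∈ base, b ≤ j) (hz : z ≤ j) (hzb : z ∉ base) (hw : A.Ready 0 1 base
      (fun v => decide (v ∈ P.take i)) 0 w)
    (h0 : ∀ u : QName, 7 + j < u.1 → w u = false) :
    run (A.gen d j i base z) w = xorf w (A.regX z ((P.drop i).take (2 ^ d))) := by
  induction d generalizing j i base z w with
  | zero =>
    rw [gen, hA.run_leaf (by simpa using hi) (fun b h => (hb b h).trans (by omega)) (by omega)
      hzb hw]
    congr 1
    funext u
    rw [pow_zero]
    rcases Nat.lt_or_ge i P.length with hlt | hge
    · obtain ⟨C, a, ha, h1, h2, h3⟩ := hP.step i hlt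
      rw [h1]
      obtain ⟨hlt', hget⟩ := List.getElem?_eq_some_iff.1 h2
      rw [List.drop_eq_getElem_cons hlt, hget]
      change A.move i z C w u = xorAll [decide (u ∈ A.patT z (lit C a).2)]
      rw [move]
      rw [map_congr_left fun a' ha' => by rw [h3 a' (mem_range.1 ha')]]
      interval_cases a <;> simp [range_succ, xorAll_cons, xorAll_nil]
    · rw [List.drop_eq_nil_of_le hge, take_of_length_le hge, hP.last]
      rfl
  | succ d ih =>
    have hpow : 2 ^ (d + 1) = 2 ^ d + 2 ^ d := by rw [pow_succ]; ring
    have hdD : D - (j + 1) = d := by omega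
    set l1 := (P.drop i).take (2 ^ d) with hl1
    set l2 := (P.drop (i + 2 ^ d)).take (2 ^ d) with hl2
    have hl1n : ∀ v ∈ l1, v < A.n := fun v hv =>
      hP.lt v (List.mem_of_mem_drop (mem_of_mem_take hv))
    have hl2n : ∀ v ∈ l2, v < A.n := fun v hv =>
      hP.lt v (List.mem_of_mem_drop (mem_of_mem_take hv))
    have hl : (P.drop i).take (2 ^ (d + 1)) = l1 ++ l2 := by
      rw [hpow, take_add, List.drop_drop]
    have hdvd1 : 2 ^ d ∣ i := (pow_dvd_pow 2 (Nat.le_succ d)).trans hdvd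
    have hjb : j + 1 ∉ base := fun h => by have := hb _ h; omega
    have e1 : ∀ u : QName, u.1 ≠ 7 + (j + 1) → A.regX (j + 1) l1 u = false := fun u hu =>
      hA.regX_eq_false (by omega) hl1n hu
    have ez : ∀ l : List ℕ, (∀ v ∈ l, v < A.n) → ∀ u : QName, u.1 ≠ 7 + z → A.regX z l u = false :=
      fun l hl u hu => hA.regX_eq_false (by omega) hl hu
    have hbD : ∀ b ∈ base, b ≤ D := fun b h => (hb b h).trans (by omega)
    have hready : ∀ δ : QName → Bool, (∀ u : QName, u.1 ≠ 7 + (j + 1) → u.1 ≠ 7 + z → δ u = false) →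
        A.Ready 0 1 base (fun v => decide (v ∈ P.take i)) 0 (xorf w δ) := by
      intro δ hδ
      refine ⟨fun a ha => ?_, fun i hi => ?_, fun v hv => ?_⟩
      · rw [xorf, hδ _ (by simp only; omega) (by simp only; omega), hw.1 a ha]; rfl
      · rw [xorf, hδ _ (by simp only; omega) (by simp only; omega), hw.2.1 i hi, Bool.xor_false]
      · rw [← hw.2.2 v hv]
        refine hA.memb_congr hbD hv fun b hbm u hu => ?_
        rw [xorf, hδ u (fun e => hjb ((by omega : b = j + 1) ▸ hbm))
          (fun e => hzb ((by omega : b = z) ▸ hbm)), Bool.xor_false]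
    have hfol : ∀ δ : QName → Bool, (∀ u : QName, u.1 ≠ 7 + (j + 1) → u.1 ≠ 7 + z → δ u = false) →
        A.Follows D P (xorf w δ) := fun δ hδ => hA.follows_congr hP fun u hu => by
      rw [xorf, hδ u (by omega) (by omega), Bool.xor_false]
    rw [gen, run_append, run_append, run_append,
      ih (j + 1) i base (j + 1) w hP (by omega) (by omega) hdvd1
        (fun b h => (hb b h).trans (by omega)) le_rfl hjb hw (fun u hu => h0 u (by omega)), ← hl1]
    set w1 := xorf w (A.regX (j + 1) l1) with hw1
    have hw1z : ∀ u : QName, u.1 = 7 + (j + 1) → w1 u = A.regX (j + 1) l1 u := fun u hu => by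
      rw [hw1, xorf, h0 u (by omega), Bool.false_xor]
    have hpat1 := hP.reg (j + 1) (by omega) i (by rwa [hdD]) w1 (by rwa [hdD])
    rw [hdD] at hpat1
    have hr1 := hready (A.regX (j + 1) l1) fun u h _ => e1 u h
    rw [ih (j + 1) (i + 2 ^ d) ((j + 1) :: base) z w1 (hfol _ fun u h _ => e1 u h) (by omega) (by omega)
      (hdvd1.add (dvd_refl _)) (by
        intro b h
        rcases mem_cons.1 h with rfl | h
        exacts [le_rfl, (hb b h).trans (by omega)]) (by omega)
      (by
        rw [mem_cons, not_or]
        exact ⟨by omega, hzb⟩)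
      ⟨hr1.1, hr1.2.1, fun v hv => by
        rw [memb, map_cons, xorAll_cons]
        change xor _ (A.memb base w1 v) = _
        rw [hr1.2.2 v hv, hpat1 v hv, ← mem_take_add hP.nodup]⟩
      (fun u hu => by rw [hw1, xorf, e1 u (by omega), h0 u (by omega)]; rfl), ← hl2]
    rw [hA.run_copy (j := j + 1) (z := z) (l := l1) (by omega) (by omega) (by omega)
      ((hP.nodup.sublist (List.drop_sublist _ _)).sublist (List.take_sublist _ _)) hl1n
      (fun v hv => by
        rw [← hpat1 v hv]
        refine holds_congr fun p hp => ?_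
        have := (hA.pat (j + 1) (by omega) v hv p hp).2
        rw [xorf, ez l2 hl2n _ (by omega), Bool.xor_false])]
    -- Before the last call, the state differs from `w` only in level `j + 1` and in `z`. Neither
    -- belongs to `base`, so the invariants of the first call still hold and it cancels its own
    -- contribution.
    set δ : QName → Bool := fun u => xor (A.regX (j + 1) l1 u) (xor (A.regX z l2 u) (A.regX z l1 u))
      with hδ
    have hδ0 : ∀ u : QName, u.1 ≠ 7 + (j + 1) → u.1 ≠ 7 + z → δ u = false := fun u h h' => by
      rw [hδ]; simp only; rw [e1 u h, ez l1 hl1n u h', ez l2 hl2n u h']; rfl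
    have e3 : xorf (xorf w1 (A.regX z l2)) (A.regX z l1) = xorf w δ := by
      rw [hw1, xorf_xorf, xorf_xorf]
    rw [e3, ih (j + 1) i base (j + 1) _ (hfol δ hδ0) (by omega) (by omega) hdvd1
      (fun b h => (hb b h).trans (by omega)) le_rfl hjb (hready δ hδ0)
      (fun u hu => by rw [xorf, hδ0 u (by omega) (by omega), h0 u (by omega)]; rfl), ← hl1, hl, hδ]
    funext u
    rw [xorf_xorf, xorf, xorf, regX_append]
    cases A.regX (j + 1) l1 u <;> cases A.regX z l1 u <;> cases A.regX z l2 u <;> simp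

/-! ### The oracle -/

/-- The circuit for the whole search, from level `0`. -/
def _root_.HybridSAT.Walk.search (A : Walk) (D : ℕ) : List (MCX QName) := A.gen D 0 0 [] 0

/-- The search and the count of the clauses which are false at its end. -/
def _root_.HybridSAT.Walk.searchCount (A : Walk) (D : ℕ) : List (MCX QName) :=
  A.search D ++ A.countAll 4 5 [0]

/-- The phase oracle: change the qubit for the phases if all clauses are true at the end. -/
def _root_.HybridSAT.Walk.oracle (A : Walk) (D : ℕ) : List (MCX QName) :=
  A.searchCount D ++ [(A.cntZero 5, ((6, 0) : QName))] ++ (A.searchCount D).reverse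

lemma Valid.fine_search : ∀ g ∈ A.search D, Fine {u | u ∈ U ∧ u.1 ∈ {s : ℕ | s ≤ 2 ∨ 7 ≤ s}} B g :=
  hA.fine_gen (by simp) D 0 0 [] 0 (by omega) (by omega) (by simp) le_rfl (by simp) (by simp)

lemma Valid.fine_searchCount :
    ∀ g ∈ A.searchCount D, Fine {u | u ∈ U ∧ u.1 ∈ {s : ℕ | s ≠ 3 ∧ s ≠ 6}} B g := by
  intro g hg
  rw [searchCount, mem_append] at hg
  rcases hg with hg | hg
  · obtain ⟨⟨h1, h2⟩, h3⟩ := hA.fine_search g hg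
    simp only [mem_ofPred_eq] at h1 h2
    exact ⟨⟨⟨h1.1, by grind⟩, fun p hp => ⟨(h2 p hp).1, by
      have := (h2 p hp).2; simp only [mem_ofPred_eq]; omega⟩⟩, h3⟩
  · exact hA.fine_countAll (.inr rfl) (by simp) (.inr rfl) (by simp) (by simp) g hg

lemma Valid.fine_oracle (h6 : ((6, 0) : QName) ∈ U) :
    ∀ g ∈ A.oracle D, Fine {u | u ∈ U ∧ u.1 ∈ {s : ℕ | s ≠ 3}} B g := by
  have h1 : ∀ g ∈ A.searchCount D, Fine {u | u ∈ U ∧ u.1 ∈ {s : ℕ | s ≠ 3}} B g := fun g hg => by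
    obtain ⟨⟨h1, h2⟩, h3⟩ := hA.fine_searchCount g hg
    exact ⟨⟨⟨h1.1, h1.2.1⟩, fun p hp => ⟨(h2 p hp).1, (h2 p hp).2.1⟩⟩, h3⟩
  intro g hg
  simp only [oracle, mem_append, mem_reverse, mem_singleton] at hg
  rcases hg with (hg | rfl) | hg
  · exact h1 g hg
  · refine ⟨⟨⟨h6, by simp⟩, fun p hp => ?_⟩, fun p hp => ?_, ?_⟩
    · simp only [cntZero, mem_map, mem_range] at hp
      obtain ⟨i, hi, rfl⟩ := hp
      exact ⟨(hA.cnt i hi).2, by simp⟩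
    · simp only [cntZero, mem_map, mem_range] at hp
      obtain ⟨i, hi, rfl⟩ := hp
      simp
    · have := hA.q_le
      simp only [cntZero, length_map, length_range]
      omega
  · exact h1 g hg

/-- All clauses are true after the search with the coins in `w`. -/
def _root_.HybridSAT.Walk.accepts (A : Walk) (D : ℕ) (w : QName → Bool) : Bool :=
  holds (run (A.searchCount D) w) (A.cntZero 5)

/-- Compute, flip the phase qubit, uncompute. No assumption on the coins or on the hash values is
made: even when the registers hold nonsense, the reversed list of gates inverts the original one
exactly, so no entanglement with garbage remains. -/
lemma Valid.run_oracle (w : QName → Bool) :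
    run (A.oracle D) w = update w (6, 0) (xor (w (6, 0)) (A.accepts D w)) := by
  have hC := hA.fine_searchCount
  have h6 : ∀ u : QName, u.1 = 6 → ∀ w, run (A.searchCount D) w u = w u := fun u hu w =>
    run_of_notMem (fun g hg => (hC g hg).1) w (fun h => h.2.2 hu)
  rw [oracle, run_append, run_append, run_singleton]
  have h1 : MCX.act (A.cntZero 5, ((6, 0) : QName)) (run (A.searchCount D) w) =
      xorf (run (A.searchCount D) w) fun u => decide (u = (6, 0)) && A.accepts D w := by
    funext u
    by_cases hu : u = (6, 0)
    · subst hu; simp [MCX.act, xorf, accepts]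
    · simp [MCX.act, xorf, hu]
  rw [h1, on_avoid (fun g hg => hC g (mem_reverse.1 hg)), run_reverse_run fun g hg => (hC g hg).2.1]
  · funext u
    by_cases hu : u = (6, 0)
    · subst hu; simp [xorf]
    · simp [xorf, hu]
  · grind

lemma Valid.accepts_congr (h : ∀ u ∈ U, u.1 ≠ 6 → w u = w' u) : A.accepts D w = A.accepts D w' := by
  refine holds_congr fun p hp => ?_
  simp only [cntZero, mem_map, mem_range] at hp
  obtain ⟨i, hi, rfl⟩ := hp
  exact run_congr (fun g hg => (hA.fine_searchCount g hg).1) (fun u hu => h u hu.1 hu.2.2) _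
    ⟨(hA.cnt i hi).2, by simp⟩

lemma Valid.run_searchCount (h4 : ∀ a, w (4, a) = false)
    (h5 : ∀ a, w (5, a) = false) : run (A.searchCount D) w = A.setCnt 5
      (A.clauses.countP (A.unsat (A.memb [0] (run (A.search D) w)))) (run (A.search D) w) := by
  have hs : ∀ u : QName, u.1 = 4 ∨ u.1 = 5 → run (A.search D) w u = w u := fun u hu =>
    run_of_notMem (fun g hg => (hA.fine_search g hg).1) w (fun h => by grind)
  have := hA.run_count (yz := 4) (cz := 5) (.inr rfl) (.inr rfl) (base := [0]) (by simp)
    (μ := A.memb [0] (run (A.search D) w)) (c := 0) (w := run (A.search D) w)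
    ⟨fun a _ => by grind, fun i _ => by grind,
      fun _ _ => rfl⟩ A.clauses fun _ h => h
  rw [zero_add] at this
  rw [searchCount, run_append, countAll, this]

lemma Valid.accepts_eq (h4 : ∀ a, w (4, a) = false) (h5 : ∀ a, w (5, a) = false) : A.accepts D w =
      decide (A.clauses.countP (A.unsat (A.memb [0] (run (A.search D) w))) = 0) := by
  rw [accepts, hA.run_searchCount h4 h5]
  refine holds_cntZero (List.countP_le_length.trans_lt hA.length_lt) fun i hi => ?_
  rw [setCnt, if_pos ⟨rfl, hi⟩]

/-- Completeness. Under `Follows` register `0` ends up with exactly the variables of the path, and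
no clause is false after changing these. -/
lemma Valid.accepts_of_follows (hP : A.Follows D P w)
    (h0 : ∀ u : QName, u.1 ≠ 2 → u.1 ≠ 6 → w u = false) : A.accepts D w = true := by
  rw [hA.accepts_eq (fun a => h0 _ (by simp) (by simp)) (fun a => h0 _ (by simp) (by simp)),
    decide_eq_true_eq]
  have hl : (P.drop 0).take (2 ^ D) = P := by
    rw [List.drop_zero, take_of_length_le hP.length_le]
  have hrun := hA.run_gen D 0 0 [] 0 w hP (by omega) (by omega) (dvd_zero _) (by simp) le_rfl
    (by simp) ⟨fun a _ => h0 _ (by simp) (by simp), fun i _ => by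
      rw [h0 _ (by simp) (by simp), zero_testBit], fun v _ => by simp [memb, xorAll_nil]⟩
    fun u hu => h0 u (by omega) (by omega)
  have hm : ∀ v < A.n, A.memb [0] (run (A.search D) w) v = decide (v ∈ P) := by
    intro v hv
    have := hP.reg 0 (by omega) 0 (dvd_zero _) (run (A.search D) w) (fun u hu => by
      rw [search, hrun, xorf, h0 u (by omega) (by omega)]; simp) v hv
    rw [Nat.sub_zero, hl] at this
    simp [memb, xorAll_cons, xorAll_nil, this]
  rw [List.countP_eq_zero]
  intro C hC
  have hu := List.find?_eq_none.1 hP.last C hC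
  intro h
  refine hu ?_
  rw [← h]
  unfold unsat
  rw [Bool.eq_iff_iff]
  simp only [all_eq_true, mem_range]
  exact forall₂_congr fun a ha => by rw [hm _ (hA.lt C hC a ha)]

/-- Soundness, without any condition on the hash values: the final count evaluates the clauses at
whatever assignment register `0` represents when it is read through its patterns, and the decoding
of the outcome reads it in the same way. -/
lemma Valid.forall_of_accepts (h4 : ∀ a, w (4, a) = false)
    (h5 : ∀ a, w (5, a) = false) (h : A.accepts D w = true) :
    ∀ C ∈ A.clauses, A.unsat (A.memb [0] (run (A.search D) w)) C = false := by
  rw [hA.accepts_eq h4 h5, decide_eq_true_eq, List.countP_eq_zero] at h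
  intro C hC
  simpa using h C hC

end Walk

end

section

/-! ### Numbers in binary -/

/-- The number with the binary digits in `l`, at most `N`. -/
def bval (N : ℕ) (l : List Bool) : ℕ := l.foldr (fun b t => min N (2 * t + bif b then 1 else 0)) 0

lemma bval_le (N : ℕ) (l : List Bool) : bval N l ≤ N := by
  cases l with
  | nil => exact Nat.zero_le _
  | cons b l => exact min_le_left _ _

variable {N : ℕ} {l : List Bool}

/-- The cap `N` is there for the calculus of polynomial time functions, in which all intermediate
values have to be bounded. It is inactive for strings which are short enough. -/
lemma bval_cons {b : Bool} (h : 2 ^ (l.length + 1) ≤ N) :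
    bval N (b :: l) = 2 * bval N l + (bif b then 1 else 0) ∧ bval N (b :: l) < 2 ^ (l.length + 1) := by
  induction l generalizing b with
  | nil => cases b <;> simp [bval] at h ⊢; omega
  | cons b' l ih =>
    rw [length_cons] at h ⊢
    have h1 : 2 ^ (l.length + 1 + 1) = 2 * 2 ^ (l.length + 1) := by grind
    have h2 := (ih (b := b') (by omega)).2
    have h3 : bval N (b :: b' :: l) = min N (2 * bval N (b' :: l) + bif b then 1 else 0) := rfl
    have h4 : (bif b then 1 else 0) ≤ 1 := by grind
    have h5 : min N (2 * bval N (b' :: l) + bif b then 1 else 0) =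
        2 * bval N (b' :: l) + bif b then 1 else 0 := min_eq_right (by omega)
    rw [h3, h5]
    exact ⟨rfl, by omega⟩

lemma bval_lt (h : 2 ^ l.length ≤ N) : bval N l < 2 ^ l.length := by
  cases l with
  | nil => simp [bval]
  | cons b l => exact (bval_cons h).2

lemma bval_injective {l' : List Bool} (hl : l.length = l'.length)
    (h : 2 ^ l.length ≤ N) (he : bval N l = bval N l') : l = l' := by
  induction l generalizing l' with
  | nil => exact (length_eq_zero_iff.1 hl.symm).symm
  | cons b l ih =>
    cases l' with
    | nil => simp at hl
    | cons b' l' =>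
      rw [length_cons, length_cons, Nat.add_right_cancel_iff] at hl
      rw [length_cons] at h
      rw [(bval_cons h).1, (bval_cons (by rwa [← hl])).1] at he
      have h1 : 2 ^ l.length ≤ 2 ^ (l.length + 1) := pow_le_pow_right (by omega) (by omega)
      have hb : b = b' := by grind
      subst hb
      rw [ih hl (h1.trans h) (by omega)]

lemma exists_bval {m : ℕ} (hN : 2 ^ m ≤ N) {s : ℕ} (hs : s < 2 ^ m) :
    ∃ l : List Bool, l.length = m ∧ bval N l = s := by
  induction m generalizing s with
  | zero => exact ⟨[], rfl, by simp at hs; simp [bval, hs]⟩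
  | succ m ih =>
    have h1 : 2 ^ (m + 1) = 2 * 2 ^ m := by grind
    obtain ⟨l, hl, hs'⟩ := ih (by omega) (s := s / 2) (by omega)
    refine ⟨decide (s % 2 = 1) :: l, by simp [hl], ?_⟩
    rw [(bval_cons (by rwa [hl])).1, hs']
    by_cases h : s % 2 = 1
    · grind
    · grind

/-! ### The registers -/

namespace Walk

/-- The number of bits which determine the place of a variable in the registers of level `j`. -/
def binBits (D j : ℕ) : ℕ := D + 8 - j / 2

/-- The size of a place in a register of level `j`, for hash values of length `L`. -/
def slot (D L j : ℕ) : ℕ := L - binBits D j + 1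

/-- The number of coins for the search. -/
def numCoins (D : ℕ) : ℕ := 5 * (2 ^ D / 3 + 1)

/-- The size of the zones. -/
def zoneSize (D L q B z : ℕ) : ℕ :=
  [3, q, numCoins D, B, 3, q, 1].getD z
    (bif Nat.ble (z - 7) D then 2 ^ binBits D (z - 7) * slot D L (z - 7) else 0)

/-- The qubits of the circuit. -/
def qubits (D L q B : ℕ) : Set QName := {u | u.2 < zoneSize D L q B u.1}

/-- The hash value of `v`, among all hash values in `H`. -/
def hash (L : ℕ) (H : List Bool) (v : ℕ) : List Bool := (H.drop (v * L)).take L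

/-- The first qubit of the place which is determined by a hash value. -/
def place (D L j : ℕ) (l : List Bool) : ℕ := bval (2 ^ (D + 8)) (l.take (binBits D j)) * slot D L j

/-- In the register of level `j`, the place of `v` is occupied, by the hash value of `v`. -/
def hashPat (D L : ℕ) (H : List Bool) (j v : ℕ) : List (QName × Bool) :=
  ((7 + j, place D L j (hash L H v)), true) ::
    (range (L - binBits D j)).map fun i =>
      ((7 + j, place D L j (hash L H v) + 1 + i), (hash L H v).getD (binBits D j + i) false)

/-- The digits of `e` in the ternary system. -/
def digit (e t : ℕ) : ℕ := e / 3 ^ t % 3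

/-- The coins for step `i` select the literal `a`: three steps share five coins. -/
def coinSel (i a : ℕ) : List (List (QName × Bool)) :=
  ((range 27).filter fun e => digit e (i % 3) == a).map fun e =>
    (range 5).map fun t => ((2, 5 * (i / 3) + t), e.testBit t)

/-- The data of the search from `x` with the hash values in `H`. -/
def ofHash (D L q : ℕ) (F : RawFormula) (x H : List Bool) : Walk :=
  ⟨F.1, F.2, x, hashPat D L H, coinSel, q⟩

variable {D L q B : ℕ} {F : RawFormula} {x H : List Bool}

variable {j : ℕ} {l : List Bool} {i v : ℕ} {w : QName → Bool} {P : List ℕ}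

lemma binBits_le : binBits D j ≤ D + 8 := sub_le _ _

lemma place_add_lt (hL : D + 8 ≤ L) (hl : l.length = L) (hi : i < slot D L j) : place D L j l + i < 2 ^ binBits D j * slot D L j := by
  have hlen : (l.take (binBits D j)).length = binBits D j := by
    rw [length_take]; have := binBits_le (D := D) (j := j); omega
  have h1 := bval_lt (N := 2 ^ (D + 8)) (l := l.take (binBits D j))
    (by rw [hlen]; exact pow_le_pow_right (by omega) binBits_le)
  rw [hlen] at h1
  unfold place
  calc _ < bval (2 ^ (D + 8)) (l.take (binBits D j)) * slot D L j + slot D L j := by omega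
    _ = (bval (2 ^ (D + 8)) (l.take (binBits D j)) + 1) * slot D L j := by ring
    _ ≤ _ := Nat.mul_le_mul_right _ h1

lemma take_eq_of_place_eq {l' : List Bool} (hl : l.length = L)
    (hl' : l'.length = L) {i' : ℕ} (hi : i < slot D L j) (hi' : i' < slot D L j)
    (h : place D L j l + i = place D L j l' + i') :
    l.take (binBits D j) = l'.take (binBits D j) ∧ i = i' := by
  have hb := binBits_le (D := D) (j := j)
  have h1 : bval (2 ^ (D + 8)) (l.take (binBits D j)) = bval (2 ^ (D + 8)) (l'.take (binBits D j)) := by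
    have := congrArg (· / slot D L j) h
    simp only [place] at this
    rwa [Nat.mul_comm, Nat.mul_add_div (by omega), Nat.div_eq_of_lt hi, Nat.mul_comm,
      Nat.mul_add_div (by omega), Nat.div_eq_of_lt hi'] at this
  refine ⟨bval_injective (by simp [hl, hl']) ?_ h1, ?_⟩
  · exact pow_le_pow_right (by omega) (by grind)
  · simp only [place, h1] at h; omega

lemma length_hash (hH : H.length = F.1 * L) (hv : v < F.1) : (hash L H v).length = L := by
  rw [hash, length_take, length_drop, hH, ← Nat.sub_mul]
  refine min_eq_left (Nat.le_mul_of_pos_left _ (by omega))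

lemma mem_hashPat {p : QName × Bool} (hp : p ∈ hashPat D L H j v) :
    p.1.1 = 7 + j ∧ ∃ i < slot D L j, p.1.2 = place D L j (hash L H v) + i := by
  unfold hashPat at hp
  rcases mem_cons.1 hp with rfl | hp
  · exact ⟨rfl, 0, by unfold slot; omega, rfl⟩
  · obtain ⟨i, hi, rfl⟩ := mem_map.1 hp
    rw [mem_range] at hi
    exact ⟨rfl, 1 + i, by unfold slot; omega, by grind⟩

lemma mem_coinSel {a : ℕ} {s : List (QName × Bool)} (hs : s ∈ coinSel i a) :
    s.length = 5 ∧ ∀ p ∈ s, ∃ t < 5, p.1 = (2, 5 * (i / 3) + t) := by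
  obtain ⟨e, -, rfl⟩ := mem_map.1 hs
  refine ⟨by simp, fun p hp => ?_⟩
  obtain ⟨t, ht, rfl⟩ := mem_map.1 hp
  exact ⟨t, mem_range.1 ht, rfl⟩

lemma zoneSize_level (hj : j ≤ D) : zoneSize D L q B (7 + j) = 2 ^ binBits D j * slot D L j := by
  have : Nat.ble j D = true := Nat.ble_eq_true_of_le hj
  rw [zoneSize, List.getD_eq_default _ _ (by simp)]
  simp [this]

lemma valid_ofHash (hL : D + 8 ≤ L) (hH : H.length = F.1 * L)
    (hlt : ∀ C ∈ F.2, ∀ a < 3, (lit C a).2 < F.1) (hq : F.2.length < 2 ^ q) {B' : ℕ}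
    (hB' : q + L + 10 ≤ B') : (ofHash D L q F x H).Valid (qubits D L q B) D B' where
  lt := hlt
  pat j hj v hv p hp := by
    obtain ⟨h1, i, hi, h2⟩ := mem_hashPat hp
    refine ⟨?_, h1⟩
    change p.1.2 < zoneSize D L q B p.1.1
    rw [h1, h2, zoneSize_level hj]
    exact place_add_lt hL (length_hash hH hv) hi
  pat_nodup j hj v hv := by
    simp only [ofHash, hashPat, map_cons, map_map, nodup_cons, mem_map,
      comp_apply, Prod.mk.injEq, true_and, not_exists, not_and]
    refine ⟨fun i _ h => by omega, ?_⟩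
    refine List.Nodup.map (fun i i' h => ?_) List.nodup_range
    simp only [comp_apply, Prod.mk.injEq, true_and] at h
    omega
  pat_length j hj v hv := by
    simp only [ofHash, hashPat, length_cons, length_map, length_range]
    omega
  sel i hi a ha s hs p hp := by
    obtain ⟨t, ht, h⟩ := (mem_coinSel hs).2 p hp
    refine ⟨?_, by rw [h]⟩
    change p.1.2 < zoneSize D L q B p.1.1
    rw [h]
    change 5 * (i / 3) + t < numCoins D
    unfold numCoins
    omega
  sel_length i hi a ha s hs := by
    rw [(mem_coinSel hs).1]
    simp only [ofHash]
    omega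
  q_le := by simp only [ofHash]; omega
  lits a ha := ⟨ha, ha⟩
  cnt i hi := ⟨hi, hi⟩
  length_lt := hq

/-- The hash values represent the relevant parts of `P`. -/
structure GoodHash (D L n : ℕ) (P : List ℕ) (h : ℕ → List Bool) : Prop where
  -- Two variables of the path can occupy the same register of level `j` only if their positions
  -- differ by less than `2^(D-j)`. Collisions of more distant ones are harmless.
  bins : ∀ p p', p < p' → p' < P.length → ∀ j ≤ D, p' - p < 2 ^ (D - j) →
    ((h (P.getD p 0)).take (binBits D j)) ≠ ((h (P.getD p' 0)).take (binBits D j))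
  full : ∀ v ∈ P, ∀ v' < n, v' ≠ v → h v' ≠ h v

lemma xorAll_of_unique {l : List ℕ} (hl : l.Nodup) (hv : v ∈ l) {f : ℕ → Bool}
    (h : ∀ v' ∈ l, v' ≠ v → f v' = false) : xorAll (l.map f) = f v := by
  induction l with
  | nil => simp at hv
  | cons a l ih =>
    rw [nodup_cons] at hl
    rw [map_cons, xorAll_cons]
    rcases mem_cons.1 hv with rfl | hv'
    · have : l.map f = l.map fun _ => false :=
        map_congr_left fun v' hv' => h v' (by simp [hv']) (by grind)
      rw [this, xorAll_false, Bool.xor_false]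
    · rw [ih hl.2 hv' (fun v' h' => h v' (by simp [h'])), h a (by simp) (by grind),
        Bool.false_xor]

/-- If the qubit `u` in the place of `v` belongs to the place of `v'` as well, then the places
are equal. -/
lemma take_eq_of_mem_patT (hH : H.length = F.1 * L) {v' : ℕ} (hv : v < F.1)
    (hv' : v' < F.1) (hi : i < slot D L j)
    (h : ((7 + j, place D L j (hash L H v) + i) : QName) ∈ (ofHash D L q F x H).patT j v') :
    (hash L H v).take (binBits D j) = (hash L H v').take (binBits D j) := by
  obtain ⟨p, hp, he⟩ := mem_map.1 h
  obtain ⟨-, i', hi', h2⟩ := mem_hashPat (mem_filter.1 hp).1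
  rw [he] at h2
  exact (take_eq_of_place_eq (length_hash hH hv) (length_hash hH hv') hi hi' h2).1

lemma mem_patT_iff {v' : ℕ} (h : (hash L H v).take (binBits D j) = (hash L H v').take (binBits D j)) :
    ((7 + j, place D L j (hash L H v)) : QName) ∈ (ofHash D L q F x H).patT j v' ∧
    ∀ i < L - binBits D j, (((7 + j, place D L j (hash L H v) + 1 + i) : QName) ∈
      (ofHash D L q F x H).patT j v' ↔ (hash L H v').getD (binBits D j + i) false = true) := by
  have hp : place D L j (hash L H v) = place D L j (hash L H v') := by rw [place, h]; rfl
  rw [hp]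
  constructor
  · refine mem_map.2 ⟨((7 + j, place D L j (hash L H v')), true), ?_, rfl⟩
    rw [mem_filter]
    exact ⟨List.mem_cons_self, rfl⟩
  · intro i hi
    constructor
    · intro h
      obtain ⟨p, hp, he⟩ := mem_map.1 h
      obtain ⟨h1, h2⟩ := mem_filter.1 hp
      rcases mem_cons.1 h1 with rfl | h1
      · grind
      · grind
    · intro h
      refine mem_map.2 ⟨((7 + j, place D L j (hash L H v') + 1 + i), true), ?_, rfl⟩
      rw [mem_filter]
      refine ⟨mem_cons_of_mem _ (mem_map.2 ⟨i, mem_range.2 hi, ?_⟩), rfl⟩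
      rw [h]

/-- A place is used by at most one variable of the chunk. If the place of `v` is empty, its first
qubit says so. If it is used by `v'`, then the address gives equality of the prefixes, and comparing
the stored bits decides whether the full hash values agree; by `hfull` this happens only for `v =
v'`. -/
lemma holds_hashPat (hH : H.length = F.1 * L) {l : List ℕ} (hl : l.Nodup) (hlt : ∀ v ∈ l, v < F.1)
    (hbins : ∀ v ∈ l, ∀ v' ∈ l, v ≠ v' →
      (hash L H v).take (binBits D j) ≠ (hash L H v').take (binBits D j))
    (hfull : ∀ v ∈ l, ∀ v' < F.1, v' ≠ v → hash L H v' ≠ hash L H v)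
    (hw : ∀ u : QName, u.1 = 7 + j → w u = (ofHash D L q F x H).regX j l u) (hv : v < F.1) :
    holds w (hashPat D L H j v) = decide (v ∈ l) := by
  have hslot0 : 0 < slot D L j := by unfold slot; omega
  have hslot : ∀ i < L - binBits D j, 1 + i < slot D L j := fun i hi => by unfold slot; omega
  by_cases hex : ∃ v' ∈ l, (hash L H v).take (binBits D j) = (hash L H v').take (binBits D j)
  · obtain ⟨v', hv', he⟩ := hex
    have hone : ∀ u : QName, (∃ i < slot D L j, u = (7 + j, place D L j (hash L H v) + i)) →
        w u = decide (u ∈ (ofHash D L q F x H).patT j v') := by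
      rintro u ⟨i, hi, rfl⟩
      rw [hw _ rfl, regX]
      refine xorAll_of_unique hl hv' fun v'' h'' hne => decide_eq_false fun hm => ?_
      have := take_eq_of_mem_patT hH hv (hlt v'' h'') hi hm
      exact hbins v' hv' v'' h'' hne.symm (he ▸ this)
    obtain ⟨m1, m2⟩ := mem_patT_iff (q := q) (F := F) (x := x) he
    have hw0 : w (7 + j, place D L j (hash L H v)) = true := by
      rw [hone (7 + j, place D L j (hash L H v)) ⟨0, hslot0, rfl⟩, decide_eq_true_eq]
      exact m1
    have hwi : ∀ i < L - binBits D j, w (7 + j, place D L j (hash L H v) + 1 + i) =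
        (hash L H v').getD (binBits D j + i) false := fun i hi => by
      rw [hone _ ⟨1 + i, hslot i hi, by grind⟩]
      rw [Bool.eq_iff_iff, decide_eq_true_eq]
      exact m2 i hi
    rw [hashPat, holds_cons, hw0, beq_self_eq_true, Bool.true_and, Bool.eq_iff_iff, holds,
      decide_eq_true_eq]
    simp only [all_map, all_eq_true, mem_range, comp_apply, beq_iff_eq]
    have l1 := length_hash (L := L) hH hv
    have l2 := length_hash (L := L) hH (hlt v' hv')
    constructor
    · intro h
      have heq : hash L H v = hash L H v' := by
        refine List.ext_getElem (by rw [l1, l2]) fun i h1 h2 => ?_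
        rcases Nat.lt_or_ge i (binBits D j) with hi | hi
        · have := congrArg (fun l => l[i]?) he
          simp only [List.getElem?_take, hi, if_true] at this
          rw [List.getElem?_eq_getElem h1, List.getElem?_eq_getElem h2] at this
          exact Option.some.inj this
        · have h3 := (hwi (i - binBits D j) (by omega)).symm.trans (h (i - binBits D j) (by omega))
          rw [Nat.add_sub_cancel' hi] at h3
          rw [getD_eq_getElem _ _ h1, getD_eq_getElem _ _ h2] at h3
          exact h3.symm
      by_cases hvv : v = v'
      · grind
      · grind
    · grind
  · push Not at hex
    have hnot : v ∉ l := fun h => hex v h rfl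
    have hw0 : w (7 + j, place D L j (hash L H v)) = false := by
      rw [hw _ rfl, regX]
      have : (l.map fun v' => decide (((7 + j, place D L j (hash L H v)) : QName) ∈
          (ofHash D L q F x H).patT j v')) = l.map fun _ => false :=
        map_congr_left fun v' hv' => decide_eq_false fun hm =>
          hex v' hv' (take_eq_of_mem_patT (i := 0) hH hv (hlt v' hv') hslot0 hm)
      rw [this, xorAll_false]
    rw [hashPat, holds_cons, hw0]
    simp [hnot]

lemma GoodHash.ne_of_mem_chunk {n : ℕ} {h : ℕ → List Bool} (hg : GoodHash D L n P h) (hj : j ≤ D) (i : ℕ) :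
    ∀ v ∈ (P.drop i).take (2 ^ (D - j)), ∀ v' ∈ (P.drop i).take (2 ^ (D - j)), v ≠ v' →
      (h v).take (binBits D j) ≠ (h v').take (binBits D j) := by
  have hget : ∀ v ∈ (P.drop i).take (2 ^ (D - j)), ∃ p, i ≤ p ∧ p < i + 2 ^ (D - j) ∧
      p < P.length ∧ P.getD p 0 = v := by
    intro v hv
    obtain ⟨t, ht, rfl⟩ := List.mem_iff_getElem.1 hv
    rw [length_take, length_drop] at ht
    refine ⟨i + t, by omega, by omega, by omega, ?_⟩
    rw [List.getElem_take, List.getElem_drop, getD_eq_getElem _ _ (by omega)]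
  intro v hv v' hv' hne
  obtain ⟨p, h1, h2, h3, rfl⟩ := hget v hv
  obtain ⟨p', h1', h2', h3', rfl⟩ := hget v' hv'
  rcases Nat.lt_trichotomy p p' with hlt | rfl | hlt
  · exact hg.bins p p' hlt h3' j hj (by omega)
  · grind
  · exact (hg.bins p' p hlt h3 j hj (by omega)).symm

/-- The conditions listed in `coinSel` exclude each other, one for each value `e < 27` of the five
coins; hence their parity is their disjunction, and only `e = c` contributes. Five coins for three
ternary digits amount to `5/3` coins for each step. -/
lemma pick_coinSel {c a : ℕ} (hc : c < 27) (hw : ∀ t < 5, w (2, 5 * (i / 3) + t) = c.testBit t) :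
    (ofHash D L q F x H).pick w i a = (a == digit c (i % 3)) := by
  have hh : ∀ e < 27, holds w ((range 5).map fun t =>
      (((2, 5 * (i / 3) + t) : QName), e.testBit t)) = decide (e = c) := by
    intro e he
    rw [holds, all_map, Bool.eq_iff_iff, decide_eq_true_eq]
    simp only [all_eq_true, mem_range, comp_apply, beq_iff_eq]
    constructor
    · intro h
      refine Nat.eq_of_testBit_eq fun t => ?_
      rcases Nat.lt_or_ge t 5 with ht | ht
      · grind
      · have hp : 2 ^ 5 ≤ 2 ^ t := pow_le_pow_right (by omega) ht
        rw [Nat.testBit_lt_two_pow (by omega), Nat.testBit_lt_two_pow (by omega)]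
    · grind
  change xorAll ((coinSel i a).map (holds w)) = _
  rw [coinSel, map_map]
  rw [map_congr_left (g := fun e => decide (e = c)) fun e he => by grind]
  by_cases hd : a = digit c (i % 3)
  · rw [xorAll_of_unique (List.nodup_range.filter _) (v := c)
      (by grind) (fun v' _ hne => by simp [hne])]
    simp [hd]
  · have hz : (((range 27).filter fun e => digit e (i % 3) == a).map fun e => decide (e = c)) =
        ((range 27).filter fun e => digit e (i % 3) == a).map fun _ => false :=
      map_congr_left fun e he => by grind
    rw [hz, xorAll_false]
    simp [hd]

/-- For each sequence of literals there are coins which select it. -/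
lemma exists_coins (a : ℕ → ℕ) (ha : ∀ i, a i < 3) : ∃ ω : ℕ → Bool, ∀ w : QName → Bool,
    (∀ t, w (2, t) = ω t) → ∀ i, ∀ a' < 3, (ofHash D L q F x H).pick w i a' = (a' == a i) := by
  set c : ℕ → ℕ := fun g => a (3 * g) + 3 * a (3 * g + 1) + 9 * a (3 * g + 2) with hc
  refine ⟨fun t => (c (t / 5)).testBit (t % 5), fun w hw i a' ha' => ?_⟩
  have b0 := ha (3 * (i / 3))
  have b1 := ha (3 * (i / 3) + 1)
  have b2 := ha (3 * (i / 3) + 2)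
  rw [pick_coinSel (c := c (i / 3)) (by grind) (fun t ht => by grind)]
  have hd : digit (c (i / 3)) (i % 3) = a i := by
    have hi : i = 3 * (i / 3) + i % 3 := by omega
    have h3 : i % 3 < 3 := mod_lt _ (by omega)
    conv_rhs => rw [hi]
    simp only [hc, digit]
    set g := i / 3
    generalize i % 3 = m at h3
    interval_cases m
    · grind
    · grind
    · grind
  rw [hd]

/-- A way from `x` to a solution: always a literal of the first clause which is false. -/
structure IsPath (F : RawFormula) (x : List Bool) (P : List ℕ) : Prop where
  nodup : P.Nodup
  lt : ∀ v ∈ P, v < F.1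
  last : F.2.find? (fun C => (range 3).all fun a =>
    xor (x.getD (lit C a).2 false) (decide ((lit C a).2 ∈ P)) != (lit C a).1) = none
  step : ∀ i < P.length, ∃ C, ∃ a < 3, F.2.find? (fun C => (range 3).all fun a =>
    xor (x.getD (lit C a).2 false) (decide ((lit C a).2 ∈ P.take i)) != (lit C a).1) = some C ∧
    P[i]? = some (lit C a).2

lemma IsPath.exists_follows (hP : IsPath F x P) (hlen : P.length ≤ 2 ^ D)
    (hH : H.length = F.1 * L) (hg : GoodHash D L F.1 P (hash L H)) :
    ∃ ω : ℕ → Bool, ∀ w : QName → Bool, (∀ t, w (2, t) = ω t) →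
      (ofHash D L q F x H).Follows D P w := by
  -- Beyond the end of the path the literal `0` is taken as a default. It has no effect, because no
  -- clause is false any more.
  have hex : ∀ i, ∃ a, a < 3 ∧ (i < P.length → ∃ C, F.2.find? (fun C => (range 3).all fun a =>
      xor (x.getD (lit C a).2 false) (decide ((lit C a).2 ∈ P.take i)) != (lit C a).1) = some C ∧
      P[i]? = some (lit C a).2) := by
    intro i
    by_cases hi : i < P.length
    · obtain ⟨C, a, ha, h1, h2⟩ := hP.step i hi
      exact ⟨a, ha, fun _ => ⟨C, h1, h2⟩⟩
    · exact ⟨0, by omega, fun h => absurd h hi⟩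
  choose a ha hstep using hex
  obtain ⟨ω, hω⟩ := exists_coins (D := D) (L := L) (q := q) (F := F) (x := x) (H := H) a ha
  refine ⟨ω, fun w hw => ⟨hP.nodup, hP.lt, hlen, hP.last, fun i hi => ?_, ?_⟩⟩
  · obtain ⟨C, h1, h2⟩ := hstep i hi
    exact ⟨C, a i, ha i, h1, h2, hω w hw i⟩
  · intro j hj i _ w' hw' v hv
    have hmem : ∀ v ∈ (P.drop i).take (2 ^ (D - j)), v ∈ P := fun v hv =>
      List.mem_of_mem_drop (mem_of_mem_take hv)
    exact holds_hashPat hH ((hP.nodup.sublist (List.drop_sublist _ _)).sublist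
      (List.take_sublist _ _)) (fun v hv => hP.lt v (hmem v hv)) (hg.ne_of_mem_chunk hj i)
      (fun v hv => hg.full v (hmem v hv)) hw' hv

end Walk

end

section

open Walk (lit IsPath)

/-! ### Ways to a solution -/

/-- The places where `y` differs from `z`. -/
def diff (n : ℕ) (y : List Bool) (z : ℕ → Bool) : Finset ℕ :=
  (Finset.range n).filter fun i => y.getD i false ≠ z i

/-- The assignment `z` is a solution. -/
def IsSolution (F : RawFormula) (z : ℕ → Bool) : Prop :=
  ∀ C ∈ F.2, ∃ a < 3, z (lit C a).2 = (lit C a).1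

variable {F : RawFormula} {z : ℕ → Bool} {y : List Bool} {p : Prop}

/-- In a false clause some literal is true under `z`, and its variable is one of the places where
the current assignment differs from `z`. Changing it brings the assignment nearer to `z`, so no
variable is used twice and the length is at most the distance. -/
lemma exists_isPath (hz : IsSolution F z)
    (hF : ∀ C ∈ F.2, ∀ a < 3, (lit C a).2 < F.1) (y : List Bool) :
    ∃ P, IsPath F y P ∧ P.length ≤ (diff F.1 y z).card := by
  have key : ∀ m, ∃ P : List ℕ, P.Nodup ∧ (∀ v ∈ P, v ∈ diff F.1 y z) ∧
      (∀ i < P.length, ∃ C, ∃ a < 3, F.2.find? (fun C => (range 3).all fun a =>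
        xor (y.getD (lit C a).2 false) (decide ((lit C a).2 ∈ P.take i)) != (lit C a).1) = some C ∧
        P[i]? = some (lit C a).2) ∧
      (F.2.find? (fun C => (range 3).all fun a =>
        xor (y.getD (lit C a).2 false) (decide ((lit C a).2 ∈ P)) != (lit C a).1) = none ∨
        P.length = m) := by
    intro m
    induction m with
    | zero => exact ⟨[], by simp⟩
    | succ m ih =>
      obtain ⟨P, h1, h2, h3, h4⟩ := ih
      by_cases hlast : F.2.find? (fun C => (range 3).all fun a =>
          xor (y.getD (lit C a).2 false) (decide ((lit C a).2 ∈ P)) != (lit C a).1) = none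
      · exact ⟨P, h1, h2, h3, .inl hlast⟩
      obtain ⟨C, hC⟩ := Option.ne_none_iff_exists'.1 hlast
      have hCmem := List.mem_of_find?_eq_some hC
      have hCbad := List.find?_some hC
      simp only [all_eq_true, mem_range, bne_iff_ne, ne_eq] at hCbad
      obtain ⟨a, ha, hza⟩ := hz C hCmem
      set v := (lit C a).2 with hv
      have hne := hCbad a ha
      rw [← hv, ← hza] at hne
      have hvP : v ∉ P := fun hvP => by
        have := (Finset.mem_filter.1 (h2 v hvP)).2
        simp only [hvP, decide_true] at hne
        cases h : y.getD v false <;> cases h' : z v <;> simp_all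
      have hvd : v ∈ diff F.1 y z := by
        refine Finset.mem_filter.2 ⟨Finset.mem_range.2 (hF C hCmem a ha), ?_⟩
        simpa [hvP] using hne
      refine ⟨P ++ [v], ?_, ?_, ?_, .inr (by rw [length_append, h4.resolve_left hlast]; rfl)⟩
      · rw [nodup_append]
        refine ⟨h1, by simp, ?_⟩
        rintro b hb c hc rfl
        rw [mem_singleton] at hc
        exact hvP (hc ▸ hb)
      · intro u hu
        rcases mem_append.1 hu with hu | hu
        · exact h2 u hu
        · grind
      · intro i hi
        rw [length_append, List.length_singleton] at hi
        rw [List.take_append_of_le_length (by omega)]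
        rcases Nat.lt_or_ge i P.length with hi' | hi'
        · obtain ⟨C', a', ha', h5, h6⟩ := h3 i hi'
          exact ⟨C', a', ha', h5, by grind⟩
        · obtain rfl : i = P.length := by omega
          refine ⟨C, a, ha, ?_, by simp [hv]⟩
          rw [List.take_length]
          exact hC
  -- A list of distinct elements of `diff` cannot have one element more than `diff`, so at this
  -- value of `m` the construction must have stopped at a solution.
  obtain ⟨P, h1, h2, h3, h4⟩ := key ((diff F.1 y z).card + 1)
  have hle : P.length ≤ (diff F.1 y z).card := by
    rw [← List.toFinset_card_of_nodup h1]
    exact card_le_card fun v hv => h2 v (List.mem_toFinset.1 hv)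
  refine ⟨P, ⟨h1, fun v hv => ?_, h4.resolve_right (by omega), h3⟩, hle⟩
  exact Finset.mem_range.1 (Finset.mem_filter.1 (h2 v hv)).1

/-- All clauses are true, and have three literals. -/
lemma isPath_nil
    (h : ∀ C ∈ F.2, ∃ a < 3, y.getD (lit C a).2 false = (lit C a).1) : IsPath F y [] := by
  refine ⟨List.nodup_nil, by simp, ?_, by simp⟩
  rw [List.find?_eq_none]
  intro C hC
  obtain ⟨a, ha, he⟩ := h C hC
  simp only [all_eq_true, mem_range, bne_iff_ne, ne_eq, not_forall]
  exact ⟨a, ha, by grind⟩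

/-! ### The random walk -/

/-- Change the value of the variable `v`. -/
def flipAt (y : List Bool) (v : ℕ) : List Bool :=
  (range y.length).map fun u => Bool.xor (y.getD u false) (u == v)

/-- The first clause which is false under `y`. -/
def firstFalse (F : RawFormula) (y : List Bool) : List (Bool × ℕ) :=
  (F.2.filter (unsatClause y)).headD []

/-- One step of the walk: change one of the three variables of the first clause which is false, or
nothing. -/
def walkStep (F : RawFormula) (y : List Bool) (b₁ b₂ : Bool) : List Bool :=
  bif satRaw F y then y else
    bif b₁ && b₂ then y else
      flipAt y ((firstFalse F y).getD (bif b₁ then 2 else bif b₂ then 1 else 0) (false, 0)).2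

/-- The state of the walk after `t` steps. -/
def walk (F : RawFormula) (x : List Bool) (t : ℕ) (ρ : List Bool) : List Bool :=
  (range t).foldl (fun y i => walkStep F y (ρ.getD (2 * i) false) (ρ.getD (2 * i + 1) false)) x

lemma walk_succ (F : RawFormula) (x : List Bool) (t : ℕ) (b₁ b₂ : Bool) (ρ : List Bool) :
    walk F x (t + 1) (b₁ :: b₂ :: ρ) = walk F (walkStep F x b₁ b₂) t ρ := by
  rw [walk, List.range_succ_eq_map, foldl_cons, List.foldl_map]
  rfl

lemma walk_append (F : RawFormula) (x : List Bool) (t : ℕ) (ρ ρ' : List Bool)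
    (h : 2 * t ≤ ρ.length) : walk F x t (ρ ++ ρ') = walk F x t ρ := by
  refine List.foldl_ext _ _ _ fun y i hi => ?_
  rw [mem_range] at hi
  rw [getD_append _ _ _ _ (by omega), getD_append _ _ _ _ (by omega)]

lemma length_flipAt (y : List Bool) (v : ℕ) : (flipAt y v).length = y.length := by simp [flipAt]

lemma length_walkStep (F : RawFormula) (y : List Bool) (b₁ b₂ : Bool) :
    (walkStep F y b₁ b₂).length = y.length := by
  unfold walkStep
  cases satRaw F y <;> cases b₁ <;> cases b₂ <;> simp [length_flipAt]

lemma length_walk (F : RawFormula) (x : List Bool) (t : ℕ) (ρ : List Bool) :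
    (walk F x t ρ).length = x.length := by
  unfold walk
  induction t with
  | zero => rfl
  | succ t ih => rw [range_succ, foldl_append, foldl_cons, foldl_nil,
      length_walkStep, ih]

lemma getD_flipAt {v u : ℕ} (hu : u < y.length) :
    (flipAt y v).getD u false = Bool.xor (y.getD u false) (u == v) := by
  rw [flipAt, getD_eq_getElem _ _ (by simpa using hu)]
  simp

lemma diff_flipAt_of_mem {n : ℕ} (hy : y.length = n) {v : ℕ}
    (hv : v ∈ diff n y z) : diff n (flipAt y v) z = (diff n y z).erase v := by
  ext u
  simp only [diff, Finset.mem_filter, Finset.mem_range, Finset.mem_erase] at hv ⊢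
  by_cases hu : u < n
  · rw [getD_flipAt (by omega)]
    by_cases huv : u = v
    · subst huv
      have := hv.2
      cases h : y.getD u false <;> cases h' : z u <;> simp_all
    · have h : (u == v) = false := by simpa using huv
      rw [h, Bool.xor_false]
      simp [huv, hu]
  · simp [hu]

lemma card_diff_flipAt_le {n : ℕ} (hy : y.length = n) (v : ℕ) :
    (diff n (flipAt y v) z).card ≤ (diff n y z).card + 1 := by
  refine (card_le_card (t := insert v (diff n y z)) fun u hu => ?_).trans
    (Finset.card_insert_le _ _)
  simp only [diff, Finset.mem_filter, Finset.mem_range, Finset.mem_insert] at hu ⊢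
  rw [getD_flipAt (by omega)] at hu
  by_cases huv : u = v
  · exact .inl huv
  · have h : (u == v) = false := by simpa using huv
    rw [h, Bool.xor_false] at hu
    exact .inr hu

/-! ### Hitting probabilities -/

/-- The probability that a walk on the natural numbers, which goes down with probability `1/4`, stays
with probability `1/4` and goes up with probability `1/2`, is at `0` within `t` steps. -/
def hit : ℕ → ℕ → ℝ
  | 0, 0 => 1
  | 0, _ + 1 => 0
  | _ + 1, 0 => 1
  | t + 1, k + 1 => 1 / 4 * hit t k + 1 / 4 * hit t (k + 1) + 1 / 2 * hit t (k + 2)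

lemma hit_zero_right (t : ℕ) : hit t 0 = 1 := by cases t <;> rfl

lemma hit_mem (t k : ℕ) : 0 ≤ hit t k ∧ hit t k ≤ 1 := by
  induction t generalizing k with
  | zero => cases k <;> simp [hit]
  | succ t ih =>
    cases k with
    | zero => simp [hit]
    | succ k =>
      have h0 := ih k
      have h1 := ih (k + 1)
      have h2 := ih (k + 2)
      simp only [hit]
      constructor <;> linarith

lemma hit_antitone (t : ℕ) : Antitone (hit t) := by
  refine antitone_nat_of_succ_le fun k => ?_
  induction t generalizing k with
  | zero => cases k <;> simp [hit]
  | succ t ih =>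
    cases k with
    | zero => rw [hit_zero_right]; exact (hit_mem _ _).2
    | succ k =>
      have h0 := ih k
      have h1 := ih (k + 1)
      have h2 := ih (k + 2)
      simp only [hit]
      linarith

/-- For the walk with probabilities `1/4`, `1/4`, `1/2`, the function `(1/2)^k` is harmonic, and
`(3/4)^k` is multiplied by `1/4 · 4/3 + 1/4 + 1/2 · 3/4 = 23/24` in each step. The second term
therefore bounds the error caused by the finite time, and it dominates `(1/2)^k` at time `0`. -/
lemma le_hit (t k : ℕ) : (1 / 2 : ℝ) ^ k - (23 / 24) ^ t * (3 / 4) ^ k ≤ hit t k := by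
  induction t generalizing k with
  | zero =>
    cases k with
    | zero => simp [hit]
    | succ k =>
      have : (1 / 2 : ℝ) ^ (k + 1) ≤ (3 / 4) ^ (k + 1) :=
        pow_le_pow_left₀ (by norm_num) (by norm_num) _
      simp only [hit, pow_zero, one_mul]
      linarith
  | succ t ih =>
    cases k with
    | zero =>
      have : (0 : ℝ) ≤ (23 / 24) ^ (t + 1) := by positivity
      simp only [hit, pow_zero, mul_one]
      linarith
    | succ k =>
      have h0 := ih k
      have h1 := ih (k + 1)
      have h2 := ih (k + 2)
      simp only [hit, pow_succ] at *
      linarith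

lemma hit_succ_le {t k k₀ k₁ k₂ k₃ : ℕ} (hk : 0 < k) (h0 : k₀ ≤ k - 1) (h1 : k₁ ≤ k)
    (h2 : k₂ ≤ k + 1) (h3 : k₃ ≤ k + 1) :
    hit (t + 1) k ≤ 1 / 4 * (hit t k₀ + hit t k₁ + hit t k₂ + hit t k₃) := by
  obtain ⟨k, rfl⟩ : ∃ k', k = k' + 1 := ⟨k - 1, by omega⟩
  have a0 := hit_antitone t (show k₀ ≤ k by omega)
  have a1 := hit_antitone t h1
  have a2 := hit_antitone t (show k₂ ≤ k + 2 by omega)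
  have a3 := hit_antitone t (show k₃ ≤ k + 2 by omega)
  simp only [hit]
  linarith

/-- The state is good: a solution, or near to the solution `z`. -/
def GoodState (F : RawFormula) (z : ℕ → Bool) (r : ℕ) (y : List Bool) : Prop :=
  satRaw F y = true ∨ (diff F.1 y z).card ≤ r

open Classical in
/-- The indicator of a proposition. -/
def ind (p : Prop) : ℝ := if p then 1 else 0

lemma ind_pos (h : p) : ind p = 1 := if_pos h
lemma ind_neg (h : ¬ p) : ind p = 0 := if_neg h
lemma ind_nonneg (p : Prop) : 0 ≤ ind p := by unfold ind; split_ifs <;> norm_num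
lemma ind_le_one (p : Prop) : ind p ≤ 1 := by unfold ind; split_ifs <;> norm_num

/-- The probability that the state after `t` steps is good. -/
def goodProb (F : RawFormula) (z : ℕ → Bool) (r t : ℕ) (x : List Bool) : ℝ :=
  (1 / 4) ^ t * bsum (2 * t) fun ρ => ind (GoodState F z r (walk F x t ρ))

lemma goodProb_nonneg (F : RawFormula) (z : ℕ → Bool) (r t : ℕ) (x : List Bool) :
    0 ≤ goodProb F z r t x :=
  mul_nonneg (by positivity) (bsum_nonneg fun ρ _ => ind_nonneg _)

lemma goodProb_succ (F : RawFormula) (z : ℕ → Bool) (r t : ℕ) (x : List Bool) :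
    goodProb F z r (t + 1) x = 1 / 4 * (goodProb F z r t (walkStep F x false false) +
      goodProb F z r t (walkStep F x false true) + goodProb F z r t (walkStep F x true false) +
      goodProb F z r t (walkStep F x true true)) := by
  simp only [goodProb]
  rw [show 2 * (t + 1) = 2 * t + 1 + 1 by ring, bsum_succ', bsum_succ', bsum_succ']
  simp only [walk_succ]
  ring

/-- The clauses of the formula have three literals, each with one of the variables. -/
structure ThreeSAT (F : RawFormula) : Prop where
  length : ∀ C ∈ F.2, C.length = 3
  lt : ∀ C ∈ F.2, ∀ a < 3, (lit C a).2 < F.1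

lemma unsatClause_eq {C : List (Bool × ℕ)} (hC : C.length = 3) (y : List Bool) :
    unsatClause y C = true ↔ ∀ a < 3, y.getD (lit C a).2 false ≠ (lit C a).1 := by
  obtain ⟨l0, l1, l2, rfl⟩ := List.length_eq_three.1 hC
  simp only [unsatClause, all_cons, all_nil, Bool.and_true, Bool.and_eq_true,
    not_eq_true', beq_eq_false_iff_ne, lit]
  constructor
  · grind
  · intro h
    exact ⟨h 0 (by omega), h 1 (by omega), h 2 (by omega)⟩

lemma satRaw_iff (hF : ThreeSAT F) (y : List Bool) :
    satRaw F y = true ↔ ∀ C ∈ F.2, ∃ a < 3, y.getD (lit C a).2 false = (lit C a).1 := by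
  simp only [satRaw, all_eq_true, not_eq_true']
  refine forall₂_congr fun C hC => ?_
  rw [← not_eq_true, unsatClause_eq (hF.length C hC)]
  push Not
  rfl

lemma firstFalse_spec (h : satRaw F y = false) :
    firstFalse F y ∈ F.2 ∧ unsatClause y (firstFalse F y) = true := by
  have hne : F.2.filter (unsatClause y) ≠ [] := by
    intro he
    rw [List.filter_eq_nil_iff] at he
    have : satRaw F y = true := by
      simp only [satRaw, all_eq_true, not_eq_true']
      exact fun C hC => by grind
    rw [h] at this
    exact absurd this (by simp)
  have hm : firstFalse F y ∈ F.2.filter (unsatClause y) := by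
    unfold firstFalse
    cases hl : F.2.filter (unsatClause y) with
    | nil => exact absurd hl hne
    | cons a l => simp
  exact mem_filter.1 hm

/-- Comparison with the walk on the distances. At a state that is not good, one of the three changes
lowers the distance, the other two raise it by at most one, and the fourth outcome of the two coins
does nothing; `hit` is antitone, so this is the worst case. The sum over `t` replaces the event of
being good at some time, because the number of steps will be chosen at random and the search is
started at that time only. -/
lemma hit_le_sum_goodProb (hF : ThreeSAT F) (hz : IsSolution F z)
    (r T : ℕ) (x : List Bool) (hx : x.length = F.1) :
    hit T ((diff F.1 x z).card - r) ≤ ∑ t ∈ Finset.range (T + 1), goodProb F z r t x := by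
  induction T generalizing x with
  | zero =>
    rw [Finset.sum_range_one]
    simp only [goodProb, pow_zero, one_mul, mul_zero, bsum_zero]
    by_cases hg : GoodState F z r (walk F x 0 [])
    · rw [ind_pos hg]; exact (hit_mem _ _).2
    · rw [ind_neg hg]
      have : ¬ (diff F.1 x z).card ≤ r := fun h => hg (.inr h)
      obtain ⟨k, hk⟩ : ∃ k, (diff F.1 x z).card - r = k + 1 := ⟨(diff F.1 x z).card - r - 1, by omega⟩
      rw [hk, hit]
  | succ T ih =>
    by_cases hg : GoodState F z r x
    · refine (hit_mem _ _).2.trans ?_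
      have h0 : goodProb F z r 0 x = 1 := by
        simp only [goodProb, pow_zero, one_mul, mul_zero, bsum_zero]
        exact ind_pos hg
      rw [← h0]
      exact Finset.single_le_sum (f := fun t => goodProb F z r t x)
        (fun t _ => goodProb_nonneg F z r t x) (Finset.mem_range.2 (Nat.succ_pos _))
    · rw [GoodState, not_or] at hg
      have hsat : satRaw F x = false := by grind
      rw [Finset.sum_range_succ']
      have h0 : 0 ≤ goodProb F z r 0 x := goodProb_nonneg F z r 0 x
      have hsum : ∑ t ∈ Finset.range (T + 1), goodProb F z r (t + 1) x = 1 / 4 *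
          ((∑ t ∈ Finset.range (T + 1), goodProb F z r t (walkStep F x false false)) +
          (∑ t ∈ Finset.range (T + 1), goodProb F z r t (walkStep F x false true)) +
          (∑ t ∈ Finset.range (T + 1), goodProb F z r t (walkStep F x true false)) +
          (∑ t ∈ Finset.range (T + 1), goodProb F z r t (walkStep F x true true))) := by
        simp only [goodProb_succ]
        rw [← mul_sum, sum_add_distrib, sum_add_distrib, sum_add_distrib]
      rw [hsum]
      have hstep : ∀ b₁ b₂, hit T ((diff F.1 (walkStep F x b₁ b₂) z).card - r) ≤
          ∑ t ∈ Finset.range (T + 1), goodProb F z r t (walkStep F x b₁ b₂) := fun b₁ b₂ =>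
        ih _ (by rw [length_walkStep, hx])
      have s00 := hstep false false
      have s01 := hstep false true
      have s10 := hstep true false
      have s11 := hstep true true
      obtain ⟨hC, hCf⟩ := firstFalse_spec hsat
      set C := firstFalse F x with hCdef
      have e : ∀ a, (lit C a).2 = (C.getD a (false, 0)).2 := fun _ => rfl
      have e00 : walkStep F x false false = flipAt x (lit C 0).2 := by simp [walkStep, hsat, ← hCdef, lit]
      have e01 : walkStep F x false true = flipAt x (lit C 1).2 := by simp [walkStep, hsat, ← hCdef, lit]
      have e10 : walkStep F x true false = flipAt x (lit C 2).2 := by simp [walkStep, hsat, ← hCdef, lit]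
      have e11 : walkStep F x true true = x := by simp [walkStep, hsat]
      rw [e00] at s00
      rw [e01] at s01
      rw [e10] at s10
      rw [e11] at s11
      rw [e00, e01, e10, e11]
      have c0 := card_diff_flipAt_le (z := z) hx (lit C 0).2
      have c1 := card_diff_flipAt_le (z := z) hx (lit C 1).2
      have c2 := card_diff_flipAt_le (z := z) hx (lit C 2).2
      obtain ⟨a, ha, hza⟩ := hz C hC
      have hmem : (lit C a).2 ∈ diff F.1 x z := by
        refine Finset.mem_filter.2 ⟨Finset.mem_range.2 (hF.lt C hC a ha), ?_⟩
        rw [hza]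
        exact (unsatClause_eq (hF.length C hC) x).1 hCf a ha
      have hd := congrArg Finset.card (diff_flipAt_of_mem hx hmem)
      rw [Finset.card_erase_of_mem hmem] at hd
      have hlt := hg.2
      have key := fun a b c => hit_succ_le (t := T) (k := (diff F.1 x z).card - r)
        (k₀ := (diff F.1 (flipAt x (lit C a).2) z).card - r) (k₁ := (diff F.1 x z).card - r)
        (k₂ := (diff F.1 (flipAt x (lit C b).2) z).card - r) (k₃ := (diff F.1 (flipAt x (lit C c).2) z).card - r)
      interval_cases a
      · linarith [key 0 1 2 (by omega) (by omega) (by omega) (by omega) (by omega)]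
      · linarith [key 1 0 2 (by omega) (by omega) (by omega) (by omega) (by omega)]
      · linarith [key 2 0 1 (by omega) (by omega) (by omega) (by omega) (by omega)]

/-! ### Random starts -/

/-- The distance to `z` is a sum over the variables, so the sum factorises; each variable
contributes `1` for agreement and `a` for disagreement. -/
lemma bsum_pow_card_diff (n : ℕ) (z : ℕ → Bool) (a : ℝ) :
    (bsum n fun x => a ^ (diff n x z).card) = (1 + a) ^ n := by
  induction n with
  | zero => simp [bsum_zero, diff]
  | succ n ih =>
    have h : ∀ (x : List Bool) (v : Bool), x.length = n →
        (diff (n + 1) (x ++ [v]) z).card = (diff n x z).card + if v ≠ z n then 1 else 0 := by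
      intro x v hx
      have h1 : ((Finset.range n).filter fun i => (x ++ [v]).getD i false ≠ z i) =
          (Finset.range n).filter fun i => x.getD i false ≠ z i :=
        Finset.filter_congr fun i hi => by grind
      have h2 : (x ++ [v]).getD n false = v := by grind
      rw [diff, Finset.range_add_one, Finset.filter_insert, h1, h2]
      split_ifs with hv
      · rw [Finset.card_insert_of_notMem (by simp)]; rfl
      · rfl
    rw [bsum_succ, bsum_congr fun x hx => by rw [h x false hx],
      bsum_congr (f := fun ρ => a ^ (diff (n + 1) (ρ ++ [true]) z).card) fun x hx => by
        rw [h x true hx], pow_succ, ← ih]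
    cases z n
    · simp only [ne_eq, not_true_eq_false, if_false, Bool.true_eq_false, not_false_eq_true, if_true,
        add_zero, pow_succ, mul_comm _ a, bsum_mul_left]
      ring
    · simp only [ne_eq, not_true_eq_false, if_false, false_eq_true, not_false_eq_true, if_true,
        add_zero, pow_succ, mul_comm _ a, bsum_mul_left]
      ring

/-- With `u = 2^r (1/2)^d` the right side is `min 1 u`, and `u - u²/4` lies below both `u` and `1`.
In this form the truncation at radius `r` can be averaged over all starts by `bsum_pow_card_diff`.
-/
lemma le_half_pow_sub (r d : ℕ) :
    (2 : ℝ) ^ r * (1 / 2) ^ d - 4 ^ r / 4 * (1 / 4) ^ d ≤ (1 / 2) ^ (d - r) := by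
  have h1 : (4 : ℝ) ^ r / 4 * (1 / 4) ^ d = (2 ^ r * (1 / 2) ^ d) ^ 2 / 4 := by
    rw [mul_pow, ← pow_mul, ← pow_mul, mul_comm r, mul_comm d, pow_mul, pow_mul]
    norm_num
    ring
  rw [h1]
  rcases le_total r d with h | h
  · have h2 : (2 : ℝ) ^ r * (1 / 2) ^ d = (1 / 2) ^ (d - r) := by
      obtain ⟨k, rfl⟩ := Nat.exists_eq_add_of_le h
      rw [Nat.add_sub_cancel_left, pow_add, ← mul_assoc, ← mul_pow]
      norm_num
    rw [h2]
    nlinarith [sq_nonneg (((1 : ℝ) / 2) ^ (d - r))]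
  · rw [Nat.sub_eq_zero_of_le h, pow_zero]
    nlinarith [sq_nonneg ((2 : ℝ) ^ r * (1 / 2) ^ d / 2 - 1)]

/-- The probability of a good state, for a random start and a random number of steps. -/
lemma le_bsum_sum_goodProb (hF : ThreeSAT F) (hz : IsSolution F z) (r T : ℕ) :
    (2 : ℝ) ^ r * (3 / 2) ^ F.1 - 4 ^ r / 4 * (5 / 4) ^ F.1 - (23 / 24) ^ T * 2 ^ F.1 ≤
      bsum F.1 fun x => ∑ t ∈ Finset.range (T + 1), goodProb F z r t x := by
  have h : ∀ x : List Bool, x.length = F.1 →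
      (2 : ℝ) ^ r * (1 / 2) ^ (diff F.1 x z).card + -(4 ^ r / 4) * (1 / 4) ^ (diff F.1 x z).card +
        -(23 / 24) ^ T ≤ ∑ t ∈ Finset.range (T + 1), goodProb F z r t x := by
    intro x hx
    refine le_trans ?_ (hit_le_sum_goodProb hF hz r T x hx)
    have h1 := le_hit T ((diff F.1 x z).card - r)
    have h2 := le_half_pow_sub r (diff F.1 x z).card
    have h3 : ((3 : ℝ) / 4) ^ ((diff F.1 x z).card - r) ≤ 1 := pow_le_one₀ (by norm_num) (by norm_num)
    have h4 : (0 : ℝ) ≤ (23 / 24) ^ T := by positivity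
    nlinarith
  refine le_trans (le_of_eq ?_) (bsum_le h)
  rw [bsum_add, bsum_add, bsum_mul_left, bsum_mul_left, bsum_pow_card_diff, bsum_pow_card_diff,
    bsum_const]
  norm_num
  ring

end

section

open Walk (binBits hash GoodHash)

lemma ind_le_ind {p q : Prop} (h : p → q) : ind p ≤ ind q := by
  by_cases hp : p
  · grind
  · rw [ind_neg hp]; exact ind_nonneg q

lemma bsum_comm (m n : ℕ) (f : List Bool → List Bool → ℝ) :
    (bsum m fun x => bsum n fun y => f x y) = bsum n fun y => bsum m fun x => f x y := by
  induction m generalizing f with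
  | zero => simp only [bsum_zero]
  | succ m ih => simp only [bsum_succ, ih, bsum_add]

/-! ### Random hash values -/

/-- The average over the hash values of length `L` of the first `n` variables. -/
def hashMean (L : ℕ) : ℕ → ((ℕ → List Bool) → ℝ) → ℝ
  | 0, f => f fun _ => []
  | n + 1, f => hashMean L n fun h => (1 / 2) ^ L * bsum L fun y => f (update h n y)

variable {L : ℕ}

variable {n : ℕ} {ι : Type*} {P : List ℕ} {D : ℕ}

lemma hashMean_mono {f g : (ℕ → List Bool) → ℝ} (h : ∀ x, f x ≤ g x) :
    hashMean L n f ≤ hashMean L n g := by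
  induction n generalizing f g with
  | zero => exact h _
  | succ n ih =>
    exact ih fun x => mul_le_mul_of_nonneg_left (bsum_le fun y _ => h _) (by positivity)

lemma hashMean_mul_right (f : (ℕ → List Bool) → ℝ) (c : ℝ) :
    hashMean L n (fun h => f h * c) = hashMean L n f * c := by
  induction n generalizing f with
  | zero => rfl
  | succ n ih =>
    simp only [hashMean]
    rw [← ih]
    congr 1
    funext h
    simp only [mul_comm _ c, bsum_mul_left]
    ring

lemma hashMean_const (n : ℕ) (c : ℝ) : hashMean L n (fun _ => c) = c := by
  induction n with
  | zero => rfl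
  | succ n ih =>
    simp only [hashMean, bsum_const]
    rw [← mul_assoc, ← mul_pow]
    norm_num
    exact ih

/-- The average does not change if one of the hash values is chosen once more. -/
lemma hashMean_resample {v : ℕ} (hv : v < n) (f : (ℕ → List Bool) → ℝ) :
    hashMean L n (fun h => (1 / 2) ^ L * bsum L fun y => f (update h v y)) =
      hashMean L n f := by
  induction n generalizing f with
  | zero => omega
  | succ n ih =>
    simp only [hashMean]
    rcases Nat.lt_or_ge v n with h | h
    · rw [← ih h (fun h => (1 / 2) ^ L * bsum L fun y => f (update h n y))]
      congr 1
      funext g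
      rw [bsum_mul_left, bsum_mul_left, bsum_comm]
      simp only [Function.update_comm (show v ≠ n by omega)]
    · obtain rfl : v = n := by omega
      congr 1
      funext g
      simp only [update_idem]
      rw [bsum_const, ← mul_assoc _ (2 ^ L), ← mul_pow]
      norm_num

/-- The blocks of length `L` of a random string are independent random hash values. The function may
only look at the first `n` of them. -/
lemma mean_hash (f : (ℕ → List Bool) → ℝ)
    (hf : ∀ g g' : ℕ → List Bool, (∀ v < n, g v = g' v) → f g = f g') :
    (1 / 2) ^ (n * L) * bsum (n * L) (fun H => f (hash L H)) = hashMean L n f := by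
  induction n generalizing f with
  | zero =>
    rw [Nat.zero_mul, bsum_zero, pow_zero, one_mul]
    exact hf _ _ (by simp)
  | succ n ih =>
    rw [hashMean, Nat.succ_mul, bsum_append, ← ih]
    · rw [pow_add, mul_assoc, bsum_mul_left]
      congr 2
      refine bsum_congr fun ρ hρ => bsum_congr fun ρ' hρ' => hf _ _ fun v hv => ?_
      rcases Nat.lt_or_ge v n with h | h
      · rw [update_of_ne (by omega), Walk.hash, Walk.hash, List.drop_append_of_le_length,
          List.take_append_of_le_length]
        · rw [length_drop, hρ, ← Nat.sub_mul]
          exact Nat.le_mul_of_pos_left _ (by omega)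
        · rw [hρ]; exact Nat.mul_le_mul_right _ h.le
      · obtain rfl : v = n := by omega
        rw [update_self, Walk.hash, List.drop_append, hρ, Nat.sub_self,
          List.drop_eq_nil_of_le hρ.le, nil_append, List.drop_zero,
          take_of_length_le hρ'.le]
    · intro g g' h
      congr 2
      funext y
      refine hf _ _ fun v hv => ?_
      rcases Nat.lt_or_ge v n with h' | h'
      · grind
      · grind

/-- If the hash values are chosen in the order `o`, and if each choice is good with a certain
probability, then all choices are good with the product of these probabilities. -/
lemma prod_le_hashMean {m : ℕ} (o : ℕ → ℕ) (ho : ∀ i < m, o i < n)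
    (ho' : ∀ i < m, ∀ j < m, o i = o j → i = j) (A : ℕ → (ℕ → List Bool) → List Bool → Prop)
    (hA : ∀ i < m, ∀ j < m, i ≤ j → ∀ h y, A i (update h (o j) y) = A i h) (b : ℕ → ℝ)
    (hb : ∀ i < m, 0 ≤ b i) (hb' : ∀ i < m, ∀ h, b i ≤ (1 / 2) ^ L * bsum L fun y => ind (A i h y)) :
    ∏ i ∈ Finset.range m, b i ≤
      hashMean L n fun h => ∏ i ∈ Finset.range m, ind (A i h (h (o i))) := by
  induction m with
  | zero => simp [hashMean_const]
  | succ m ih =>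
    have h1 := ih (fun i hi => ho i (by omega)) (fun i hi j hj => ho' i (by omega) j (by omega))
      (fun i hi j hj => hA i (by omega) j (by omega)) (fun i hi => hb i (by omega))
      (fun i hi => hb' i (by omega))
    -- The hash value of `o m` is drawn once more. The earlier conditions do not depend on it, and
    -- the last one then holds with probability at least `b m`, whatever the others are.
    rw [Finset.prod_range_succ, ← hashMean_resample (ho m (by omega))]
    refine (mul_le_mul_of_nonneg_right h1 (hb m (by omega))).trans ?_
    rw [← hashMean_mul_right]
    refine hashMean_mono fun h => ?_
    have h2 : ∀ y, ∏ i ∈ Finset.range (m + 1), ind (A i (update h (o m) y)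
        (update h (o m) y (o i))) =
        (∏ i ∈ Finset.range m, ind (A i h (h (o i)))) * ind (A m h y) := by
      intro y
      rw [Finset.prod_range_succ, update_self, hA m (by omega) m (by omega) le_rfl]
      congr 1
      refine Finset.prod_congr rfl fun i hi => ?_
      rw [Finset.mem_range] at hi
      rw [hA i (by omega) m (by omega) hi.le, update_of_ne]
      exact fun e => absurd (ho' i (by omega) m (by omega) e) (by omega)
    simp only [h2, bsum_mul_left]
    rw [mul_left_comm]
    exact mul_le_mul_of_nonneg_left (hb' m (by omega) h)
      (Finset.prod_nonneg fun i _ => ind_nonneg _)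

/-! ### The probability of good hash values -/

lemma bsum_ind_take_le {N : ℕ} (hN : N ≤ L) (l : List Bool) :
    (1 / 2 : ℝ) ^ L * bsum L (fun y => ind (l = y.take N)) ≤ (1 / 2) ^ N := by
  obtain ⟨k, rfl⟩ := Nat.exists_eq_add_of_le hN
  have h1 : ∀ m, ∀ l : List Bool, bsum m (fun y => ind (l = y)) ≤ 1 := by
    intro m
    induction m with
    | zero => intro l; rw [bsum_zero]; exact ind_le_one _
    | succ m ih =>
      intro l
      rw [bsum_succ']
      cases l with
      | nil =>
        simp only [List.nil_eq, reduceCtorEq]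
        rw [ind_neg not_false, bsum_const]
        norm_num
      | cons b l =>
        cases b
        · simp only [List.cons.injEq, true_and, false_eq_true, false_and]
          rw [ind_neg not_false, bsum_const, mul_zero, add_zero]
          exact ih l
        · simp only [List.cons.injEq, true_and, Bool.true_eq_false, false_and]
          rw [ind_neg not_false, bsum_const, mul_zero, zero_add]
          exact ih l
  rw [bsum_append, bsum_congr (g := fun y => 2 ^ k * ind (l = y)) fun y hy => by
    rw [bsum_congr (g := fun _ => ind (l = y)) fun y' _ => by
      rw [take_left' hy], bsum_const], bsum_mul_left, pow_add]
  have h2 : (1 / 2 : ℝ) ^ k * 2 ^ k = 1 := by rw [← mul_pow]; norm_num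
  calc _ = (1 / 2 : ℝ) ^ N * ((1 / 2 : ℝ) ^ k * 2 ^ k) * bsum N (fun y => ind (l = y)) := by ring
    _ ≤ (1 / 2 : ℝ) ^ N * 1 * 1 := by rw [h2]; exact mul_le_mul_of_nonneg_left (h1 N l) (by positivity)
    _ = _ := by ring

lemma bsum_sum (s : Finset ι) (m : ℕ) (f : ι → List Bool → ℝ) :
    (bsum m fun y => ∑ i ∈ s, f i y) = ∑ i ∈ s, bsum m (f i) := by
  classical
  induction s using Finset.induction_on with
  | empty => simp [bsum_const]
  | insert a s ha ih => simp only [Finset.sum_insert ha, bsum_add, ih]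

/-- The union bound. -/
lemma one_sub_le_mean (s : Finset ι) (p : ι → List Bool → Prop) (q : List Bool → Prop)
    (h : ∀ y, (∀ i ∈ s, ¬ p i y) → q y) (b : ι → ℝ)
    (hb : ∀ i ∈ s, (1 / 2) ^ L * bsum L (fun y => ind (p i y)) ≤ b i) :
    1 - ∑ i ∈ s, b i ≤ (1 / 2) ^ L * bsum L fun y => ind (q y) := by
  have h1 : ∀ y, 1 ≤ ind (q y) + ∑ i ∈ s, ind (p i y) := by
    intro y
    by_cases hy : ∀ i ∈ s, ¬ p i y
    · rw [ind_pos (h y hy)]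
      have : 0 ≤ ∑ i ∈ s, ind (p i y) := sum_nonneg fun i _ => ind_nonneg _
      linarith
    · push Not at hy
      obtain ⟨i, hi, hp⟩ := hy
      have h2 := Finset.single_le_sum (f := fun i => ind (p i y)) (fun i _ => ind_nonneg _) hi
      simp only [ind_pos hp] at h2
      have := ind_nonneg (q y)
      linarith
  have h2 := mul_le_mul_of_nonneg_left (bsum_le (n := L) fun y _ => h1 y)
    (show (0 : ℝ) ≤ (1 / 2) ^ L by positivity)
  rw [bsum_const, bsum_add, bsum_sum, mul_one, ← mul_pow, mul_add, mul_sum] at h2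
  norm_num at h2
  have h3 := Finset.sum_le_sum hb
  norm_num at h3 ⊢
  linarith

/-- This is the reason for the term `j / 2` in `binBits`. On level `j` fewer than `2^(D-j)` earlier
variables can collide, each with probability `2^(-(D+8-j/2))`; together at most `2^(-8) (3/4)^j`, as
`1/2 ≤ (3/4)^2`. The geometric series over the levels gives `4/256`. -/
lemma sum_bins_le (D i : ℕ) :
    ∑ x ∈ (Finset.range (D + 1) ×ˢ Finset.range i).filter (fun x => i - x.2 < 2 ^ (D - x.1)),
      (1 / 2 : ℝ) ^ binBits D x.1 ≤ 1 / 64 := by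
  rw [sum_filter, Finset.sum_product]
  have h1 : ∀ j ∈ Finset.range (D + 1),
      (∑ p ∈ Finset.range i, if i - p < 2 ^ (D - j) then (1 / 2 : ℝ) ^ binBits D j else 0) ≤
        1 / 256 * (3 / 4) ^ j := by
    intro j hj
    rw [Finset.mem_range] at hj
    rw [← sum_filter, sum_const, nsmul_eq_mul]
    have hc : (Finset.filter (fun p => i - p < 2 ^ (D - j)) (Finset.range i)).card ≤ 2 ^ (D - j) := by
      have : (Finset.filter (fun p => i - p < 2 ^ (D - j)) (Finset.range i)).card ≤
          (Finset.range (2 ^ (D - j))).card := by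
        refine Finset.card_le_card_of_injOn (fun p => i - p) (fun p hp => ?_) fun p hp p' hp' h => ?_
        · grind
        · grind
      simpa using this
    have hc' : (((Finset.filter (fun p => i - p < 2 ^ (D - j)) (Finset.range i)).card : ℕ) : ℝ) ≤
        2 ^ (D - j) := by exact_mod_cast hc
    refine (mul_le_mul_of_nonneg_right hc' (by positivity)).trans ?_
    obtain ⟨k, hk⟩ : ∃ k, j = k + j / 2 := ⟨j - j / 2, by omega⟩
    have e1 : binBits D j = (D - j) + 8 + k := by unfold binBits; omega
    have h2 : (2 : ℝ) ^ (D - j) * (1 / 2) ^ (D - j) = 1 := by rw [← mul_pow]; norm_num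
    have h3 : (1 / 2 : ℝ) ^ k ≤ (3 / 4) ^ j := by
      calc (1 / 2 : ℝ) ^ k ≤ ((3 / 4) ^ 2) ^ k := pow_le_pow_left₀ (by norm_num) (by norm_num) _
        _ = (3 / 4) ^ (2 * k) := by rw [pow_mul]
        _ ≤ (3 / 4) ^ j := pow_le_pow_of_le_one (by norm_num) (by norm_num) (by omega)
    rw [e1, pow_add, pow_add, ← mul_assoc, ← mul_assoc, h2]
    have h4 : (0 : ℝ) ≤ (1 / 2) ^ k := by positivity
    norm_num at h3 h4 ⊢
    linarith
  refine (Finset.sum_le_sum h1).trans ?_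
  rw [← mul_sum]
  have h5 := geom_sum_eq (show (3 / 4 : ℝ) ≠ 1 by norm_num) (D + 1)
  have h6 : (0 : ℝ) < (3 / 4) ^ (D + 1) := by positivity
  rw [h5, show (3 / 4 - 1 : ℝ) = -(1 / 4) by norm_num]
  have h7 : ((3 / 4 : ℝ) ^ (D + 1) - 1) / -(1 / 4) = 4 * (1 - (3 / 4) ^ (D + 1)) := by grind
  rw [h7]
  linarith

/-- The order in which the hash values are chosen. -/
def hashOrder (n : ℕ) (P : List ℕ) : List ℕ := P ++ (range n).filter (· ∉ P)

lemma mem_hashOrder (hP : ∀ v ∈ P, v < n) {v : ℕ} : v ∈ hashOrder n P ↔ v < n := by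
  simp only [hashOrder, mem_append, mem_filter, mem_range, decide_eq_true_eq]
  by_cases h : v ∈ P
  · grind
  · simp [h]

lemma nodup_hashOrder (hP : P.Nodup) : (hashOrder n P).Nodup := by
  rw [hashOrder, nodup_append]
  refine ⟨hP, List.nodup_range.filter _, fun a ha b hb => ?_⟩
  rintro rfl
  have := (mem_filter.1 hb).2
  simp [ha] at this

lemma length_hashOrder (hP : P.Nodup) (hP' : ∀ v ∈ P, v < n) : (hashOrder n P).length = n := by
  have h : (hashOrder n P).Perm (range n) :=
    (List.perm_ext_iff_of_nodup (nodup_hashOrder hP) List.nodup_range).2 fun v => by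
      rw [mem_hashOrder hP', mem_range]
  simpa using h.length_eq

/-- Each of the two factors is at least `2^(-2^(D-5))`. The first one by `(63/64)^32 ≥ 1/2`. For the
second one put `k = L - D - 1`: Bernoulli's inequality shows that the `2^k`-th power of the base is
at least `1/2`, and `n ≤ 2^(L-8) ≤ 2^k 2^(D-5)`. -/
lemma half_pow_le {L : ℕ} (hD : 7 ≤ D) (hL : D + 8 ≤ L) (hn : 256 * n ≤ 2 ^ L) {m : ℕ}
    (hm : m ≤ 2 ^ D) : (1 / 2 : ℝ) ^ (2 ^ (D - 4)) ≤ (63 / 64) ^ m * (1 - 2 ^ D * (1 / 2) ^ L) ^ n := by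
  have h1 : (1 / 2 : ℝ) ^ (2 ^ (D - 5)) ≤ (63 / 64) ^ m := by
    have h : (1 / 2 : ℝ) ≤ (63 / 64) ^ 32 := by norm_num
    calc (1 / 2 : ℝ) ^ (2 ^ (D - 5)) ≤ ((63 / 64) ^ 32) ^ (2 ^ (D - 5)) :=
          pow_le_pow_left₀ (by norm_num) h _
      _ = (63 / 64) ^ (2 ^ D) := by
          rw [← pow_mul, show 32 = 2 ^ 5 from rfl, ← pow_add, show 5 + (D - 5) = D by omega]
      _ ≤ _ := pow_le_pow_of_le_one (by norm_num) (by norm_num) hm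
  set k := L - D - 1 with hk
  have e : (2 : ℝ) ^ D * (1 / 2) ^ L = 1 / 2 * (1 / 2) ^ k := by
    rw [show L = D + (k + 1) by omega, pow_add, ← mul_assoc, ← mul_pow, pow_succ]
    norm_num
    ring
  have h2 : (1 / 2 : ℝ) ^ (2 ^ (D - 5)) ≤ (1 - 2 ^ D * (1 / 2) ^ L) ^ n := by
    have hk1 : (1 / 2 : ℝ) ^ k ≤ 1 := pow_le_one₀ (by norm_num) (by norm_num)
    have hk0 : (0 : ℝ) < (1 / 2 : ℝ) ^ k := by positivity
    have h : (1 / 2 : ℝ) ≤ (1 - 2 ^ D * (1 / 2) ^ L) ^ (2 ^ k) := by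
      have hb := one_add_mul_le_pow (a := -(2 ^ D * (1 / 2) ^ L : ℝ)) (by grind) (2 ^ k)
      have h' : (2 : ℝ) ^ k * (1 / 2) ^ k = 1 := by rw [← mul_pow]; norm_num
      rw [← sub_eq_add_neg] at hb
      refine le_trans (le_of_eq ?_) hb
      rw [e]
      push_cast
      linear_combination (1 / 2 : ℝ) * h'
    have hn' : n ≤ 2 ^ k * 2 ^ (D - 5) := by
      have : 2 ^ L = 256 * 2 ^ (L - 8) := by
        rw [show 256 = 2 ^ 8 from rfl, ← pow_add, show 8 + (L - 8) = L by omega]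
      have h3 : 2 ^ (L - 8) ≤ 2 ^ (k + (D - 5)) := pow_le_pow_right (by omega) (by omega)
      rw [pow_add] at h3
      omega
    calc (1 / 2 : ℝ) ^ (2 ^ (D - 5)) ≤ ((1 - 2 ^ D * (1 / 2) ^ L) ^ (2 ^ k)) ^ (2 ^ (D - 5)) :=
          pow_le_pow_left₀ (by norm_num) h _
      _ = (1 - 2 ^ D * (1 / 2) ^ L) ^ (2 ^ k * 2 ^ (D - 5)) := by rw [pow_mul]
      _ ≤ _ := pow_le_pow_of_le_one (by grind) (by grind) hn'
  calc (1 / 2 : ℝ) ^ (2 ^ (D - 4)) = (1 / 2) ^ (2 ^ (D - 5)) * (1 / 2) ^ (2 ^ (D - 5)) := by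
        rw [← pow_add, ← two_mul, ← pow_succ', show D - 5 + 1 = D - 4 by omega]
    _ ≤ _ := mul_le_mul h1 h2 (by positivity) (by positivity)

lemma goodHash_congr (hP : ∀ v ∈ P, v < n) {g g' : ℕ → List Bool}
    (h : ∀ v < n, g v = g' v) (hg : GoodHash D L n P g) : GoodHash D L n P g' := by
  have hget : ∀ p < P.length, P.getD p 0 < n := fun p hp => hP _ (by
    rw [getD_eq_getElem _ _ hp]; exact getElem_mem hp)
  refine ⟨fun p p' hpp hp' j hj hlt => ?_, fun v hv v' hv' hne => ?_⟩
  · rw [← h _ (hget p (by omega)), ← h _ (hget p' hp')]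
    exact hg.bins p p' hpp hp' j hj hlt
  · rw [← h v' hv', ← h v (hP v hv)]
    exact hg.full v hv v' hv' hne

/-- Random hash values represent the relevant parts of `P` with sufficient probability. -/
lemma le_mean_goodHash (hD : 7 ≤ D) (hL : D + 8 ≤ L) (hn : 256 * n ≤ 2 ^ L)
    (hP : P.Nodup) (hP' : ∀ v ∈ P, v < n) (hlen : P.length ≤ 2 ^ D) :
    (1 / 2 : ℝ) ^ (2 ^ (D - 4)) ≤
      (1 / 2) ^ (n * L) * bsum (n * L) (fun H => ind (GoodHash D L n P (hash L H))) := by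
  rw [mean_hash (fun h => ind (GoodHash D L n P h)) fun g g' h =>
    le_antisymm (ind_le_ind (goodHash_congr hP' h))
      (ind_le_ind (goodHash_congr hP' fun v hv => (h v hv).symm))]
  set O := hashOrder n P with hO
  have hOlen : O.length = n := length_hashOrder hP hP'
  have hOnd : O.Nodup := nodup_hashOrder hP
  set o : ℕ → ℕ := fun i => O.getD i 0 with ho
  have hoget : ∀ i, ∀ hi : i < n, o i = O[i]'(by omega) := fun i hi =>
    getD_eq_getElem _ _ (by omega)
  have hoP : ∀ i < P.length, o i = P.getD i 0 := fun i hi => by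
    simp only [ho, hO, hashOrder]
    rw [getD_append _ _ _ _ hi]
  have hoinj : ∀ i < n, ∀ j < n, o i = o j → i = j := fun i hi j hj h => by
    rw [hoget i hi, hoget j hj] at h
    exact (List.Nodup.getElem_inj_iff hOnd).1 h
  have hon : ∀ i < n, o i < n := fun i hi => by
    rw [hoget i hi]
    exact (mem_hashOrder hP').1 (getElem_mem _)
  have hPn : P.length ≤ n := by rw [← hOlen, hO, hashOrder, length_append]; omega
  have hPmem : ∀ v ∈ P, ∃ p < P.length, o p = v := fun v hv => by
    obtain ⟨p, hp, rfl⟩ := List.mem_iff_getElem.1 hv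
    exact ⟨p, hp, by rw [hoP p hp, getD_eq_getElem _ _ hp]⟩
  -- The variables of the path come first, each avoiding the places of its predecessors on all
  -- relevant levels; every other variable only has to avoid the full hash values of the path. So
  -- each condition refers to hash values drawn earlier.
  set A : ℕ → (ℕ → List Bool) → List Bool → Prop := fun i h y =>
    if i < P.length then ∀ x ∈ (Finset.range (D + 1) ×ˢ Finset.range i).filter
      (fun x => i - x.2 < 2 ^ (D - x.1)), ¬ ((h (o x.2)).take (binBits D x.1) = y.take (binBits D x.1))
    else ∀ p ∈ Finset.range P.length, ¬ (h (o p) = y) with hA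
  set b : ℕ → ℝ := fun i => if i < P.length then 63 / 64 else 1 - 2 ^ D * (1 / 2) ^ L with hbdef
  have h2L : (2 : ℝ) ^ D * (1 / 2) ^ L ≤ 1 := by
    have : (2 : ℝ) ^ D ≤ 2 ^ L := pow_le_pow_right₀ (by norm_num) (by omega)
    rw [one_div, inv_pow, ← div_eq_mul_inv, div_le_one (by positivity)]
    exact this
  have hprod := prod_le_hashMean (L := L) o hon hoinj A (by
    intro i hi j hj hij h y
    funext y'
    simp only [hA]
    split_ifs with hiP
    · refine propext (forall₂_congr fun x hx => ?_)
      simp only [Finset.mem_filter, mem_product, Finset.mem_range] at hx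
      rw [update_of_ne fun e => by grind]
    · refine propext (forall₂_congr fun p hp => ?_)
      rw [Finset.mem_range] at hp
      rw [update_of_ne fun e => by grind]) b
    (by
      intro i hi
      simp only [hbdef]
      split_ifs
      · norm_num
      · linarith)
    (by
      intro i hi h
      simp only [hbdef, hA]
      split_ifs with hiP
      · refine le_trans ?_ (one_sub_le_mean _ (fun (x : ℕ × ℕ) y => (h (o x.2)).take (binBits D x.1) =
          y.take (binBits D x.1)) _ (fun y hy => hy) (fun x : ℕ × ℕ => (1 / 2) ^ binBits D x.1)
          fun x hx => bsum_ind_take_le (Walk.binBits_le.trans hL) _)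
        have := sum_bins_le D i
        linarith
      · refine le_trans ?_ (one_sub_le_mean (Finset.range P.length)
          (fun p y => h (o p) = y) _ (fun y hy => hy) (fun x => (1 / 2) ^ L)
          fun p hp => ?_)
        swap
        · rw [bsum_congr (g := fun y => ind (h (o p) = y.take L)) fun y hy => by grind]
          exact bsum_ind_take_le le_rfl _
        rw [sum_const, card_range, nsmul_eq_mul]
        have : (P.length : ℝ) ≤ 2 ^ D := by exact_mod_cast hlen
        have h' := mul_le_mul_of_nonneg_right this (show (0 : ℝ) ≤ (1 / 2) ^ L by positivity)
        linarith)
  have hbprod : (1 / 2 : ℝ) ^ (2 ^ (D - 4)) ≤ ∏ i ∈ Finset.range n, b i := by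
    refine (half_pow_le hD hL hn hlen).trans ?_
    simp only [hbdef]
    rw [Finset.prod_ite, prod_const, prod_const]
    have c1 : ((Finset.range n).filter fun i => i < P.length).card = P.length := by
      have : ((Finset.range n).filter fun i => i < P.length) = Finset.range P.length := by grind
      rw [this, card_range]
    rw [c1]
    refine mul_le_mul_of_nonneg_left (pow_le_pow_of_le_one (by linarith) ?_ ?_) (by positivity)
    · have : (0 : ℝ) ≤ 2 ^ D * (1 / 2) ^ L := by positivity
      linarith
    · grind
  refine (hbprod.trans hprod).trans (hashMean_mono fun h => ?_)
  by_cases hall : ∀ i < n, A i h (h (o i))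
  · refine (Finset.prod_le_one (fun i _ => ind_nonneg _) fun i _ => ind_le_one _).trans ?_
    rw [ind_pos]
    have hbins : ∀ p p', p < p' → p' < P.length → ∀ j ≤ D, p' - p < 2 ^ (D - j) →
        (h (P.getD p 0)).take (binBits D j) ≠ (h (P.getD p' 0)).take (binBits D j) := by
      intro p p' hpp hp' j hj hlt
      have := hall p' (by omega)
      simp only [hA, if_pos hp'] at this
      rw [← hoP p (by omega), ← hoP p' hp']
      exact this (j, p) (by
        simp only [Finset.mem_filter, mem_product, Finset.mem_range]
        omega)
    refine ⟨hbins, fun v hv v' hv' hne he => ?_⟩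
    obtain ⟨p, hp, rfl⟩ := hPmem v hv
    by_cases hvP : v' ∈ P
    · obtain ⟨p', hp', rfl⟩ := hPmem v' hvP
      rw [hoP p hp, hoP p' hp'] at he
      rcases Nat.lt_trichotomy p p' with hlt | rfl | hlt
      -- Level `0` covers any two positions of the path, so different prefixes there already give
      -- different hash values.
      · exact hbins p p' hlt hp' 0 (by omega) (by grind) (by rw [he])
      · exact hne rfl
      · exact hbins p' p hlt hp 0 (by omega) (by grind) (by rw [he])
    · obtain ⟨i, hi, hiv⟩ := List.mem_iff_getElem.1 ((mem_hashOrder hP' (P := P)).2 hv')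
      have hi' : i < n := by grind
      have hoi : o i = v' := by grind
      have hiP : ¬ i < P.length := fun hiP => hvP (by
        rw [← hoi, hoP i hiP, getD_eq_getElem _ _ hiP]; exact getElem_mem hiP)
      have := hall i hi'
      simp only [hA, if_neg hiP] at this
      refine this p (Finset.mem_range.2 hp) ?_
      rw [hoi, he]
  · push Not at hall
    obtain ⟨i, hi, hAi⟩ := hall
    rw [Finset.prod_eq_zero (Finset.mem_range.2 hi) (ind_neg hAi)]
    exact ind_nonneg _

end

open Walk (lit IsPath binBits hash GoodHash numCoins zoneSize qubits ofHash hashPat)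

/-! ### The parameters of a trial -/

namespace Trial

variable (h : ℕ)

/-- The number of levels of the registers, for `n` variables. -/
def lev (n : ℕ) : ℕ := Nat.log 2 n - h

/-- The length of the hash values. -/
def hlen (n : ℕ) : ℕ := lev h n + h + 9

/-- The size of the counters. -/
def csz (n : ℕ) : ℕ := 3 * Nat.log 2 n + 7

/-- The number of auxiliary qubits. -/
def scrSize (n : ℕ) : ℕ := numCoins (lev h n) + csz n + hlen h n + 11

/-- The size of the zones. -/
def zsize (n z : ℕ) : ℕ := zoneSize (lev h n) (hlen h n) (csz n) (scrSize h n) z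

/-- The number of the first qubit of a zone. -/
def offset (n z : ℕ) : ℕ := ((range z).map (zsize h n)).sum

/-- The number of a qubit. -/
def index (n : ℕ) (u : QName) : ℕ := offset h n u.1 + u.2

/-- The total number of qubits. -/
def numQubits (n : ℕ) : ℕ := offset h n (8 + lev h n)

/-- The number of coins for the number of steps of the walk. -/
def timeBits (n : ℕ) : ℕ := lev h n + h + 8

/-- The number of coins. -/
def ncoins (n : ℕ) : ℕ :=
  n + (2 * 2 ^ timeBits h n + (timeBits h n + (n * hlen h n + (lev h n + 1))))

/-- The coins of the walk, and those which follow. -/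
def walkCoins (a : RawFormula × List Bool) : List Bool := a.2.drop a.1.1

/-- The coins for the number of steps, and those which follow. -/
def timeCoins (a : RawFormula × List Bool) : List Bool :=
  (walkCoins a).drop (2 * 2 ^ timeBits h a.1.1)

/-- The number of steps. -/
def time (a : RawFormula × List Bool) : ℕ :=
  bval (2 ^ timeBits h a.1.1) ((timeCoins h a).take (timeBits h a.1.1))

/-- The hash values, and the coins which follow. -/
def hashCoins (a : RawFormula × List Bool) : List Bool := (timeCoins h a).drop (timeBits h a.1.1)

/-- The hash values. -/
def hashes (a : RawFormula × List Bool) : List Bool :=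
  (hashCoins h a).take (a.1.1 * hlen h a.1.1)

/-- The number which determines the number of iterations. -/
def iterNum (a : RawFormula × List Bool) : ℕ :=
  min ((numCoins (lev h a.1.1) + 1) / 2 + 1)
    (bval (2 ^ (lev h a.1.1 + 1)) ((hashCoins h a).drop (a.1.1 * hlen h a.1.1)))

/-- The start of the search. -/
def center (a : RawFormula × List Bool) : List Bool :=
  walk a.1 (a.2.take a.1.1) (time h a) (walkCoins a)

/-- The data of the search. -/
def data (a : RawFormula × List Bool) : Walk :=
  ofHash (lev h a.1.1) (hlen h a.1.1) (csz a.1.1) a.1 (center h a) (hashes h a)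

/-- The auxiliary qubits. -/
def scr (i : ℕ) : QName := (3, i)

/-- The coins of the search. -/
def coin (i : ℕ) : QName := (2, i)

/-- The gates before the iterations. -/
def prep (a : RawFormula × List Bool) : List Gate :=
  groverPrep (index h a.1.1) (numCoins (lev h a.1.1)) coin (6, 0)

/-- The gates of an iteration. -/
def body (a : RawFormula × List Bool) : List Gate :=
  groverBody scr (index h a.1.1) (numCoins (lev h a.1.1)) coin (6, 0)
    ((data h a).oracle (lev h a.1.1))

/-- The gates after the iterations. -/
def post (a : RawFormula × List Bool) : List Gate :=
  compile scr (index h a.1.1) ((data h a).search (lev h a.1.1))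

/-- The assignment which the values of the qubits stand for. -/
def decode (a : RawFormula × List Bool) (c : ℕ → Bool) : List Bool :=
  (range a.1.1).map fun v => Bool.xor ((center h a).getD v false)
    (holds (fun u => c (index h a.1.1 u)) ((data h a).pat 0 v))

/-- The assignment which the outcomes stand for. -/
def cand (p : (RawFormula × List Bool) × List Bool) : List Bool :=
  decode h p.1 fun i => p.2.getD i false

/-! ### Numbers of qubits -/

variable {h} {n : ℕ}

lemma offset_succ (z : ℕ) : offset h n (z + 1) = offset h n z + zsize h n z := by
  simp [offset, range_succ]

lemma offset_mono : Monotone (offset h n) :=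
  monotone_nat_of_le_succ fun z => by rw [offset_succ]; omega

lemma zsize_eq_zero {z : ℕ} (hz : 8 + lev h n ≤ z) : zsize h n z = 0 := by
  have : Nat.ble (z - 7) (lev h n) = false := by
    rw [← not_eq_true, ble_eq]; omega
  rw [zsize, zoneSize, List.getD_eq_default _ _ (by simp; omega), this]
  rfl

/-- The qubits of the trial. -/
def space (h n : ℕ) : Set QName := qubits (lev h n) (hlen h n) (csz n) (scrSize h n)

lemma mem_space {u : QName} : u ∈ space h n ↔ u.2 < zsize h n u.1 := Iff.rfl

lemma index_injOn : Set.InjOn (index h n) (space h n) := by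
  have key : ∀ u u' : QName, u ∈ space h n → u.1 < u'.1 → index h n u < index h n u' := by
    intro u u' hu hlt
    rw [mem_space] at hu
    have := offset_mono (h := h) (n := n) (show u.1 + 1 ≤ u'.1 from hlt)
    rw [offset_succ] at this
    unfold index
    omega
  intro u hu u' hu' he
  rcases Nat.lt_trichotomy u.1 u'.1 with hlt | heq | hlt
  · grind
  · simp only [index, heq] at he
    exact Prod.ext heq (by omega)
  · grind

lemma index_lt {u : QName} (hu : u ∈ space h n) : index h n u < numQubits h n := by
  rw [mem_space] at hu
  have h1 : u.1 < 8 + lev h n := by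
    by_contra hc
    rw [zsize_eq_zero (by omega)] at hu
    omega
  have := offset_mono (h := h) (n := n) (show u.1 + 1 ≤ 8 + lev h n from h1)
  rw [offset_succ] at this
  unfold index numQubits
  omega

lemma coin_mem {i : ℕ} : coin i ∈ space h n ↔ i < numCoins (lev h n) := Iff.rfl

lemma scr_mem {i : ℕ} : scr i ∈ space h n ↔ i < scrSize h n := Iff.rfl

lemma layout : GroverLayout scr (index h n) (space h n) (numQubits h n) (numCoins (lev h n)) coin
    ((6, 0) : QName) where
  inj := index_injOn
  lt u hu := index_lt hu
  coin_mem j hj := coin_mem.2 hj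
  coin_inj i j hij := (Prod.mk.injEq _ _ _ _ ▸ hij : _ ∧ _).2
  minus_mem := mem_space.2 (by simp [zsize, zoneSize])
  minus_ne j := by simp [coin]
  scr_ne i := by simp [coin, scr]

/-- A list of well-formed gates without auxiliary qubits. -/
lemma compilable {B : ℕ} (hB : B < scrSize h n) {L : List (MCX QName)}
    (hL : ∀ g ∈ L, Walk.Fine {u | u ∈ space h n ∧ u.1 ∈ {s : ℕ | s ≠ 3}} B g) :
    Compilable scr (index h n) (space h n) (numQubits h n) L where
  inj := index_injOn
  lt u hu := index_lt hu
  scr_inj i j hij := (Prod.mk.injEq _ _ _ _ ▸ hij : _ ∧ _).2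
  on g hg := ⟨(hL g hg).1.1.1, fun p hp => ((hL g hg).1.2 p hp).1⟩
  proper g hg := (hL g hg).2.1
  scr_mem g hg j hj := scr_mem.2 (by have := (hL g hg).2.2; omega)
  target g hg i e := (hL g hg).1.1.2 (by rw [e]; rfl)
  control g hg p hp i e := ((hL g hg).1.2 p hp).2 (by rw [e]; rfl)

lemma compilable_zero : Compilable scr (index h n) (space h n) (numQubits h n)
    [((range (numCoins (lev h n))).map fun j => (coin j, false), ((6, 0) : QName))] := by
  refine compilable (B := numCoins (lev h n)) (by unfold scrSize; omega) fun g hg => ?_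
  rw [mem_singleton] at hg
  subst hg
  refine ⟨⟨⟨layout.minus_mem, by simp⟩, fun p hp => ?_⟩, fun p hp => ?_, by simp⟩
  · obtain ⟨j, hj, rfl⟩ := mem_map.1 hp
    exact ⟨coin_mem.2 (mem_range.1 hj), by simp [coin]⟩
  · obtain ⟨j, hj, rfl⟩ := mem_map.1 hp
    simp [coin]

/-! ### The gates are correct -/

variable {F : RawFormula} {ρ : List Bool}

lemma length_hashes (hρ : ρ.length = ncoins h F.1) : (hashes h (F, ρ)).length = F.1 * hlen h F.1 := by
  simp only [hashes, hashCoins, timeCoins, walkCoins, length_take, length_drop, hρ, ncoins]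
  omega

lemma valid (hF : ThreeSAT F) (hcl : F.2.length < 2 ^ csz F.1) (hρ : ρ.length = ncoins h F.1) :
    (data h (F, ρ)).Valid (space h F.1) (lev h F.1) (csz F.1 + hlen h F.1 + 10) :=
  Walk.valid_ofHash (by change lev h F.1 + 8 ≤ lev h F.1 + h + 9; omega) (length_hashes hρ) hF.lt hcl le_rfl

lemma compilable_oracle (hF : ThreeSAT F) (hcl : F.2.length < 2 ^ csz F.1)
    (hρ : ρ.length = ncoins h F.1) : Compilable scr (index h F.1) (space h F.1) (numQubits h F.1)
      ((data h (F, ρ)).oracle (lev h F.1)) :=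
  compilable (by unfold scrSize; omega) ((valid hF hcl hρ).fine_oracle layout.minus_mem)

lemma compilable_search (hF : ThreeSAT F) (hcl : F.2.length < 2 ^ csz F.1)
    (hρ : ρ.length = ncoins h F.1) : Compilable scr (index h F.1) (space h F.1) (numQubits h F.1)
      ((data h (F, ρ)).search (lev h F.1)) :=
  compilable (B := csz F.1 + hlen h F.1 + 10) (by unfold scrSize; omega) fun g hg => by
    obtain ⟨⟨h1, h2⟩, h3⟩ := (valid hF hcl hρ).fine_search g hg
    have aux : ∀ s : ℕ, s ∈ {s : ℕ | s ≤ 2 ∨ 7 ≤ s} → s ∈ {s : ℕ | s ≠ 3} := by grind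
    exact ⟨⟨⟨h1.1, aux _ h1.2⟩, fun p hp => ⟨(h2 p hp).1, aux _ (h2 p hp).2⟩⟩, h3⟩

/-- The state of the qubits with the coins `c`. -/
def coinState {k : ℕ} (c : Fin k → Bool) : QName → Bool := fun u =>
  if hu : u.1 = 2 ∧ u.2 < k then c ⟨u.2, hu.2⟩ else false

/-- The search with the coins `c` finds a solution. -/
def flag (a : RawFormula × List Bool) (c : Fin (numCoins (lev h a.1.1)) → Bool) : Bool :=
  (data h a).accepts (lev h a.1.1) (coinState c)

lemma coinState_eq {w : QName → Bool}
    (hw : ∀ u ∈ space h n, w u = true → u = (6, 0) ∨ ∃ j < numCoins (lev h n), u = coin j) :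
    ∀ u ∈ space h n, u.1 ≠ 6 →
      w u = coinState (fun j : Fin (numCoins (lev h n)) => w (coin j)) u := by
  rintro ⟨z, i⟩ hu h6
  simp only at h6
  by_cases hz : z = 2
  · subst hz
    have hi : i < numCoins (lev h n) := coin_mem.1 hu
    simp [coinState, hi, coin]
  · rw [coinState, dif_neg (by simp [hz]), ← not_eq_true]
    intro ht
    rcases hw _ hu ht with he | ⟨j, -, he⟩
    · grind
    · exact hz (congrArg Prod.fst he)

lemma isPhaseOracle (hF : ThreeSAT F) (hcl : F.2.length < 2 ^ csz F.1)
    (hρ : ρ.length = ncoins h F.1) : IsPhaseOracle (space h F.1) (numCoins (lev h F.1)) coin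
      ((6, 0) : QName) (flag (h := h) (F, ρ)) ((data h (F, ρ)).oracle (lev h F.1)) := by
  intro w hw u _
  rw [(valid hF hcl hρ).run_oracle, (valid hF hcl hρ).accepts_congr (coinState_eq hw)]
  rfl

/-- A measured outcome is decoded by reading register `0` in the same way as the final count of the
oracle does. Hence a marked value of the coins always yields a solution, for good and bad hash
values alike. Only qubits of the search are read, and these do not see the qubit for the phases. -/
lemma satRaw_decode (hF : ThreeSAT F) (hcl : F.2.length < 2 ^ csz F.1)
    (hρ : ρ.length = ncoins h F.1) {w : QName → Bool}
    (hw : ∀ u ∈ space h F.1, w u = true → u = (6, 0) ∨ ∃ j < numCoins (lev h F.1), u = coin j)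
    (hf : flag (h := h) (F, ρ) (fun j => w (coin j)) = true) {c : ℕ → Bool}
    (hc : ∀ u ∈ space h F.1, c (index h F.1 u) = run ((data h (F, ρ)).search (lev h F.1)) w u) :
    satRaw F (decode h (F, ρ) c) = true := by
  have hV := valid hF hcl hρ
  set w' := coinState fun j : Fin (numCoins (lev h F.1)) => w (coin j) with hw'
  have hz : ∀ z a, z ≠ 2 → w' (z, a) = false := fun z a hz => by
    rw [hw', coinState, dif_neg (by simp [hz])]
  have hall := hV.forall_of_accepts (w := w') (fun a => hz 4 a (by omega)) (fun a => hz 5 a (by omega)) hf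
  have hrun : ∀ v < F.1, holds (fun u => c (index h F.1 u)) ((data h (F, ρ)).pat 0 v) =
      (data h (F, ρ)).memb [0] (run ((data h (F, ρ)).search (lev h F.1)) w') v := by
    intro v hv
    have : (data h (F, ρ)).memb [0] (run ((data h (F, ρ)).search (lev h F.1)) w') v =
        holds (run ((data h (F, ρ)).search (lev h F.1)) w') ((data h (F, ρ)).pat 0 v) := by
      simp [Walk.memb, xorAll_cons, xorAll_nil]
    rw [this]
    refine holds_congr fun p hp => ?_
    obtain ⟨h1, h2⟩ := hV.pat 0 (by omega) v hv p hp
    rw [hc _ h1]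
    refine run_congr (fun g hg => (hV.fine_search g hg).1) (fun u hu => ?_) p.1
      ⟨h1, by rw [h2]; simp⟩
    refine coinState_eq hw u hu.1 fun h6 => ?_
    have := hu.2
    simp only [mem_ofPred_eq, h6] at this
    omega
  rw [satRaw_iff hF]
  intro C hC
  have := hall C hC
  rw [← not_eq_true, Walk.unsat, all_eq_true] at this
  push Not at this
  obtain ⟨a, ha, hne⟩ := this
  rw [mem_range] at ha
  refine ⟨a, ha, ?_⟩
  have hv := hF.lt C hC a ha
  rw [decode, getD_eq_getElem _ _ (by simpa using hv), getElem_map, getElem_range,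
    hrun _ hv]
  change ¬ (xor ((center h (F, ρ)).getD (lit C a).2 false) _ != (lit C a).1) = true at hne
  rwa [bne_iff_ne, not_not] at hne

/-- Good hash values and a path of length at most `2^lev` provide at least one marked value of the
coins, which is all that Grover's search requires. -/
lemma exists_flag (hF : ThreeSAT F) (hcl : F.2.length < 2 ^ csz F.1)
    (hρ : ρ.length = ncoins h F.1) {P : List ℕ} (hP : IsPath F (center h (F, ρ)) P)
    (hPl : P.length ≤ 2 ^ lev h F.1)
    (hg : GoodHash (lev h F.1) (hlen h F.1) F.1 P (hash (hlen h F.1) (hashes h (F, ρ)))) :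
    0 < (Finset.univ.filter fun c => flag (h := h) (F, ρ) c = true).card := by
  have hV := valid hF hcl hρ
  obtain ⟨ω, hω⟩ := hP.exists_follows (q := csz F.1) hPl (length_hashes hρ) hg
  rw [Finset.card_pos]
  refine ⟨fun j => ω j, Finset.mem_filter.2 ⟨mem_univ _, ?_⟩⟩
  rw [← hV.accepts_of_follows (w := fun u => decide (u.1 = 2) && ω u.2) (hω _ fun t => by simp)
    (fun u h2 _ => by simp [h2])]
  refine hV.accepts_congr fun u hu _ => ?_
  obtain ⟨z, i⟩ := u
  by_cases hz : z = 2
  · subst hz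
    have hi : i < numCoins (lev h F.1) := coin_mem.1 hu
    simp [coinState, hi]
  · simp [coinState, hz]

end Trial

open Walk (lit binBits slot hash place hashPat numCoins zoneSize coinSel digit)

/-! ### The trial in polynomial time -/

section arithmetic

variable {σ : Type} [Code σ] {f g m n : σ → ℕ}

@[fun_prop] lemma PT.min (hf : PT f) (hg : PT g) : PT fun e => min (f e) (g e) := by
  have : (fun e => Min.min (f e) (g e)) = fun e => f e - (f e - g e) := by grind
  rw [this]; fun_prop

lemma iterate_threshold {p : ℕ → Bool} {b : ℕ} (h : ∀ t ≤ b, p t = decide (t < b)) (j : ℕ) :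
    (fun t => bif p t then t + 1 else t)^[j] 0 = min j b := by
  induction j with
  | zero => simp
  | succ j ih =>
    rw [iterate_succ_apply', ih, h _ (min_le_right _ _)]
    by_cases hj : min j b < b <;> simp only [hj, decide_true, decide_false, cond_true, cond_false] <;>
      omega

/-- A function is determined by the numbers below its values. -/
lemma PT.of_threshold {p : σ → ℕ → Bool} (hn : PT n) (hp : PT fun q : σ × ℕ => p q.1 q.2)
    (hfn : ∀ e, f e ≤ n e) (h : ∀ e, ∀ t ≤ f e, p e t = decide (t < f e)) : PT f := by
  have := PT.iterate (init := fun _ => 0) (g := fun e t => bif p e t then t + 1 else t) hn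
    (by fun_prop) (by fun_prop) (.C 2) fun e t => by
      cases p e t <;> simp [csize_nat]; omega
  simpa only [fun e => iterate_threshold (h e) (n e), fun e => min_eq_right (hfn e)] using this

@[fun_prop] lemma PT.div_const (hf : PT f) (k : ℕ) : PT fun e => f e / k := by
  rcases Nat.eq_zero_or_pos k with rfl | hk
  · simpa using PT.const 0
  · refine PT.of_threshold (p := fun e t => Nat.ble ((t + 1) * k) (f e)) hf (by fun_prop)
      (fun e => Nat.div_le_self _ _) fun e t _ => ?_
    rw [Bool.eq_iff_iff, ble_eq, decide_eq_true_eq, ← Nat.le_div_iff_mul_le hk, Nat.succ_le_iff]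

@[fun_prop] lemma PT.mod_const (hf : PT f) (k : ℕ) : PT fun e => f e % k := by
  have : (fun e => f e % k) = fun e => f e - k * (f e / k) := by
    funext e; have := Nat.mod_add_div (f e) k; omega
  rw [this]; fun_prop

lemma iterate_min_two_mul (N j : ℕ) : (fun t => min N (t + t))^[j] (min N 1) = min N (2 ^ j) := by
  induction j with
  | zero => rfl
  | succ j ih => rw [iterate_succ_apply', ih, pow_succ]; omega

/-- Numbers are in unary, so a power of two is polynomial only under a cap; repeated doubling with
the cap applied in each step keeps all intermediate values below it. -/
lemma PT.min_two_pow (hn : PT n) (hm : PT m) : PT fun e => Min.min (n e) (2 ^ m e) := by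
  obtain ⟨B, hB, -⟩ := _root_.id hn
  have := PT.iterate_of_bound (init := fun e => Min.min (n e) 1) (g := fun e t => Min.min (n e) (t + t))
    hm (by fun_prop) (by fun_prop) B fun e j _ => by
      rw [iterate_min_two_mul]
      have := hB e
      rw [csize_nat] at *
      omega
  simpa only [iterate_min_two_mul] using this

lemma PT.two_pow (hn : PT n) (hm : PT m) (h : ∀ e, 2 ^ m e ≤ n e) : PT fun e => 2 ^ m e := by
  simpa only [fun e => min_eq_right (h e)] using hn.min_two_pow hm

@[fun_prop] lemma PT.log_two (hn : PT n) : PT fun e => Nat.log 2 (n e) := by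
  have h1 : PT fun q : σ × ℕ => Min.min (n q.1 + 1) (2 ^ (q.2 + 1)) :=
    PT.min_two_pow (by fun_prop) (by fun_prop)
  refine PT.of_threshold (p := fun e t => Nat.ble (Min.min (n e + 1) (2 ^ (t + 1))) (n e)) hn
    (by fun_prop) (fun e => Nat.log_le_self 2 _) fun e t _ => ?_
  rw [Bool.eq_iff_iff, ble_eq, decide_eq_true_eq, ← Nat.succ_le_iff]
  rcases Nat.eq_zero_or_pos (n e) with h0 | h0
  · have := Nat.one_lt_two_pow (n := t + 1) (by omega)
    simp only [h0, Nat.log_zero_right]; omega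
  · rw [Nat.le_log_iff_pow_le (by omega) (by omega)]; omega

@[fun_prop] lemma PT.bval {l : σ → List Bool} (hn : PT n) (hl : PT l) : PT fun e => bval (n e) (l e) := by
  obtain ⟨B, hB, -⟩ := _root_.id hn
  have := PT.foldl_of_bound (l := fun e => (l e).reverse) (init := fun _ => 0)
    (g := fun e t b => Min.min (n e) (2 * t + bif b then 1 else 0)) (by fun_prop) (by fun_prop)
    (by fun_prop) B fun e i => by
      refine le_trans ?_ (hB e)
      rw [← List.foldr_reverse, csize_nat, csize_nat]
      have := bval_le (n e) ((l e).reverse.take i).reverse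
      unfold HybridSAT.bval at this
      omega
  simp only [List.foldl_reverse] at this
  exact this

lemma PT.sum_map_range {f : σ → ℕ → ℕ} (hn : PT n) (hf : PT fun p : σ × ℕ => f p.1 p.2) :
    PT fun e => ((List.range (n e)).map (f e)).sum := by
  have : PT fun e => ((List.range (n e)).flatMap fun i => List.range (f e i)).length := by fun_prop
  simpa [List.length_flatMap] using this

end arithmetic

section walk

variable {σ : Type} [Code σ]

@[fun_prop] lemma PT.walk {F : σ → RawFormula} {x ρ : σ → List Bool} {t : σ → ℕ} (hF : PT F) (hx : PT x)
    (ht : PT t) (hρ : PT ρ) : PT fun e => walk (F e) (x e) (t e) (ρ e) := by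
  obtain ⟨B, hB, -⟩ := _root_.id hx
  refine PT.foldl_of_bound (l := fun e => List.range (t e)) (init := x) (g := fun e y i =>
    walkStep (F e) y ((ρ e).getD (2 * i) false) ((ρ e).getD (2 * i + 1) false)) (by fun_prop) hx ?_
    (4 * B + 1) fun e i => ?_
  · unfold walkStep flipAt firstFalse satRaw unsatClause
    fun_prop
  · rw [List.take_range]
    refine (csize_bits_le _).trans ?_
    have h1 := length_walk (F e) (x e) (Min.min i (t e)) (ρ e)
    have h2 := length_lt_csize (x e)
    have h3 := hB e
    unfold HybridSAT.walk at h1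
    simp only [eval_add, eval_mul, Polynomial.eval_ofNat, eval_one]
    omega

end walk

/-! #### Gates with many controls -/

namespace Trial

/-- A condition on the next auxiliary qubit. -/
def block (j : ℕ) (p : QName × Bool) : List (MCX QName) :=
  (bif p.2 then [] else [([], p.1)]) ++ [([(scr j, true), (p.1, true)], scr (j + 1))] ++
    bif p.2 then [] else [([], p.1)]

/-- `chain` is recursive in the middle of a list, which is not of a form covered by the calculus.
Unfolded, it consists of blocks in ascending order, the gate on the target, and the same blocks in
descending order; each block is a palindrome and need not be reversed. -/
lemma chain_scr (j : ℕ) (c : List (QName × Bool)) (t : QName) : chain scr (scr j) (j + 1) c t =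
      (range c.length).flatMap (fun i => block (j + i) (c.getD i ((0, 0), false))) ++
        [([(scr (j + c.length), true)], t)] ++
        (range c.length).reverse.flatMap fun i => block (j + i) (c.getD i ((0, 0), false)) := by
  induction c generalizing j with
  | nil => rfl
  | cons p c ih =>
    obtain ⟨q, v⟩ := p
    have h (i : ℕ) : j + 1 + i = j + (i + 1) := by omega
    simp only [chain, ih, length_cons, List.range_succ_eq_map, flatMap_cons,
      reverse_cons, List.flatMap_append, ← List.map_reverse, flatMap_map, h,
      List.getD_cons_zero, List.getD_cons_succ, flatMap_nil, block, Nat.add_zero]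
    simp

variable {σ : Type} [Code σ] {h : ℕ} {n j v : σ → ℕ} {a : σ → RawFormula × List Bool}

@[fun_prop] lemma pt_lev (hn : PT n) : PT fun e => lev h (n e) := by unfold lev; fun_prop

@[fun_prop] lemma pt_pow_lev (hn : PT n) : PT fun e => 2 ^ lev h (n e) :=
  PT.two_pow (n := fun e => n e + 1) (by fun_prop) (by fun_prop) fun e => by
    refine (pow_le_pow_right (by omega) (sub_le (Nat.log 2 (n e)) h)).trans ?_
    rcases Nat.eq_zero_or_pos (n e) with h0 | h0
    · simp [h0]
    · exact (Nat.pow_log_le_self 2 (by omega)).trans (by omega)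

@[fun_prop] lemma pt_pow_lev_add (hn : PT n) (k : ℕ) : PT fun e => 2 ^ (lev h (n e) + k) := by
  simp only [pow_add]; fun_prop

@[fun_prop] lemma pt_pow_timeBits (hn : PT n) : PT fun e => 2 ^ timeBits h (n e) := by
  simp only [timeBits, Nat.add_assoc]; fun_prop

@[fun_prop] lemma pt_binBits (hn : PT n) (hj : PT j) : PT fun e => binBits (lev h (n e)) (j e) := by
  unfold binBits; fun_prop

@[fun_prop] lemma pt_pow_binBits (hn : PT n) (hj : PT j) : PT fun e => 2 ^ binBits (lev h (n e)) (j e) :=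
  PT.two_pow (pt_pow_lev_add hn 8) (pt_binBits hn hj) fun e =>
    pow_le_pow_right (by omega) Walk.binBits_le

@[fun_prop] lemma pt_numCoins (hn : PT n) : PT fun e => numCoins (lev h (n e)) := by
  unfold numCoins; fun_prop

@[fun_prop] lemma pt_hlen (hn : PT n) : PT fun e => hlen h (n e) := by unfold hlen; fun_prop

@[fun_prop] lemma pt_csz (hn : PT n) : PT fun e => csz (n e) := by unfold csz; fun_prop

@[fun_prop] lemma pt_slot (hn : PT n) (hj : PT j) :
    PT fun e => slot (lev h (n e)) (hlen h (n e)) (j e) := by unfold slot; fun_prop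

@[fun_prop] lemma pt_offset (hn : PT n) (hj : PT j) : PT fun e => offset h (n e) (j e) := by
  refine PT.sum_map_range hj ?_
  unfold zsize zoneSize scrSize
  fun_prop

@[fun_prop] lemma pt_index {u : σ → QName} (hn : PT n) (hu : PT u) : PT fun e => index h (n e) (u e) := by
  unfold index; fun_prop

@[fun_prop] lemma pt_compile {L : σ → List (MCX QName)} (hn : PT n) (hL : PT L) :
    PT fun e => compile scr (index h (n e)) (L e) := by
  have h1 : ∀ (f : QName → ℕ) (g : MCX QName), g.toGate f = bif g.1.isEmpty then
      (0, f g.2, f g.2, f g.2) else bif g.1.tail.isEmpty then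
        (2, f (g.1.headD ((0, 0), false)).1, f g.2, f g.2) else
        (3, f (g.1.headD ((0, 0), false)).1, f (g.1.tail.headD ((0, 0), false)).1, f g.2) := by
    rintro f ⟨_ | ⟨a, _ | ⟨b, c⟩⟩, t⟩ <;> rfl
  have h0 := chain_scr 0
  have h2 : PT fun p : σ × MCX QName => expand scr p.2 := by
    simp only [Nat.zero_add] at h0
    simp only [expand, h0]
    simp only [block, scr]
    fun_prop
  unfold compile
  simp only [funext (h1 _)]
  fun_prop

end Trial

open Walk (lit binBits slot place hashPat numCoins zoneSize coinSel digit)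

/-! #### The circuit of the local search -/

lemma iterate_flatMap_append {α : Type} (f : α → List α) (d : ℕ) (l l' : List α) :
    (fun L => L.flatMap f)^[d] (l ++ l') =
      (fun L => L.flatMap f)^[d] l ++ (fun L => L.flatMap f)^[d] l' := by
  induction d generalizing l l' with
  | zero => rfl
  | succ d ih => simp only [iterate_succ_apply, List.flatMap_append, ih]

/-- For `i` up to the number of levels, `2^i` is at most linear in the number of variables, so a
constant factor for each level gives polynomial growth. -/
lemma csize_iterate_le {α : Type} [Code α] {g : α → α} {k : ℕ} (hg : ∀ t, csize (g t) ≤ 2 ^ k * csize t)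
    (i : ℕ) (t : α) : csize (g^[i] t) ≤ (2 ^ i) ^ k * csize t := by
  induction i with
  | zero => simp
  | succ i ih =>
    rw [iterate_succ_apply', pow_succ, mul_pow]
    nlinarith [(hg (g^[i] t)).trans (Nat.mul_le_mul_left _ ih)]

namespace Walk

/-- A part of the circuit: whether it is a copy, the level, the step, the registers. -/
abbrev Part : Type := Bool × (ℕ × ℕ) × (List ℕ × ℕ)

/-- The pieces of a part, on the next level. -/
def refine (s : Part) : List Part :=
  bif s.1 then [s] else
    [(false, (s.2.1.1 + 1, 2 * s.2.1.2), (s.2.2.1, s.2.1.1 + 1)),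
      (false, (s.2.1.1 + 1, 2 * s.2.1.2 + 1), ((s.2.1.1 + 1) :: s.2.2.1, s.2.2.2)),
      (true, (s.2.1.1 + 1, 0), ([], s.2.2.2)),
      (false, (s.2.1.1 + 1, 2 * s.2.1.2), (s.2.2.1, s.2.1.1 + 1))]

/-- The gates of a part. -/
def partGates (A : Walk) (s : Part) : List (MCX QName) :=
  bif s.1 then A.copy s.2.1.1 s.2.2.2 else A.leaf s.2.1.2 s.2.2.1 s.2.2.2

lemma iterate_refine_copy (d : ℕ) (c : (ℕ × ℕ) × (List ℕ × ℕ)) :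
    (fun L : List Part => L.flatMap refine)^[d] [(true, c)] = [(true, c)] := by
  induction d with
  | zero => rfl
  | succ d ih => rw [iterate_succ_apply]; exact ih

/-- The recursion with three calls is replaced by an iteration: a list of symbolic parts is refined
level by level, all parts at once, and translated into gates only at the end. This puts the circuit
into the reach of `PT.iterate_of_bound`. -/
lemma gen_eq (A : Walk) (d j k : ℕ) (base : List ℕ) (z : ℕ) : A.gen d j (k * 2 ^ d) base z =
    ((fun L : List Part => L.flatMap refine)^[d] [(false, (j, k), (base, z))]).flatMap A.partGates := by
  induction d generalizing j k base z with
  | zero => simp [gen, partGates]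
  | succ d ih =>
    have h1 : k * 2 ^ (d + 1) = (2 * k) * 2 ^ d := by ring
    have h2 : (2 * k) * 2 ^ d + 2 ^ d = (2 * k + 1) * 2 ^ d := by ring
    rw [iterate_succ_apply, gen, h1, h2, ih, ih]
    change _ = List.flatMap _ (_^[d] ([_] ++ ([_] ++ ([_] ++ [_]))))
    simp only [iterate_flatMap_append, iterate_refine_copy, List.flatMap_append, append_assoc]
    simp [partGates]

lemma csize_refine_le (L : List Part) : csize (L.flatMap refine) ≤ 2 ^ 6 * csize L := by
  induction L with
  | nil => simp [csize_nil]
  | cons s L ih =>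
    have h1 := csize_append (refine s) (L.flatMap refine)
    have h2 : csize (refine s) ≤ 2 ^ 6 * csize s := by
      obtain ⟨b, ⟨j, k⟩, base, z⟩ := s
      have h3 := csize_pos base
      have h4 := csize_bool_le false
      have h5 := csize_bool_le true
      cases b <;> simp only [refine, cond_true, cond_false, csize_cons, csize_nil, csize_pair,
        csize_nat] <;> omega
    rw [flatMap_cons, csize_cons]
    omega

end Walk

namespace Trial

variable {σ : Type} [Code σ] {h : ℕ} {j v : σ → ℕ} {a : σ → RawFormula × List Bool}

@[fun_prop] lemma pt_timeCoins (ha : PT a) : PT fun e => timeCoins h (a e) := by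
  unfold timeCoins walkCoins; fun_prop

@[fun_prop] lemma pt_timeBits (hj : PT j) : PT fun e => timeBits h (j e) := by unfold timeBits; fun_prop

@[fun_prop] lemma pt_hashCoins (ha : PT a) : PT fun e => hashCoins h (a e) := by unfold hashCoins; fun_prop

@[fun_prop] lemma pt_center (ha : PT a) : PT fun e => center h (a e) := by
  unfold center time walkCoins; fun_prop

@[fun_prop] lemma pt_hashPat (ha : PT a) (hj : PT j) (hv : PT v) : PT fun e =>
    hashPat (lev h (a e).1.1) (hlen h (a e).1.1) (hashes h (a e)) (j e) (v e) := by
  unfold hashPat place Walk.hash hashes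
  fun_prop

@[fun_prop] lemma pt_coinSel (hj : PT j) (hv : PT v) : PT fun e => coinSel (j e) (v e) := by
  -- Digits and bits are needed for the 27 constants only, so they are put into a constant table and
  -- no arithmetic on them has to be carried out.
  have h1 : ∀ i c, coinSel i c = (((range 27).map fun e => ((range 3).map (digit e),
      (range 5).map e.testBit)).filter fun p => p.1.getD (i % 3) 0 == c).map fun p =>
      (range 5).map fun t => (((2, 5 * (i / 3) + t) : QName), p.2.getD t false) := by
    intro i c
    have h3 : i % 3 < 3 := mod_lt _ (by omega)
    simp only [coinSel, List.filter_map, map_map, comp_def]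
    have h4 : ∀ e, ((range 3).map (digit e)).getD (i % 3) 0 = digit e (i % 3) := by grind
    simp only [h4]
    refine map_congr_left fun e _ => map_congr_left fun t ht => ?_
    rw [getD_eq_getElem _ _ (by simpa using ht), getElem_map, getElem_range]
  simp only [h1]
  fun_prop

lemma data_n (a : RawFormula × List Bool) : (data h a).n = a.1.1 := rfl
lemma data_clauses (a : RawFormula × List Bool) : (data h a).clauses = a.1.2 := rfl
lemma data_x (a : RawFormula × List Bool) : (data h a).x = center h a := rfl
lemma data_pat (a : RawFormula × List Bool) : (data h a).pat =
    hashPat (lev h a.1.1) (hlen h a.1.1) (hashes h a) := rfl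
lemma data_sel (a : RawFormula × List Bool) : (data h a).sel = coinSel := rfl
lemma data_q (a : RawFormula × List Bool) : (data h a).q = csz a.1.1 := rfl

@[fun_prop] lemma pt_toggles {l : σ → List (List (QName × Bool) × ℕ)} (ha : PT a) (hj : PT j) (hl : PT l) :
    PT fun e => (data h (a e)).toggles (j e) (l e) := by
  simp only [Walk.toggles, Walk.patT, data_pat]; fun_prop

variable {base : σ → List ℕ} {C : σ → List (Bool × ℕ)}

@[fun_prop] lemma pt_pre (ha : PT a) (hj : PT j) (hb : PT base) (hC : PT C) :
    PT fun e => (data h (a e)).pre (j e) (base e) (C e) := by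
  simp only [Walk.pre, lit, data_pat]; fun_prop

@[fun_prop] lemma pt_uns (ha : PT a) (hj : PT j) (hC : PT C) :
    PT fun e => (data h (a e)).uns (j e) (C e) := by
  obtain ⟨x, hx⟩ : ∃ x : σ → List Bool, ∀ e, center h (a e) = x e := ⟨_, fun _ => rfl⟩
  have h1 : PT fun e => center h (a e) := by fun_prop
  simp only [hx] at h1
  simp only [Walk.uns, lit, data_x, hx]
  fun_prop

@[fun_prop] lemma pt_inc {c : σ → List (QName × Bool)} (ha : PT a) (hj : PT j) (hc : PT c) :
    PT fun e => (data h (a e)).inc (j e) (c e) := by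
  simp only [Walk.inc, data_q]; fun_prop

@[fun_prop] lemma pt_cntZero (ha : PT a) (hj : PT j) : PT fun e => (data h (a e)).cntZero (j e) := by
  simp only [Walk.cntZero, data_q]; fun_prop

@[fun_prop] lemma pt_count (ha : PT a) (hj : PT j) (hv : PT v) (hb : PT base) (hC : PT C) :
    PT fun e => (data h (a e)).count (j e) (v e) (base e) (C e) := by
  unfold Walk.count; fun_prop

@[fun_prop] lemma pt_leafClause (ha : PT a) (hj : PT j) (hv : PT v) (hb : PT base) (hC : PT C) :
    PT fun e => (data h (a e)).leafClause (j e) (base e) (v e) (C e) := by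
  simp only [Walk.leafClause, lit, data_sel]; fun_prop

@[fun_prop] lemma pt_partGates {s : σ → Walk.Part} (ha : PT a) (hs : PT s) :
    PT fun e => (data h (a e)).partGates (s e) := by
  simp only [Walk.partGates, Walk.leaf, Walk.copy, data_n, data_clauses, data_pat]; fun_prop

-- The number of refinements is `lev`, and each one multiplies the size by at most `2^6`; so the
-- list of parts is bounded by the sixth power of `2^lev` times a constant.
@[fun_prop] lemma pt_search (ha : PT a) : PT fun e => (data h (a e)).search (lev h (a e).1.1) := by
  have h1 : PT fun e => 2 ^ lev h (a e).1.1 := by fun_prop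
  obtain ⟨B, hB, -⟩ := h1
  have h2 := PT.iterate_of_bound (σ := σ) (n := fun e => lev h (a e).1.1)
    (init := fun _ => [((false, (0, 0), ([], 0)) : Walk.Part)])
    (g := fun _ L => L.flatMap Walk.refine) (by fun_prop) (by fun_prop)
    (by unfold Walk.refine; fun_prop)
    (B ^ 6 * .C (csize [((false, (0, 0), ([], 0)) : Walk.Part)])) fun e i hi => by
      refine (csize_iterate_le Walk.csize_refine_le i _).trans ?_
      rw [eval_mul, eval_pow, eval_C]
      refine Nat.mul_le_mul_right _ (Nat.pow_le_pow_left ?_ _)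
      have := hB e
      simp only [csize_nat] at this
      exact (pow_le_pow_right (by omega) hi).trans (by omega)
  have h3 : ∀ D (A : Walk), A.search D = _ := fun D A => by
    simpa only [Nat.zero_mul] using! A.gen_eq D 0 0 [] 0
  simp only [h3]
  exact h2.flatMap (by fun_prop)

@[fun_prop] lemma pt_prep : PT (prep h) := by
  unfold prep groverPrep coin; fun_prop

@[fun_prop] lemma pt_body : PT (body h) := by
  unfold body groverBody Walk.oracle Walk.searchCount Walk.countAll coin
  simp only [data_clauses]
  fun_prop

@[fun_prop] lemma pt_post : PT (post h) := by
  unfold post; fun_prop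

@[fun_prop] lemma pt_cand : PT (cand h) := by
  unfold cand decode holds
  simp only [data_pat]
  fun_prop

@[fun_prop] lemma pt_stack : PT fun a => groverStack (iterNum h a) := by
  unfold groverStack iterNum; fun_prop

/-- The scheme with `P * n / Q` repetitions less than all repetitions which the search saves. -/
def scheme (h P Q : ℕ) : Scheme where
  ncoins F := ncoins h F.1
  prep := prep h
  body := body h
  post := post h
  stack a := groverStack (iterNum h a)
  nq F := numQubits h F.1
  cand := cand h
  rounds F := P * F.1 / Q - 15 * 2 ^ lev h F.1 / 16
  pt_ncoins := by unfold ncoins; fun_prop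
  pt_prep := pt_prep
  pt_body := pt_body
  pt_post := pt_post
  pt_stack := pt_stack
  pt_nq := by unfold numQubits; fun_prop
  pt_cand := pt_cand
  pt_rounds := by fun_prop

end Trial

open Walk (lit IsPath GoodHash numCoins ofHash)

/-! ### The probability of success -/

lemma threeSAT_rawFormula {n : ℕ} (F : Formula n) : ThreeSAT (rawFormula F) := by
  constructor <;> intro C hC <;> obtain ⟨C, -, rfl⟩ := mem_map.1 hC
  · rfl
  · intro a ha
    interval_cases a <;> simp [lit, rawClause, rawFormula]

/-- Binary digits from fair coins give a uniformly distributed number; the sum is split into even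
and odd numbers according to the first digit. -/
lemma bsum_bval (m N : ℕ) (hN : 2 ^ m ≤ N) (g : ℕ → ℝ) :
    bsum m (fun l => g (bval N l)) = ∑ t ∈ Finset.range (2 ^ m), g t := by
  have h2 (g : ℕ → ℝ) (k : ℕ) :
      ∑ t ∈ Finset.range (2 * k), g t = ∑ t ∈ Finset.range k, (g (2 * t) + g (2 * t + 1)) := by
    induction k with
    | zero => simp
    | succ k ih => rw [Nat.mul_succ, sum_range_succ, sum_range_succ, ih,
        sum_range_succ, add_assoc]
  induction m generalizing g with
  | zero => simp [bsum_zero, bval]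
  | succ m ih =>
    have h1 : 2 ^ m ≤ N := (pow_le_pow_right (by omega) (by omega)).trans hN
    have h3 (b : Bool) : bsum m (fun l => g (bval N (b :: l))) =
        bsum m fun l => g (2 * bval N l + bif b then 1 else 0) :=
      bsum_congr fun l hl => by rw [(bval_cons (by rwa [hl])).1]
    rw [bsum_succ', h3, h3, ih h1 (fun t => g (2 * t + bif false then 1 else 0)),
      ih h1 (fun t => g (2 * t + bif true then 1 else 0)), pow_succ', h2, sum_add_distrib]
    rfl

namespace Trial

variable {h n M P Q : ℕ} (F : Formula n)

lemma length_clauses_lt : (rawFormula F).2.length < 2 ^ csz n := by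
  have h1 : F.clauses.length ≤ (n * 2) * ((n * 2) * (n * 2)) := by
    rw [← List.toFinset_card_of_nodup F.nodup]
    refine (Finset.card_le_univ _).trans_eq ?_
    simp [Clause, Literal]
  have h2 : n < 2 ^ (Nat.log 2 n + 1) := Nat.lt_pow_succ_log_self (by omega) n
  have h3 : (2 ^ (Nat.log 2 n + 1)) ^ 3 * 16 = 2 ^ csz n := by
    rw [csz, ← pow_mul, show 16 = 2 ^ 4 by rfl, ← pow_add]
    congr 1
    ring
  have h4 : n ^ 3 < (2 ^ (Nat.log 2 n + 1)) ^ 3 := Nat.pow_lt_pow_left h2 (by omega)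
  rw [rawFormula, length_map, ← h3]
  nlinarith

variable {ρ : List Bool} (hρ : ρ.length = ncoins h n)

lemma stackReps_groverStack_le (s : ℕ) : stackReps (groverStack s) ≤ 2 ^ (s - 1) := by
  rcases s with _ | s <;> simp [groverStack, stackReps]

lemma fits (hM : numQubits h n ≤ M) (hn : 0 < M) : (scheme h P Q).Fits M
    (2 ^ ((numCoins (lev h n) + 1) / 2)) (rawFormula F) where
  pos := hn
  nq_le := hM
  prep ρ hρ g hg := by
    have h1 : index h n (6, 0) < numQubits h n := index_lt layout.minus_mem
    change g ∈ groverPrep (index h n) _ _ _ at hg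
    simp only [groverPrep, cons_append, nil_append, mem_cons, mem_map, mem_range] at hg
    rcases hg with rfl | rfl | ⟨j, hj, rfl⟩
    · exact ⟨h1, h1, h1⟩
    · exact ⟨h1, h1, h1⟩
    · have := index_lt (coin_mem.2 hj)
      exact ⟨this, this, this⟩
  body ρ hρ g hg := by
    change g ∈ groverBody scr (index h n) _ _ _ _ at hg
    have h2 : ∀ g ∈ (range (numCoins (lev h n))).map fun j =>
        ((1, index h n (coin j), index h n (coin j), index h n (coin j)) : Gate),
        Gate.Below (numQubits h n) g := by
      intro g hg
      obtain ⟨j, hj, rfl⟩ := mem_map.1 hg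
      have := index_lt (coin_mem.2 (mem_range.1 hj))
      exact ⟨this, this, this⟩
    simp only [groverBody, mem_append, mem_reverse] at hg
    rcases hg with ((hg | hg) | hg) | hg
    · exact (compilable_oracle (threeSAT_rawFormula F) (length_clauses_lt F) hρ).below g hg
    · exact h2 g hg
    · exact compilable_zero.below g hg
    · exact h2 g hg
  post ρ hρ g hg := (compilable_search (threeSAT_rawFormula F) (length_clauses_lt F) hρ).below g hg
  reps ρ hρ := (stackReps_groverStack_le _).trans (pow_le_pow_right (by omega)
    (Nat.sub_le_of_le_add (min_le_left _ _)))
  cand ρ o hρ ho := (length_map _).trans length_range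

/-- The probability of success with the coins `ρ`. -/
def success (h M : ℕ) (F : Formula n) (ρ : List Bool) : ℝ :=
  bsum (numQubits h n) fun o => if satRaw (rawFormula F) (cand h ((rawFormula F, ρ), o)) then
    ‖(scheme h 0 0).final M (rawFormula F, ρ) (toBits o)‖ ^ 2 else 0

lemma successProb_eq : (scheme h P Q).successProb M (rawFormula F) =
    (1 / 2) ^ ncoins h n * bsum (ncoins h n) (success h M F) :=
  bsum_mul_left _ _

lemma success_nonneg : 0 ≤ success h M F ρ :=
  bsum_nonneg fun o _ => by split_ifs <;> positivity

lemma sin_sq_le_success (hM : numQubits h n ≤ M) (hn : 0 < M) {F : Formula n}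
    (hρ : ρ.length = ncoins h n)
    (hf : 0 < (Finset.univ.filter fun c => flag (h := h) (rawFormula F, ρ) c = true).card) :
    sin ((2 * stackReps (groverStack (iterNum h (rawFormula F, ρ))) + 1) *
      groverAngle (flag (h := h) (rawFormula F, ρ))) ^ 2 ≤ success h M F ρ := by
  have hF := threeSAT_rawFormula F
  have hcl := length_clauses_lt F
  have h1 := layout.sin_sq_le hM (compilable_oracle hF hcl hρ) (isPhaseOracle hF hcl hρ)
    compilable_zero hf (compilable_search hF hcl hρ)
    (fun c : Fin M → Bool => satRaw (rawFormula F) (decode h (rawFormula F, ρ)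
      fun i => if hi : i < M then c ⟨i, hi⟩ else false) = true)
    (fun w hw hfl c hc => satRaw_decode hF hcl hρ hw hfl fun u hu => hc u hu)
    (stackReps (groverStack (iterNum h (rawFormula F, ρ))))
  refine h1.trans_eq ?_
  rw [sum_eq_bsum hM]
  · refine bsum_congr fun o ho => ?_
    have h2 : (fun i => if hi : i < M then (toBits o : Fin M → Bool) ⟨i, hi⟩ else false) =
        fun i => o.getD i false := by
      funext i
      split_ifs with hi
      · rfl
      · rw [List.getD_eq_default _ _ (by omega)]
    rw [h2]
    rfl
  · intro b i hi hb
    have := (fits (P := 0) (Q := 0) F hM hn).suppBelow_final hρ b i hi hb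
    split_ifs
    · change ‖(scheme h 0 0).final M (rawFormula F, ρ) b‖ ^ 2 = 0
      rw [this]; simp
    · rfl

variable {x w τ H s : List Bool}

lemma data_append (hx : x.length = n) (hw : w.length = 2 * 2 ^ timeBits h n)
    (hτ : τ.length = timeBits h n) (hH : H.length = n * hlen h n) :
    center h (rawFormula F, x ++ (w ++ (τ ++ (H ++ s)))) =
        walk (rawFormula F) x (bval (2 ^ timeBits h n) τ) w ∧
      hashes h (rawFormula F, x ++ (w ++ (τ ++ (H ++ s)))) = H ∧
      iterNum h (rawFormula F, x ++ (w ++ (τ ++ (H ++ s)))) =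
        min ((numCoins (lev h n) + 1) / 2 + 1) (bval (2 ^ (lev h n + 1)) s) := by
  have h1 : walkCoins (rawFormula F, x ++ (w ++ (τ ++ (H ++ s)))) = w ++ (τ ++ (H ++ s)) :=
    drop_left' hx
  have h2 : timeCoins h (rawFormula F, x ++ (w ++ (τ ++ (H ++ s)))) = τ ++ (H ++ s) := by
    rw [timeCoins, h1]; exact drop_left' hw
  have h3 : time h (rawFormula F, x ++ (w ++ (τ ++ (H ++ s)))) = bval (2 ^ timeBits h n) τ := by
    rw [time, h2]; exact congrArg _ (take_left' hτ)
  have h4 : hashCoins h (rawFormula F, x ++ (w ++ (τ ++ (H ++ s)))) = H ++ s := by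
    rw [hashCoins, h2]; exact drop_left' hτ
  refine ⟨?_, ?_, ?_⟩
  · rw [center, h1, h3]
    change walk _ ((x ++ _).take n) _ _ = _
    rw [take_left' hx, walk_append]
    have := bval_lt (N := 2 ^ timeBits h n) (l := τ) (by rw [hτ])
    rw [hτ] at this
    omega
  · rw [hashes, h4]; exact take_left' hH
  · rw [iterNum, h4]
    change min _ (bval _ ((H ++ s).drop (n * hlen h n))) = _
    rw [drop_left' hH]
    rfl

/-- The last coins choose the number of iterations. The marked set does not depend on them, so the
good choice of `exists_iterations` exists independently of them, and this single choice already
contributes `1/4`. That `lev + 1` coins suffice to represent it uses `7 ≤ lev`. -/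
lemma le_sum_success (hM : numQubits h n ≤ M) (hn : 0 < M) (hD : 7 ≤ lev h n) {P : List ℕ}
    (hx : x.length = n) (hw : w.length = 2 * 2 ^ timeBits h n) (hτ : τ.length = timeBits h n)
    (hH : H.length = n * hlen h n)
    (hP : IsPath (rawFormula F) (walk (rawFormula F) x (bval (2 ^ timeBits h n) τ) w) P)
    (hPl : P.length ≤ 2 ^ lev h n)
    (hg : GoodHash (lev h n) (hlen h n) n P (Walk.hash (hlen h n) H)) :
    1 / 4 ≤ bsum (lev h n + 1) fun s => success h M F (x ++ (w ++ (τ ++ (H ++ s)))) := by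
  have hlen : ∀ s : List Bool, s.length = lev h n + 1 →
      (x ++ (w ++ (τ ++ (H ++ s)))).length = ncoins h n := fun s hs => by
    simp only [length_append, hx, hw, hτ, hH, hs, ncoins]
  have hc (s : List Bool) := data_append (h := h) F (s := s) hx hw hτ hH
  have hflag : ∀ s : List Bool, s.length = lev h n + 1 → 0 < (Finset.univ.filter fun c =>
      flag (h := h) (rawFormula F, x ++ (w ++ (τ ++ (H ++ s)))) c = true).card := fun s hs =>
    exists_flag (threeSAT_rawFormula F) (length_clauses_lt F) (hlen s hs)
      (by rw [(hc s).1]; exact hP) hPl (by rw [(hc s).2.1]; exact hg)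
  have hz : (List.replicate (lev h n + 1) false).length = lev h n + 1 := List.length_replicate
  obtain ⟨m, hm, hsin⟩ := exists_iterations _ (hflag _ hz)
  have hk : (numCoins (lev h n) + 1) / 2 + 1 < 2 ^ (lev h n + 1) := by
    have : 2 ^ 7 ≤ 2 ^ lev h n := pow_le_pow_right (by omega) hD
    rw [numCoins, pow_succ]
    omega
  obtain ⟨s, hs, hsm⟩ := exists_bval (N := 2 ^ (lev h n + 1)) le_rfl (hm.trans_lt hk)
  have hfl : flag (h := h) (rawFormula F, x ++ (w ++ (τ ++ (H ++ List.replicate (lev h n + 1) false)))) =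
      flag (h := h) (rawFormula F, x ++ (w ++ (τ ++ (H ++ s)))) := by
    funext c
    simp only [flag, data, (hc s).1, (hc s).2.1, (hc _).1, (hc _).2.1]
  have h1 := sin_sq_le_success hM hn (hlen s hs) (hflag s hs)
  rw [(hc s).2.2, hsm, min_eq_right (show m ≤ (numCoins (lev h n) + 1) / 2 + 1 from hm), ← hfl] at h1
  refine (hsin.trans h1).trans ?_
  refine List.single_le_sum (fun r hr => ?_) _ (mem_map.2 ⟨s, mem_bitLists hs, rfl⟩)
  obtain ⟨s', -, rfl⟩ := mem_map.1 hr
  exact success_nonneg F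

lemma exists_isSolution {F : Formula n} (hF : ∃ x, F.IsSatisfied x) :
    ∃ z, IsSolution (rawFormula F) z := by
  obtain ⟨x, hx⟩ := hF
  refine ⟨fun i => if hi : i < n then x ⟨i, hi⟩ else false, fun C hC => ?_⟩
  obtain ⟨C, hC', rfl⟩ := mem_map.1 hC
  rcases hx C hC' with hl | hl | hl
  · exact ⟨0, by omega, by simpa [lit, rawClause, Literal.IsTrue] using hl⟩
  · exact ⟨1, by omega, by simpa [lit, rawClause, Literal.IsTrue] using hl⟩
  · exact ⟨2, by omega, by simpa [lit, rawClause, Literal.IsTrue] using hl⟩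

/-- Coins are thrown for the maximal number of steps; those beyond step `t` are not read and only
contribute their number. -/
lemma bsum_ind_goodState (F : RawFormula) (z : ℕ → Bool) (r : ℕ) (x : List Bool) {t T : ℕ}
    (ht : t ≤ T) : (bsum (2 * T) fun w => ind (GoodState F z r (walk F x t w))) =
      4 ^ T * goodProb F z r t x := by
  obtain ⟨k, rfl⟩ := Nat.exists_eq_add_of_le ht
  rw [Nat.mul_add, bsum_append]
  have : ∀ w : List Bool, w.length = 2 * t → (bsum (2 * k) fun w' =>
      ind (GoodState F z r (walk F x t (w ++ w')))) = 4 ^ k * ind (GoodState F z r (walk F x t w)) :=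
    fun w hw => by
      simp only [walk_append F x t w _ hw.ge]
      rw [bsum_const, pow_mul]
      norm_num
  rw [bsum_congr this, bsum_mul_left, goodProb, pow_add, one_div, inv_pow]
  field_simp

/-- The coins are divided into start, walk, number of steps, hash values and number of iterations,
and the probabilities multiply. The first factor pays for the start and for guessing the two
numbers, `1/4` comes from Grover's search, the power `2^(lev - 4)` from the hash values. The bracket
is the sum over starts and times for the walk to be near a solution. -/
lemma le_successProb {F : Formula n} (hM : numQubits h n ≤ M) (hn : 0 < M) (hD : 7 ≤ lev h n)
    (hF : ∃ x, F.IsSatisfied x) :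
    (1 / 2) ^ (n + timeBits h n + (lev h n + 1)) * (1 / 4 * (1 / 2) ^ 2 ^ (lev h n - 4)) *
        (2 ^ 2 ^ lev h n * (3 / 2) ^ n - 4 ^ 2 ^ lev h n / 4 * (5 / 4) ^ n -
          (23 / 24) ^ (2 ^ timeBits h n - 1) * 2 ^ n) ≤
      (scheme h P Q).successProb M (rawFormula F) := by
  obtain ⟨z, hz⟩ := exists_isSolution hF
  have hF3 := threeSAT_rawFormula F
  set e := timeBits h n
  set N := n * hlen h n
  set K : ℝ := 2 ^ N * (1 / 4 * (1 / 2) ^ 2 ^ (lev h n - 4)) with hK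
  have hK0 : 0 ≤ K := by positivity
  have hpos : 0 < 2 ^ e := by positivity
  -- The hash length is at least `Nat.log 2 n + 9`; this is eight bits more than are necessary to
  -- tell `n` variables apart.
  have h2n : 256 * n ≤ 2 ^ hlen h n := by
    have h1 : n < 2 ^ (Nat.log 2 n + 1) := Nat.lt_pow_succ_log_self (by omega) n
    have h2 : 2 ^ 8 * 2 ^ (Nat.log 2 n + 1) ≤ 2 ^ hlen h n := by
      rw [← pow_add]
      exact pow_le_pow_right (by omega) (by unfold hlen lev; omega)
    omega
  have h1 : ∀ x w τ : List Bool, x.length = n → w.length = 2 * 2 ^ e → τ.length = e →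
      K * ind (GoodState (rawFormula F) z (2 ^ lev h n) (walk (rawFormula F) x (bval (2 ^ e) τ) w)) ≤
        bsum N fun H => bsum (lev h n + 1) fun s => success h M F (x ++ (w ++ (τ ++ (H ++ s)))) := by
    intro x w τ hx hw hτ
    by_cases hg : GoodState (rawFormula F) z (2 ^ lev h n) (walk (rawFormula F) x (bval (2 ^ e) τ) w)
    · obtain ⟨p, hp, hpl⟩ : ∃ p, IsPath (rawFormula F) (walk (rawFormula F) x (bval (2 ^ e) τ) w) p ∧
          p.length ≤ 2 ^ lev h n := by
        rcases hg with hg | hg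
        -- If the walk has met some other solution, the empty path serves: the search has nothing to
        -- do and accepts at once.
        · exact ⟨[], isPath_nil ((satRaw_iff hF3 _).1 hg), Nat.zero_le _⟩
        · obtain ⟨p, hp, hpl⟩ := exists_isPath hz hF3.lt _
          exact ⟨p, hp, hpl.trans hg⟩
      have h2 := le_mean_goodHash (L := hlen h n) hD (by unfold hlen; omega) h2n hp.nodup hp.lt hpl
      have h3 : (1 / 4 : ℝ) * bsum N (fun H => ind (GoodHash (lev h n) (hlen h n) n p
          (Walk.hash (hlen h n) H))) ≤ bsum N fun H => bsum (lev h n + 1) fun s =>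
            success h M F (x ++ (w ++ (τ ++ (H ++ s)))) := by
        rw [← bsum_mul_left]
        refine bsum_le fun H hH => ?_
        by_cases hgh : GoodHash (lev h n) (hlen h n) n p (Walk.hash (hlen h n) H)
        · rw [ind_pos hgh, mul_one]
          exact le_sum_success F hM hn hD hx hw hτ hH hp hpl hgh
        · rw [ind_neg hgh, mul_zero]
          exact bsum_nonneg fun s _ => success_nonneg F
      refine le_trans ?_ h3
      rw [ind_pos hg, mul_one, hK]
      have h4 : (2 : ℝ) ^ N * (1 / 2) ^ N = 1 := by rw [← mul_pow]; norm_num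
      have h5 := mul_le_mul_of_nonneg_left h2 (by positivity : (0 : ℝ) ≤ 2 ^ N * (1 / 4))
      rw [show (2 : ℝ) ^ N * (1 / 4) * ((1 / 2) ^ N * bsum N fun H => ind (GoodHash (lev h n)
        (hlen h n) n p (Walk.hash (hlen h n) H))) = (2 ^ N * (1 / 2) ^ N) * (1 / 4 * bsum N fun H =>
          ind (GoodHash (lev h n) (hlen h n) n p (Walk.hash (hlen h n) H))) by ring, h4, one_mul] at h5
      linarith
    · rw [ind_neg hg, mul_zero]
      exact bsum_nonneg fun H _ => bsum_nonneg fun s _ => success_nonneg F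
  have h2 : K * 4 ^ 2 ^ e * (2 ^ 2 ^ lev h n * (3 / 2) ^ n - 4 ^ 2 ^ lev h n / 4 * (5 / 4) ^ n -
      (23 / 24) ^ (2 ^ e - 1) * 2 ^ n) ≤ bsum (ncoins h n) (success h M F) := by
    rw [ncoins, bsum_append]
    refine (mul_le_mul_of_nonneg_left (le_bsum_sum_goodProb hF3 hz (2 ^ lev h n) (2 ^ e - 1))
      (by positivity)).trans ?_
    rw [Nat.sub_add_cancel hpos, ← bsum_mul_left]
    refine bsum_le fun x hx => ?_
    rw [bsum_append]
    have h3 : ∀ w : List Bool, w.length = 2 * 2 ^ e → (K * ∑ t ∈ Finset.range (2 ^ e),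
        ind (GoodState (rawFormula F) z (2 ^ lev h n) (walk (rawFormula F) x t w))) ≤
        bsum (e + (N + (lev h n + 1))) fun ρ => success h M F (x ++ (w ++ ρ)) := by
      intro w hw
      rw [← bsum_bval e (2 ^ e) le_rfl, bsum_append, ← bsum_mul_left]
      refine bsum_le fun τ hτ => ?_
      rw [bsum_append]
      exact h1 x w τ hx hw hτ
    refine le_trans (le_of_eq ?_) (bsum_le h3)
    rw [bsum_mul_left, bsum_sum, mul_assoc, mul_sum, sum_congr rfl fun t ht =>
      bsum_ind_goodState _ _ _ _ (Finset.mem_range.1 ht).le]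
  rw [successProb_eq]
  refine le_trans (le_of_eq ?_) (mul_le_mul_of_nonneg_left h2 (by positivity))
  have h3 : (4 : ℝ) ^ 2 ^ e * (1 / 2) ^ (2 * 2 ^ e) = 1 := by
    rw [pow_mul, ← mul_pow]; norm_num
  have h4 : (2 : ℝ) ^ N * (1 / 2) ^ N = 1 := by rw [← mul_pow]; norm_num
  have h5 : (1 / 2 : ℝ) ^ ncoins h n = (1 / 2) ^ (n + e + (lev h n + 1)) * (1 / 2) ^ (2 * 2 ^ e) *
      (1 / 2) ^ N := by
    rw [← pow_add, ← pow_add]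
    congr 1
    unfold ncoins
    ring
  rw [h5, hK, show ∀ a b c d f g X : ℝ, a * b * c * (d * f * g * X) = (g * b) * (d * c) * (a * f * X)
    from fun a b c d f g X => by ring, h3, h4, one_mul, one_mul]

end Trial

open Walk (numCoins)

/-! ### The resources -/

namespace Trial

variable {h n : ℕ}

/-- The levels `2i` and `2i + 1` have the same number of places. The extra summand on the left is
chosen so that each step of the induction is an equality; it is the tail of the infinite series. -/
lemma sum_level_le (a D : ℕ) : ∀ i : ℕ, 2 * i ≤ D + 16 →
    ∑ j ∈ Finset.range (2 * i), 2 ^ (D + 8 - j / 2) * (a + j / 2) + 2 ^ (D + 9 - i) * (a + i + 1) * 2 ≤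
      2 ^ (D + 8) * (4 * a + 4) := by
  intro i hi
  induction i with
  | zero => simp [pow_succ]; ring_nf; rfl
  | succ i ih =>
    have h1 := ih (by omega)
    rw [Nat.mul_succ, sum_range_succ, sum_range_succ]
    have h2 : 2 * i / 2 = i := by omega
    have h3 : (2 * i + 1) / 2 = i := by omega
    obtain ⟨k, hk⟩ : ∃ k, D + 8 = i + k := ⟨D + 8 - i, by omega⟩
    have h4 : D + 8 - i = k := by omega
    have h5 : D + 9 - i = k + 1 := by omega
    have h6 : D + 9 - (i + 1) = k := by omega
    rw [h2, h3, h4, h6]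
    rw [h5, pow_succ] at h1
    nlinarith

/-- A place on level `j` has `h + 2 + j/2` qubits, so the registers need at most `2^lev · 256 · (4
(h + 2) + 4) = (1024 h + 3072) 2^lev`. The coins and the equally many auxiliary qubits add `4 ·
2^lev`; counters and the rest are logarithmic in `n`. -/
lemma numQubits_le (hh : h ≤ Nat.log 2 n) : (numQubits h n : ℝ) ≤
    (1024 * h + 3076) * 2 ^ lev h n + (10 * Nat.log 2 n + 58) := by
  have h1 : ∀ i ≤ lev h n + 1, offset h n (7 + i) = offset h n 7 +
      ∑ j ∈ Finset.range i, 2 ^ (lev h n + 8 - j / 2) * (h + 2 + j / 2) := by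
    intro i hi
    induction i with
    | zero => simp
    | succ i ih =>
      rw [sum_range_succ, ← Nat.add_assoc, offset_succ, ih (by omega), zsize,
        Walk.zoneSize_level (by omega), Walk.slot, Walk.binBits, hlen,
        show lev h n + h + 9 - (lev h n + 8 - i / 2) + 1 = h + 2 + i / 2 by omega, Nat.add_assoc]
  have h2 := h1 (lev h n + 1) le_rfl
  have h3 := sum_level_le (h + 2) (lev h n) (lev h n / 2 + 1) (by omega)
  have h4 : ∑ j ∈ Finset.range (lev h n + 1), 2 ^ (lev h n + 8 - j / 2) * (h + 2 + j / 2) ≤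
      ∑ j ∈ Finset.range (2 * (lev h n / 2 + 1)), 2 ^ (lev h n + 8 - j / 2) * (h + 2 + j / 2) :=
    Finset.sum_le_sum_of_subset (Finset.range_mono (by omega))
  have h5 : offset h n 7 = 18 + 2 * numCoins (lev h n) + 3 * csz n + hlen h n := by
    simp [offset, range_succ, zsize, Walk.zoneSize, scrSize]
    ring
  have h6 : lev h n + h = Nat.log 2 n := by unfold lev; omega
  have h7 : numQubits h n ≤ (1024 * h + 3076) * 2 ^ lev h n + (10 * Nat.log 2 n + 58) := by
    rw [numQubits, show 8 + lev h n = 7 + (lev h n + 1) by ring, h2, h5, numCoins, csz, hlen, h6]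
    rw [pow_add] at h3
    have : 2 * (5 * (2 ^ lev h n / 3 + 1)) ≤ 4 * 2 ^ lev h n + 10 := by omega
    nlinarith [Nat.zero_le (2 ^ (lev h n + 9 - (lev h n / 2 + 1)) * (h + 2 + (lev h n / 2 + 1) + 1) * 2)]
  exact_mod_cast h7

lemma log_le (n : ℕ) : (Nat.log 2 n : ℝ) ≤ 2 * log n := by
  rcases Nat.eq_zero_or_pos n with rfl | hn
  · simp
  have h1 : ((2 : ℝ) ^ Nat.log 2 n) ≤ n := by exact_mod_cast Nat.pow_log_le_self 2 hn.ne'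
  have h2 := log_le_log (by positivity) h1
  rw [log_pow] at h2
  nlinarith [Real.log_two_gt_d9, (cast_nonneg (Nat.log 2 n) : (0 : ℝ) ≤ _)]

lemma eventually_log_le {δ : ℝ} (hδ : 0 < δ) :
    ∀ᶠ n : ℕ in Filter.atTop, 10 * (Nat.log 2 n : ℝ) + 58 ≤ δ * n := by
  have h1 := (Real.isLittleO_log_id_atTop.comp_tendsto tendsto_natCast_atTop_atTop).bound
    (show 0 < δ / 40 by positivity)
  have h2 := tendsto_natCast_atTop_atTop.eventually (Filter.eventually_ge_atTop (116 / δ))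
  filter_upwards [h1, h2, Filter.eventually_ge_atTop 1] with n h1 h2 h3
  have h4 : (0 : ℝ) ≤ log n := Real.log_natCast_nonneg n
  simp only [comp_apply, id, norm_eq_abs, abs_of_nonneg h4, Nat.abs_cast] at h1
  have h5 := log_le n
  rw [div_le_iff₀ hδ] at h2
  linarith

lemma le_schoeningExponent : 1 / 4 ≤ schoeningExponent := by
  rw [schoeningExponent, Real.le_logb_iff_rpow_le (by norm_num) (by norm_num)]
  have : ((2 : ℝ) ^ (1 / 4 : ℝ)) ^ 4 ≤ (4 / 3) ^ 4 := by
    rw [← rpow_natCast, ← rpow_mul (by norm_num)]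
    norm_num
  exact le_of_pow_le_pow_left₀ (by norm_num) (by norm_num) this

lemma three_quarters_pow (n : ℕ) : (3 / 4 : ℝ) ^ n = 2 ^ (-(schoeningExponent * n)) := by
  rw [Real.rpow_neg (by norm_num), rpow_mul (by norm_num), schoeningExponent,
    Real.rpow_logb (by norm_num) (by norm_num) (by norm_num), rpow_natCast, ← inv_pow]
  norm_num

/-- The size of the registers. -/
lemma pow_lev (hh : h ≤ Nat.log 2 n) (hn : n ≠ 0) :
    2 ^ h * 2 ^ lev h n ≤ n ∧ n < 2 * (2 ^ h * 2 ^ lev h n) := by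
  have : 2 ^ h * 2 ^ lev h n = 2 ^ Nat.log 2 n := by
    rw [← pow_add, lev]; congr 1; omega
  rw [this]
  refine ⟨Nat.pow_log_le_self 2 hn, ?_⟩
  rw [← pow_succ']
  exact Nat.lt_pow_succ_log_self (by omega) n

/-- Each of the two error terms is at most a quarter of the main term. For the first one, `4 · 2^lev
≤ n` gives `2^(2^lev) ≤ (6/5)^n`, and `6/5 · 5/4 = 3/2`. For the second one, there are at least `128
n + 127` steps, and `(23/24)^128 · 2 ≤ 3/2`. -/
lemma le_bracket (hh : 2 ≤ h) (hn : h ≤ Nat.log 2 n) (hn0 : n ≠ 0) :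
    (1 / 2 : ℝ) * (2 ^ 2 ^ lev h n * (3 / 2) ^ n) ≤ 2 ^ 2 ^ lev h n * (3 / 2) ^ n -
      4 ^ 2 ^ lev h n / 4 * (5 / 4) ^ n - (23 / 24) ^ (2 ^ timeBits h n - 1) * 2 ^ n := by
  obtain ⟨h1, h2⟩ := pow_lev hn hn0
  set r := 2 ^ lev h n
  have h4 : 4 * r ≤ n := (Nat.mul_le_mul_right r (pow_le_pow_right (by omega) hh)).trans h1
  have h5 : (2 : ℝ) ^ r ≤ (6 / 5) ^ n := calc
    (2 : ℝ) ^ r ≤ ((6 / 5) ^ 4) ^ r := pow_le_pow_left₀ (by norm_num) (by norm_num) r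
    _ = (6 / 5) ^ (4 * r) := (pow_mul _ _ _).symm
    _ ≤ (6 / 5) ^ n := pow_le_pow_right₀ (by norm_num) h4
  have h6 : (4 : ℝ) ^ r / 4 * (5 / 4) ^ n ≤ 1 / 4 * (2 ^ r * (3 / 2) ^ n) := by
    have e1 : (4 : ℝ) ^ r = 2 ^ r * 2 ^ r := by rw [← mul_pow]; norm_num
    have e2 : (3 / 2 : ℝ) ^ n = (6 / 5) ^ n * (5 / 4) ^ n := by rw [← mul_pow]; norm_num
    rw [e1, e2]
    have : 0 ≤ (2 : ℝ) ^ r * (5 / 4) ^ n := by positivity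
    nlinarith [mul_le_mul_of_nonneg_left h5 this]
  have h7 : 128 * n + 127 ≤ 2 ^ timeBits h n - 1 := by
    have : 2 ^ timeBits h n = 256 * (2 ^ h * r) := by
      rw [timeBits, pow_add, pow_add]; ring
    omega
  have h8 : (23 / 24 : ℝ) ^ (2 ^ timeBits h n - 1) * 2 ^ n ≤ 1 / 4 * (2 ^ r * (3 / 2) ^ n) := calc
    _ ≤ (23 / 24 : ℝ) ^ (128 * n + 127) * 2 ^ n :=
      mul_le_mul_of_nonneg_right (pow_le_pow_of_le_one (by norm_num) (by norm_num) h7) (by positivity)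
    _ = (23 / 24 : ℝ) ^ 127 * ((23 / 24 : ℝ) ^ 128 * 2) ^ n := by
      rw [pow_add, pow_mul, mul_pow]; ring
    _ ≤ 1 / 4 * (2 ^ r * (3 / 2) ^ n) := by
      refine mul_le_mul (by norm_num) ?_ (by positivity) (by norm_num)
      refine (pow_le_pow_left₀ (by positivity) (by norm_num : _ ≤ (3 / 2 : ℝ)) n).trans ?_
      exact le_mul_of_one_le_left (by positivity) (one_le_pow₀ (by norm_num))
  linarith

variable {P Q : ℕ} {δ : ℝ}

lemma lt_div_add_one (hQ : 0 < Q) : ((P : ℝ) / Q) * n < ((P * n / Q : ℕ) : ℝ) + 1 := by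
  have e : ((P * n : ℕ) : ℝ) < (P * n / Q : ℕ) * Q + Q := by
    exact_mod_cast Nat.lt_div_mul_add (a := P * n) hQ
  rw [div_mul_eq_mul_div, div_lt_iff₀ (by exact_mod_cast hQ)]
  push_cast at e
  linarith

/-- The balance with `r = 2^lev = 16 m`: being allowed to stop at distance `r` multiplies the
probability by `2^(16m)`, the hash values cost `2^m`, and the `15 m` rounds which are left out use
up the rest. The polynomial factors are absorbed by `δ n`. -/
lemma two_le_successProb {M : ℕ} {F : Formula n} (hM : numQubits h n ≤ M) (hh : 2 ≤ h)
    (hn : h + 7 ≤ Nat.log 2 n) (hQ : 0 < Q) (hPQ : schoeningExponent + δ ≤ P / Q)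
    (hδ : 10 * (Nat.log 2 n : ℝ) + 58 ≤ δ * n) (hF : ∃ x, F.IsSatisfied x) :
    2 ≤ 2 ^ (P * n / Q - 15 * 2 ^ lev h n / 16) * (scheme h P Q).successProb M (rawFormula F) := by
  have hn0 : n ≠ 0 := by rintro rfl; simp at hn
  have hlev : 7 ≤ lev h n := by unfold lev; omega
  have hM0 : 0 < M := (Nat.zero_le _).trans_lt ((index_lt layout.minus_mem).trans_le hM)
  have h1 := le_successProb (P := P) (Q := Q) hM hM0 hlev hF
  have h2 := le_bracket (n := n) hh (by omega) hn0
  -- Divisibility of the radius by `16` makes `15 r / 16` exact.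
  have h3 : 2 ^ lev h n = 16 * 2 ^ (lev h n - 4) := by
    rw [show 16 = 2 ^ 4 by rfl, ← pow_add]; congr 1; omega
  rw [h3] at h1 h2 ⊢
  set m := 2 ^ (lev h n - 4)
  have h4 : (2 : ℝ) ^ (timeBits h n + lev h n + 5) ≤ 2 ^ (P * n / Q) * (3 / 4) ^ n := by
    rw [three_quarters_pow, ← rpow_natCast, ← rpow_natCast, ← rpow_add (by norm_num)]
    refine Real.rpow_le_rpow_of_exponent_le (by norm_num) ?_
    have e1 := lt_div_add_one (P := P) (n := n) hQ
    have e2 : ((timeBits h n + lev h n + 5 : ℕ) : ℝ) ≤ 2 * Nat.log 2 n + 13 := by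
      have : timeBits h n + lev h n + 5 ≤ 2 * Nat.log 2 n + 13 := by unfold timeBits lev; omega
      exact_mod_cast this
    have e3 := mul_le_mul_of_nonneg_right hPQ (cast_nonneg n)
    have e4 : (0 : ℝ) ≤ Nat.log 2 n := cast_nonneg _
    linarith
  have h5 : P * n / Q ≤ P * n / Q - 15 * (16 * m) / 16 + 15 * m := by omega
  have h6 : (2 : ℝ) ^ (P * n / Q) ≤ 2 ^ (P * n / Q - 15 * (16 * m) / 16) * 2 ^ (15 * m) := by
    rw [← pow_add]; exact pow_le_pow_right₀ (by norm_num) h5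
  set b := P * n / Q - 15 * (16 * m) / 16
  have h7 := mul_le_mul_of_nonneg_left ((mul_le_mul_of_nonneg_left h2 (by positivity)).trans h1)
    (by positivity : (0 : ℝ) ≤ 2 ^ b)
  refine le_trans ?_ h7
  have h8 : (2 : ℝ) ^ b * ((1 / 2) ^ (n + timeBits h n + (lev h n + 1)) * (1 / 4 * (1 / 2) ^ m) *
      (1 / 2 * (2 ^ (16 * m) * (3 / 2) ^ n))) =
      (1 / 2) ^ (timeBits h n + lev h n + 4) * (2 ^ b * 2 ^ (15 * m) * (3 / 4) ^ n) := by
    have e1 : (3 / 4 : ℝ) ^ n = (1 / 2) ^ n * (3 / 2) ^ n := by rw [← mul_pow]; norm_num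
    have e2 : (1 / 2 : ℝ) ^ m * 2 ^ (16 * m) = 2 ^ (15 * m) := by
      rw [show 16 * m = m + 15 * m by ring, pow_add, ← mul_assoc, ← mul_pow]; norm_num
    rw [e1, ← e2]
    ring
  rw [h8]
  calc (2 : ℝ) = (1 / 2) ^ (timeBits h n + lev h n + 4) * 2 ^ (timeBits h n + lev h n + 5) := by
        rw [pow_succ (2 : ℝ), ← mul_assoc, ← mul_pow]; norm_num
    _ ≤ _ := mul_le_mul_of_nonneg_left (h4.trans (mul_le_mul_of_nonneg_right h6 (by positivity)))
      (by positivity)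

/-- The rounds save `15 r / 16` in the exponent and Grover's iterations cost about `5 r / 6`, so `5
r / 48` is saved; with `n < 2 · 2^h · r` this is at least `5/96 / 2^h` for each variable. -/
lemma time_le {γ : ℝ} (hh : 2 ≤ h) (hn : h + 7 ≤ Nat.log 2 n) (hQ : 0 < Q)
    (hPQ : schoeningExponent + δ ≤ P / Q) (hδ : 10 * (Nat.log 2 n : ℝ) + 58 ≤ δ * n)
    (hγ : (P : ℝ) / Q - 5 / 96 / 2 ^ h ≤ γ) :
    (2 : ℝ) ^ (P * n / Q - 15 * 2 ^ lev h n / 16) *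
      (((2 ^ ((numCoins (lev h n) + 1) / 2) : ℕ) : ℝ) + 1) ≤ 2 ^ 4 * 2 ^ (γ * n) := by
  have hn0 : n ≠ 0 := by rintro rfl; simp at hn
  obtain ⟨h1, h2⟩ := pow_lev (h := h) (n := n) (by omega) hn0
  have h3 : 2 ^ lev h n = 16 * 2 ^ (lev h n - 4) := by
    rw [show 16 = 2 ^ 4 by rfl, ← pow_add]; congr 1; unfold lev; omega
  set k := (numCoins (lev h n) + 1) / 2
  have hk : 6 * k ≤ 5 * 2 ^ lev h n + 18 := by
    simp only [k, numCoins]; omega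
  set r := 2 ^ lev h n
  have h4 : 4 * r ≤ n := (Nat.mul_le_mul_right r (pow_le_pow_right (by omega) hh)).trans h1
  have e1 : ((P * n / Q : ℕ) : ℝ) ≤ (P : ℝ) / Q * n := by
    have := Nat.cast_div_le (α := ℝ) (m := P * n) (n := Q)
    rw [div_mul_eq_mul_div]
    exact_mod_cast this
  have e2 := lt_div_add_one (P := P) (n := n) hQ
  have e3 := mul_le_mul_of_nonneg_right hPQ (cast_nonneg n)
  have e4 : (0 : ℝ) ≤ Nat.log 2 n := cast_nonneg _
  have e5 := mul_le_mul_of_nonneg_right le_schoeningExponent (cast_nonneg (α := ℝ) n)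
  -- The number of rounds is a truncated difference. By `1/4 ≤ schoeningExponent` and `4 r ≤ n`
  -- nothing is truncated.
  have e6 : r ≤ P * n / Q := by
    have : (4 * r : ℝ) ≤ n := by exact_mod_cast h4
    have : (r : ℝ) ≤ (P * n / Q : ℕ) := by linarith
    exact_mod_cast this
  have e7 : (((P * n / Q - 15 * r / 16 + (k + 1) : ℕ)) : ℝ) ≤ 4 + γ * n := by
    have f1 : 48 * (P * n / Q - 15 * r / 16 + (k + 1)) + 5 * r ≤ 48 * (P * n / Q) + 192 := by omega
    have f2 : (48 * ((P * n / Q - 15 * r / 16 + (k + 1) : ℕ) : ℝ) + 5 * r) ≤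
        48 * (P * n / Q : ℕ) + 192 := by exact_mod_cast f1
    have f3 : 5 / 96 / 2 ^ h * (n : ℝ) ≤ 5 / 48 * r := by
      rw [div_mul_eq_mul_div, div_le_iff₀ (by positivity)]
      have : (n : ℝ) ≤ 2 * (2 ^ h * r) := by exact_mod_cast h2.le
      linarith
    have f4 := mul_le_mul_of_nonneg_right hγ (cast_nonneg (α := ℝ) n)
    linarith
  calc _ ≤ (2 : ℝ) ^ (P * n / Q - 15 * r / 16) * 2 ^ (k + 1) := by
        refine mul_le_mul_of_nonneg_left ?_ (by positivity)
        have : (1 : ℝ) ≤ 2 ^ k := one_le_pow₀ (by norm_num)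
        push_cast
        rw [pow_succ]
        linarith
    _ = (2 : ℝ) ^ (((P * n / Q - 15 * r / 16 + (k + 1) : ℕ)) : ℝ) := by
        rw [rpow_natCast, ← pow_add]
    _ ≤ (2 : ℝ) ^ (4 + γ * n) := Real.rpow_le_rpow_of_exponent_le (by norm_num) e7
    _ = _ := by rw [rpow_add (by norm_num)]; norm_num

/-- The same `δ` is spent twice: in the exponent for the polynomial factors of the probability, and
in the fraction of qubits for the logarithmic part of the space. -/
lemma hybridSolvable {c γ : ℝ} (hh : 2 ≤ h) (hQ : 0 < Q) (hδ : 0 < δ)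
    (hPQ : schoeningExponent + δ ≤ P / Q) (hγ : (P : ℝ) / Q - 5 / 96 / 2 ^ h ≤ γ)
    (hc : (1024 * h + 3076) / 2 ^ h + δ ≤ c) : HybridSolvable c γ := by
  obtain ⟨n₀, hn₀⟩ := Filter.eventually_atTop.1 (eventually_log_le hδ)
  have hlog : ∀ n, max n₀ (2 ^ (h + 7)) ≤ n → h + 7 ≤ Nat.log 2 n := fun n hn =>
    Nat.le_log_of_pow_le (by omega) ((le_max_right _ _).trans hn)
  have hq : ∀ n, max n₀ (2 ^ (h + 7)) ≤ n → numQubits h n ≤ ⌊c * n⌋₊ := fun n hn => by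
    have hl := hlog n hn
    refine Nat.le_floor ((numQubits_le (by omega)).trans ?_)
    have h1 : (2 : ℝ) ^ h * 2 ^ lev h n ≤ n := by
      exact_mod_cast (pow_lev (n := n) (h := h) (by omega) (by rintro rfl; simp at hl)).1
    have h2 := hn₀ n ((le_max_left _ _).trans hn)
    have h3 : (1024 * (h : ℝ) + 3076) * 2 ^ lev h n ≤ (1024 * h + 3076) / 2 ^ h * n := by
      rw [div_mul_eq_mul_div, le_div_iff₀ (by positivity)]
      nlinarith [(by positivity : (0 : ℝ) ≤ 1024 * h + 3076)]
    have h4 := mul_le_mul_of_nonneg_right hc (cast_nonneg (α := ℝ) n)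
    linarith
  refine (scheme h P Q).hybridSolvable (max n₀ (2 ^ (h + 7)))
    (fun n => P * n / Q - 15 * 2 ^ lev h n / 16) (fun n => 2 ^ ((numCoins (lev h n) + 1) / 2))
    (fun n hn F => fits F (hq n hn) ?_) (fun n _ F => rfl)
    (fun n hn F hF => two_le_successProb (hq n hn) hh (hlog n hn) hQ hPQ
      (hn₀ n ((le_max_left _ _).trans hn)) hF) ⟨.C (2 ^ 4), ?_⟩
  · exact (Nat.zero_le _).trans_lt ((index_lt layout.minus_mem).trans_le (hq n hn))
  · refine Asymptotics.IsBigO.of_bound 1 ?_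
    filter_upwards [Filter.eventually_ge_atTop (max n₀ (2 ^ (h + 7)))] with n hn
    rw [norm_of_nonneg (by positivity), norm_of_nonneg (by simp; positivity), one_mul,
      eval_C]
    exact time_le hh (hlog n hn) hQ hPQ (hn₀ n ((le_max_left _ _).trans hn)) hγ

end Trial

/-! ### The fraction of the qubits -/

/-- The fraction of the qubits, up to a constant factor, as a function of the fraction of the
levels. -/
def load (x : ℝ) : ℝ := 2 ^ 20 * x * log (1 / x) + 2 ^ 20 * x

lemma load_eq (x : ℝ) : load x = 2 ^ 20 * (x + negMulLog x) := by
  rw [load, one_div, log_inv, negMulLog]; ring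

lemma strictMonoOn_load : StrictMonoOn load (Set.Icc 0 1) := by
  have h : StrictMonoOn (fun x => x + negMulLog x) (Set.Icc 0 1) := by
    refine strictMonoOn_of_deriv_pos (convex_Icc 0 1)
      (continuous_id.add Real.continuous_negMulLog).continuousOn fun x hx => ?_
    rw [interior_Icc] at hx
    have h1 := ((hasDerivAt_id x).add (Real.hasDerivAt_negMulLog hx.1.ne')).deriv
    have h2 := Real.log_neg hx.1 hx.2
    change deriv (id + negMulLog) x > 0
    rw [h1]
    linarith
  intro x hx y hy hxy
  rw [load_eq, load_eq]
  have := h hx hy hxy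
  simp only at this
  linarith

lemma exists_load_eq {c : ℝ} (hc : c ∈ Set.Ioo (0 : ℝ) 1) : ∃ x ∈ Set.Ioo (0 : ℝ) 1, load x = c := by
  have h : ContinuousOn load (Set.Icc 0 1) := by
    rw [funext load_eq]
    exact (continuous_const.mul (continuous_id.add Real.continuous_negMulLog)).continuousOn
  have := intermediate_value_Ioo zero_le_one h
  exact this ⟨by simpa [load_eq] using hc.1, by
    have := hc.2
    simp only [load_eq, Real.negMulLog_one]
    linarith⟩

/-- The fraction of the levels which are possible with the fraction `c` of the qubits. -/
def levelFraction (c : ℝ) : ℝ :=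
  open Classical in if hc : c ∈ Set.Ioo (0 : ℝ) 1 then (exists_load_eq hc).choose else 0

lemma levelFraction_spec {c : ℝ} (hc : c ∈ Set.Ioo (0 : ℝ) 1) :
    levelFraction c ∈ Set.Ioo (0 : ℝ) 1 ∧ load (levelFraction c) = c := by
  rw [levelFraction, dif_pos hc]
  exact (exists_load_eq hc).choose_spec

lemma log_bounds {x c : ℝ} (hx : x ∈ Set.Ioo (0 : ℝ) 1) (hc : c < 1) (h : load x = c) :
    2 ^ 20 * x < 1 ∧ 1 ≤ log (1 / x) ∧ 0 < log (1 / c) ∧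
      log (1 / c) ≤ log (1 / x) := by
  have h0 : 0 < log (1 / x) := log_pos (by rw [one_div]; exact (one_lt_inv₀ hx.1).2 hx.2)
  have h1 : 2 ^ 20 * x ≤ c := by
    rw [← h, load]
    have := mul_pos (mul_pos (by norm_num : (0 : ℝ) < 2 ^ 20) hx.1) h0
    linarith
  have hc0 : 0 < c := lt_of_lt_of_le (mul_pos (by norm_num) hx.1) h1
  refine ⟨h1.trans_lt hc, ?_, log_pos (by rw [one_div]; exact (one_lt_inv₀ hc0).2 hc),
    log_le_log (by positivity) (one_div_le_one_div_of_le hx.1 ?_)⟩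
  · rw [Real.le_log_iff_exp_le (by have := hx.1; positivity), le_div_iff₀ hx.1]
    have := Real.exp_one_lt_d9
    nlinarith [hx.1]
  · nlinarith [hx.1]

/-- Up to constants the equation is `x log (1/x) = c`, so the claim is that `log (1/x)` and `log
(1/c)` are comparable. One direction is `x ≤ c`, the other one a crude polynomial bound `c^4 ≤ x`
for small `c`. -/
lemma isTheta_levelFraction : Asymptotics.IsTheta (nhdsWithin 0 (Set.Ioi 0)) levelFraction
    fun c => c / log (1 / c) := by
  have hev : ∀ᶠ c : ℝ in nhdsWithin 0 (Set.Ioi 0), c ∈ Set.Ioo (0 : ℝ) (1 / 2 ^ 21) :=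
    Ioo_mem_nhdsGT (by norm_num)
  constructor <;> refine Asymptotics.IsBigO.of_bound (2 ^ 23) ?_ <;> filter_upwards [hev] with c hc
  all_goals
    have hc1 : c < 1 := hc.2.trans (by norm_num)
    obtain ⟨hx, h⟩ := levelFraction_spec ⟨hc.1, hc1⟩
    obtain ⟨h1, h2, h3, h4⟩ := log_bounds hx hc1 h
    rw [norm_of_nonneg hx.1.le, norm_of_nonneg (div_nonneg hc.1.le h3.le)]
    set x := levelFraction c
    have hx0 := hx.1
    have hl : c = 2 ^ 20 * x * log (1 / x) + 2 ^ 20 * x := h.symm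
  · rw [← mul_div_assoc, le_div_iff₀ h3]
    nlinarith [mul_le_mul_of_nonneg_left h4 hx0.le]
  · have h5 : log (1 / x) ≤ 4 * log (1 / c) := by
      -- From `log (1/x) ≤ 2 (1/√x - 1)` follows `c ≤ 2^21 √x`; the restriction to `c < 1/2^21`
      -- turns the constant into another factor `c`.
      have h6 : c ^ 2 ≤ sqrt x := by
        have h7 : 0 < sqrt x := sqrt_pos.2 hx0
        have h8 : log (1 / x) ≤ 2 * (1 / sqrt x - 1) := by
          have := Real.log_le_sub_one_of_pos (show 0 < 1 / sqrt x by positivity)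
          rw [one_div, log_inv, Real.log_sqrt hx0.le] at this
          rw [one_div x, log_inv]
          rw [← one_div] at this
          linarith
        have h9 : x * (1 / sqrt x) = sqrt x := by
          rw [mul_one_div, Real.div_sqrt]
        have h10 : c ≤ 2 ^ 21 * sqrt x := by
          rw [hl]
          nlinarith [mul_le_mul_of_nonneg_left h8 hx0.le]
        have : c * 2 ^ 21 ≤ 1 := by
          have := hc.2.le
          rwa [le_div_iff₀ (by positivity)] at this
        nlinarith [hc.1]
      have h11 : c ^ 4 ≤ x := by
        have := pow_le_pow_left₀ (by positivity) h6 2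
        rw [sq_sqrt hx0.le] at this
        calc c ^ 4 = (c ^ 2) ^ 2 := by ring
          _ ≤ x := this
      have h12 := log_le_log (by have := hc.1; positivity) h11
      rw [log_pow] at h12
      rw [one_div, one_div, log_inv, log_inv]
      push_cast at h12
      linarith
    rw [div_le_iff₀ h3]
    nlinarith [mul_le_mul_of_nonneg_left h5 hx0.le]

/-- The upper bound is crude: `3^6 ≥ 2^7` gives `1 - (1/2) log₂ 3 ≤ 5/12 = 40/96`. It is all that is
needed, as the radius may be taken larger than `x n`. -/
lemma gain_bounds {x : ℝ} (hx : 0 < x) : 0 < gain x ∧ gain x ≤ 40 / 96 * x := by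
  have h1 : logb 2 (sqrt 3) = 1 / 2 * logb 2 3 := by
    rw [Real.sqrt_eq_rpow, Real.logb_rpow_eq_mul_logb_of_pos (by norm_num)]
  have h2 : logb 2 3 < 2 := by
    rw [Real.logb_lt_iff_lt_rpow (by norm_num) (by norm_num)]; norm_num
  have h3 : 7 / 6 ≤ logb 2 3 := by
    have h : (7 : ℝ) ≤ logb 2 (3 ^ 6) := by
      rw [Real.le_logb_iff_rpow_le (by norm_num) (by norm_num)]; norm_num
    rw [Real.logb_pow] at h
    push_cast at h
    linarith
  rw [gain, h1]
  constructor <;> nlinarith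

/-- The parameter `m` is chosen with `1/(16x) < 2^m ≤ 1/(8x)`. The upper bound makes the saving
`5/96 / 2^m` at least `40/96 · x`, hence at least `gain x`; the lower bound and `m ≤ 2 log (1/x)`
show that the qubits needed are covered by `load x`, whose constants are far larger than necessary.
-/
lemma hybridSolvable_of_load {x c ε : ℝ} (hx : x ∈ Set.Ioo (0 : ℝ) 1) (hc : c < 1)
    (h : load x = c) (hε : 0 < ε) : HybridSolvable c (schoeningExponent - gain x + ε) := by
  obtain ⟨h1, h2, -, -⟩ := log_bounds hx hc h
  have hx0 := hx.1
  have hfl : ⌊1 / (8 * x)⌋₊ ≠ 0 := (Nat.floor_pos.2 (by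
    rw [le_div_iff₀ (by positivity)]; linarith)).ne'
  set m := Nat.log 2 ⌊1 / (8 * x)⌋₊ with hm
  have hm1 : (2 : ℝ) ^ m ≤ 1 / (8 * x) := by
    refine le_trans ?_ (Nat.floor_le (by positivity))
    exact_mod_cast Nat.pow_log_le_self 2 hfl
  have hm2 : 1 / (8 * x) < 2 * 2 ^ m := by
    have h3 : (⌊1 / (8 * x)⌋₊ + 1 : ℕ) ≤ 2 ^ (m + 1) := Nat.lt_pow_succ_log_self (by omega) _
    have h4 : ((⌊1 / (8 * x)⌋₊ : ℝ) + 1) ≤ 2 ^ (m + 1) := by exact_mod_cast h3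
    rw [pow_succ'] at h4
    exact (Nat.lt_floor_add_one _).trans_le h4
  rw [le_div_iff₀ (by positivity)] at hm1
  rw [div_lt_iff₀ (by positivity)] at hm2
  have hm3 : 2 ≤ m := by
    by_contra hlt
    have : (2 : ℝ) ^ m ≤ 2 ^ 1 := pow_le_pow_right₀ (by norm_num) (by omega)
    nlinarith
  have hm4 : (m : ℝ) ≤ 2 * log (1 / x) := by
    have h3 : (2 : ℝ) ^ m ≤ 1 / x := by
      rw [le_div_iff₀ hx0]
      nlinarith [(by positivity : (0 : ℝ) < 2 ^ m)]
    have h4 := log_le_log (by positivity) h3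
    rw [log_pow] at h4
    nlinarith [Real.log_two_gt_d9, (cast_nonneg m : (0 : ℝ) ≤ m)]
  -- A rational exponent slightly above Schöning's lets the program compute the number of rounds by
  -- integer arithmetic; the excess pays for the polynomial factors and stays below `ε`.
  obtain ⟨q, hq1, hq2⟩ := exists_rat_btwn (show schoeningExponent + min x (ε / 2) <
    schoeningExponent + ε by linarith [min_le_right x (ε / 2)])
  have hmin : 0 < min x (ε / 2) := lt_min hx0 (by positivity)
  have hq0 : 0 < q := by
    have : (0 : ℝ) < q := by linarith [Trial.le_schoeningExponent]
    exact_mod_cast this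
  have hq : ((q.num.toNat : ℕ) : ℝ) / (q.den : ℕ) = q := by
    have h3 : ((q.num.toNat : ℕ) : ℤ) = q.num := Int.toNat_of_nonneg (Rat.num_pos.2 hq0).le
    have h4 : ((q.num.toNat : ℕ) : ℝ) = (q.num : ℝ) := by exact_mod_cast congrArg (Int.cast : ℤ → ℝ) h3
    rw [h4, ← Rat.cast_def]
  refine Trial.hybridSolvable (h := m) (P := q.num.toNat) (Q := q.den) hm3 q.den_pos hmin
    (by rw [hq]; exact hq1.le) ?_ ?_
  · rw [hq]
    have h3 := (gain_bounds hx0).2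
    have h4 : 8 * x * (5 / 96) ≤ 5 / 96 / 2 ^ m := by
      rw [le_div_iff₀ (by positivity)]
      nlinarith
    linarith
  · have h3 : (1024 * (m : ℝ) + 3076) / 2 ^ m ≤ (1024 * m + 3076) * (16 * x) := by
      rw [div_le_iff₀ (by positivity)]
      nlinarith [(by positivity : (0 : ℝ) ≤ 1024 * m + 3076)]
    rw [← h, load]
    nlinarith [min_le_left x (ε / 2), mul_le_mul_of_nonneg_right hm4 hx0.le]

end HybridSAT

/-! ### The main theorem -/

theorem mainTheorem2 :
    ∃ A B : ℝ, 0 < A ∧ 0 < B ∧ ∃ β : ℝ → ℝ,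
      (∀ c ∈ Set.Ioo (0 : ℝ) 1, β c ∈ Set.Ioo (0 : ℝ) 1 ∧
        ∀ x ∈ Set.Ioo (0 : ℝ) 1, A * x * Real.log (1 / x) + B * x = c ↔ x = β c) ∧
      Asymptotics.IsTheta (nhdsWithin 0 (Set.Ioi 0)) β (fun c => c / Real.log (1 / c)) ∧
      ∀ c ∈ Set.Ioo (0 : ℝ) 1,
        0 < HybridSAT.gain (β c) ∧
        (∀ ε : ℝ, 0 < ε →
          HybridSAT.HybridSolvable c
            (HybridSAT.schoeningExponent - HybridSAT.gain (β c) + ε)) ∧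
        ∃ γ < HybridSAT.schoeningExponent, HybridSAT.HybridSolvable c γ := by
  refine ⟨2 ^ 20, 2 ^ 20, by norm_num, by norm_num, HybridSAT.levelFraction, fun c hc => ?_,
    HybridSAT.isTheta_levelFraction, fun c hc => ?_⟩ <;>
    obtain ⟨hx, h⟩ := HybridSAT.levelFraction_spec hc
  · refine ⟨hx, fun x hx' => ⟨fun h' => ?_, fun h' => by rw [h']; exact h⟩⟩
    exact HybridSAT.strictMonoOn_load.injOn (Set.Ioo_subset_Icc_self hx')
      (Set.Ioo_subset_Icc_self hx) (Eq.trans h' h.symm)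
  · have hg := (HybridSAT.gain_bounds hx.1).1
    -- For the last claim half of the gain is spent as `ε`, which leaves an exponent strictly below
    -- Schöning's.
    refine ⟨hg, fun ε hε => HybridSAT.hybridSolvable_of_load hx hc.2 h hε, _, ?_,
      HybridSAT.hybridSolvable_of_load hx hc.2 h (half_pos hg)⟩
    linarith
end
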